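/- **Conventions.** Graphs are finite, simple and undirected; $n\ge 1$ is the number of vertices of $G$. A *$k$-separator* of $G$ is a set $S$ of $k'\le k$ vertices such that every connected component of $G-S$ has at most $k-k'$ vertices. The machine model is the word RAM with words of $O(\log n)$ bits (all words used are at most $c\,n^{c}$ for a constant $c$), in which every arithmetic, comparison, bitwise, memory-access and branching instruction, and every toss of a fair coin, costs one step. $\omega$ denotes a real number such that two $n\times n$ matrices can be multiplied deterministically in $O(n^{\omega})$ time in this model (it is enough that this holds for $0$-$1$-matrices multiplied over the integers). **Theorem.** For every such $\omega$ there are a randomized word-RAM program and constants $c$, $C$ such that the following holds. Given a graph $G$ on $n$ vertices (by its adjacency lists), a $k$-separator $S$ of $G$, and a graph $H$ on four vertices that is neither $K_4$ nor its complement $\overline{K_4}$, the program uses only words that are at most $c\,n^{c}$, always halts within $C\,k^{\omega-1}n$ steps, and tests whether $G$ contains an induced copy of $H$: if $G$ contains no induced copy of $H$, it always answers "no"; if $G$ contains an induced copy of $H$, it answers "yes" with probability at least $2/3$. -/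

import Mathlib

/-! ## The machine model: a word RAM with a step count and fair coins -/

namespace WordRAM

/-- The arithmetic, comparison and bitwise operations on words. -/
inductive BinOp : Type
  | add | sub | mul | div | mod | lt | eq | land | lor | lxor | shl | shr

/-- Natural subtraction is truncated at `0`; comparisons return `1` (true) or `0` (false). -/
def BinOp.eval : BinOp → ℕ → ℕ → ℕ
  | .add, a, b => a + b
  | .sub, a, b => a - b
  | .mul, a, b => a * b
  | .div, a, b => a / b
  | .mod, a, b => a % b
  | .lt, a, b => if a < b then 1 else 0
  | .eq, a, b => if a = b then 1 else 0
  | .land, a, b => a &&& b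
  | .lor, a, b => a ||| b
  | .lxor, a, b => a ^^^ b
  | .shl, a, b => a <<< b
  | .shr, a, b => a >>> b

/-- Programs of a (structured) random access machine. The arguments of type `ℕ` are names of
registers, except for the value `v` of `const r v`. A program is a finite piece of syntax, fixed
before the input is known, and hence mentions only finitely many registers and constants. -/
inductive Prog : Type
  /-- do nothing -/
  | skip : Prog
  /-- `r := v` -/
  | const (r v : ℕ) : Prog
  /-- `r := a o b` for registers `a`, `b` -/
  | op (o : BinOp) (r a b : ℕ) : Prog
  /-- `r := mem[a]`, the address being the content of register `a` -/
  | load (r a : ℕ) : Prog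
  /-- `mem[a] := r`, the address being the content of register `a` -/
  | store (a r : ℕ) : Prog
  /-- `r :=` the next fair coin, as `0` or `1` -/
  | flip (r : ℕ) : Prog
  | seq (p q : Prog) : Prog
  /-- if register `a` is nonzero run `p`, else run `q` -/
  | cond (a : ℕ) (p q : Prog) : Prog
  /-- while register `a` is nonzero run `p` -/
  | loop (a : ℕ) (p : Prog) : Prog

/-- Contents of the registers and of the memory, and the number of coins used so far. -/
structure State : Type where
  reg : ℕ → ℕ
  mem : ℕ → ℕ
  pos : ℕ

def State.setReg (s : State) (r v : ℕ) : State :=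
  { s with reg := Function.update s.reg r v }

def State.setMem (s : State) (a v : ℕ) : State :=
  { s with mem := Function.update s.mem a v }

/-- The initial state: the input stands in the cells `0, 1, 2, …` of the memory, everything else
is `0`. -/
def init (input : List ℕ) : State where
  reg := fun _ => 0
  mem := fun a => input.getD a 0
  pos := 0

/-- `Exec coins B p s t s'`: with the coin sequence `coins`, program `p` started in state `s`
halts in state `s'` after exactly `t` steps, and no word written to a register exceeds `B`
(so neither does a word written to the memory, or an address used, if the registers of `s` do not
exceed `B`). Each elementary instruction, and each test of a conditional or of a loop, is one
step. -/
inductive Exec (coins : ℕ → Bool) (B : ℕ) : Prog → State → ℕ → State → Prop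
  | skip (s : State) : Exec coins B .skip s 1 s
  | const (s : State) (r v : ℕ) (h : v ≤ B) :
      Exec coins B (.const r v) s 1 (s.setReg r v)
  | op (s : State) (o : BinOp) (r a b : ℕ) (h : o.eval (s.reg a) (s.reg b) ≤ B) :
      Exec coins B (.op o r a b) s 1 (s.setReg r (o.eval (s.reg a) (s.reg b)))
  | load (s : State) (r a : ℕ) (h : s.mem (s.reg a) ≤ B) :
      Exec coins B (.load r a) s 1 (s.setReg r (s.mem (s.reg a)))
  | store (s : State) (a r : ℕ) :
      Exec coins B (.store a r) s 1 (s.setMem (s.reg a) (s.reg r))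
  | flip (s : State) (r : ℕ) (h : (coins s.pos).toNat ≤ B) :
      Exec coins B (.flip r) s 1 { s.setReg r (coins s.pos).toNat with pos := s.pos + 1 }
  | seq {p q : Prog} {s s₁ s₂ : State} {t₁ t₂ : ℕ}
      (hp : Exec coins B p s t₁ s₁) (hq : Exec coins B q s₁ t₂ s₂) :
      Exec coins B (.seq p q) s (t₁ + t₂) s₂
  | cond_true {a : ℕ} {p q : Prog} {s s₁ : State} {t : ℕ} (ha : s.reg a ≠ 0)
      (hp : Exec coins B p s t s₁) : Exec coins B (.cond a p q) s (t + 1) s₁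
  | cond_false {a : ℕ} {p q : Prog} {s s₁ : State} {t : ℕ} (ha : s.reg a = 0)
      (hq : Exec coins B q s t s₁) : Exec coins B (.cond a p q) s (t + 1) s₁
  | loop_exit {a : ℕ} {p : Prog} {s : State} (ha : s.reg a = 0) :
      Exec coins B (.loop a p) s 1 s
  | loop_step {a : ℕ} {p : Prog} {s s₁ s₂ : State} {t₁ t₂ : ℕ} (ha : s.reg a ≠ 0)
      (hp : Exec coins B p s t₁ s₁) (hl : Exec coins B (.loop a p) s₁ t₂ s₂) :
      Exec coins B (.loop a p) s (t₁ + t₂ + 1) s₂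

/-- `HaltsWith coins B p input T s`: started on `input`, the program `p` halts in state `s` after at
most `T` steps, using only words that are at most `B`. -/
def HaltsWith (coins : ℕ → Bool) (B : ℕ) (p : Prog) (input : List ℕ) (T : ℕ) (s : State) : Prop :=
  ∃ t, t ≤ T ∧ Exec coins B p (init input) t s

/-- The coin sequence that starts with `ρ`. A run of at most `T` steps uses at most `T` coins, so
the coins after the first `T` are irrelevant for it. -/
def extendCoins {T : ℕ} (ρ : Fin T → Bool) : ℕ → Bool :=
  fun i => if h : i < T then ρ ⟨i, h⟩ else false

/-- The probability of the event `E` for `T` independent fair coins. -/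
noncomputable def coinProb (T : ℕ) (E : (Fin T → Bool) → Prop) : ℝ :=
  (Nat.card {ρ : Fin T → Bool // E ρ} : ℝ) / 2 ^ T

end WordRAM

/-! ## Matrix multiplication exponents -/

/-- A matrix as a list of words, row by row. -/
def encodeMatrix {n : ℕ} (A : Matrix (Fin n) (Fin n) ℕ) : List ℕ :=
  (List.ofFn fun i => List.ofFn fun j => A i j).flatten

/-- Two `n × n` matrices can be multiplied in `O(n ^ ω)` time, on a (deterministic) word RAM with
words of `O(log n)` bits, that is, with words bounded by `c * n ^ c` for a constant `c`. The input
is `n, A, B`; the product is written row by row to the cells that follow the input. Only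
`0`-`1`-matrices (multiplied over the natural numbers) have to be handled. -/
def IsMatMulExponent (ω : ℝ) : Prop :=
  ∃ (P : WordRAM.Prog) (c : ℕ) (C : ℝ), ∀ n : ℕ, 1 ≤ n →
    ∀ A B : Matrix (Fin n) (Fin n) ℕ, (∀ i j, A i j ≤ 1) → (∀ i j, B i j ≤ 1) →
      ∀ coins : ℕ → Bool, ∃ s : WordRAM.State,
        WordRAM.HaltsWith coins (c * n ^ c) P (n :: (encodeMatrix A ++ encodeMatrix B))
          ⌊C * (n : ℝ) ^ ω⌋₊ s ∧
        ∀ i j : Fin n, s.mem (1 + 2 * n ^ 2 + (i * n + j)) = (A * B) i j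

/-! ## Graphs -/

/-- `S` is a `k`-separator of `G`: a set of `k' ≤ k` vertices such that every connected component
of `G - S` has at most `k - k'` vertices. -/
def IsKSeparator {V : Type*} (G : SimpleGraph V) (k : ℕ) (S : Finset V) : Prop :=
  S.card ≤ k ∧
    ∀ K : (G.induce {v : V | v ∉ S}).ConnectedComponent, K.supp.ncard ≤ k - S.card

/-- `adj` lists the neighbours of each vertex of `G`, without repetition and in any order. -/
def IsAdjacencyList {n : ℕ} (G : SimpleGraph (Fin n)) (adj : Fin n → List (Fin n)) : Prop :=
  ∀ u, (adj u).Nodup ∧ ∀ v, v ∈ adj u ↔ G.Adj u v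

open Classical in
/-- The input of the detection problem: the number `n` of vertices of `G`; the adjacency matrix of
the four-vertex graph `H`; the characteristic vector of the separator `S`; the degrees of the
vertices of `G`; the adjacency lists of the vertices of `G`, one after the other. -/
noncomputable def encodeInput {n : ℕ} (H : SimpleGraph (Fin 4)) (adj : Fin n → List (Fin n))
    (S : Finset (Fin n)) : List ℕ :=
  n :: ((List.ofFn fun i => List.ofFn fun j => if H.Adj i j then 1 else 0).flatten ++
    (List.ofFn fun v => if v ∈ S then 1 else 0) ++
    (List.ofFn fun v => (adj v).length) ++
    (List.ofFn fun v => (adj v).map fun u => (u : ℕ)).flatten)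

set_option linter.constructorNameAsVariable false
set_option linter.unusedSectionVars false
set_option linter.unusedSimpArgs false

/-! ## A small imperative language with arrays, compiled to the word RAM -/


namespace WordRAM

/-! Counting. Consider labelled induced copies of `H` inside a vertex set `R`. If `H'` arises from
`H` by inserting one missing edge, the copies of `H` and of `H'` together are the quadruples in
which five of the six adjacencies are prescribed and the last pair is only required to be distinct.
Once the first two vertices are fixed, the other two range over classes whose sizes are linear in 1,
the two degrees and the codegree. Hence this total is a polynomial in nine statistics of the graph
on `R` (`sum_four`). Labelled copies of the complete graph come in groups of 24, so induction
downwards from the complete graph expresses the number of copies of every `H` modulo 24 through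
these statistics (`exists_expressible`).

Detection. A nonzero residue proves that a copy exists, so there are no false positives. Conversely,
if `H` is neither complete nor empty, some permutation of its vertices is not an automorphism, so a
4-set that carries a copy carries between 1 and 23 labelled ones. By inclusion-exclusion over the
subsets of that 4-set, any choice of the other vertices can be completed to a set `R` whose count is
not divisible by 24 (`exists_not_dvd_embCount`). A uniformly random `R` therefore succeeds with
probability at least 1/16 (`two_pow_le_card`), and twenty independent rounds succeed with
probability at least 2/3 (`two_thirds_le_coinProb`).

Computing the statistics. Let the separator have `s` vertices. The components of the rest are packed
greedily into chunks of at most `k` vertices; all chunks except an empty first one and a possibly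
small last one have at least `max s 1` vertices. A block is a chunk together with the separator: it
has at most `2 * k` vertices, and the block sizes add up to O(n). Squaring the adjacency matrices of
all blocks thus costs O(k^(ω-1) n). The squares give the codegrees of equal or adjacent vertices:
two such vertices share a block, and for pairs inside the separator the contributions of the chunks
are added up. The only statistic that involves all pairs is the sum of the squared codegrees.
Vertices in different chunks have their common neighbours in the separator, and exchanging the order
of summation turns their part into a sum of products over pairs in the separator (`sum_cross`,
`sum_sq`). The remaining statistics are sums over the O(kn) edges.

Machine. The program is written in a small imperative language with weakest preconditions.
`compile_sound` converts a weakest precondition, including its step count, into a run of the word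
RAM. The given multiplication program runs relocated into a window of the memory; every call
receives a fresh window, so its cells are zero as it expects and nothing has to be cleared. -/

/-- Variables of the programs below. -/
inductive Var : Type
  | n | sg | u | j | w | y | x | hd | tl | nc | kc | lo | b | i | off | p | h | q2 | rep | ans
  | str | nr | e1 | ed | ed2 | edd | ep | epd | epp | res
  deriving DecidableEq

/-- Arrays of the programs below. -/
inductive Arr : Type
  | st | es | adj | mk | ord | cs | r | qm | pc | g0 | hb
  deriving DecidableEq

def Var.code (x : Var) : ℕ := x.ctorIdx
def Arr.code (x : Arr) : ℕ := x.ctorIdx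

theorem Var.code_injective : Function.Injective Var.code := by
  intro x y h
  have hx : Var.ofNat x.code = x := by cases x <;> rfl
  have hy : Var.ofNat y.code = y := by cases y <;> rfl
  rw [← hx, ← hy, h]

theorem Arr.code_injective : Function.Injective Arr.code := by
  intro x y h
  have hx : Arr.ofNat x.code = x := by cases x <;> rfl
  have hy : Arr.ofNat y.code = y := by cases y <;> rfl
  rw [← hx, ← hy, h]

/-- The arrays are interleaved in memory with stride 16; codes below 16 are what keeps their cells
apart. -/
theorem Arr.code_lt (x : Arr) : x.code < 16 := by cases x <;> decide

/-- Binary operations of the expression language. -/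
inductive Bop : Type
  | add | sub | mul | mod | lt | eq

def Bop.toBin : Bop → BinOp
  | .add => .add | .sub => .sub | .mul => .mul | .mod => .mod | .lt => .lt | .eq => .eq

inductive Expr : Type
  | var (x : Var)
  | num (k : ℕ)
  | get (A : Arr) (e : Expr)
  | bin (o : Bop) (e f : Expr)

/-- Variables, arrays, the number of coins used, and the number of steps made. -/
structure St : Type where
  v : Var → ℕ
  a : Arr → ℕ → ℕ
  pos : ℕ
  time : ℕ

namespace St

def tick (σ : St) : St := { σ with time := σ.time + 1 }

def set (σ : St) (x : Var) (k : ℕ) : St :=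
  { σ with v := Function.update σ.v x k, time := σ.time + 1 }

def write (σ : St) (A : Arr) (i k : ℕ) : St :=
  { σ with a := Function.update σ.a A (Function.update (σ.a A) i k), time := σ.time + 1 }

def toss (σ : St) (x : Var) (k : ℕ) : St :=
  { σ with v := Function.update σ.v x k, pos := σ.pos + 1, time := σ.time + 1 }

/-- Here `m` is the content of the whole array `qm` after the call, not only of the window that was
used. -/
def multiply (σ : St) (m : ℕ → ℕ) (t : ℕ) : St :=
  { σ with a := Function.update σ.a .qm m, time := σ.time + t + 1 }

end St

def Expr.eval (σ : St) : Expr → ℕ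
  | .var x => σ.v x
  | .num k => k
  | .get A e => σ.a A (e.eval σ)
  | .bin o e f => o.toBin.eval (e.eval σ) (f.eval σ)

/-- A numeral has size `k + 1`, so that `L ^ size` bounds every value as soon as `2 ≤ L`; the same
number also bounds the length of the compiled code up to a factor. -/
def Expr.size : Expr → ℕ
  | .var _ => 1
  | .num k => k + 1
  | .get _ e => e.size + 1
  | .bin _ e f => e.size + f.size + 1

/-- The input is read by `inp` only and is never overwritten. The command `mm` runs the
multiplication program on matrices of order `b` stored in `qm` from position `off` on. -/
inductive Cmd : Type
  | skip
  | asg (x : Var) (e : Expr)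
  | wr (A : Arr) (i e : Expr)
  | inp (x : Var) (e : Expr)
  | flip (x : Var)
  | seq (p q : Cmd)
  | ite (e : Expr) (p q : Cmd)
  | whl (e : Expr) (p : Cmd)
  | mm

/-- The data a run depends on: the coins, a bound for the contents of variables and arrays, the
start of the array memory, the input, and the properties of the matrix multiplication program:
length of the memory it is given, word bound, and number of steps. -/
structure Env : Type where
  coins : ℕ → Bool
  lim : ℕ
  base : ℕ
  inp : ℕ → ℕ
  str : ℕ
  qlim : ℕ → ℕ
  qtime : ℕ → ℕ

def matInput {b : ℕ} (A B : Matrix (Fin b) (Fin b) ℕ) : List ℕ :=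
  b :: (encodeMatrix A ++ encodeMatrix B)

/-- The unfolding of a loop. -/
def whlN (e : Expr) (W : (St → Prop) → St → Prop) (Q : St → Prop) : ℕ → St → Prop
  | 0 => fun _ => False
  | m + 1 => fun σ => if e.eval σ = 0 then Q σ.tick else W (whlN e W Q m) σ.tick

/-- The weakest precondition of a command. -/
def wp (E : Env) : Cmd → (St → Prop) → St → Prop
  | .skip => fun Q σ => Q σ.tick
  | .asg x e => fun Q σ => e.eval σ ≤ E.lim ∧ Q (σ.set x (e.eval σ))
  | .wr A i e => fun Q σ => e.eval σ ≤ E.lim ∧ Q (σ.write A (i.eval σ) (e.eval σ))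
  | .inp x e => fun Q σ => e.eval σ < E.base ∧ Q (σ.set x (E.inp (e.eval σ)))
  | .flip x => fun Q σ => Q (σ.toss x (E.coins σ.pos).toNat)
  | .seq p q => fun Q σ => wp E p (wp E q Q) σ
  | .ite e p q => fun Q σ =>
      (e.eval σ ≠ 0 → wp E p Q σ.tick) ∧ (e.eval σ = 0 → wp E q Q σ.tick)
  | .whl e p => fun Q σ => ∃ m, whlN e (wp E p) Q m σ
  -- The postcondition must hold for every `m` that is unchanged outside the window and contains the
  -- product, because nothing else is known about what the multiplication program leaves behind.
  | .mm => fun Q σ => 1 ≤ σ.v .b ∧ ∃ A B : Matrix (Fin (σ.v .b)) (Fin (σ.v .b)) ℕ,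
      (∀ i j, A i j ≤ 1) ∧ (∀ i j, B i j ≤ 1) ∧
      (∀ i, i < E.str → σ.a .qm (σ.v .off + i) = (matInput A B).getD i 0) ∧
      E.qlim (σ.v .b) < E.str ∧ 3 * σ.v .b ^ 2 < E.str ∧ E.qlim (σ.v .b) ≤ E.lim ∧
      ∀ m : ℕ → ℕ, (∀ i, i < σ.v .off ∨ σ.v .off + E.str ≤ i → m i = σ.a .qm i) →
        (∀ i j : Fin (σ.v .b),
          m (σ.v .off + (1 + 2 * σ.v .b ^ 2 + (i * σ.v .b + j))) = (A * B) i j) →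
        Q (σ.multiply m (E.qtime (σ.v .b)))

/-! ### Compilation -/

/-- Registers are separated by residues modulo 4: multiples of 4 form the stack for expressions,
residue 1 holds variables, residue 2 the registers of the relocated program. Of residue 3, register
3 holds the start of the arrays, 7 the number 16, 11 the number 0, 19 the start of the window, and
23 is scratch. -/
def vr (x : Var) : ℕ := 4 * x.code + 1
def qr (r : ℕ) : ℕ := 4 * r + 2

/-- The result is left in register `4 * d`, and only registers `4 * d'` with `d ≤ d'` are used.
Adding the zero register 11 serves as a move instruction. -/
def compileE : Expr → ℕ → Prog
  | .var x, d => .op .add (4 * d) (vr x) 11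
  | .num k, d => .const (4 * d) k
  | .get A e, d => .seq (compileE e d) (.seq (.op .mul (4 * d) (4 * d) 7)
      (.seq (.op .add (4 * d) (4 * d) 3) (.seq (.const (4 * (d + 1)) A.code)
      (.seq (.op .add (4 * d) (4 * d) (4 * (d + 1))) (.load (4 * d) (4 * d))))))
  | .bin o e f, d => .seq (compileE e d) (.seq (compileE f (d + 1))
      (.op o.toBin (4 * d) (4 * d) (4 * (d + 1))))

/-- The registers of a program are less than `M`. -/
def Prog.regsLt (M : ℕ) : Prog → Prop
  | .skip => True
  | .const r _ => r < M
  | .op _ r a b => r < M ∧ a < M ∧ b < M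
  | .load r a => r < M ∧ a < M
  | .store a r => r < M ∧ a < M
  | .flip r => r < M
  | .seq p q => p.regsLt M ∧ q.regsLt M
  | .cond a p q => a < M ∧ p.regsLt M ∧ q.regsLt M
  | .loop a p => a < M ∧ p.regsLt M

theorem Prog.regsLt_mono {M N : ℕ} (h : M ≤ N) : ∀ {p : Prog}, p.regsLt M → p.regsLt N
  | .skip, _ => trivial
  | .const _ _, hp => lt_of_lt_of_le hp h
  | .op _ _ _ _, hp => ⟨hp.1.trans_le h, hp.2.1.trans_le h, hp.2.2.trans_le h⟩
  | .load _ _, hp => ⟨hp.1.trans_le h, hp.2.trans_le h⟩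
  | .store _ _, hp => ⟨hp.1.trans_le h, hp.2.trans_le h⟩
  | .flip _, hp => lt_of_lt_of_le hp h
  | .seq _ _, hp => ⟨regsLt_mono h hp.1, regsLt_mono h hp.2⟩
  | .cond _ _ _, hp => ⟨hp.1.trans_le h, regsLt_mono h hp.2.1, regsLt_mono h hp.2.2⟩
  | .loop _ _, hp => ⟨hp.1.trans_le h, regsLt_mono h hp.2⟩

theorem Prog.exists_regsLt (p : Prog) : ∃ M, p.regsLt M := by
  induction p with
  | skip => exact ⟨0, trivial⟩
  | const r v => exact ⟨r + 1, by simp [regsLt]⟩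
  | op o r a b => exact ⟨r + a + b + 1, by simp only [regsLt]; omega⟩
  | load r a => exact ⟨r + a + 1, by simp only [regsLt]; omega⟩
  | store a r => exact ⟨r + a + 1, by simp only [regsLt]; omega⟩
  | flip r => exact ⟨r + 1, by simp [regsLt]⟩
  | seq p q hp hq =>
    obtain ⟨M, hM⟩ := hp
    obtain ⟨N, hN⟩ := hq
    exact ⟨max M N, regsLt_mono (le_max_left _ _) hM, regsLt_mono (le_max_right _ _) hN⟩
  | cond a p q hp hq =>
    obtain ⟨M, hM⟩ := hp
    obtain ⟨N, hN⟩ := hq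
    exact ⟨max M N + a + 1, by omega, regsLt_mono (by omega) hM, regsLt_mono (by omega) hN⟩
  | loop a p hp =>
    obtain ⟨M, hM⟩ := hp
    exact ⟨M + a + 1, by omega, regsLt_mono (by omega) hM⟩

/-- Run a program on the part of the memory that consists of the cells `o + 16 * i`, where `o` is
the content of register `19`; coins are replaced by zeros. -/
def reloc : Prog → Prog
  | .skip => .skip
  | .const r v => .const (qr r) v
  | .op o r a b => .op o (qr r) (qr a) (qr b)
  | .load r a => .seq (.op .mul 23 (qr a) 7) (.seq (.op .add 23 23 19) (.load (qr r) 23))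
  | .store a r => .seq (.op .mul 23 (qr a) 7) (.seq (.op .add 23 23 19) (.store 23 (qr r)))
  | .flip r => .const (qr r) 0
  | .seq p q => .seq (reloc p) (reloc q)
  | .cond a p q => .cond (qr a) (reloc p) (reloc q)
  | .loop a p => .loop (qr a) (reloc p)

/-- Set the registers `qr r` with `r < M` to zero. -/
def resetRegs : ℕ → Prog
  | 0 => .skip
  | M + 1 => .seq (resetRegs M) (.const (qr M) 0)

/-- For `mm` the relocated registers are reset first, since the multiplication program is only known
to work from an initial state. -/
def compile (P : Prog) (M : ℕ) : Cmd → Prog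
  | .skip => .skip
  | .asg x e => .seq (compileE e 0) (.op .add (vr x) 0 11)
  | .wr A i e => .seq (compileE i 0) (.seq (.op .mul 0 0 7) (.seq (.op .add 0 0 3)
      (.seq (.const 4 A.code) (.seq (.op .add 0 0 4) (.seq (compileE e 1) (.store 0 4))))))
  | .inp x e => .seq (compileE e 0) (.load (vr x) 0)
  | .flip x => .flip (vr x)
  | .seq p q => .seq (compile P M p) (compile P M q)
  | .ite e p q => .seq (compileE e 0) (.cond 0 (compile P M p) (compile P M q))
  | .whl e p => .seq (compileE e 0) (.loop 0 (.seq (compile P M p) (compileE e 0)))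
  | .mm => .seq (resetRegs M) (.seq (.op .mul 19 (vr .off) 7) (.seq (.op .add 19 19 3)
      (.seq (.const 0 Arr.qm.code) (.seq (.op .add 19 19 0) (reloc P)))))

def Cmd.size : Cmd → ℕ
  | .skip => 0
  | .asg _ e => e.size
  | .wr _ i e => i.size + e.size
  | .inp _ e => e.size
  | .flip _ => 0
  | .seq p q => max p.size q.size
  | .ite e p q => max e.size (max p.size q.size)
  | .whl e p => max e.size p.size
  | .mm => 0

/-! ### Correctness of the compilation -/

/-- Entry `i` of an array lies in cell `base + 16 * i + code`. The interleaving makes all arrays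
unbounded without fixing their lengths in advance, and makes every array a copy of the memory with
stride 16. -/
structure Rep (E : Env) (σ : St) (s : State) : Prop where
  var : ∀ x, s.reg (vr x) = σ.v x
  base : s.reg 3 = E.base
  sixteen : s.reg 7 = 16
  zero : s.reg 11 = 0
  inp : ∀ i, i < E.base → s.mem i = E.inp i
  arr : ∀ A i, s.mem (E.base + 16 * i + Arr.code A) = σ.a A i
  pos : s.pos = σ.pos
  var_le : ∀ x, σ.v x ≤ E.lim
  arr_le : ∀ A i, σ.a A i ≤ E.lim

/-- The stack registers for expressions carry no part of the represented state. -/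
theorem Rep.of_agree {E : Env} {σ : St} {s s' : State} (h : Rep E σ s)
    (hreg : ∀ r, (∀ d, r ≠ 4 * d) → s'.reg r = s.reg r) (hmem : s'.mem = s.mem)
    (hpos : s'.pos = s.pos) : Rep E σ s' where
  var x := by rw [hreg _ (by intro d; unfold vr; omega), h.var]
  base := by rw [hreg _ (by intro d; omega), h.base]
  sixteen := by rw [hreg _ (by intro d; omega), h.sixteen]
  zero := by rw [hreg _ (by intro d; omega), h.zero]
  inp i hi := by rw [hmem, h.inp i hi]
  arr A i := by rw [hmem, h.arr]
  pos := by rw [hpos, h.pos]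
  var_le := h.var_le
  arr_le := h.arr_le

theorem Bop.eval_le_pow {o : Bop} {L a b k l : ℕ} (hL : 2 ≤ L) (ha : a ≤ L ^ k) (hb : b ≤ L ^ l) :
    o.toBin.eval a b ≤ L ^ (k + l + 1) := by
  have h1 : 1 ≤ L ^ k := Nat.one_le_pow _ _ (by omega)
  have h2 : 1 ≤ L ^ l := Nat.one_le_pow _ _ (by omega)
  have h3 : L ^ (k + l + 1) = L ^ k * L ^ l * L := by rw [pow_succ, pow_add]
  have h4 : L ^ k ≤ L ^ k * L ^ l := Nat.le_mul_of_pos_right _ (by omega)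
  have h5 : L ^ l ≤ L ^ k * L ^ l := Nat.le_mul_of_pos_left _ (by omega)
  have h6 : L ^ k * L ^ l * 2 ≤ L ^ k * L ^ l * L := Nat.mul_le_mul_left _ hL
  have h7 : a * b ≤ L ^ k * L ^ l := Nat.mul_le_mul ha hb
  rw [h3]
  cases o <;> simp only [Bop.toBin, BinOp.eval]
  · omega
  · omega
  · omega
  · have := Nat.mod_le a b
    omega
  · split_ifs <;> omega
  · split_ifs <;> omega

/-- Each operation at most multiplies its arguments, so the exponents add up. This bounds all
intermediate words, and it is polynomial because expressions have constant size. -/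
theorem Expr.eval_le_pow {σ : St} {L : ℕ} (hL : 2 ≤ L) (hv : ∀ x, σ.v x ≤ L)
    (ha : ∀ A i, σ.a A i ≤ L) : ∀ e : Expr, e.eval σ ≤ L ^ e.size
  | .var x => by simpa [eval, size] using hv x
  | .num k => by
    have h1 : k < 2 ^ k := Nat.lt_two_pow_self
    have h2 : 2 ^ k ≤ L ^ k := Nat.pow_le_pow_left hL k
    have h3 : L ^ k ≤ L ^ (k + 1) := Nat.pow_le_pow_right (by omega) (by omega)
    simp only [eval, size]
    omega
  | .get A e => by
    have h : L ^ 1 ≤ L ^ (e.size + 1) := Nat.pow_le_pow_right (by omega) (by omega)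
    exact (ha _ _).trans (by simpa [size] using h)
  | .bin o e f => Bop.eval_le_pow hL (eval_le_pow hL hv ha e) (eval_le_pow hL hv ha f)

variable {coins : ℕ → Bool} {B : ℕ}

/-- The induction carries the claim that registers `4 * d'` with `d' < d` survive; this keeps the
left operand intact while the right one is computed one level higher. -/
theorem compileE_exec {E : Env} {σ : St} {K : ℕ} (hL : 2 ≤ E.lim)
    (hB : E.base + 16 * E.lim ^ K + 16 ≤ B) :
    ∀ (e : Expr) (d : ℕ) (s : State), e.size ≤ K → Rep E σ s →
    ∃ t s', Exec coins B (compileE e d) s t s' ∧ t ≤ 6 * e.size ∧ s'.reg (4 * d) = e.eval σ ∧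
      (∀ r, (∀ d', d ≤ d' → r ≠ 4 * d') → s'.reg r = s.reg r) ∧ s'.mem = s.mem ∧
      s'.pos = s.pos := by
  have hlim : ∀ {e : Expr} {s : State}, e.size ≤ K → Rep E σ s → e.eval σ ≤ E.lim ^ K := by
    intro e s he hR
    exact (Expr.eval_le_pow hL hR.var_le hR.arr_le e).trans
      (Nat.pow_le_pow_right (by omega) he)
  intro e
  induction e with
  | var x =>
    intro d s he hR
    have h := hlim he hR
    simp only [Expr.eval] at h
    refine ⟨1, _, Exec.op s .add (4 * d) (vr x) 11 ?_, ?_, ?_, ?_, rfl, rfl⟩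
    · simp only [BinOp.eval, hR.var, hR.zero]; omega
    · simp [Expr.size]
    · simp [State.setReg, BinOp.eval, hR.var, hR.zero, Expr.eval]
    · intro r hr
      simp [State.setReg, hr d le_rfl]
  | num k =>
    intro d s he hR
    have h := hlim he hR
    simp only [Expr.eval] at h
    refine ⟨1, _, Exec.const s (4 * d) k (by omega), ?_, ?_, ?_, rfl, rfl⟩
    · simp only [Expr.size]; omega
    · simp [State.setReg, Expr.eval]
    · intro r hr
      simp [State.setReg, hr d le_rfl]
  | get A e ih =>
    intro d s he hR
    simp only [Expr.size] at he
    obtain ⟨t, s1, hs1, ht, hval, hreg, hmem, hpos⟩ := ih d s (by omega) hR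
    have hR1 : Rep E σ s1 := hR.of_agree (fun r hr => hreg r fun d' _ => hr d') hmem hpos
    have h := hlim (e := e) (by omega) hR
    have hA := A.code_lt
    have hle := hR.arr_le A (e.eval σ)
    have hLK : E.lim ^ 1 ≤ E.lim ^ K := Nat.pow_le_pow_right (by omega) (by omega)
    rw [pow_one] at hLK
    have h7 : s1.reg 7 = 16 := hR1.sixteen
    have h3 : s1.reg 3 = E.base := hR1.base
    have ne1 : (7 : ℕ) ≠ 4 * d := by omega
    have ne2 : (3 : ℕ) ≠ 4 * d := by omega
    have ne3 : 4 * d ≠ 4 * (d + 1) := by omega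
    have hv : ∀ m, m = e.eval σ * 16 + E.base + A.code → s1.mem m = σ.a A (e.eval σ) := by
      intro m hm
      rw [hm, ← hR1.arr]
      congr 1
      ring
    refine ⟨_, _, Exec.seq hs1 (Exec.seq (Exec.op _ _ _ _ _ ?_) (Exec.seq (Exec.op _ _ _ _ _ ?_)
      (Exec.seq (Exec.const _ _ _ ?_) (Exec.seq (Exec.op _ _ _ _ _ ?_)
      (Exec.load _ _ _ ?_))))), ?_, ?_, ?_, ?_, ?_⟩
    · simp only [BinOp.eval, hval, h7]; omega
    · simp [State.setReg, BinOp.eval, hval, h7, ne2, h3]; omega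
    · omega
    · simp [State.setReg, BinOp.eval, hval, h7, ne2, h3, ne3]; omega
    · simp [State.setReg, BinOp.eval, hval, h7, ne2, h3, ne3]
      rw [hv _ rfl]
      omega
    · simp only [Expr.size]; omega
    · simp [State.setReg, BinOp.eval, hval, h7, ne2, h3, ne3]
      rw [hv _ rfl]
      rfl
    · intro r hr
      have := hr d le_rfl
      have h' := hr (d + 1) (by omega)
      simp [State.setReg, this, h', hreg r hr]
    · simpa [State.setReg] using hmem
    · simpa [State.setReg] using hpos
  | bin o e f ihe ihf =>
    intro d s he hR
    have hv := hlim he hR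
    simp only [Expr.size] at he
    obtain ⟨t, s1, hs1, ht, hval, hreg, hmem, hpos⟩ := ihe d s (by omega) hR
    have hR1 : Rep E σ s1 := hR.of_agree (fun r hr => hreg r fun d' _ => hr d') hmem hpos
    obtain ⟨t2, s2, hs2, ht2, hval2, hreg2, hmem2, hpos2⟩ := ihf (d + 1) s1 (by omega) hR1
    have h4 : s2.reg (4 * d) = e.eval σ := by
      rw [hreg2 _ (by intro d' hd'; omega), hval]
    refine ⟨_, _, Exec.seq hs1 (Exec.seq hs2 (Exec.op _ _ _ _ _ ?_)), ?_, ?_, ?_, ?_, ?_⟩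
    · rw [h4, hval2]
      simp only [Expr.eval] at hv
      omega
    · simp only [Expr.size]; omega
    · simp [State.setReg, h4, hval2, Expr.eval]
    · intro r hr
      simp [State.setReg, hr d le_rfl]
      rw [hreg2 r (fun d' hd' => hr d' (by omega)), hreg r hr]
    · simp [State.setReg, hmem, hmem2]
    · simp [State.setReg, hpos, hpos2]

/-- `m` simulates the state `q` on the cells `o + 16 * i` with `i < N`. -/
structure Sim (M N o : ℕ) (q m : State) : Prop where
  reg : ∀ r, r < M → m.reg (qr r) = q.reg r
  sixteen : m.reg 7 = 16
  off : m.reg 19 = o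
  mem : ∀ i, i < N → m.mem (o + 16 * i) = q.mem i

/-- `m'` differs from `m` only in registers reserved for a relocated program, and in cells
`o + 16 * i` with `i < N`. -/
structure Outside (N o : ℕ) (m m' : State) : Prop where
  reg : ∀ r, r % 4 ≠ 2 → r ≠ 23 → m'.reg r = m.reg r
  mem : ∀ i, (∀ i', i' < N → i ≠ o + 16 * i') → m'.mem i = m.mem i
  pos : m'.pos = m.pos

theorem Outside.refl (N o : ℕ) (m : State) : Outside N o m m :=
  ⟨fun _ _ _ => rfl, fun _ _ => rfl, rfl⟩

theorem Outside.trans {N o : ℕ} {m₁ m₂ m₃ : State} (h : Outside N o m₁ m₂)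
    (h' : Outside N o m₂ m₃) : Outside N o m₁ m₃ :=
  ⟨fun r h1 h2 => (h'.reg r h1 h2).trans (h.reg r h1 h2),
    fun i hi => (h'.mem i hi).trans (h.mem i hi), h'.pos.trans h.pos⟩

/-- Addresses are register contents, hence at most `b < N`, so the program never leaves its window.
Two bounds are needed because initially a cell may exceed `b`, while loaded and stored words do not.
An access costs three instructions instead of one, which explains the factor 3. -/
theorem reloc_exec {M N o b L : ℕ} (hbN : b < N) (hbL : b ≤ L) (hB : o + 16 * N + L ≤ B)
    {p : Prog} {q : State} {t : ℕ} {q' : State} (h : Exec (fun _ => false) b p q t q') :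
    ∀ m, p.regsLt M → (∀ r, q.reg r ≤ b) → (∀ i, i < N → q.mem i ≤ L) → Sim M N o q m →
    ∃ t' m', Exec coins B (reloc p) m t' m' ∧ t' ≤ 3 * t ∧ Sim M N o q' m' ∧ Outside N o m m' ∧
      (∀ r, q'.reg r ≤ b) ∧ (∀ i, i < N → q'.mem i ≤ L) := by
  have key : ∀ {q m : State} {r v : ℕ}, Sim M N o q m →
      Sim M N o (q.setReg r v) (m.setReg (qr r) v) := by
    intro q m r v hS
    refine ⟨fun r' hr' => ?_, ?_, ?_, hS.mem⟩
    · by_cases h : r' = r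
      · subst h
        simp [State.setReg]
      · have : qr r' ≠ qr r := by unfold qr; omega
        simp [State.setReg, h, this, hS.reg r' hr']
    · have : 7 ≠ qr r := by unfold qr; omega
      simp [State.setReg, this, hS.sixteen]
    · have : 19 ≠ qr r := by unfold qr; omega
      simp [State.setReg, this, hS.off]
  have key2 : ∀ {q m : State} {v : ℕ}, Sim M N o q m → Sim M N o q (m.setReg 23 v) := by
    intro q m v hS
    refine ⟨fun r' hr' => ?_, ?_, ?_, hS.mem⟩
    · have : qr r' ≠ 23 := by unfold qr; omega
      simp [State.setReg, this, hS.reg r' hr']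
    · simp [State.setReg, hS.sixteen]
    · simp [State.setReg, hS.off]
  have out : ∀ {m : State} {r v : ℕ}, Outside N o m (m.setReg (qr r) v) := by
    intro m r v
    refine ⟨fun r' h1 h2 => ?_, fun _ _ => rfl, rfl⟩
    have : r' ≠ qr r := by unfold qr; omega
    simp [State.setReg, this]
  have out2 : ∀ {m : State} {v : ℕ}, Outside N o m (m.setReg 23 v) := by
    intro m v
    refine ⟨fun r' h1 h2 => ?_, fun _ _ => rfl, rfl⟩
    simp [State.setReg, h2]
  have upd : ∀ {q : State} {r v : ℕ}, (∀ r, q.reg r ≤ b) → v ≤ b →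
      ∀ r', (q.setReg r v).reg r' ≤ b := by
    intro q r v hq hv r'
    by_cases h : r' = r
    · subst h; simpa [State.setReg] using hv
    · simpa [State.setReg, h] using hq r'
  induction h with
  | skip s => exact fun m _ hq hmem hS => ⟨1, m, .skip m, by omega, hS, .refl _ _ _, hq, hmem⟩
  | const s r v h =>
    intro m hr hq hmem hS
    exact ⟨1, _, .const m _ _ (by omega), by omega, key hS, out, upd hq h, hmem⟩
  | op s op r x y h =>
    intro m hr hq hmem hS
    simp only [Prog.regsLt] at hr
    have := Exec.op (coins := coins) (B := B) m op (qr r) (qr x) (qr y)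
    rw [hS.reg _ hr.2.1, hS.reg _ hr.2.2] at this
    exact ⟨1, _, this (by omega), by omega, key hS, out, upd hq h, hmem⟩
  | load s r x h =>
    intro m hr hq hmem hS
    simp only [Prog.regsLt] at hr
    have hx := hS.reg _ hr.2
    have hxb := hq x
    have h7 := hS.sixteen
    have h19 := hS.off
    have hme := hS.mem (s.reg x) (by omega)
    have hcell : m.mem (s.reg x * 16 + o) = s.mem (s.reg x) := by
      rw [← hme]
      congr 1
      ring
    have e3 := Exec.load (coins := coins) (B := B)
      ((m.setReg 23 (s.reg x * 16)).setReg 23 (s.reg x * 16 + o)) (qr r) 23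
    simp only [State.setReg, Function.update_self, hcell] at e3
    refine ⟨1 + (1 + 1), _, .seq (.op _ _ _ _ _ ?_) (.seq (.op _ _ _ _ _ ?_) ?_), by omega,
      key (key2 (v := s.reg x * 16 + o) (key2 (v := s.reg x * 16) hS)) (r := r) (v := s.mem (s.reg x)),
      (out2.trans out2).trans out, upd hq h, hmem⟩
    · simp only [BinOp.eval, hx, h7]; omega
    · simp [State.setReg, BinOp.eval, hx, h7, h19]; omega
    · simpa [State.setReg, BinOp.eval, hx, h7, h19] using e3 (by omega)
  | store s x r =>
    intro m hr hq hmem hS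
    simp only [Prog.regsLt] at hr
    have hx := hS.reg _ hr.2
    have hrr := hS.reg _ hr.1
    have hxb := hq x
    have h7 := hS.sixteen
    have h19 := hS.off
    have hne : qr r ≠ 23 := by unfold qr; omega
    refine ⟨1 + (1 + 1), ((m.setReg 23 (s.reg x * 16)).setReg 23 (s.reg x * 16 + o)).setMem
      (s.reg x * 16 + o) (s.reg r), .seq (.op _ _ _ _ _ ?_) (.seq (.op _ _ _ _ _ ?_) ?_), by omega,
      ?_, ?_, hq, ?_⟩
    · simp only [BinOp.eval, hx, h7]; omega
    · simp [State.setReg, BinOp.eval, hx, h7, h19]; omega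
    · have e3 := Exec.store (coins := coins) (B := B)
        ((m.setReg 23 (s.reg x * 16)).setReg 23 (s.reg x * 16 + o)) 23 (qr r)
      simpa [State.setReg, BinOp.eval, hx, h7, h19, hne, hrr] using e3
    · have h2 := key2 (v := s.reg x * 16 + o) (key2 (v := s.reg x * 16) hS)
      refine ⟨h2.reg, h2.sixteen, h2.off, fun i hi => ?_⟩
      have h3 := h2.mem i hi
      by_cases hix : i = s.reg x
      · subst hix
        have : o + 16 * s.reg x = s.reg x * 16 + o := by ring
        simp [State.setMem, this]
      · have : o + 16 * i ≠ s.reg x * 16 + o := by omega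
        simpa [State.setMem, this, hix] using h3
    · refine Outside.trans (m₂ := (m.setReg 23 (s.reg x * 16)).setReg 23 (s.reg x * 16 + o))
        (out2.trans out2) ⟨fun _ _ _ => rfl, fun i hi => ?_, rfl⟩
      have : i ≠ s.reg x * 16 + o := by
        have := hi (s.reg x) (by omega)
        omega
      simp [State.setMem, this]
    · intro i hi
      by_cases hix : i = s.reg x
      · subst hix
        have := hq r
        simp [State.setMem]
        omega
      · simpa [State.setMem, hix] using hmem i hi
  | flip s r h =>
    intro m hr hq hmem hS
    have hS' := key (r := r) (v := 0) hS
    exact ⟨1, _, .const m _ _ (by omega), by omega, ⟨hS'.reg, hS'.sixteen, hS'.off, hS'.mem⟩, out,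
      upd hq (Nat.zero_le _), hmem⟩
  | seq _ _ ih1 ih2 =>
    intro m hr hq hmem hS
    obtain ⟨t1, m1, h1, ht1, hS1, ho1, hq1, hm1⟩ := ih1 m hr.1 hq hmem hS
    obtain ⟨t2, m2, h2, ht2, hS2, ho2, hq2, hm2⟩ := ih2 m1 hr.2 hq1 hm1 hS1
    exact ⟨_, m2, .seq h1 h2, by omega, hS2, ho1.trans ho2, hq2, hm2⟩
  | cond_true ha _ ih =>
    intro m hr hq hmem hS
    obtain ⟨t1, m1, h1, ht1, hS1, ho1, hq1, hm1⟩ := ih m hr.2.1 hq hmem hS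
    exact ⟨_, m1, .cond_true (by rwa [hS.reg _ hr.1]) h1, by omega, hS1, ho1, hq1, hm1⟩
  | cond_false ha _ ih =>
    intro m hr hq hmem hS
    obtain ⟨t1, m1, h1, ht1, hS1, ho1, hq1, hm1⟩ := ih m hr.2.2 hq hmem hS
    exact ⟨_, m1, .cond_false (by rwa [hS.reg _ hr.1]) h1, by omega, hS1, ho1, hq1, hm1⟩
  | loop_exit ha =>
    intro m hr hq hmem hS
    exact ⟨1, m, .loop_exit (by rwa [hS.reg _ hr.1]), by omega, hS, .refl _ _ _, hq, hmem⟩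
  | loop_step ha _ _ ih1 ih2 =>
    intro m hr hq hmem hS
    obtain ⟨t1, m1, h1, ht1, hS1, ho1, hq1, hm1⟩ := ih1 m hr.2 hq hmem hS
    obtain ⟨t2, m2, h2, ht2, hS2, ho2, hq2, hm2⟩ := ih2 m1 hr hq1 hm1 hS1
    exact ⟨_, m2, .loop_step (by rwa [hS.reg _ hr.1]) h1 h2, by omega, hS2, ho1.trans ho2, hq2, hm2⟩

theorem resetRegs_exec (M : ℕ) (s : State) :
    ∃ s', Exec coins B (resetRegs M) s (M + 1) s' ∧ (∀ r, r < M → s'.reg (qr r) = 0) ∧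
      (∀ r, r % 4 ≠ 2 → s'.reg r = s.reg r) ∧ s'.mem = s.mem ∧ s'.pos = s.pos := by
  induction M with
  | zero => exact ⟨s, .skip s, by simp, fun _ _ => rfl, rfl, rfl⟩
  | succ M ih =>
    obtain ⟨s', h, h0, hr, hm, hp⟩ := ih
    refine ⟨_, .seq h (.const _ _ _ (Nat.zero_le _)), fun r hr' => ?_, fun r hr' => ?_, hm, hp⟩
    · by_cases hrM : r = M
      · subst hrM; simp [State.setReg]
      · have : qr r ≠ qr M := by unfold qr; omega
        simp [State.setReg, this, h0 r (by omega)]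
    · have : r ≠ qr M := by unfold qr; omega
      simp [State.setReg, this, hr r hr']

end WordRAM

/-! ### Simulation of commands on the word RAM, with step counts. -/

namespace WordRAM

variable {coins : ℕ → Bool} {B : ℕ}

theorem vr_injective {x y : Var} (h : vr x = vr y) : x = y :=
  Var.code_injective (by unfold vr at h; omega)

theorem Rep.set {E : Env} {σ : St} {s : State} (h : Rep E σ s) {x : Var} {k : ℕ}
    (hk : k ≤ E.lim) : Rep E (σ.set x k) (s.setReg (vr x) k) where
  var y := by
    by_cases hxy : y = x
    · subst hxy; simp [State.setReg, St.set]
    · have : vr y ≠ vr x := fun h' => hxy (vr_injective h')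
      simp [State.setReg, St.set, this, hxy, h.var]
  base := by
    have : 3 ≠ vr x := by unfold vr; omega
    simp [State.setReg, this, h.base]
  sixteen := by
    have : 7 ≠ vr x := by unfold vr; omega
    simp [State.setReg, this, h.sixteen]
  zero := by
    have : 11 ≠ vr x := by unfold vr; omega
    simp [State.setReg, this, h.zero]
  inp := h.inp
  arr := h.arr
  pos := h.pos
  var_le y := by
    by_cases hxy : y = x
    · subst hxy; simpa [St.set] using hk
    · simpa [St.set, hxy] using h.var_le y
  arr_le := h.arr_le

theorem Rep.write {E : Env} {σ : St} {s : State} (h : Rep E σ s) {A : Arr} {i k : ℕ}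
    (hk : k ≤ E.lim) : Rep E (σ.write A i k) (s.setMem (E.base + 16 * i + A.code) k) where
  var := h.var
  base := h.base
  sixteen := h.sixteen
  zero := h.zero
  inp j hj := by
    have : j ≠ E.base + 16 * i + A.code := by omega
    simp [State.setMem, this, h.inp j hj]
  arr A' j := by
    have h1 := A.code_lt
    have h2 := A'.code_lt
    by_cases hA : A' = A
    · subst hA
      by_cases hj : j = i
      · subst hj; simp [State.setMem, St.write]
      · have : E.base + 16 * j + A'.code ≠ E.base + 16 * i + A'.code := by omega
        simp [State.setMem, St.write, hj, h.arr]
    · have : E.base + 16 * j + A'.code ≠ E.base + 16 * i + A.code := by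
        have : A'.code ≠ A.code := fun h' => hA (Arr.code_injective h')
        omega
      simp [State.setMem, St.write, hA, h.arr, this]
  pos := h.pos
  var_le := h.var_le
  arr_le A' j := by
    by_cases hA : A' = A
    · subst hA
      by_cases hj : j = i
      · subst hj; simpa [St.write] using hk
      · simpa [St.write, hj] using h.arr_le A' j
    · simpa [St.write, hA] using h.arr_le A' j

theorem Rep.tick {E : Env} {σ : St} {s : State} (h : Rep E σ s) : Rep E σ.tick s :=
  ⟨h.var, h.base, h.sixteen, h.zero, h.inp, h.arr, h.pos, h.var_le, h.arr_le⟩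

/-- `P` multiplies matrices, as the environment says. -/
def Env.Multiplies (E : Env) (P : Prog) : Prop :=
  ∀ (b : ℕ), 1 ≤ b → ∀ A C : Matrix (Fin b) (Fin b) ℕ, (∀ i j, A i j ≤ 1) → (∀ i j, C i j ≤ 1) →
    ∃ t q', Exec (fun _ => false) (E.qlim b) P (init (matInput A C)) t q' ∧ t ≤ E.qtime b ∧
      ∀ i j : Fin b, q'.mem (1 + 2 * b ^ 2 + (i * b + j)) = (A * C) i j

theorem encodeMatrix_le {b : ℕ} {A : Matrix (Fin b) (Fin b) ℕ} (hA : ∀ i j, A i j ≤ 1) :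
    ∀ x ∈ encodeMatrix A, x ≤ 1 := by
  intro x hx
  simp only [encodeMatrix, List.mem_flatten, List.mem_ofFn] at hx
  obtain ⟨l, ⟨i, rfl⟩, hx⟩ := hx
  obtain ⟨j, rfl⟩ := (List.mem_ofFn' _ _).1 hx
  exact hA i j

theorem matInput_le {b L : ℕ} {A C : Matrix (Fin b) (Fin b) ℕ} (hA : ∀ i j, A i j ≤ 1)
    (hC : ∀ i j, C i j ≤ 1) (hb : b ≤ L) (hL : 1 ≤ L) (i : ℕ) : (matInput A C).getD i 0 ≤ L := by
  have h : ∀ x ∈ matInput A C, x ≤ L := by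
    intro x hx
    simp only [matInput, List.mem_cons, List.mem_append] at hx
    rcases hx with rfl | hx | hx
    · exact hb
    · exact (encodeMatrix_le hA x hx).trans hL
    · exact (encodeMatrix_le hC x hx).trans hL
  rw [List.getD_eq_getElem?_getD]
  cases hi : (matInput A C)[i]? with
  | none => simp
  | some x => simpa using h x (List.mem_of_getElem? hi)

/-- After the reset, the window looks exactly like the initial memory of the multiplication program
on `matInput A C`: the precondition of `mm` demands this for all cells up to `E.str`, which exceeds
every address the program can use. -/
theorem mm_exec {E : Env} {P : Prog} {M : ℕ} {σ : St} {Q : St → Prop} {s : State}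
    (hP : P.regsLt M) (hmul : E.Multiplies P) (hL : 2 ≤ E.lim)
    (hB : E.base + 17 * E.lim + 16 + 16 * E.str ≤ B)
    (hwp : wp E .mm Q σ) (hR : Rep E σ s) :
    ∃ t s' σ', Exec coins B (compile P M .mm) s t s' ∧ Rep E σ' s' ∧ Q σ' ∧
      t + (M + 10) * σ.time ≤ (M + 10) * σ'.time := by
  obtain ⟨hb, A, C, hA, hC, hin, hqs, h3, hql, hQ⟩ := hwp
  obtain ⟨t, q', hex, ht, hout⟩ := hmul _ hb A C hA hC
  obtain ⟨s1, hs1, hz1, hr1, hm1, hp1⟩ := resetRegs_exec (coins := coins) (B := B) M s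
  have h7 : s1.reg 7 = 16 := by rw [hr1 7 (by norm_num), hR.sixteen]
  have h3' : s1.reg 3 = E.base := by rw [hr1 3 (by norm_num), hR.base]
  have hoff : s1.reg (vr .off) = σ.v .off := by rw [hr1 _ (by unfold vr; omega), hR.var]
  have hofl := hR.var_le .off
  set o := E.base + 16 * σ.v .off + Arr.qm.code with ho
  have hcode := Arr.qm.code_lt
  set s2 : State := { s1 with
    reg := Function.update (Function.update s1.reg 0 Arr.qm.code) 19 o } with hs2
  have hpre : ∀ {p : Prog} {t : ℕ} {s' : State}, Exec coins B p s2 t s' →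
      Exec coins B (.seq (.op .mul 19 (vr .off) 7) (.seq (.op .add 19 19 3)
        (.seq (.const 0 Arr.qm.code) (.seq (.op .add 19 19 0) p)))) s1 (1 + (1 + (1 + (1 + t)))) s' := by
    intro p t s' h
    refine .seq (.op _ _ _ _ _ ?_) (.seq (.op _ _ _ _ _ ?_) (.seq (.const _ _ _ ?_)
      (.seq (.op _ _ _ _ _ ?_) ?_)))
    · simp only [BinOp.eval, hoff, h7]; omega
    · simp [State.setReg, BinOp.eval, hoff, h7, h3']; omega
    · omega
    · simp [State.setReg, BinOp.eval, hoff, h7, h3']; omega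
    · convert h using 1
      rw [hs2]
      simp only [State.setReg, BinOp.eval, hoff, h7]
      congr 1
      funext r
      by_cases hr0 : r = 0
      · subst hr0; simp
      by_cases hr19 : r = 19
      · subst hr19
        simp [h3', ho]
        ring
      · simp [hr0, hr19]
  have hS : Sim M E.str o (init (matInput A C)) s2 := by
    refine ⟨fun r hr => ?_, ?_, ?_, fun i hi => ?_⟩
    · have h1 : qr r ≠ 0 := by unfold qr; omega
      have h2 : qr r ≠ 19 := by unfold qr; omega
      simp [hs2, h1, h2, hz1 r hr, init]
    · simp [hs2, h7]
    · simp [hs2]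
    · have : s2.mem = s.mem := hm1
      rw [this, ho]
      have h := hR.arr .qm (σ.v .off + i)
      rw [hin i hi] at h
      simp only [init]
      rw [← h]
      congr 1
      ring
  obtain ⟨t', s3, hs3, ht', hS3, hO3, hq3, hq3'⟩ :=
    reloc_exec (coins := coins) (B := B) (L := E.lim) hqs hql (by omega) hex s2 hP
      (fun r => by simp [init]) (fun i _ => matInput_le hA hC (hR.var_le _) (by omega) i) hS
  -- The new content of `qm` is read off from the simulated memory inside the window and is the old
  -- one elsewhere.
  set m : ℕ → ℕ := fun i => if σ.v .off ≤ i ∧ i < σ.v .off + E.str then q'.mem (i - σ.v .off)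
    else σ.a .qm i with hm
  have hreg : ∀ r, r % 4 ≠ 2 → r ≠ 23 → r ≠ 0 → r ≠ 19 → s3.reg r = s.reg r := by
    intro r h1 h2 h3 h4
    rw [hO3.reg r h1 h2, ← hr1 r h1]
    simp [hs2, h3, h4]
  have hs2mem : s2.mem = s.mem := hm1
  refine ⟨_, s3, σ.multiply m (E.qtime (σ.v .b)), .seq hs1 (hpre hs3), ?_, hQ m ?_ ?_, ?_⟩
  · refine ⟨fun x => ?_, ?_, ?_, ?_, fun i hi => ?_, fun A' i => ?_, ?_, hR.var_le, fun A' i => ?_⟩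
    · rw [hreg] <;> first | exact hR.var x | (unfold vr; omega)
    · rw [hreg] <;> first | exact hR.base | norm_num
    · rw [hreg] <;> first | exact hR.sixteen | norm_num
    · rw [hreg] <;> first | exact hR.zero | norm_num
    · rw [hO3.mem i (by intro i' _; omega), hs2mem, hR.inp i hi]
    · have hA' := A'.code_lt
      by_cases hAq : A' = .qm
      · subst hAq
        simp only [St.multiply, Function.update_self, hm]
        split_ifs with h
        · have := hS3.mem (i - σ.v .off) (by omega)
          rw [← this, ho]
          congr 1
          omega
        · rw [hO3.mem _ (by intro i' hi'; omega), hs2mem, hR.arr]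
      · have hne : A'.code ≠ Arr.qm.code := fun h' => hAq (Arr.code_injective h')
        simp only [St.multiply, Function.update_of_ne hAq]
        rw [hO3.mem _ (by intro i' hi'; omega), hs2mem, hR.arr]
    · rw [hO3.pos]
      exact hp1.trans hR.pos
    · by_cases hAq : A' = .qm
      · subst hAq
        simp only [St.multiply, Function.update_self, hm]
        split_ifs with h
        · exact hq3' _ (by omega)
        · exact hR.arr_le _ _
      · simpa [St.multiply, Function.update_of_ne hAq] using hR.arr_le A' i
  · intro i hi
    have : ¬ (σ.v .off ≤ i ∧ i < σ.v .off + E.str) := by omega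
    simp only [hm, if_neg this]
  · intro i j
    have h1 : (i : ℕ) * σ.v .b + j < σ.v .b ^ 2 := by
      have hi := i.2
      have hj := j.2
      calc (i : ℕ) * σ.v .b + j < i * σ.v .b + σ.v .b := by omega
        _ = (i + 1) * σ.v .b := by ring
        _ ≤ σ.v .b * σ.v .b := Nat.mul_le_mul_right _ hi
        _ = _ := by ring
    rw [← hout i j]
    simp only [hm]
    rw [if_pos (by omega)]
    congr 1
    omega
  · simp only [St.multiply]
    have e : (M + 10) * (σ.time + E.qtime (σ.v .b) + 1) =
      (M + 10) * σ.time + (M * E.qtime (σ.v .b) + 10 * E.qtime (σ.v .b)) + (M + 10) := by ring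
    rw [e]
    have := Nat.zero_le (M * E.qtime (σ.v .b))
    omega

theorem Expr.exec {E : Env} {σ : St} {K : ℕ} {s : State} (hL : 2 ≤ E.lim)
    (hB : E.base + 16 * E.lim ^ K + 16 ≤ B) (e : Expr) (he : e.size ≤ K) (hR : Rep E σ s) :
    ∃ t s', Exec coins B (compileE e 0) s t s' ∧ t ≤ 6 * K ∧ s'.reg 0 = e.eval σ ∧
      Rep E σ s' := by
  obtain ⟨t, s', h1, h2, h3, h4, h5, h6⟩ := compileE_exec (coins := coins) hL hB e 0 s he hR
  exact ⟨t, s', h1, by omega, h3, hR.of_agree (fun r hr => h4 r fun d' _ => hr d') h5 h6⟩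

/-- The compiled program does what the weakest precondition promises. -/
theorem compile_sound {E : Env} {P : Prog} {M K : ℕ} (hE : E.coins = coins)
    (hP : P.regsLt M) (hmul : E.Multiplies P) (hL : 2 ≤ E.lim)
    (hinp : ∀ i, i < E.base → E.inp i ≤ E.lim)
    (hB : E.base + 16 * E.lim ^ K + 16 ≤ B) (hB' : E.base + 17 * E.lim + 16 + 16 * E.str ≤ B) :
    ∀ (c : Cmd) (Q : St → Prop) (σ : St) (s : State), c.size ≤ K → wp E c Q σ → Rep E σ s →
    ∃ t s' σ', Exec coins B (compile P M c) s t s' ∧ Rep E σ' s' ∧ Q σ' ∧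
      t + (12 * K + M + 10) * σ.time ≤ (12 * K + M + 10) * σ'.time := by
  intro c
  induction c with
  | skip =>
    intro Q σ s _ hwp hR
    exact ⟨1, s, σ.tick, .skip s, hR.tick, hwp, by simp only [St.tick]; linarith⟩
  | asg x e =>
    intro Q σ s hs hwp hR
    obtain ⟨hle, hQ⟩ := hwp
    obtain ⟨t, s1, h1, ht, h0, hR1⟩ := e.exec (coins := coins) hL hB hs hR
    have hx := hR1.set (x := x) hle
    refine ⟨_, _, _, .seq h1 (.op _ _ _ _ _ ?_), ?_, hQ, ?_⟩
    · simp only [BinOp.eval, h0, hR1.zero]; omega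
    · simpa [BinOp.eval, h0, hR1.zero] using hx
    · simp only [St.set]; linarith
  | wr A i e =>
    intro Q σ s hs hwp hR
    obtain ⟨hle, hQ⟩ := hwp
    simp only [Cmd.size] at hs
    obtain ⟨t, s1, h1, ht, h0, hR1⟩ := i.exec (coins := coins) hL hB (by omega) hR
    have hi : i.eval σ ≤ E.lim ^ K := (Expr.eval_le_pow hL hR.var_le hR.arr_le i).trans
      (Nat.pow_le_pow_right (by omega) (by omega))
    have hA := A.code_lt
    set s2 : State := { s1 with
      reg := Function.update (Function.update s1.reg 0 (E.base + 16 * i.eval σ + A.code)) 4 A.code }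
      with hs2
    have hR2 : Rep E σ s2 := by
      refine hR1.of_agree (fun r hr => ?_) rfl rfl
      have h0' := hr 0
      have h4 := hr 1
      simp [hs2, h0', h4]
    obtain ⟨t2, s3, h3, ht2, h4, hreg3, hmem3, hpos3⟩ :=
      compileE_exec (coins := coins) hL hB e 1 s2 (by omega) hR2
    have hR3 : Rep E σ s3 := hR2.of_agree (fun r hr => hreg3 r fun d' _ => hr d') hmem3 hpos3
    have h30 : s3.reg 0 = E.base + 16 * i.eval σ + A.code := by
      rw [hreg3 0 (by omega)]
      simp [hs2]
    refine ⟨_, _, _, .seq h1 (.seq (.op _ _ _ _ _ ?_) (.seq (.op _ _ _ _ _ ?_)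
      (.seq (.const _ _ _ ?_) (.seq (.op _ _ _ _ _ ?_) (.seq (?_ : Exec coins B _ _ t2 s3)
      (.store _ _ _)))))), ?_, hQ, ?_⟩
    · simp only [BinOp.eval, h0, hR1.sixteen]; omega
    · simp [State.setReg, BinOp.eval, h0, hR1.sixteen, hR1.base]; omega
    · omega
    · simp [State.setReg, BinOp.eval, h0, hR1.sixteen, hR1.base]; omega
    · convert h3 using 1
      rw [hs2]
      simp only [State.setReg, BinOp.eval, h0, hR1.sixteen]
      congr 1
      funext r
      by_cases hr0 : r = 0
      · subst hr0
        simp [hR1.base]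
        ring
      by_cases hr4 : r = 4
      · subst hr4; simp
      · simp [hr0, hr4]
    · have := hR3.write (A := A) (i := i.eval σ) hle
      rw [h30]
      simpa [h4] using this
    · simp only [St.write]; linarith
  | inp x e =>
    intro Q σ s hs hwp hR
    obtain ⟨hle, hQ⟩ := hwp
    obtain ⟨t, s1, h1, ht, h0, hR1⟩ := e.exec (coins := coins) hL hB hs hR
    have hv := hinp _ hle
    have hx := hR1.set (x := x) hv
    have hm := hR1.inp _ hle
    refine ⟨_, _, _, .seq h1 (.load _ _ _ ?_), ?_, hQ, ?_⟩
    · rw [h0, hm]; omega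
    · rw [h0, hm]; exact hx
    · simp only [St.set]; linarith
  | flip x =>
    intro Q σ s hs hwp hR
    have hb : (coins s.pos).toNat ≤ 1 := Bool.toNat_le _
    have hx := hR.set (x := x) (k := (coins s.pos).toNat) (by omega)
    refine ⟨_, _, _, .flip s _ ?_, ?_, hwp, ?_⟩
    · omega
    · rw [hE, ← hR.pos]
      refine ⟨hx.var, hx.base, hx.sixteen, hx.zero, hx.inp, hx.arr, ?_, hx.var_le, hx.arr_le⟩
      simp [St.toss, hR.pos]
    · simp only [St.toss]; linarith
  | seq p q ihp ihq =>
    intro Q σ s hs hwp hR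
    simp only [Cmd.size] at hs
    obtain ⟨t1, s1, σ1, h1, hR1, hQ1, ht1⟩ := ihp _ σ s (by omega) hwp hR
    obtain ⟨t2, s2, σ2, h2, hR2, hQ2, ht2⟩ := ihq _ σ1 s1 (by omega) hQ1 hR1
    exact ⟨_, s2, σ2, .seq h1 h2, hR2, hQ2, by omega⟩
  | ite e p q ihp ihq =>
    intro Q σ s hs hwp hR
    simp only [Cmd.size] at hs
    obtain ⟨t, s1, h1, ht, h0, hR1⟩ := e.exec (coins := coins) hL hB (by omega) hR
    by_cases he : e.eval σ = 0
    · obtain ⟨t2, s2, σ2, h2, hR2, hQ2, ht2⟩ := ihq _ σ.tick s1 (by omega) (hwp.2 he) hR1.tick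
      refine ⟨_, s2, σ2, .seq h1 (.cond_false (h0.trans he) h2), hR2, hQ2, ?_⟩
      simp only [St.tick] at ht2
      linarith
    · obtain ⟨t2, s2, σ2, h2, hR2, hQ2, ht2⟩ := ihp _ σ.tick s1 (by omega) (hwp.1 he) hR1.tick
      refine ⟨_, s2, σ2, .seq h1 (.cond_true (by rwa [h0]) h2), hR2, hQ2, ?_⟩
      simp only [St.tick] at ht2
      linarith
  | whl e p ih =>
    intro Q σ s hs hwp hR
    simp only [Cmd.size] at hs
    obtain ⟨m, hm⟩ := hwp
    -- The additional `6 * K` pays for evaluating the loop condition, which happens once before the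
    -- loop and again at the end of each pass.
    have key : ∀ m (σ : St) (s : State), whlN e (wp E p) Q m σ → Rep E σ s → s.reg 0 = e.eval σ →
        ∃ t s' σ', Exec coins B (.loop 0 (.seq (compile P M p) (compileE e 0))) s t s' ∧
          Rep E σ' s' ∧ Q σ' ∧
          t + 6 * K + (12 * K + M + 10) * σ.time ≤ (12 * K + M + 10) * σ'.time := by
      intro m
      induction m with
      | zero => intro σ s h; exact h.elim
      | succ m ihm =>
        intro σ s h hR h0
        simp only [whlN] at h
        split_ifs at h with he
        · exact ⟨1, s, σ.tick, .loop_exit (h0.trans he), hR.tick, h, by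
            simp only [St.tick]; linarith⟩
        · obtain ⟨t1, s1, σ1, h1, hR1, hQ1, ht1⟩ := ih _ σ.tick s (by omega) h hR.tick
          obtain ⟨t2, s2, h2, ht2, h02, hR2⟩ := e.exec (coins := coins) hL hB (by omega) hR1
          obtain ⟨t3, s3, σ3, h3, hR3, hQ3, ht3⟩ := ihm σ1 s2 hQ1 hR2 h02
          refine ⟨_, s3, σ3, .loop_step (by rwa [h0]) (.seq h1 h2) h3, hR3, hQ3, ?_⟩
          simp only [St.tick] at ht1
          linarith
    obtain ⟨t, s1, h1, ht, h0, hR1⟩ := e.exec (coins := coins) hL hB (by omega) hR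
    obtain ⟨t2, s2, σ2, h2, hR2, hQ2, ht2⟩ := key m σ s1 hm hR1 h0
    exact ⟨_, s2, σ2, .seq h1 h2, hR2, hQ2, by omega⟩
  | mm =>
    intro Q σ s hs hwp hR
    obtain ⟨t, s', σ', h1, h2, h3, h4⟩ := mm_exec (coins := coins) hP hmul hL hB' hwp hR
    refine ⟨t, s', σ', h1, h2, h3, ?_⟩
    -- The bound for `mm` has the smaller constant `M + 10`; since the clock does not run backwards,
    -- it may be raised to the common constant.
    have h5 : σ.time ≤ σ'.time := by
      by_contra h
      push Not at h
      have := Nat.mul_lt_mul_of_pos_left h (by omega : 0 < M + 10)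
      omega
    have h6 : 12 * K * σ.time ≤ 12 * K * σ'.time := Nat.mul_le_mul_left _ h5
    linarith

end WordRAM

/-! ## Counting induced copies modulo 24 -/

namespace FourVertex

open Finset

/-! ### Sums over quadruples of vertices as polynomials in degree and codegree statistics. -/

section Algebra

variable {V : Type*} [Fintype V] [DecidableEq V] {R : Type*} [CommRing R]

/-- Adjacency `a` and membership `r` of a graph on a subset of `V`, as `0`-`1`-functions. -/
structure IsGraphOn (a : V → V → R) (r : V → R) : Prop where
  r_idem : ∀ x, r x * r x = r x
  a_idem : ∀ x y, a x y * a x y = a x y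
  symm : ∀ x y, a x y = a y x
  irrefl : ∀ x, a x x = 0
  r_a : ∀ x y, r x * a x y = a x y

/-- Adjacency in the complete graph on the subset `r`. -/
def comp (r : V → R) (x y : V) : R := if x = y then 0 else r x * r y

/-- Adjacency or non-adjacency. -/
def rel (a : V → V → R) (r : V → R) (b : Bool) (x y : V) : R :=
  if b then a x y else comp r x y - a x y

def deg (a : V → V → R) (x : V) : R := ∑ y, a x y

/-- For a graph the value on the diagonal is the degree, so the squared adjacency matrix delivers
degrees and codegrees together. -/
def codeg (a : V → V → R) (x y : V) : R := ∑ z, a x z * a z y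

variable {a : V → V → R} {r : V → R}

namespace IsGraphOn

variable (h : IsGraphOn a r)
include h

theorem r_a' (x y : V) : r y * a x y = a x y := by rw [h.symm x y, h.r_a]

theorem comp_a (x y : V) : comp r x y * a x y = a x y := by
  unfold comp
  split_ifs with hxy
  · subst hxy; simp [h.irrefl]
  · rw [mul_assoc, h.r_a', h.r_a]

theorem comp_idem (x y : V) : comp r x y * comp r x y = comp r x y := by
  unfold comp
  split_ifs
  · simp
  · calc r x * r y * (r x * r y) = (r x * r x) * (r y * r y) := by ring
      _ = _ := by rw [h.r_idem, h.r_idem]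

theorem comp_symm (x y : V) : comp r x y = comp r y x := by
  unfold comp
  by_cases hxy : x = y
  · simp [hxy]
  · rw [if_neg hxy, if_neg (Ne.symm hxy), mul_comm]

theorem rel_idem (b : Bool) (x y : V) : rel a r b x y * rel a r b x y = rel a r b x y := by
  cases b
  · simp only [rel, Bool.false_eq_true, if_false]
    linear_combination h.comp_idem x y - 2 * h.comp_a x y + h.a_idem x y
  · simpa [rel] using h.a_idem x y

theorem rel_mul_rel_not (b : Bool) (x y : V) : rel a r b x y * rel a r (!b) x y = 0 := by
  cases b <;> simp only [rel, Bool.not_false, Bool.not_true, Bool.false_eq_true, if_false, if_true]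
  · linear_combination h.comp_a x y - h.a_idem x y
  · linear_combination h.comp_a x y - h.a_idem x y

theorem r_comp (x y : V) : r x * comp r x y = comp r x y := by
  unfold comp
  split_ifs
  · simp
  · rw [← mul_assoc, h.r_idem]

theorem r_rel (b : Bool) (x y : V) : r x * rel a r b x y = rel a r b x y := by
  cases b
  · simp only [rel, Bool.false_eq_true, if_false, mul_sub, h.r_comp, h.r_a]
  · simpa [rel] using h.r_a x y

theorem rel_symm (b : Bool) (x y : V) : rel a r b x y = rel a r b y x := by
  unfold rel
  rw [h.symm x y, h.comp_symm x y]

theorem r_rel' (b : Bool) (x y : V) : r y * rel a r b x y = rel a r b x y := by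
  rw [h.rel_symm, h.r_rel]

theorem rel_diag (b : Bool) (x : V) : rel a r b x x = 0 := by
  cases b <;> simp [rel, comp, h.irrefl]

theorem rel_a (b : Bool) (x y : V) :
    rel a r b x y * a x y = rel a r b x y * (if b then 1 else 0) := by
  cases b
  · simp only [rel, Bool.false_eq_true, if_false]
    linear_combination h.comp_a x y - h.a_idem x y
  · simpa [rel] using h.a_idem x y

end IsGraphOn

/-- The coefficients of a linear form in `1`, `deg x`, `deg y`, `codeg x y`. -/
structure Lin (R : Type*) where
  k : R
  x : R
  y : R
  p : R

/-- The number of `z` with prescribed adjacency to `x` and to `y`, if `x` and `y` are different,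
adjacent if and only if `b₀`. -/
def lin (N : R) (b₀ b b' : Bool) : Lin R :=
  match b, b' with
  | true, true => ⟨0, 0, 0, 1⟩
  | true, false => ⟨if b₀ then -1 else 0, 1, 0, -1⟩
  | false, true => ⟨if b₀ then -1 else 0, 0, 1, -1⟩
  | false, false => ⟨N - 2 + if b₀ then 2 else 0, -1, -1, 1⟩

def Lin.eval (l : Lin R) (dx dy p : R) : R := l.k + l.x * dx + l.y * dy + l.p * p

def common (a : V → V → R) (r : V → R) (b b' : Bool) (x y : V) : R :=
  ∑ z, rel a r b x z * rel a r b' y z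

theorem IsGraphOn.sum_a_comp (h : IsGraphOn a r) (x y : V) :
    ∑ z, a x z * comp r y z = r y * deg a x - a x y := by
  have : ∀ z, a x z * comp r y z = r y * a x z - if z = y then a x y else 0 := by
    intro z
    unfold comp
    by_cases hz : z = y
    · subst hz; simp [h.r_a']
    · rw [if_neg (Ne.symm hz), if_neg hz]
      linear_combination r y * h.r_a' x z
  simp only [this, Finset.sum_sub_distrib, ← Finset.mul_sum, Finset.sum_ite_eq', Finset.mem_univ,
    if_true, deg]

theorem IsGraphOn.sum_comp_comp (h : IsGraphOn a r) {x y : V} (hxy : x ≠ y) :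
    ∑ z, comp r x z * comp r y z = r x * r y * (∑ z, r z - 2) := by
  have : ∀ z, comp r x z * comp r y z = r x * r y * r z -
      ((if z = x then r x * r y else 0) + if z = y then r x * r y else 0) := by
    intro z
    unfold comp
    by_cases hz : z = x
    · subst hz
      simp only [if_true, zero_mul, if_neg hxy]
      linear_combination - r y * h.r_idem z
    · by_cases hz' : z = y
      · subst hz'
        simp only [if_true, mul_zero, if_neg hz]
        linear_combination - r x * h.r_idem z
      · rw [if_neg (Ne.symm hz), if_neg (Ne.symm hz'), if_neg hz, if_neg hz']
        linear_combination r x * r y * h.r_idem z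
  simp only [this, Finset.sum_sub_distrib, ← Finset.mul_sum, Finset.sum_add_distrib,
    Finset.sum_ite_eq', Finset.mem_univ, if_true]
  ring

/-- Inclusion-exclusion over the two prescribed adjacencies. The factor `rel a r b₀ x y` restricts
to distinct vertices of the subset whose adjacency is known, which fixes the corrections for `z = x`
and `z = y`. -/
theorem IsGraphOn.rel_mul_common (h : IsGraphOn a r) (b₀ b b' : Bool) (x y : V) :
    rel a r b₀ x y * common a r b b' x y =
      rel a r b₀ x y * (lin (∑ z, r z) b₀ b b').eval (deg a x) (deg a y) (codeg a x y) := by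
  by_cases hxy : x = y
  · subst hxy; simp [h.rel_diag]
  have h1 := h.r_rel b₀ x y
  have h2 := h.r_rel' b₀ x y
  have h3 := h.rel_a b₀ x y
  have hp : ∑ z, a x z * a y z = codeg a x y := by
    unfold codeg
    exact Finset.sum_congr rfl fun z _ => by rw [h.symm y z]
  have h4 := h.sum_a_comp x y
  have h5 : ∑ z, comp r x z * a y z = r x * deg a y - a x y := by
    rw [h.symm x y, ← h.sum_a_comp y x]
    exact Finset.sum_congr rfl fun z _ => mul_comm _ _
  have h6 := h.sum_comp_comp hxy
  obtain ⟨w, hw⟩ : ∃ w, w = rel a r b₀ x y := ⟨_, rfl⟩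
  rw [← hw] at h1 h2 h3 ⊢
  cases b <;> cases b' <;>
    simp only [common, rel, lin, Lin.eval, Bool.false_eq_true, if_false, if_true, mul_sub, sub_mul,
      Finset.sum_sub_distrib, hp, h4, h5, h6]
  · cases b₀ <;> simp only [Bool.false_eq_true, if_false, if_true] at h3 ⊢ <;>
      linear_combination r y * (∑ z, r z - 2) * h1 + (∑ z, r z - 2) * h2 - deg a y * h1 -
        deg a x * h2 + 2 * h3
  · cases b₀ <;> simp only [Bool.false_eq_true, if_false, if_true] at h3 ⊢ <;>
      linear_combination deg a y * h1 - h3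
  · cases b₀ <;> simp only [Bool.false_eq_true, if_false, if_true] at h3 ⊢ <;>
      linear_combination deg a x * h2 - h3
  · ring

/-- The graph statistics in which induced counts are expressed. -/
structure IsStats (a : V → V → R) (r : V → R) (s : WordRAM.Var → R) : Prop where
  nr : s .nr = ∑ x, r x
  e1 : s .e1 = ∑ x, ∑ y, a x y
  ed : s .ed = ∑ x, ∑ y, a x y * deg a x
  ed2 : s .ed2 = ∑ x, ∑ y, a x y * (deg a x * deg a x)
  edd : s .edd = ∑ x, ∑ y, a x y * (deg a x * deg a y)
  ep : s .ep = ∑ x, ∑ y, a x y * codeg a x y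
  epd : s .epd = ∑ x, ∑ y, a x y * (codeg a x y * deg a x)
  epp : s .epp = ∑ x, ∑ y, a x y * (codeg a x y * codeg a x y)
  q2 : s .q2 = ∑ x, ∑ y, codeg a x y * codeg a x y

/-- Moments of a symmetric weight function. -/
structure Moments (R : Type*) where
  m1 : R
  md : R
  md2 : R
  mdd : R
  mp : R
  mpd : R
  mpp : R

structure IsMoments (a : V → V → R) (w : V → V → R) (m : Moments R) : Prop where
  symm : ∀ x y, w x y = w y x
  m1 : m.m1 = ∑ x, ∑ y, w x y
  md : m.md = ∑ x, ∑ y, w x y * deg a x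
  md2 : m.md2 = ∑ x, ∑ y, w x y * (deg a x * deg a x)
  mdd : m.mdd = ∑ x, ∑ y, w x y * (deg a x * deg a y)
  mp : m.mp = ∑ x, ∑ y, w x y * codeg a x y
  mpd : m.mpd = ∑ x, ∑ y, w x y * (codeg a x y * deg a x)
  mpp : m.mpp = ∑ x, ∑ y, w x y * (codeg a x y * codeg a x y)

theorem IsGraphOn.codeg_symm (h : IsGraphOn a r) (x y : V) : codeg a x y = codeg a y x := by
  unfold codeg
  exact Finset.sum_congr rfl fun z _ => by rw [h.symm x z, h.symm z y, mul_comm]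

/-- The sum of `l * l'` against a weight function with moments `m`. -/
def Lin.pair (m : Moments R) (l l' : Lin R) : R :=
  l.k * l'.k * m.m1 + (l.k * l'.x + l.x * l'.k + l.k * l'.y + l.y * l'.k) * m.md +
    (l.x * l'.x + l.y * l'.y) * m.md2 + (l.x * l'.y + l.y * l'.x) * m.mdd +
    (l.k * l'.p + l.p * l'.k) * m.mp + (l.x * l'.p + l.p * l'.x + l.y * l'.p + l.p * l'.y) * m.mpd +
    l.p * l'.p * m.mpp

/-- By the symmetry of the weight, a moment in the degree of `y` equals the one in the degree of
`x`; hence seven moments suffice for all products of two linear forms. -/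
theorem sum_lin_mul_lin {w : V → V → R} {m : Moments R} (h : IsGraphOn a r)
    (hm : IsMoments a w m) (l l' : Lin R) :
    ∑ x, ∑ y, w x y * (l.eval (deg a x) (deg a y) (codeg a x y) *
      l'.eval (deg a x) (deg a y) (codeg a x y)) = Lin.pair m l l' := by
  have swap : ∀ f : V → V → R, ∑ x, ∑ y, w x y * f y x = ∑ x, ∑ y, w x y * f x y := by
    intro f
    rw [Finset.sum_comm]
    exact Finset.sum_congr rfl fun x _ => Finset.sum_congr rfl fun y _ => by rw [hm.symm]
  have e1 : ∑ x, ∑ y, w x y * deg a y = m.md := by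
    rw [hm.md]; exact swap fun x _ => deg a x
  have e2 : ∑ x, ∑ y, w x y * (deg a y * deg a y) = m.md2 := by
    rw [hm.md2]; exact swap fun x _ => deg a x * deg a x
  have e3 : ∑ x, ∑ y, w x y * (codeg a x y * deg a y) = m.mpd := by
    rw [hm.mpd, ← swap fun x y => codeg a x y * deg a x]
    exact Finset.sum_congr rfl fun x _ => Finset.sum_congr rfl fun y _ => by rw [h.codeg_symm y x]
  have expand : ∀ x y, w x y * (l.eval (deg a x) (deg a y) (codeg a x y) *
      l'.eval (deg a x) (deg a y) (codeg a x y)) =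
      l.k * l'.k * w x y + (l.k * l'.x + l.x * l'.k) * (w x y * deg a x) +
      (l.k * l'.y + l.y * l'.k) * (w x y * deg a y) +
      (l.x * l'.x) * (w x y * (deg a x * deg a x)) + (l.y * l'.y) * (w x y * (deg a y * deg a y)) +
      (l.x * l'.y + l.y * l'.x) * (w x y * (deg a x * deg a y)) +
      (l.k * l'.p + l.p * l'.k) * (w x y * codeg a x y) +
      (l.x * l'.p + l.p * l'.x) * (w x y * (codeg a x y * deg a x)) +
      (l.y * l'.p + l.p * l'.y) * (w x y * (codeg a x y * deg a y)) +
      l.p * l'.p * (w x y * (codeg a x y * codeg a x y)) := by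
    intro x y
    unfold Lin.eval
    ring
  simp only [expand, Finset.sum_add_distrib, ← Finset.mul_sum]
  rw [e1, e2, e3, ← hm.m1, ← hm.md, ← hm.md2, ← hm.mdd, ← hm.mp, ← hm.mpd, ← hm.mpp, Lin.pair]
  ring

def adjMoments (s : WordRAM.Var → R) : Moments R :=
  ⟨s .e1, s .ed, s .ed2, s .edd, s .ep, s .epd, s .epp⟩

def compMoments (s : WordRAM.Var → R) : Moments R :=
  ⟨s .nr * (s .nr - 1), (s .nr - 1) * s .e1, (s .nr - 1) * s .ed, s .e1 * s .e1 - s .ed,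
    s .ed - s .e1, s .edd - s .ed, s .q2 - s .ed⟩

def relMoments (s : WordRAM.Var → R) (b : Bool) : Moments R :=
  if b then adjMoments s else
    ⟨(compMoments s).m1 - s .e1, (compMoments s).md - s .ed, (compMoments s).md2 - s .ed2,
      (compMoments s).mdd - s .edd, (compMoments s).mp - s .ep, (compMoments s).mpd - s .epd,
      (compMoments s).mpp - s .epp⟩

theorem isMoments_adj (h : IsGraphOn a r) {s : WordRAM.Var → R} (hs : IsStats a r s) :
    IsMoments a a (adjMoments s) :=
  ⟨h.symm, hs.e1, hs.ed, hs.ed2, hs.edd, hs.ep, hs.epd, hs.epp⟩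

/-- A sum over distinct pairs is the sum over all pairs minus the diagonal, where the codegree is
the degree. Over all pairs, products of degrees factor, and a codegree that occurs linearly can be
summed from the middle vertex of the path, which leads back to sums of degrees or over edges. Only
the square of the codegree resists, which is why `q2` is a statistic of its own. -/
theorem isMoments_comp (h : IsGraphOn a r) {s : WordRAM.Var → R} (hs : IsStats a r s) :
    IsMoments a (comp r) (compMoments s) := by
  have hd : ∀ x, r x * deg a x = deg a x := by
    intro x
    simp only [deg, Finset.mul_sum, h.r_a]
  have hdx : ∀ x, codeg a x x = deg a x := by
    intro x
    exact Finset.sum_congr rfl fun z _ => by rw [h.symm z x, h.a_idem]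
  have hp : ∀ x y, r x * codeg a x y = codeg a x y := by
    intro x y
    simp only [codeg, Finset.mul_sum, ← mul_assoc, h.r_a]
  have hp' : ∀ x y, r y * codeg a x y = codeg a x y := by
    intro x y
    rw [h.codeg_symm, hp]
  have e1 : s .e1 = ∑ x, deg a x := hs.e1
  have ed : s .ed = ∑ x, deg a x * deg a x := by
    rw [hs.ed]
    exact Finset.sum_congr rfl fun x _ => by rw [← Finset.sum_mul, deg]
  have key : ∀ f : V → V → R, ∑ x, ∑ y, comp r x y * f x y =
      ∑ x, ∑ y, r x * r y * f x y - ∑ x, r x * f x x := by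
    intro f
    rw [← Finset.sum_sub_distrib]
    refine Finset.sum_congr rfl fun x _ => ?_
    have : ∀ y, comp r x y * f x y = r x * r y * f x y - if x = y then r x * f x x else 0 := by
      intro y
      unfold comp
      by_cases hxy : x = y
      · subst hxy
        simp only [if_true]
        linear_combination - f x x * h.r_idem x
      · simp [hxy]
    simp only [this, Finset.sum_sub_distrib, Finset.sum_ite_eq, Finset.mem_univ, if_true]
  refine ⟨h.comp_symm, ?_, ?_, ?_, ?_, ?_, ?_, ?_⟩ <;> simp only [compMoments]
  · have := key fun _ _ => 1
    simp only [mul_one] at this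
    rw [this, hs.nr, mul_sub, mul_one, Finset.sum_mul_sum]
  · rw [key fun x _ => deg a x, hs.nr, e1, sub_mul, one_mul, mul_comm, Finset.sum_mul_sum]
    congr 1
    · refine Finset.sum_congr rfl fun x _ => Finset.sum_congr rfl fun y _ => ?_
      linear_combination -r y * hd x
    · exact Finset.sum_congr rfl fun x _ => (hd x).symm
  · rw [key fun x _ => deg a x * deg a x, hs.nr, ed, sub_mul, one_mul, mul_comm,
      Finset.sum_mul_sum]
    congr 1
    · refine Finset.sum_congr rfl fun x _ => Finset.sum_congr rfl fun y _ => ?_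
      linear_combination -r y * deg a x * hd x
    · exact Finset.sum_congr rfl fun x _ => by rw [← mul_assoc, hd]
  · rw [key fun x y => deg a x * deg a y, e1, ed, Finset.sum_mul_sum]
    congr 1
    · refine Finset.sum_congr rfl fun x _ => Finset.sum_congr rfl fun y _ => ?_
      linear_combination -r y * deg a y * hd x - deg a x * hd y
    · exact Finset.sum_congr rfl fun x _ => by rw [← mul_assoc, hd]
  · rw [key fun x y => codeg a x y, e1, ed]
    congr 1
    · have : ∀ x y, r x * r y * codeg a x y = codeg a x y := fun x y => by
        rw [mul_assoc, hp', hp]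
      simp only [this]
      simp only [codeg]
      rw [Finset.sum_congr rfl fun x _ => Finset.sum_comm, Finset.sum_comm]
      refine Finset.sum_congr rfl fun z _ => ?_
      simp only [← Finset.mul_sum, ← Finset.sum_mul, deg]
      congr 1
      exact Finset.sum_congr rfl fun x _ => h.symm z x
    · exact Finset.sum_congr rfl fun x _ => by rw [hdx, hd]
  · rw [key fun x y => codeg a x y * deg a x, hs.edd, ed]
    congr 1
    · refine Finset.sum_congr rfl fun x _ => ?_
      have : ∀ y, r x * r y * (codeg a x y * deg a x) = codeg a x y * deg a x := fun y => by
        linear_combination r x * deg a x * hp' x y + deg a x * hp x y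
      simp only [this]
      simp only [codeg, ← Finset.sum_mul]
      rw [Finset.sum_comm, Finset.sum_mul]
      refine Finset.sum_congr rfl fun z _ => ?_
      rw [← Finset.mul_sum]
      simp only [deg]
      ring
    · exact Finset.sum_congr rfl fun x _ => by rw [hdx, ← mul_assoc, hd]
  · rw [key fun x y => codeg a x y * codeg a x y, hs.q2, ed]
    congr 1
    · refine Finset.sum_congr rfl fun x _ => Finset.sum_congr rfl fun y _ => ?_
      linear_combination - r x * codeg a x y * hp' x y - codeg a x y * hp x y
    · exact Finset.sum_congr rfl fun x _ => by rw [hdx, ← mul_assoc, hd]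

theorem isMoments_rel (h : IsGraphOn a r) {s : WordRAM.Var → R} (hs : IsStats a r s) (b : Bool) :
    IsMoments a (rel a r b) (relMoments s b) := by
  cases b
  · have hc := isMoments_comp h hs
    refine ⟨h.rel_symm _, ?_, ?_, ?_, ?_, ?_, ?_, ?_⟩ <;>
      simp only [rel, relMoments, Bool.false_eq_true, if_false, sub_mul, Finset.sum_sub_distrib]
    · rw [hc.m1, hs.e1]
    · rw [hc.md, hs.ed]
    · rw [hc.md2, hs.ed2]
    · rw [hc.mdd, hs.edd]
    · rw [hc.mp, hs.ep]
    · rw [hc.mpd, hs.epd]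
    · rw [hc.mpp, hs.epp]
  · exact isMoments_adj h hs

/-- The sum over all `x₀, x₁, x₂, x₃` with prescribed adjacencies, except that `x₂, x₃` are only
required to be different, as a function of the statistics. -/
def pairSum (s : WordRAM.Var → R) (b01 b02 b03 b12 b13 : Bool) : R :=
  Lin.pair (relMoments s b01) (lin (s .nr) b01 b02 b12) (lin (s .nr) b01 b03 b13) -
    if b02 = b03 ∧ b12 = b13 then
      Lin.pair (relMoments s b01) (lin (s .nr) b01 b02 b12) ⟨1, 0, 0, 0⟩ else 0

/-- For fixed `x`, `y` the vertices `z` and `z'` vary independently except that `z = z'` is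
excluded. The diagonal term is nonzero only if both are chosen from the same class, because
adjacency and non-adjacency to a vertex exclude each other. -/
theorem sum_four (h : IsGraphOn a r) {s : WordRAM.Var → R} (hs : IsStats a r s)
    (b01 b02 b03 b12 b13 : Bool) :
    ∑ x, ∑ y, rel a r b01 x y * (∑ z, ∑ z', rel a r b02 x z * rel a r b12 y z *
      (rel a r b03 x z' * rel a r b13 y z') * comp r z z') = pairSum s b01 b02 b03 b12 b13 := by
  have h1 : ∀ x y, ∑ z, ∑ z', rel a r b02 x z * rel a r b12 y z *
      (rel a r b03 x z' * rel a r b13 y z') * comp r z z' =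
      common a r b02 b12 x y * common a r b03 b13 x y -
      if b02 = b03 ∧ b12 = b13 then common a r b02 b12 x y else 0 := by
    intro x y
    have h2 : ∀ z z', rel a r b02 x z * rel a r b12 y z *
        (rel a r b03 x z' * rel a r b13 y z') * comp r z z' =
        rel a r b02 x z * rel a r b12 y z * (rel a r b03 x z' * rel a r b13 y z') -
        if z = z' then (rel a r b02 x z * rel a r b03 x z) *
          (rel a r b12 y z * rel a r b13 y z) else 0 := by
      intro z z'
      unfold comp
      by_cases hz : z = z'
      · subst hz
        simp only [if_true]
        ring
      · rw [if_neg hz, if_neg hz]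
        linear_combination r z' * rel a r b12 y z * rel a r b03 x z' * rel a r b13 y z' *
          h.r_rel' b02 x z + rel a r b02 x z * rel a r b12 y z * rel a r b13 y z' *
          h.r_rel' b03 x z'
    simp only [h2, Finset.sum_sub_distrib, Finset.sum_ite_eq, Finset.mem_univ, if_true]
    congr 1
    · rw [common, common, Finset.sum_mul_sum]
    · split_ifs with hb
      · obtain ⟨rfl, rfl⟩ := hb
        simp only [h.rel_idem, common]
      · refine Finset.sum_eq_zero fun z _ => ?_
        by_cases h3 : b02 = b03
        · have h4 : b13 = !b12 := by
            cases b12 <;> cases b13 <;> simp_all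
          rw [h4, h.rel_mul_rel_not, mul_zero]
        · have h4 : b03 = !b02 := by
            cases b02 <;> cases b03 <;> simp_all
          rw [h4, h.rel_mul_rel_not, zero_mul]
  have hm := isMoments_rel h hs b01
  simp only [h1, mul_sub, Finset.sum_sub_distrib, pairSum]
  rw [← sum_lin_mul_lin h hm, ← sum_lin_mul_lin h hm]
  congr 1
  · refine Finset.sum_congr rfl fun x _ => Finset.sum_congr rfl fun y _ => ?_
    rw [hs.nr, ← mul_assoc, h.rel_mul_common, ← mul_assoc, mul_right_comm, h.rel_mul_common]
    ring
  · split_ifs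
    · refine Finset.sum_congr rfl fun x _ => Finset.sum_congr rfl fun y _ => ?_
      rw [hs.nr, h.rel_mul_common]
      simp [Lin.eval]
    · simp

end Algebra

end FourVertex

/-! ### Residues modulo 24 computed by expressions. -/

namespace FourVertex

open Finset WordRAM

/-- Functions of the variables that some expression computes modulo `24`. -/
def Expressible (F : (Var → ZMod 24) → ZMod 24) : Prop :=
  ∃ e : Expr, ∀ σ : St, ((e.eval σ : ℕ) : ZMod 24) = F fun x => (σ.v x : ZMod 24)

namespace Expressible

theorem const (c : ZMod 24) : Expressible fun _ => c :=
  ⟨.num c.val, fun σ => by simp [Expr.eval]⟩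

theorem var (x : Var) : Expressible fun s => s x := ⟨.var x, fun σ => by simp [Expr.eval]⟩

theorem add {F F' : (Var → ZMod 24) → ZMod 24} (h : Expressible F) (h' : Expressible F') :
    Expressible fun s => F s + F' s := by
  obtain ⟨e, he⟩ := h
  obtain ⟨e', he'⟩ := h'
  exact ⟨.bin .add e e', fun σ => by simp [Expr.eval, Bop.toBin, BinOp.eval, he, he']⟩

theorem mul {F F' : (Var → ZMod 24) → ZMod 24} (h : Expressible F) (h' : Expressible F') :
    Expressible fun s => F s * F' s := by
  obtain ⟨e, he⟩ := h
  obtain ⟨e', he'⟩ := h'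
  exact ⟨.bin .mul e e', fun σ => by simp [Expr.eval, Bop.toBin, BinOp.eval, he, he']⟩

/-- Truncated subtraction of naturals is not compatible with residues, so the difference is formed
as a sum with the multiple by 23, the representative of -1. -/
theorem sub {F F' : (Var → ZMod 24) → ZMod 24} (h : Expressible F) (h' : Expressible F') :
    Expressible fun s => F s - F' s := by
  have := h.add ((const (-1)).mul h')
  simpa [sub_eq_add_neg] using this

end Expressible

theorem expressible_pairSum (b01 b02 b03 b12 b13 : Bool) :
    Expressible fun s => pairSum s b01 b02 b03 b12 b13 := by
  have hite : ∀ (c : Prop) [Decidable c] (F F' : (Var → ZMod 24) → ZMod 24), Expressible F →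
      Expressible F' → Expressible fun s => if c then F s else F' s := by
    intro c _ F F' h h'
    by_cases hc : c <;> simpa [hc]
  have hlin : ∀ b b' : Bool, Expressible (fun s => (lin (s .nr) b01 b b').k) ∧
      Expressible (fun s => (lin (s .nr) b01 b b').x) ∧
      Expressible (fun s => (lin (s .nr) b01 b b').y) ∧
      Expressible (fun s => (lin (s .nr) b01 b b').p) := by
    intro b b'
    cases b <;> cases b' <;> simp only [lin] <;> refine ⟨?_, ?_, ?_, ?_⟩ <;>
      first
      | exact Expressible.const _
      | exact ((Expressible.var _).sub (.const _)).add (.const _)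
  have hrel : Expressible (fun s => (relMoments s b01).m1) ∧
      Expressible (fun s => (relMoments s b01).md) ∧
      Expressible (fun s => (relMoments s b01).md2) ∧
      Expressible (fun s => (relMoments s b01).mdd) ∧
      Expressible (fun s => (relMoments s b01).mp) ∧
      Expressible (fun s => (relMoments s b01).mpd) ∧
      Expressible (fun s => (relMoments s b01).mpp) := by
    have hv := Expressible.var
    have h1 := (hv .nr).sub (.const 1)
    cases b01 <;> simp only [relMoments, adjMoments, compMoments, Bool.false_eq_true, if_false,
      if_true]
    · exact ⟨((hv _).mul h1).sub (hv _), (h1.mul (hv _)).sub (hv _), (h1.mul (hv _)).sub (hv _),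
        (((hv _).mul (hv _)).sub (hv _)).sub (hv _), ((hv _).sub (hv _)).sub (hv _),
        ((hv _).sub (hv _)).sub (hv _), ((hv _).sub (hv _)).sub (hv _)⟩
    · exact ⟨hv _, hv _, hv _, hv _, hv _, hv _, hv _⟩
  obtain ⟨m1, m2, m3, m4, m5, m6, m7⟩ := hrel
  have hpair : ∀ l l' : (Var → ZMod 24) → Lin (ZMod 24),
      (Expressible (fun s => (l s).k) ∧ Expressible (fun s => (l s).x) ∧
        Expressible (fun s => (l s).y) ∧ Expressible (fun s => (l s).p)) →
      (Expressible (fun s => (l' s).k) ∧ Expressible (fun s => (l' s).x) ∧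
        Expressible (fun s => (l' s).y) ∧ Expressible (fun s => (l' s).p)) →
      Expressible fun s => Lin.pair (relMoments s b01) (l s) (l' s) := by
    intro l l' ⟨k, x, y, p⟩ ⟨k', x', y', p'⟩
    simp only [Lin.pair]
    exact ((((((((k.mul k').mul m1).add (((((k.mul x').add (x.mul k')).add (k.mul y')).add
      (y.mul k')).mul m2)).add (((x.mul x').add (y.mul y')).mul m3)).add
      (((x.mul y').add (y.mul x')).mul m4)).add (((k.mul p').add (p.mul k')).mul m5)).add
      (((((x.mul p').add (p.mul x')).add (y.mul p')).add (p.mul y')).mul m6)).add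
      ((p.mul p').mul m7))
  unfold pairSum
  exact (hpair _ _ (hlin _ _) (hlin _ _)).sub (hite _ _ _ (hpair _ _ (hlin _ _)
    ⟨.const _, .const _, .const _, .const _⟩) (.const 0))

/-! ### Labelled induced copies, their number modulo 24, and their detection. -/

section Emb

variable {V : Type} [Fintype V] [DecidableEq V]

/-- `x` embeds `H` as an induced subgraph of `G`, with all vertices in `R`. -/
def IsEmb (G : SimpleGraph V) (R : Finset V) (H : SimpleGraph (Fin 4)) (x : Fin 4 → V) : Prop :=
  (∀ i, x i ∈ R) ∧ ∀ i j, i ≠ j → x i ≠ x j ∧ (G.Adj (x i) (x j) ↔ H.Adj i j)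

open Classical in
/-- The number of induced labelled copies of `H` on `R`. -/
noncomputable def embCount (G : SimpleGraph V) (R : Finset V) (H : SimpleGraph (Fin 4)) : ℕ :=
  #{x : Fin 4 → V | IsEmb G R H x}

theorem IsEmb.injective {G : SimpleGraph V} {R : Finset V} {H : SimpleGraph (Fin 4)}
    {x : Fin 4 → V} (h : IsEmb G R H x) : Function.Injective x := by
  intro i j hij
  by_contra hne
  exact (h.2 i j hne).1 hij

theorem IsEmb.isIndContained {G : SimpleGraph V} {R : Finset V} {H : SimpleGraph (Fin 4)}
    {x : Fin 4 → V} (h : IsEmb G R H x) : H.IsIndContained G := by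
  refine ⟨⟨⟨x, h.injective⟩, ?_⟩⟩
  intro i j
  by_cases hij : i = j
  · subst hij; simp
  · exact (h.2 i j hij).2

theorem exists_isEmb {G : SimpleGraph V} {H : SimpleGraph (Fin 4)} (h : H.IsIndContained G) :
    ∃ x, IsEmb G univ H x := by
  obtain ⟨f⟩ := h
  exact ⟨f, fun _ => mem_univ _, fun i j hij => ⟨fun h => hij (f.injective h), f.map_rel_iff⟩⟩

open Classical in
/-- The embeddings with the same image as `x` are obtained from `x` by permutations. -/
theorem fiber_subset {G : SimpleGraph V} {R : Finset V} {H : SimpleGraph (Fin 4)}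
    {x : Fin 4 → V} :
    ({y : Fin 4 → V | IsEmb G R H y ∧ univ.image y = univ.image x} : Finset (Fin 4 → V)) ⊆
      univ.image fun π : Equiv.Perm (Fin 4) => x ∘ π := by
  intro y hy
  simp only [mem_filter, mem_univ, true_and] at hy
  obtain ⟨hy, him⟩ := hy
  have h1 : ∀ i, ∃ j, x j = y i := by
    intro i
    have : y i ∈ univ.image x := him ▸ mem_image_of_mem _ (mem_univ _)
    simpa using this
  choose f hf using h1
  have hf' : Function.Injective f := by
    intro i j hij
    apply hy.injective
    rw [← hf, ← hf, hij]
  simp only [mem_image, mem_univ, true_and]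
  refine ⟨Equiv.ofBijective f (Finite.injective_iff_bijective.1 hf'), ?_⟩
  funext i
  simp [hf]

open Classical in
theorem card_image_perm {x : Fin 4 → V} (hx : Function.Injective x) :
    #(univ.image fun π : Equiv.Perm (Fin 4) => x ∘ π) = 24 := by
  rw [card_image_of_injective]
  · rfl
  · intro π π' h
    ext i : 1
    exact hx (congrFun h i)

/-- The permutations of the four labels act freely on the copies of the complete graph; the copies
are grouped by their vertex sets, and each group is a full orbit of 24 elements. -/
theorem embCount_top (G : SimpleGraph V) (R : Finset V) : 24 ∣ embCount G R ⊤ := by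
  classical
  unfold embCount
  rw [card_eq_sum_card_image (fun y : Fin 4 → V => univ.image y)]
  refine dvd_sum fun U hU => ?_
  obtain ⟨x, hx, rfl⟩ := mem_image.1 hU
  simp only [mem_filter, mem_univ, true_and] at hx
  rw [filter_filter]
  have : ({y : Fin 4 → V | IsEmb G R ⊤ y ∧ univ.image y = univ.image x} : Finset (Fin 4 → V)) =
      univ.image fun π : Equiv.Perm (Fin 4) => x ∘ π := by
    refine Subset.antisymm fiber_subset fun y hy => ?_
    obtain ⟨π, -, rfl⟩ := mem_image.1 hy
    simp only [mem_filter, mem_univ, true_and]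
    refine ⟨⟨fun i => hx.1 _, fun i j hij => ?_⟩, ?_⟩
    · have := hx.2 (π i) (π j) fun h => hij (π.injective h)
      simpa [hij] using this
    · rw [← image_image, image_univ_equiv]
  rw [this, card_image_perm hx.injective]

/-- The adjacency function of the graph induced on `R`. -/
noncomputable def adjFun (G : SimpleGraph V) (R : Finset V) (x y : V) : ZMod 24 :=
  open Classical in if G.Adj x y ∧ x ∈ R ∧ y ∈ R then 1 else 0

def memFun (R : Finset V) (x : V) : ZMod 24 := if x ∈ R then 1 else 0

theorem isGraphOn (G : SimpleGraph V) (R : Finset V) : IsGraphOn (adjFun G R) (memFun R) where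
  r_idem x := by unfold memFun; split_ifs <;> simp
  a_idem x y := by unfold adjFun; split_ifs <;> simp
  symm x y := by
    unfold adjFun
    congr 1
    rw [G.adj_comm, and_comm (a := x ∈ R)]
  irrefl x := by simp [adjFun]
  r_a x y := by
    unfold adjFun memFun
    split_ifs with h1 h2 <;> simp_all

theorem rel_eq (G : SimpleGraph V) (R : Finset V) (b : Bool) (x y : V) :
    rel (adjFun G R) (memFun R) b x y =
      open Classical in if x ∈ R ∧ y ∈ R ∧ x ≠ y ∧ (G.Adj x y ↔ b) then 1 else 0 := by
  have hne : G.Adj x y → x ≠ y := fun h => h.ne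
  unfold rel comp adjFun memFun
  by_cases h1 : x ∈ R <;> by_cases h2 : y ∈ R <;> by_cases h3 : G.Adj x y <;>
    by_cases h4 : x = y <;> cases b <;> simp_all

/-- A property of `Fin 4` that is symmetric in a pair of indices. -/
theorem forall_pairs {p : Fin 4 → Fin 4 → Prop} (hp : ∀ i j, p i j → p j i) :
    (∀ i j, i ≠ j → p i j) ↔ p 0 1 ∧ p 0 2 ∧ p 1 2 ∧ p 0 3 ∧ p 1 3 ∧ p 2 3 := by
  constructor
  · intro h
    exact ⟨h _ _ (by decide), h _ _ (by decide), h _ _ (by decide), h _ _ (by decide),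
      h _ _ (by decide), h _ _ (by decide)⟩
  · rintro ⟨h1, h2, h3, h4, h5, h6⟩ i j hij
    fin_cases i <;> fin_cases j <;>
      first
      | exact absurd rfl hij
      | assumption
      | exact hp _ _ (by assumption)

/-- The indicator of an embedding is the product of six indicators, one for each pair of labels.
They are arranged so that the pair of the last two labels stands alone. -/
theorem embCount_eq_sum (G : SimpleGraph V) (R : Finset V) (H : SimpleGraph (Fin 4))
    (b : Fin 4 → Fin 4 → Bool) (hb : ∀ i j, b i j = true ↔ H.Adj i j) :
    (embCount G R H : ZMod 24) = ∑ x, ∑ y, rel (adjFun G R) (memFun R) (b 0 1) x y *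
      (∑ z, ∑ z', rel (adjFun G R) (memFun R) (b 0 2) x z *
        rel (adjFun G R) (memFun R) (b 1 2) y z *
        (rel (adjFun G R) (memFun R) (b 0 3) x z' *
        rel (adjFun G R) (memFun R) (b 1 3) y z') *
        rel (adjFun G R) (memFun R) (b 2 3) z z') := by
  classical
  have h1 : ∀ f : Fin 4 → V, IsEmb G R H f ↔ ∀ i j, i ≠ j →
      (f i ∈ R ∧ f j ∈ R ∧ f i ≠ f j ∧ (G.Adj (f i) (f j) ↔ b i j = true)) := by
    intro f
    constructor
    · intro h i j hij
      exact ⟨h.1 i, h.1 j, (h.2 i j hij).1, by rw [hb]; exact (h.2 i j hij).2⟩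
    · intro h
      refine ⟨fun i => ?_, fun i j hij => ⟨(h i j hij).2.2.1, by rw [← hb]; exact (h i j hij).2.2.2⟩⟩
      by_cases hi : i = 0
      · exact (h i 1 (by simp [hi])).1
      · exact (h i 0 hi).1
  have h2 : ∀ x y z z' : V, (if IsEmb G R H ![x, y, z, z'] then (1 : ZMod 24) else 0) =
      rel (adjFun G R) (memFun R) (b 0 1) x y *
      (rel (adjFun G R) (memFun R) (b 0 2) x z *
        rel (adjFun G R) (memFun R) (b 1 2) y z *
        (rel (adjFun G R) (memFun R) (b 0 3) x z' *
        rel (adjFun G R) (memFun R) (b 1 3) y z') *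
        rel (adjFun G R) (memFun R) (b 2 3) z z') := by
    intro x y z z'
    have h3 := (h1 ![x, y, z, z']).trans (forall_pairs fun i j h =>
      ⟨h.2.1, h.1, h.2.2.1.symm, by
        rw [G.adj_comm, hb, H.adj_comm, ← hb]; exact h.2.2.2⟩)
    have h4 : ∀ (p q : Prop) [Decidable p] [Decidable q] [Decidable (p ∧ q)],
        (if p then (1 : ZMod 24) else 0) * (if q then 1 else 0) = if p ∧ q then 1 else 0 := by
      intro p q _ _ _
      by_cases hp : p <;> by_cases hq : q <;> simp [hp, hq]
    simp only [rel_eq, h4]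
    exact if_congr (h3.trans ⟨fun ⟨a, b, c, d, e, f⟩ => ⟨a, ⟨⟨b, c⟩, d, e⟩, f⟩,
      fun ⟨a, ⟨⟨b, c⟩, d, e⟩, f⟩ => ⟨a, b, c, d, e, f⟩⟩) rfl rfl
  let e : (Fin 4 → V) ≃ V × V × V × V :=
    { toFun := fun f => (f 0, f 1, f 2, f 3)
      invFun := fun t => ![t.1, t.2.1, t.2.2.1, t.2.2.2]
      left_inv := fun f => by funext i; fin_cases i <;> rfl
      right_inv := fun _ => rfl }
  rw [embCount, card_filter, Nat.cast_sum, ← e.symm.sum_comp]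
  simp only [Fintype.sum_prod_type, mul_sum, ← h2]
  refine sum_congr rfl fun x _ => sum_congr rfl fun y _ => sum_congr rfl fun z _ =>
    sum_congr rfl fun z' _ => ?_
  simp only [Nat.cast_ite, Nat.cast_one, Nat.cast_zero]
  rfl

/-- Relabelling the vertices of `H` permutes the coordinates of the embeddings. -/
theorem embCount_comap (G : SimpleGraph V) (R : Finset V) (H : SimpleGraph (Fin 4))
    (π : Equiv.Perm (Fin 4)) : embCount G R (H.comap π) = embCount G R H := by
  classical
  refine card_bij' (fun x _ => x ∘ π.symm) (fun x _ => x ∘ π) ?_ ?_ ?_ ?_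
  · intro x hx
    simp only [mem_filter, mem_univ, true_and] at hx ⊢
    refine ⟨fun i => hx.1 _, fun i j hij => ?_⟩
    have := hx.2 (π.symm i) (π.symm j) (by simpa using hij)
    simpa using this
  · intro x hx
    simp only [mem_filter, mem_univ, true_and] at hx ⊢
    refine ⟨fun i => hx.1 _, fun i j hij => ?_⟩
    have := hx.2 (π i) (π j) (by simpa using hij)
    simpa using this
  · intro x _
    funext i
    simp
  · intro x _
    funext i
    simp

/-- This moves a given pair of labels to the last two places, and it yields the 2-transitivity of
the symmetric group. -/
theorem exists_perm : ∀ i j : Fin 4, i ≠ j → ∃ π : Equiv.Perm (Fin 4), π 2 = i ∧ π 3 = j := by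
  decide

/-- Induced copies are counted by a function of the statistics, modulo `24`. -/
theorem exists_expressible (H : SimpleGraph (Fin 4)) : ∃ F, Expressible F ∧
    ∀ (V : Type) [Fintype V] [DecidableEq V] (G : SimpleGraph V) (R : Finset V)
      (s : Var → ZMod 24), IsStats (adjFun G R) (memFun R) s → (embCount G R H : ZMod 24) = F s := by
  classical
  -- Induction downwards: the claim for `H` is derived from graphs with more edges, starting from
  -- the complete graph, whose count vanishes modulo 24.
  induction H using WellFoundedGT.induction with
  | ind H ih =>
  by_cases hH : H = ⊤
  · subst hH
    refine ⟨fun _ => 0, .const 0, fun V _ _ G R s _ => ?_⟩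
    exact (ZMod.natCast_eq_zero_iff _ _).2 (embCount_top G R)
  obtain ⟨i, j, hij, hadj⟩ : ∃ i j, i ≠ j ∧ ¬ H.Adj i j := by
    by_contra! h
    apply hH
    ext i j
    exact ⟨fun h => h.ne, fun hne => h i j hne⟩
  obtain ⟨π, hi, hj⟩ := exists_perm i j hij
  set H' := H ⊔ SimpleGraph.edge i j with hH'
  have hH'adj : ∀ u v, H'.Adj u v ↔ H.Adj u v ∨ (u = i ∧ v = j ∨ u = j ∧ v = i) := by
    intro u v
    rw [hH', SimpleGraph.sup_adj, SimpleGraph.edge_adj]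
    constructor
    · tauto
    · rintro (h | h | h)
      · exact Or.inl h
      · exact Or.inr ⟨by tauto, by rw [h.1, h.2]; exact hij⟩
      · exact Or.inr ⟨by tauto, by rw [h.1, h.2]; exact hij.symm⟩
  have hlt : H < H' := by
    refine lt_of_le_of_ne le_sup_left fun h => hadj ?_
    rw [h, hH'adj]
    simp
  obtain ⟨F, hF, hF'⟩ := ih H' hlt
  have h0 : ∀ k : Fin 4, k ≠ 2 → π k ≠ i := fun k hk h => hk (π.injective (h.trans hi.symm))
  have h1 : ∀ k : Fin 4, k ≠ 3 → π k ≠ j := fun k hk h => hk (π.injective (h.trans hj.symm))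
  obtain ⟨b, hb⟩ : ∃ b : Fin 4 → Fin 4 → Bool, ∀ k l, b k l = true ↔ (H.comap π).Adj k l :=
    ⟨fun k l => decide ((H.comap π).Adj k l), fun k l => by simp⟩
  obtain ⟨b', hb'⟩ : ∃ b : Fin 4 → Fin 4 → Bool, ∀ k l, b k l = true ↔ (H'.comap π).Adj k l :=
    ⟨fun k l => decide ((H'.comap π).Adj k l), fun k l => by simp⟩
  -- After the relabelling, the inserted edge joins labels 2 and 3, so every other adjacency is
  -- common to both graphs.
  have hsame : ∀ k l : Fin 4, k ≠ 2 → k ≠ 3 → b' k l = b k l := by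
    intro k l hk hk'
    rw [Bool.eq_iff_iff, hb, hb']
    simp [hH'adj, h0 k hk, h1 k hk']
  have hT : b' 2 3 = true := by simp [hb', hH'adj, hi, hj]
  have hFa : b 2 3 = false := by
    rw [Bool.eq_false_iff, Ne, hb]
    simp [hi, hj, hadj]
  refine ⟨fun s => pairSum s (b 0 1) (b 0 2) (b 0 3) (b 1 2) (b 1 3) - F s,
    (expressible_pairSum _ _ _ _ _).sub hF, fun V _ _ G R s hs => ?_⟩
  beta_reduce
  -- The identity proved here is that the counts for `H` and `H'` add up to `pairSum`: for the last
  -- pair, adjacency and non-adjacency together mean being distinct.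
  rw [← hF' V G R s hs, eq_sub_iff_add_eq, ← embCount_comap G R H π, ← embCount_comap G R H' π,
    embCount_eq_sum _ _ _ b hb, embCount_eq_sum _ _ _ b' hb', ← sum_four (isGraphOn G R) hs,
    hsame 0 1 (by decide) (by decide), hsame 0 2 (by decide) (by decide),
    hsame 0 3 (by decide) (by decide), hsame 1 2 (by decide) (by decide),
    hsame 1 3 (by decide) (by decide), hT, hFa]
  simp only [← sum_add_distrib]
  refine sum_congr rfl fun x _ => sum_congr rfl fun y _ => ?_
  rw [← mul_add]
  simp only [← sum_add_distrib]
  congr 1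
  refine sum_congr rfl fun z _ => sum_congr rfl fun z' _ => ?_
  rw [← mul_add]
  simp [rel]

/-! ### Random subsets -/

/-- With 24 copies on one vertex set, every permutation would be an automorphism of `H`. Since any
pair of labels can be moved to any other, all pairs would be adjacent or none. -/
theorem card_fiber_pos_lt {G : SimpleGraph V} {H : SimpleGraph (Fin 4)} (hT : H ≠ ⊤) (hB : H ≠ ⊥)
    {x : Fin 4 → V} (hx : IsEmb G univ H x) : open Classical in
    0 < #{y : Fin 4 → V | IsEmb G univ H y ∧ univ.image y = univ.image x} ∧
    #{y : Fin 4 → V | IsEmb G univ H y ∧ univ.image y = univ.image x} < 24 := by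
  classical
  refine ⟨card_pos.2 ⟨x, by simp [hx]⟩, ?_⟩
  rw [← card_image_perm hx.injective]
  refine card_lt_card (ssubset_of_subset_of_ne fiber_subset fun h => ?_)
  have hall : ∀ (π : Equiv.Perm (Fin 4)) (i j : Fin 4), i ≠ j →
      (H.Adj (π i) (π j) ↔ H.Adj i j) := by
    intro π i j hij
    have h1 : x ∘ π ∈ univ.image fun π : Equiv.Perm (Fin 4) => x ∘ π :=
      mem_image_of_mem _ (mem_univ _)
    rw [← h] at h1
    simp only [mem_filter, mem_univ, true_and] at h1
    rw [← (h1.1.2 i j hij).2]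
    exact (hx.2 (π i) (π j) fun h => hij (π.injective h)).2.symm
  have htrans : ∀ i j k l : Fin 4, i ≠ j → k ≠ l → ∃ π : Equiv.Perm (Fin 4), π i = k ∧ π j = l := by
    intro i j k l hij hkl
    obtain ⟨π, hπ, hπ'⟩ := exists_perm i j hij
    obtain ⟨τ, hτ, hτ'⟩ := exists_perm k l hkl
    exact ⟨π.symm.trans τ, by simp [← hπ, hτ], by simp [← hπ', hτ']⟩
  by_cases hE : ∃ i j, H.Adj i j
  · obtain ⟨i, j, hij⟩ := hE
    apply hT
    ext k l
    refine ⟨fun h => h.ne, fun hkl => ?_⟩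
    obtain ⟨π, rfl, rfl⟩ := htrans i j k l hij.ne hkl
    exact (hall π i j hij.ne).2 hij
  · push Not at hE
    apply hB
    ext k l
    simp [hE]

/-- The alternating sum of the counts on `R ∪ W` over all `W` inside the image of `x` counts
precisely the copies with that image. There are between 1 and 23 of them, so not all summands can be
multiples of 24. -/
theorem exists_not_dvd_embCount {G : SimpleGraph V} {H : SimpleGraph (Fin 4)} (hT : H ≠ ⊤)
    (hB : H ≠ ⊥) {x : Fin 4 → V} (hx : IsEmb G univ H x) {R : Finset V}
    (hR : Disjoint R (univ.image x)) :
    ∃ W ⊆ univ.image x, ¬ 24 ∣ embCount G (R ∪ W) H := by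
  classical
  set U := univ.image x with hU
  have hcard : #U = 4 := by
    rw [hU, card_image_of_injective _ hx.injective]
    rfl
  have hemb : ∀ W, (embCount G (R ∪ W) H : ℤ) = ∑ y : Fin 4 → V with IsEmb G univ H y,
      if univ.image y ⊆ R ∪ W then 1 else 0 := by
    intro W
    rw [embCount, card_eq_sum_ones, Nat.cast_sum, ← sum_filter, filter_filter]
    refine sum_congr ?_ fun _ _ => by simp
    ext y
    simp only [mem_filter, mem_univ, true_and, image_subset_iff, forall_const]
    simp only [IsEmb, mem_univ, implies_true, true_and]
    tauto
  have hsum : ∑ W ∈ U.powerset, (-1 : ℤ) ^ #W * embCount G (R ∪ W) H =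
      #{y : Fin 4 → V | IsEmb G univ H y ∧ univ.image y = U} := by
    simp only [hemb, mul_sum]
    rw [sum_comm, ← filter_filter, card_filter, Nat.cast_sum]
    refine sum_congr rfl fun y hy => ?_
    simp only [mem_filter, mem_univ, true_and] at hy
    have hycard : #(univ.image y) = 4 := by
      rw [card_image_of_injective _ hy.injective]
      rfl
    by_cases hyU : univ.image y = U
    · rw [hyU]
      simp only [if_true, Nat.cast_one]
      rw [sum_eq_single U]
      · simp [hcard]
      · intro W hW hne
        rw [if_neg, mul_zero]
        intro hUW
        apply hne
        refine Subset.antisymm (mem_powerset.1 hW) fun v hv => ?_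
        rcases mem_union.1 (hUW hv) with h | h
        · exact absurd hv (disjoint_left.1 hR h)
        · exact h
      · intro h
        exact absurd (mem_powerset.2 Subset.rfl) h
    · obtain ⟨u, hu, huy⟩ : ∃ u ∈ U, u ∉ univ.image y := by
        by_contra! h
        exact hyU (eq_of_subset_of_card_le h (by omega)).symm
      -- Some vertex `u` of `U` is missed by the copy; the sets `W` with and without `u` cancel in
      -- pairs.
      rw [if_neg hyU, ← insert_erase hu, sum_powerset_insert (notMem_erase u U), ← sum_add_distrib]
      refine sum_eq_zero fun W hW => ?_
      have huW : u ∉ W := fun h => notMem_erase u U (mem_powerset.1 hW h)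
      have : univ.image y ⊆ R ∪ insert u W ↔ univ.image y ⊆ R ∪ W := by
        rw [union_insert, subset_insert_iff_of_notMem huy]
      rw [card_insert_of_notMem huW]
      simp only [this]
      ring
  by_contra! hall
  have hdvd : (24 : ℤ) ∣ #{y : Fin 4 → V | IsEmb G univ H y ∧ univ.image y = U} := by
    rw [← hsum]
    refine dvd_sum fun W hW => Dvd.dvd.mul_left ?_ _
    exact_mod_cast hall W (mem_powerset.1 hW)
  obtain ⟨h1, h2⟩ := card_fiber_pos_lt hT hB hx
  have h3 := Nat.le_of_dvd h1 (by exact_mod_cast hdvd)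
  omega

/-- A random subset of the vertices detects an induced copy with probability at least `1/16`. -/
theorem two_pow_le_card {G : SimpleGraph V} {H : SimpleGraph (Fin 4)} (hT : H ≠ ⊤) (hB : H ≠ ⊥)
    (h : H.IsIndContained G) :
    2 ^ Fintype.card V ≤ 16 * #{R : Finset V | ¬ 24 ∣ embCount G R H} := by
  classical
  obtain ⟨x, hx⟩ := exists_isEmb h
  set U := univ.image x with hU
  have hcard : #U = 4 := by
    rw [hU, card_image_of_injective _ hx.injective]
    rfl
  have hex : ∀ R : Finset V, ∃ W ⊆ U, Disjoint R U → ¬ 24 ∣ embCount G (R ∪ W) H := by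
    intro R
    by_cases hR : Disjoint R U
    · obtain ⟨W, hW, h⟩ := exists_not_dvd_embCount hT hB hx hR
      exact ⟨W, hW, fun _ => h⟩
    · exact ⟨∅, by simp, fun h => absurd h hR⟩
  choose W hW hW' using hex
  have hdisj : ∀ R ∈ Uᶜ.powerset, Disjoint R U := fun R hR =>
    disjoint_left.2 fun v hv hvU => by simpa [hvU] using mem_powerset.1 hR hv
  have h1 : #Uᶜ.powerset ≤ #{R : Finset V | ¬ 24 ∣ embCount G R H} := by
    -- Each of the sets outside `U`, a fraction 1/16 of all sets, is completed to a good one. It can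
    -- be recovered by removing `U`, so different sets give different completions.
    refine card_le_card_of_injOn (fun R => R ∪ W R) ?_ ?_
    · intro R hR
      simpa using hW' R (hdisj R hR)
    · intro R hR R' hR' hRR'
      have key : ∀ R ∈ Uᶜ.powerset, (R ∪ W R) \ U = R := by
        intro R hR
        rw [union_sdiff_distrib, sdiff_eq_empty_iff_subset.2 (hW R), union_empty,
          sdiff_eq_self_of_disjoint (hdisj R hR)]
      rw [← key R hR, ← key R' hR']
      exact congrArg (· \ U) hRR'
  rw [card_powerset, card_compl, hcard] at h1
  have h2 : 4 ≤ Fintype.card V := hcard ▸ card_le_univ U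
  calc 2 ^ Fintype.card V = 16 * 2 ^ (Fintype.card V - 4) := by
        rw [show (16 : ℕ) = 2 ^ 4 by norm_num, ← pow_add]
        congr 1
        omega
    _ ≤ _ := Nat.mul_le_mul_left _ h1

end Emb

end FourVertex

/-! ## Independent repetitions -/

namespace WordRAM

open Finset

/-- Restricting uniform coins to a set of positions gives uniform coins: every fibre of the
restriction has the same size. This is all the independence that the repetitions need. -/
theorem card_comp_mem {α β : Type*} [Fintype α] [Fintype β] [DecidableEq α] [DecidableEq β]
    {g : α → β} (hg : Function.Injective g) (X : Finset (α → Bool)) :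
    #{ρ : β → Bool | ρ ∘ g ∈ X} * 2 ^ Fintype.card α = #X * 2 ^ Fintype.card β := by
  classical
  let e : α ⊕ ((Set.range g)ᶜ : Set β) ≃ β :=
    (Equiv.sumCongr (Equiv.ofInjective g hg) (Equiv.refl _)).trans (Equiv.Set.sumCompl _)
  have he : ∀ x, e (Sum.inl x) = g x := fun x => by simp [e]
  let Φ : (β → Bool) ≃ (α → Bool) × (((Set.range g)ᶜ : Set β) → Bool) :=
    (Equiv.arrowCongr e.symm (Equiv.refl _)).trans (Equiv.sumArrowEquivProdArrow _ _ _)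
  have hΦ : ∀ ρ, (Φ ρ).1 = ρ ∘ g := by
    intro ρ
    funext x
    simp [Φ, he]
  have h1 : #{ρ : β → Bool | ρ ∘ g ∈ X} =
      #(X ×ˢ (univ : Finset (((Set.range g)ᶜ : Set β) → Bool))) := by
    refine card_equiv Φ fun ρ => ?_
    simp [hΦ]
  have h2 : Fintype.card β = Fintype.card α + Fintype.card ((Set.range g)ᶜ : Set β) := by
    rw [← Fintype.card_sum]
    exact (Fintype.card_congr e).symm
  rw [h1, card_product, card_univ, Fintype.card_fun, Fintype.card_bool, h2, pow_add]
  ring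

theorem coinProb_mono {T : ℕ} {E F : (Fin T → Bool) → Prop} (h : ∀ ρ, E ρ → F ρ) :
    coinProb T E ≤ coinProb T F := by
  unfold coinProb
  gcongr
  exact Nat.card_mono (Set.toFinite {ρ | F ρ}) (fun ρ hρ => h ρ hρ)

/-- The subset chosen by the `i`-th block of `n` coins. -/
def coinSet (coins : ℕ → Bool) (n i : ℕ) : Finset (Fin n) := {v | coins (i * n + v) = true}

/-- Twenty repetitions of an experiment that succeeds with probability at least `1/16` succeed
with probability at least `2/3`. -/
theorem two_thirds_le_coinProb {n T : ℕ} (hT : 20 * n ≤ T) (good : Finset (Fin n) → Prop)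
    [DecidablePred good] (h : 2 ^ n ≤ 16 * #{R : Finset (Fin n) | good R}) :
    2 / 3 ≤ coinProb T fun ρ => ∃ i < 20, good (coinSet (extendCoins ρ) n i) := by
  classical
  have hlt : ∀ p : Fin 20 × Fin n, (p.1 : ℕ) * n + p.2 < T := by
    intro p
    have h1 : ((p.1 : ℕ) + 1) * n ≤ 20 * n := Nat.mul_le_mul_right _ p.1.2
    have h2 := p.2.2
    have h3 : ((p.1 : ℕ) + 1) * n = p.1 * n + n := by ring
    omega
  -- The rounds use disjoint blocks of `n` coins, which is the injectivity of this map.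
  let g : Fin 20 × Fin n → Fin T := fun p => ⟨p.1 * n + p.2, hlt p⟩
  have hg : Function.Injective g := by
    intro p q hpq
    have h1 : (p.1 : ℕ) * n + p.2 = q.1 * n + q.2 := congrArg Fin.val hpq
    have hp := p.2.2
    have hq := q.2.2
    have h2 : (p.1 : ℕ) = q.1 := by
      have := congrArg (· / n) h1
      simpa [Nat.add_div_of_dvd_right, mul_comm _ n, Nat.mul_add_div (by omega : 0 < n),
        Nat.div_eq_of_lt hp, Nat.div_eq_of_lt hq] using this
    have h3 : (p.2 : ℕ) = q.2 := by rw [h2] at h1; omega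
    exact Prod.ext (Fin.ext h2) (Fin.ext h3)
  let S : (Fin n → Bool) ≃ Finset (Fin n) :=
    { toFun := fun y => {v | y v = true}
      invFun := fun R v => decide (v ∈ R)
      left_inv := fun y => by funext v; simp
      right_inv := fun R => by ext v; simp }
  have hS : ∀ y v, v ∈ S y ↔ y v = true := by
    intro y v
    simp [S]
  let bad : Finset (Fin n → Bool) := {y | ¬ good (S y)}
  have hbad : 16 * #bad ≤ 15 * 2 ^ n := by
    have h1 : #bad = #{R : Finset (Fin n) | ¬ good R} := by
      refine card_equiv S fun y => ?_
      simp [bad]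
    have h2 := card_filter_add_card_filter_not (s := (univ : Finset (Finset (Fin n)))) good
    rw [card_univ, Fintype.card_finset, Fintype.card_fin] at h2
    change 2 ^ n ≤ 16 * #(univ.filter good) at h
    omega
  let X : Finset (Fin 20 × Fin n → Bool) := {y | ∀ i, Function.curry y i ∈ bad}
  have hX : #X = #bad ^ 20 := by
    have : #X = #(Fintype.piFinset fun _ : Fin 20 => bad) := by
      refine card_equiv (Equiv.curry _ _ _) fun y => ?_
      simp [X, Fintype.mem_piFinset]
    rw [this, Fintype.card_piFinset]
    simp
  have hcoin : ∀ (ρ : Fin T → Bool) (i : Fin 20),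
      coinSet (extendCoins ρ) n i = S (Function.curry (ρ ∘ g) i) := by
    intro ρ i
    ext v
    have h1 : v ∈ coinSet (extendCoins ρ) n i ↔ extendCoins ρ (i * n + v) = true := by
      simp [coinSet]
    have h2 : v ∈ S (Function.curry (ρ ∘ g) i) ↔ ρ (g (i, v)) = true := hS _ v
    have h3 : extendCoins ρ (i * n + v) = ρ (g (i, v)) := by
      unfold extendCoins
      exact dif_pos (hlt (i, v))
    rw [h1, h2, h3]
  have hfail : ∀ ρ : Fin T → Bool, ρ ∘ g ∈ X ↔
      ¬ ∃ i < 20, good (coinSet (extendCoins ρ) n i) := by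
    intro ρ
    simp only [X, bad, mem_filter, mem_univ, true_and]
    push Not
    constructor
    · intro h i hi
      have := h ⟨i, hi⟩
      rwa [← hcoin] at this
    · intro h i
      rw [← hcoin]
      exact h i i.2
  have hcard := card_comp_mem hg X
  rw [hX, Fintype.card_prod, Fintype.card_fin, Fintype.card_fin, Fintype.card_fin] at hcard
  have hsplit := card_filter_add_card_filter_not (s := (univ : Finset (Fin T → Bool)))
    (fun ρ => ρ ∘ g ∈ X)
  rw [card_univ, Fintype.card_fun, Fintype.card_bool, Fintype.card_fin] at hsplit
  have hE : Nat.card {ρ : Fin T → Bool // ∃ i < 20, good (coinSet (extendCoins ρ) n i)} =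
      #{ρ : Fin T → Bool | ¬ ρ ∘ g ∈ X} := by
    rw [Nat.card_eq_fintype_card, Fintype.card_subtype]
    congr 1
    ext ρ
    simp only [mem_filter, mem_univ, true_and, hfail, not_not]
  unfold coinProb
  rw [hE, le_div_iff₀ (by positivity)]
  set F := #{ρ : Fin T → Bool | ρ ∘ g ∈ X}
  set N := #{ρ : Fin T → Bool | ¬ ρ ∘ g ∈ X}
  have h1 : (F : ℝ) + N = 2 ^ T := by exact_mod_cast hsplit
  have h2 : (F : ℝ) * 2 ^ (20 * n) = #bad ^ 20 * 2 ^ T := by exact_mod_cast hcard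
  have h3 : (#bad : ℝ) ≤ 15 / 16 * 2 ^ n := by
    have : (16 : ℝ) * #bad ≤ 15 * 2 ^ n := by exact_mod_cast hbad
    linarith
  have h4 : (#bad : ℝ) ^ 20 ≤ (15 / 16) ^ 20 * 2 ^ (20 * n) := by
    calc (#bad : ℝ) ^ 20 ≤ (15 / 16 * 2 ^ n) ^ 20 := by gcongr
      _ = _ := by rw [mul_pow, ← pow_mul, mul_comm n 20]
  have h5 : (F : ℝ) ≤ (15 / 16) ^ 20 * 2 ^ T := by
    have h6 : (0 : ℝ) < 2 ^ (20 * n) := by positivity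
    refine le_of_mul_le_mul_right ?_ h6
    rw [h2]
    calc (#bad : ℝ) ^ 20 * 2 ^ T ≤ (15 / 16) ^ 20 * 2 ^ (20 * n) * 2 ^ T := by gcongr
      _ = _ := by ring
  -- Twenty is a number of rounds for which `(15/16)^20` is below `1/3`.
  have h6 : (F : ℝ) ≤ 1 / 3 * 2 ^ T := h5.trans (by gcongr; norm_num)
  linarith

end WordRAM

/-! ## Rules for weakest preconditions -/

namespace WordRAM

instance : Coe Var Expr := ⟨.var⟩
instance : CoeFun Arr fun _ => Expr → Expr := ⟨.get⟩
instance (k : ℕ) : OfNat Expr k := ⟨.num k⟩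
instance : Add Expr := ⟨.bin .add⟩
instance : Sub Expr := ⟨.bin .sub⟩
instance : Mul Expr := ⟨.bin .mul⟩
instance : Mod Expr := ⟨.bin .mod⟩
instance : AndThen Cmd := ⟨fun p q => .seq p (q ())⟩

def Expr.lt (e f : Expr) : Expr := .bin .lt e f
def Expr.eq (e f : Expr) : Expr := .bin .eq e f

namespace Expr

variable (σ : St) (e f : Expr)

@[simp] theorem eval_var (x : Var) : (Expr.var x).eval σ = σ.v x := rfl
@[simp] theorem eval_num (k : ℕ) : (Expr.num k).eval σ = k := rfl
@[simp] theorem eval_ofNat (k : ℕ) : (ofNat(k) : Expr).eval σ = ofNat(k) := rfl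
@[simp] theorem eval_zero : (0 : Expr).eval σ = 0 := rfl
@[simp] theorem eval_one : (1 : Expr).eval σ = 1 := rfl
@[simp] theorem eval_get (A : Arr) : (Expr.get A e).eval σ = σ.a A (e.eval σ) := rfl
@[simp] theorem eval_add : (e + f).eval σ = e.eval σ + f.eval σ := rfl
@[simp] theorem eval_sub : (e - f).eval σ = e.eval σ - f.eval σ := rfl
@[simp] theorem eval_mul : (e * f).eval σ = e.eval σ * f.eval σ := rfl
@[simp] theorem eval_mod : (e % f).eval σ = e.eval σ % f.eval σ := rfl
@[simp] theorem eval_lt : (e.lt f).eval σ = if e.eval σ < f.eval σ then 1 else 0 := rfl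
@[simp] theorem eval_eq : (e.eq f).eval σ = if e.eval σ = f.eval σ then 1 else 0 := rfl

end Expr

namespace St

variable (σ : St) (x y : Var) (A A' : Arr) (i j k t : ℕ)

@[simp] theorem tick_v : σ.tick.v = σ.v := rfl
@[simp] theorem tick_a : σ.tick.a = σ.a := rfl
@[simp] theorem tick_pos : σ.tick.pos = σ.pos := rfl
@[simp] theorem tick_time : σ.tick.time = σ.time + 1 := rfl
@[simp] theorem set_v : (σ.set x k).v y = if y = x then k else σ.v y := by
  simp [set, Function.update_apply]
@[simp] theorem set_a : (σ.set x k).a = σ.a := rfl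
@[simp] theorem set_pos : (σ.set x k).pos = σ.pos := rfl
@[simp] theorem set_time : (σ.set x k).time = σ.time + 1 := rfl
@[simp] theorem toss_v : (σ.toss x k).v y = if y = x then k else σ.v y := by
  simp [toss, Function.update_apply]
@[simp] theorem toss_a : (σ.toss x k).a = σ.a := rfl
@[simp] theorem toss_pos : (σ.toss x k).pos = σ.pos + 1 := rfl
@[simp] theorem toss_time : (σ.toss x k).time = σ.time + 1 := rfl
@[simp] theorem write_v : (σ.write A i k).v = σ.v := rfl
@[simp] theorem write_a :
    (σ.write A i k).a A' = if A' = A then Function.update (σ.a A) i k else σ.a A' := by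
  simp [write, Function.update_apply]
@[simp] theorem write_pos : (σ.write A i k).pos = σ.pos := rfl
@[simp] theorem write_time : (σ.write A i k).time = σ.time + 1 := rfl
@[simp] theorem multiply_v (m : ℕ → ℕ) : (σ.multiply m t).v = σ.v := rfl
@[simp] theorem multiply_a (m : ℕ → ℕ) :
    (σ.multiply m t).a A = if A = .qm then m else σ.a A := by
  simp [multiply, Function.update_apply]
@[simp] theorem multiply_pos (m : ℕ → ℕ) : (σ.multiply m t).pos = σ.pos := rfl
@[simp] theorem multiply_time (m : ℕ → ℕ) : (σ.multiply m t).time = σ.time + t + 1 := rfl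

end St

/-- The variables a command may change. -/
def Cmd.wv : Cmd → List Var
  | .asg x _ => [x]
  | .inp x _ => [x]
  | .flip x => [x]
  | .seq p q => p.wv ++ q.wv
  | .ite _ p q => p.wv ++ q.wv
  | .whl _ p => p.wv
  | _ => []

/-- The arrays a command may change. -/
def Cmd.wa : Cmd → List Arr
  | .wr A _ _ => [A]
  | .seq p q => p.wa ++ q.wa
  | .ite _ p q => p.wa ++ q.wa
  | .whl _ p => p.wa
  | .mm => [.qm]
  | _ => []

/-- Does a command toss coins? -/
def Cmd.tosses : Cmd → Bool
  | .flip _ => true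
  | .seq p q => p.tosses || q.tosses
  | .ite _ p q => p.tosses || q.tosses
  | .whl _ p => p.tosses
  | _ => false

/-- `σ` and `τ` agree on what `c` does not change. -/
structure Agree (c : Cmd) (σ τ : St) : Prop where
  v : ∀ x, x ∉ c.wv → τ.v x = σ.v x
  a : ∀ A, A ∉ c.wa → τ.a A = σ.a A
  pos : c.tosses = false → τ.pos = σ.pos

theorem Agree.trans {c p q : Cmd} {σ τ υ : St} (h : Agree p σ τ) (h' : Agree q τ υ)
    (hv : ∀ x, x ∉ c.wv → x ∉ p.wv ∧ x ∉ q.wv) (ha : ∀ A, A ∉ c.wa → A ∉ p.wa ∧ A ∉ q.wa)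
    (ht : c.tosses = false → p.tosses = false ∧ q.tosses = false) : Agree c σ υ :=
  ⟨fun x hx => (h'.v x (hv x hx).2).trans (h.v x (hv x hx).1),
    fun A hA => (h'.a A (ha A hA).2).trans (h.a A (ha A hA).1),
    fun hc => (h'.pos (ht hc).2).trans (h.pos (ht hc).1)⟩

variable {E : Env}

theorem whlN_mono {e : Expr} {W W' : (St → Prop) → St → Prop} {Q Q' : St → Prop}
    (hW : ∀ (P P' : St → Prop) (τ : St), (∀ υ, P υ → P' υ) → W P τ → W' P' τ)
    (h : ∀ τ, Q τ → Q' τ) : ∀ m τ, whlN e W Q m τ → whlN e W' Q' m τ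
  | 0, _, hm => hm
  | m + 1, τ, hm => by
    simp only [whlN] at hm ⊢
    split_ifs at hm ⊢ with he
    · exact h _ hm
    · exact hW _ _ _ (whlN_mono hW h m) hm

theorem wp_mono {c : Cmd} : ∀ {Q Q' : St → Prop} {σ : St}, (∀ τ, Q τ → Q' τ) →
    wp E c Q σ → wp E c Q' σ := by
  induction c with
  | skip => exact fun h hq => h _ hq
  | asg x e => exact fun h hq => ⟨hq.1, h _ hq.2⟩
  | wr A i e => exact fun h hq => ⟨hq.1, h _ hq.2⟩
  | inp x e => exact fun h hq => ⟨hq.1, h _ hq.2⟩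
  | flip x => exact fun h hq => h _ hq
  | seq p q ihp ihq => exact fun h hq => ihp (fun τ => ihq h) hq
  | ite e p q ihp ihq => exact fun h hq => ⟨fun he => ihp h (hq.1 he), fun he => ihq h (hq.2 he)⟩
  | whl e p ih =>
    rintro Q Q' σ h ⟨m, hm⟩
    exact ⟨m, whlN_mono (W := wp E p) (W' := wp E p) (fun _ _ _ h => ih h) h m σ hm⟩
  | mm =>
    rintro Q Q' σ h ⟨hb, A, B, h1, h2, h3, h4, h5, h6, h7⟩
    exact ⟨hb, A, B, h1, h2, h3, h4, h5, h6, fun m hm hm' => h _ (h7 m hm hm')⟩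

/-- A command does not change what it does not mention. -/
theorem wp_agree {c : Cmd} : ∀ {Q : St → Prop} {σ : St}, wp E c Q σ →
    wp E c (fun τ => Q τ ∧ Agree c σ τ) σ := by
  induction c with
  | skip => exact fun h => ⟨h, fun _ _ => rfl, fun _ _ => rfl, fun _ => rfl⟩
  | asg x e =>
    refine fun h => ⟨h.1, h.2, fun y hy => ?_, fun _ _ => rfl, fun _ => rfl⟩
    have : y ≠ x := by simpa [Cmd.wv] using hy
    simp [this]
  | wr A i e =>
    refine fun h => ⟨h.1, h.2, fun _ _ => rfl, fun A' hA => ?_, fun _ => rfl⟩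
    have : A' ≠ A := by simpa [Cmd.wa] using hA
    simp [this]
  | inp x e =>
    refine fun h => ⟨h.1, h.2, fun y hy => ?_, fun _ _ => rfl, fun _ => rfl⟩
    have : y ≠ x := by simpa [Cmd.wv] using hy
    simp [this]
  | flip x =>
    refine fun h => ⟨h, fun y hy => ?_, fun _ _ => rfl, fun h => by simp [Cmd.tosses] at h⟩
    have : y ≠ x := by simpa [Cmd.wv] using hy
    simp [this]
  | seq p q ihp ihq =>
    intro Q σ h
    refine wp_mono (c := p) (fun τ hτ => ?_) (ihp h)
    refine wp_mono (c := q) (fun υ hυ => ?_) (ihq hτ.1)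
    exact ⟨hυ.1, hτ.2.trans hυ.2 (by simp [Cmd.wv]) (by simp [Cmd.wa]) (by simp [Cmd.tosses])⟩
  | ite e p q ihp ihq =>
    intro Q σ h
    refine ⟨fun he => wp_mono (fun τ hτ => ⟨hτ.1, ?_⟩) (ihp (h.1 he)),
      fun he => wp_mono (fun τ hτ => ⟨hτ.1, ?_⟩) (ihq (h.2 he))⟩
    · refine ⟨fun x hx => hτ.2.v x ?_, fun A hA => hτ.2.a A ?_, fun ht => hτ.2.pos ?_⟩ <;>
        simp_all [Cmd.wv, Cmd.wa, Cmd.tosses]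
    · refine ⟨fun x hx => hτ.2.v x ?_, fun A hA => hτ.2.a A ?_, fun ht => hτ.2.pos ?_⟩ <;>
        simp_all [Cmd.wv, Cmd.wa, Cmd.tosses]
  | whl e p ih =>
    rintro Q σ ⟨m, hm⟩
    refine ⟨m, ?_⟩
    have key : ∀ m σ, whlN e (wp E p) Q m σ →
        whlN e (wp E p) (fun τ => Q τ ∧ Agree (.whl e p) σ τ) m σ := by
      intro m
      induction m with
      | zero => exact fun _ h => h
      | succ m ihm =>
        intro σ h
        simp only [whlN] at h ⊢
        split_ifs at h ⊢ with he
        · exact ⟨h, fun _ _ => rfl, fun _ _ => rfl, fun _ => rfl⟩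
        · refine wp_mono (fun τ hτ => ?_) (ih h)
          refine whlN_mono (W := wp E p) (W' := wp E p) (fun _ _ _ h => wp_mono h) (fun υ hυ => ?_) m τ (ihm τ hτ.1)
          refine ⟨hυ.1, ?_⟩
          exact Agree.trans (c := .whl e p) (p := p) ⟨hτ.2.v, hτ.2.a, hτ.2.pos⟩ hυ.2
            (by simp [Cmd.wv]) (by simp [Cmd.wa]) (by simp [Cmd.tosses])
    exact key m σ hm
  | mm =>
    rintro Q σ ⟨hb, A, B, h1, h2, h3, h4, h5, h6, h7⟩
    refine ⟨hb, A, B, h1, h2, h3, h4, h5, h6, fun m hm hm' => ⟨h7 m hm hm', fun _ _ => rfl,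
      fun A' hA => ?_, fun _ => rfl⟩⟩
    have : A' ≠ .qm := by simpa [Cmd.wa] using hA
    simp [this]

/-- Frame rule: a specification has to mention only what a command changes, and everything else is
supplied by `Agree`. The two rules below are the versions for sequences. -/
theorem wp_cut {p : Cmd} {P Q : St → Prop} {σ : St} (hp : wp E p P σ)
    (hq : ∀ τ, P τ → Agree p σ τ → Q τ) : wp E p Q σ :=
  wp_mono (fun τ hτ => hq τ hτ.1 hτ.2) (wp_agree hp)

theorem wp_seq {p q : Cmd} {P Q : St → Prop} {σ : St} (hp : wp E p P σ)
    (hq : ∀ τ, P τ → Agree p σ τ → wp E q Q τ) : wp E (.seq p q) Q σ :=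
  wp_mono (c := p) (fun τ hτ => hq τ hτ.1 hτ.2) (wp_agree hp)

theorem wp_then {p q : Cmd} {P Q : St → Prop} {σ : St} (hp : wp E p P σ)
    (hq : ∀ τ, P τ → Agree p σ τ → wp E q Q τ) : wp E (p >> q) Q σ :=
  wp_seq hp hq

@[simp] theorem wp_skip_iff {Q : St → Prop} {σ : St} : wp E .skip Q σ ↔ Q σ.tick := Iff.rfl
@[simp] theorem wp_asg_iff {x : Var} {e : Expr} {Q : St → Prop} {σ : St} :
    wp E (.asg x e) Q σ ↔ e.eval σ ≤ E.lim ∧ Q (σ.set x (e.eval σ)) := Iff.rfl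
@[simp] theorem wp_wr_iff {A : Arr} {i e : Expr} {Q : St → Prop} {σ : St} :
    wp E (.wr A i e) Q σ ↔ e.eval σ ≤ E.lim ∧ Q (σ.write A (i.eval σ) (e.eval σ)) := Iff.rfl
@[simp] theorem wp_inp_iff {x : Var} {e : Expr} {Q : St → Prop} {σ : St} :
    wp E (.inp x e) Q σ ↔ e.eval σ < E.base ∧ Q (σ.set x (E.inp (e.eval σ))) := Iff.rfl
@[simp] theorem wp_flip_iff {x : Var} {Q : St → Prop} {σ : St} :
    wp E (.flip x) Q σ ↔ Q (σ.toss x (E.coins σ.pos).toNat) := Iff.rfl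
@[simp] theorem wp_then_iff {p q : Cmd} {Q : St → Prop} {σ : St} :
    wp E (p >> q) Q σ ↔ wp E p (wp E q Q) σ := Iff.rfl
@[simp] theorem wp_ite_iff {e : Expr} {p q : Cmd} {Q : St → Prop} {σ : St} :
    wp E (.ite e p q) Q σ ↔ if e.eval σ = 0 then wp E q Q σ.tick else wp E p Q σ.tick := by
  split_ifs with h <;> simp [wp, h]

/-- Count `x` up from `e` to `f`. -/
def Cmd.for (x : Var) (e f : Expr) (c : Cmd) : Cmd :=
  .asg x e >> .whl ((x : Expr).lt f) (c >> .asg x (x + 1))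

/-- `τ` is a state at the head of a loop with counter `x` and body `c` that was entered in `σ`. -/
structure InLoop (x : Var) (c : Cmd) (σ τ : St) : Prop where
  v : ∀ y, y ∉ c.wv → y ≠ x → τ.v y = σ.v y
  a : ∀ A, A ∉ c.wa → τ.a A = σ.a A
  pos : c.tosses = false → τ.pos = σ.pos

@[simp] theorem Cmd.wv_then (p q : Cmd) : (p >> q).wv = p.wv ++ q.wv := rfl
@[simp] theorem Cmd.wa_then (p q : Cmd) : (p >> q).wa = p.wa ++ q.wa := rfl
@[simp] theorem Cmd.wv_for (x : Var) (e f : Expr) (c : Cmd) :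
    (Cmd.for x e f c).wv = x :: (c.wv ++ [x]) := rfl
@[simp] theorem Cmd.wa_for (x : Var) (e f : Expr) (c : Cmd) : (Cmd.for x e f c).wa = c.wa :=
  List.append_nil _
@[simp] theorem Cmd.wv_asg (x : Var) (e : Expr) : (Cmd.asg x e).wv = [x] := rfl
@[simp] theorem Cmd.wa_asg (x : Var) (e : Expr) : (Cmd.asg x e).wa = [] := rfl

/-- The upper bound is evaluated anew in every pass, so it must keep the value `N` in all states
reachable in the loop. The invariant is stated for the head of the loop, after the counter has been
advanced. -/
theorem wp_for {x : Var} {e f : Expr} {c : Cmd} {Q : St → Prop} {σ : St} (I : ℕ → St → Prop)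
    (k N : ℕ) (he : e.eval σ = k) (hkN : k ≤ N) (hN : N ≤ E.lim) (hx : x ∉ c.wv)
    (hf : ∀ τ, InLoop x c σ τ → f.eval τ = N)
    (h0 : I k (σ.set x k))
    (hstep : ∀ i τ, k ≤ i → i < N → τ.v x = i → InLoop x c σ τ → I i τ →
      wp E c (fun τ' => I (i + 1) (τ'.set x (i + 1))) τ.tick)
    (hend : ∀ τ, τ.v x = N → InLoop x c σ τ → I N τ → Q τ.tick) :
    wp E (.for x e f c) Q σ := by
  have key : ∀ m i τ, i + m = N → k ≤ i → τ.v x = i → InLoop x c σ τ → I i τ →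
      whlN ((x : Expr).lt f) (wp E (c >> .asg x (x + 1))) Q (m + 1) τ := by
    intro m
    induction m with
    | zero =>
      intro i τ hi hki hτ hl hI
      have : i = N := by omega
      subst this
      simp only [whlN, Expr.eval_lt, Expr.eval_var, hτ, hf τ hl, lt_irrefl, if_false, if_true]
      exact hend τ hτ hl hI
    | succ m ih =>
      intro i τ hi hki hτ hl hI
      have hlt : i < N := by omega
      rw [whlN]
      simp only [Expr.eval_lt, Expr.eval_var, hτ, hf τ hl, hlt, if_true, one_ne_zero, if_false]
      refine wp_mono (c := c) (fun υ hυ => ?_) (wp_agree (hstep i τ hki hlt hτ hl hI))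
      have hυx : υ.v x = i := by rw [hυ.2.v x hx]; exact hτ
      simp only [wp_asg_iff, Expr.eval_add, Expr.eval_var, Expr.eval_one, hυx]
      refine ⟨by omega, ih (i + 1) _ (by omega) (by omega) (by simp) ?_ hυ.1⟩
      refine ⟨fun y hy hyx => ?_, fun A hA => ?_, fun ht => ?_⟩
      · simp only [St.set_v, if_neg hyx]
        rw [hυ.2.v y hy]
        exact hl.v y hy hyx
      · rw [St.set_a, hυ.2.a A hA]
        exact hl.a A hA
      · rw [St.set_pos, hυ.2.pos ht]
        exact hl.pos ht
  refine ⟨by omega, N - k + 1, ?_⟩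
  rw [he]
  refine key (N - k) k _ (by omega) le_rfl (by simp) ⟨fun y _ hy => by simp [hy], fun _ _ => rfl,
    fun _ => rfl⟩ h0

/-- The variant `μ` bounds the number of passes and so supplies the depth to which the loop has to
be unfolded. -/
theorem wp_whl {e : Expr} {c : Cmd} {Q : St → Prop} {σ : St} (I : St → Prop) (μ : St → ℕ)
    (h0 : I σ)
    (hstep : ∀ τ, Agree c σ τ → I τ → e.eval τ ≠ 0 →
      wp E c (fun τ' => I τ' ∧ μ τ' < μ τ) τ.tick)
    (hend : ∀ τ, Agree c σ τ → I τ → e.eval τ = 0 → Q τ.tick) : wp E (.whl e c) Q σ := by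
  have key : ∀ m τ, μ τ < m → Agree c σ τ → I τ → whlN e (wp E c) Q m τ := by
    intro m
    induction m with
    | zero => intro τ hτ; omega
    | succ m ih =>
      intro τ hτ hl hI
      simp only [whlN]
      split_ifs with he
      · exact hend τ hl hI he
      · refine wp_mono (c := c) (fun υ hυ => ih υ (by omega) ?_ hυ.1.1) (wp_agree (hstep τ hl hI he))
        exact Agree.trans (p := c) (q := c) hl ⟨hυ.2.v, hυ.2.a, hυ.2.pos⟩ (fun _ h => ⟨h, h⟩)
          (fun _ h => ⟨h, h⟩) (fun h => ⟨h, h⟩)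
  exact ⟨μ σ + 1, key _ σ (by omega) ⟨fun _ _ => rfl, fun _ _ => rfl, fun _ => rfl⟩ h0⟩

end WordRAM

/-! ## The detection program -/

namespace WordRAM

open Var Arr

namespace Program

/-- Copy the adjacency matrix of `H`. -/
def readH : Cmd :=
  .for i 0 16 (.inp x (i + 1) >> .wr hb i x)

/-- Compute the positions of the adjacency lists. -/
def starts : Cmd :=
  -- The lists are preceded by one cell for `n`, 16 for `H`, `n` for the separator and `n` for the
  -- degrees.
  .wr st 0 (2 * n + 17) >>
  .for u 0 n (.inp x (u + n + 17) >> .wr st (u + 1) ((st u) + x))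

/-- Build the adjacency matrix and the list of the first ends of the edges. -/
def edges : Cmd :=
  .for u 0 n (.for j (st u) (st (u + 1))
    (.inp w j >> .wr adj (u * n + w) 1 >> .wr es j u))

/-- Put the separator to the beginning of the vertex order. -/
def separator : Cmd :=
  .asg tl 0 >>
  .for u 0 n (.inp x (u + 17) >>
    .ite x (.wr ord tl u >> .wr mk u 1 >> .asg tl (tl + 1)) .skip) >>
  .asg sg tl

/-- Append the unmarked neighbours of the vertex at the head of the queue. -/
def expand : Cmd :=
  .asg y (ord hd) >>
  .for j (st y) (st (y + 1)) (.inp w j >>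
    .ite (mk w) .skip (.wr mk w 1 >> .wr ord tl w >> .asg tl (tl + 1))) >>
  .asg hd (hd + 1)

/-- Append the component of `u`, and close the current chunk if it is large enough. -/
def component : Cmd :=
  .ite (mk u) .skip
    (.wr mk u 1 >> .wr ord tl u >> .asg tl (tl + 1) >>
    .whl (Expr.lt hd tl) expand >>
    .ite (Expr.lt tl ((cs nc) + sg)) .skip (.asg nc (nc + 1) >> .wr cs nc tl))

/-- Order the vertices outside of the separator by components, and cut the order into chunks. -/
def chunks : Cmd :=
  -- The first two cuts coincide, so chunk 0 is empty and block 0 is the separator alone. It records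
  -- the common neighbours inside the separator, which later blocks would otherwise count again.
  .asg hd sg >> .asg nc 1 >> .wr cs 0 sg >> .wr cs 1 sg >>
  .for u 0 n component >>
  .asg nc (nc + 1) >> .wr cs nc tl

/-- Choose a random subset of the vertices. -/
def sample : Cmd :=
  .asg nr 0 >> .for u 0 n (.flip x >> .wr r u x >> .asg nr (nr + x))

/-- The vertex with number `z` of the current block. -/
def vertex (z : Var) : Expr := (ord (z + (1 - Expr.lt z sg) * lo))

/-- Run `c` for all pairs of vertices with numbers less than `z`. -/
def pairs (z : Var) (c : Cmd) : Cmd :=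
  .for i 0 z (.asg u (vertex i) >> .for j 0 z (.asg w (vertex j) >> c))

/-- Write the adjacency matrix of the current block twice to the memory for the product. -/
def fill : Cmd :=
  .wr qm off b >>
  pairs b (.asg x ((adj (u * n + w)) * ((r u) * (r w))) >>
    .wr qm (off + (1 + (i * b + j))) x >>
    .wr qm (off + (1 + b * b + (i * b + j))) x)

/-- Add the numbers of common neighbours in the current block. -/
def collect : Cmd :=
  pairs b (.asg p ((qm (off + (1 + 2 * (b * b) + (i * b + j)))) % 24) >>
    .ite (Expr.lt i sg * Expr.lt j sg)
      (.ite kc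
        -- As 23 is -1 modulo 24, `h` is the number of common neighbours inside the chunk, and `q2`
        -- is decreased by its square.
        (.asg h ((p + 23 * (g0 (u * n + w))) % 24) >>
          .wr pc (u * n + w) (((pc (u * n + w)) + h) % 24) >>
          .asg q2 ((q2 + 23 * (h * h)) % 24))
        (.wr g0 (u * n + w) p >> .wr pc (u * n + w) p))
      (.wr pc (u * n + w) p >> .asg q2 ((q2 + p * p) % 24)))

/-- The step of `off` abandons the window after use, so that the next product is formed on cells
that are still zero. An empty block is skipped because the multiplication program needs matrices of
positive order. -/
def block : Cmd :=
  .asg lo ((cs kc) - sg) >> .asg b ((cs (kc + 1)) - lo) >> fill >>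
  .ite b .mm .skip >> collect >> .asg off (off + str)

/-- Complete the sum of the squares of the codegrees. -/
def crossing : Cmd :=
  pairs sg (.asg p (pc (u * n + w)) >> .asg h ((p + 23 * (g0 (u * n + w))) % 24) >>
    .asg q2 ((q2 + (p * p + h * h)) % 24))

/-- Compute the sums over the edges. -/
def edgeSums : Cmd :=
  .asg e1 0 >> .asg ed 0 >> .asg ed2 0 >> .asg edd 0 >> .asg ep 0 >> .asg epd 0 >> .asg epp 0 >>
  .for j (st 0) (st n) (.asg u (es j) >> .inp w j >>
    .asg x ((r u) * (r w)) >> .asg y (pc (u * n + u)) >> .asg i (pc (w * n + w)) >>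
    .asg p (pc (u * n + w)) >>
    .asg e1 ((e1 + x) % 24) >> .asg ed ((ed + x * y) % 24) >>
    .asg ed2 ((ed2 + x * (y * y)) % 24) >> .asg edd ((edd + x * (y * i)) % 24) >>
    .asg ep ((ep + x * p) % 24) >> .asg epd ((epd + x * (p * y)) % 24) >>
    .asg epp ((epp + x * (p * p)) % 24))

/-- Evaluate the expression for the graph `H` of the input. -/
def dispatch {α : Type*} (test val : α → Expr) : List α → Cmd
  | [] => .skip
  | H :: l => .ite (test H) (.asg res (val H % 24)) (dispatch test val l)

/-- No array is cleared between rounds: block 0 overwrites the entries for pairs in the separator,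
and each remaining entry that is read later is overwritten by its own block. Also `off` keeps
growing. -/
def round (eval : Cmd) : Cmd :=
  sample >> .asg q2 0 >> .for kc 0 nc block >> crossing >> edgeSums >> eval >>
  .ite res (.asg ans 1) .skip

/-- `c * n ^ d + 3 * n ^ 2 + 1` -/
def stride (c : ℕ) : ℕ → Expr
  | 0 => .num c
  | d + 1 => stride c d * n

def setup (c d : ℕ) : Cmd :=
  .inp n 0 >> .asg str (stride c d + 3 * (n * n) + 1)

def main (c d : ℕ) (eval : Cmd) : Cmd :=
  setup c d >> readH >> starts >> edges >> separator >> chunks >>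
  .asg off 0 >> .asg ans 0 >> .for rep 0 20 (round eval)

end Program

end WordRAM

/-! ## Reading the input -/

namespace WordRAM

theorem pair_div {b i j : ℕ} (hj : j < b) : (i * b + j) / b = i ∧ (i * b + j) % b = j := by
  constructor
  · rw [mul_comm, Nat.mul_add_div (by omega), Nat.div_eq_of_lt hj, add_zero]
  · rw [Nat.mul_add_mod', Nat.mod_eq_of_lt hj]

theorem pair_lt {b i j : ℕ} (hi : i < b) (hj : j < b) : i * b + j < b * b := by
  have := Nat.mul_le_mul_right b (Nat.succ_le_of_lt hi)
  rw [Nat.succ_mul] at this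
  omega

theorem pair_inj {n u w u' w' : ℕ} (hw : w < n) (hw' : w' < n) (h : u * n + w = u' * n + w') :
    u = u' ∧ w = w' := by
  have h1 := pair_div (i := u) hw
  have h2 := pair_div (i := u') hw'
  rw [h] at h1
  exact ⟨h1.1.symm.trans h2.1, h1.2.symm.trans h2.2⟩

/-- The input encodes a graph with vertices `0, …, n - 1` and adjacency function `a`; the
adjacency list of `u` starts at `pos u`. -/
structure Input (E : Env) (n : ℕ) (a : ℕ → ℕ → ℕ) (pos : ℕ → ℕ) : Prop where
  inp_zero : E.inp 0 = n
  pos_zero : pos 0 = 2 * n + 17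
  pos_succ : ∀ u, u < n → pos (u + 1) = pos u + E.inp (u + n + 17)
  inp_lt : ∀ u, u < n → ∀ j, pos u ≤ j → j < pos (u + 1) → E.inp j < n
  adj_one : ∀ u, u < n → ∀ j, pos u ≤ j → j < pos (u + 1) → a u (E.inp j) = 1
  adj_zero : ∀ u, u < n → ∀ w, (∀ j, pos u ≤ j → j < pos (u + 1) → E.inp j ≠ w) → a u w = 0
  inj : ∀ u, u < n → ∀ j j', pos u ≤ j → j < pos (u + 1) → pos u ≤ j' → j' < pos (u + 1) →
    E.inp j = E.inp j' → j = j'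
  base : pos n ≤ E.base
  base_le : E.base ≤ E.lim
  two_le : 24 ≤ E.lim

namespace Input

variable {E : Env} {n : ℕ} {a : ℕ → ℕ → ℕ} {pos : ℕ → ℕ} (hI : Input E n a pos)
include hI

theorem pos_le_succ {u : ℕ} (hu : u < n) : pos u ≤ pos (u + 1) := by
  rw [hI.pos_succ u hu]; omega

theorem pos_mono {u v : ℕ} (huv : u ≤ v) (hv : v ≤ n) : pos u ≤ pos v := by
  induction v, huv using Nat.le_induction with
  | base => exact le_rfl
  | succ v _ ih => exact (ih (by omega)).trans (hI.pos_le_succ (by omega))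

theorem pos_lt_base {u j : ℕ} (hu : u < n) (hj : j < pos (u + 1)) : j < E.base :=
  (hj.trans_le (hI.pos_mono (by omega) le_rfl)).trans_le hI.base

theorem head_lt_base {j : ℕ} (hj : j < 2 * n + 17) : j < E.base := by
  have := hI.pos_mono (Nat.zero_le n) le_rfl
  have := hI.base
  have := hI.pos_zero
  omega

theorem n_le : 2 * n + 17 ≤ E.lim := by
  have := hI.pos_mono (Nat.zero_le n) le_rfl
  have := hI.base
  have := hI.pos_zero
  have := hI.base_le
  omega

theorem pos_le_lim {u : ℕ} (hu : u ≤ n) : pos u ≤ E.lim :=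
  ((hI.pos_mono hu le_rfl).trans hI.base).trans hI.base_le

end Input

namespace Program

variable {E : Env} {n : ℕ} {a : ℕ → ℕ → ℕ} {pos : ℕ → ℕ} {σ : St}

theorem readH_spec (hI : Input E n a pos) (hbit : ∀ i, i < 16 → E.inp (i + 1) ≤ 1) :
    wp E readH (fun τ => (∀ i, i < 16 → τ.a .hb i = E.inp (i + 1)) ∧ τ.time ≤ σ.time + 100) σ := by
  have hlim := hI.two_le
  refine wp_for (fun i τ => (∀ j, j < i → τ.a .hb j = E.inp (j + 1)) ∧
    τ.time ≤ σ.time + 4 * i + 1) 0 16 rfl (by omega) (by omega) (by decide) (fun τ hτ => rfl)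
    ⟨by omega, by simp⟩ ?_ ?_
  · rintro i τ - hi hx - ⟨h1, h2⟩
    have := hbit i hi
    simp only [wp_then_iff, wp_inp_iff, wp_wr_iff, Expr.eval_add, Expr.eval_var, Expr.eval_one,
      St.tick_v, hx, St.set_v, St.tick_time, St.set_time, St.write_time, St.set_a, St.write_a,
      St.tick_a, reduceCtorEq, if_true, if_false]
    refine ⟨hI.head_lt_base (by omega), by omega, fun j hj => ?_, by omega⟩
    by_cases hji : j = i
    · subst hji; simp
    · rw [Function.update_of_ne hji]
      exact h1 j (by omega)
  · rintro τ - - ⟨h1, h2⟩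
    exact ⟨by simpa using h1, by simp; omega⟩

theorem starts_spec (hI : Input E n a pos) (hn : σ.v .n = n) :
    wp E starts (fun τ => (∀ u, u ≤ n → τ.a .st u = pos u) ∧ τ.time ≤ σ.time + 4 * n + 10) σ := by
  have hlim := hI.n_le
  unfold starts
  rw [wp_then_iff]
  simp only [wp_wr_iff, Expr.eval_add, Expr.eval_mul, Expr.eval_ofNat, Expr.eval_var, hn,
    Expr.eval_zero]
  refine ⟨by omega, ?_⟩
  refine wp_for (fun i τ => (∀ j, j ≤ i → τ.a .st j = pos j) ∧
    τ.time ≤ σ.time + 4 * i + 2) 0 n rfl (by omega) (by omega) (by decide) ?_ ?_ ?_ ?_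
  · intro τ hτ
    exact (hτ.v .n (by decide) (by decide)).trans (by simpa using hn)
  · exact ⟨fun j hj => by simp [Nat.le_zero.1 hj, hI.pos_zero], by simp⟩
  · rintro i τ - hi hx hl ⟨h1, h2⟩
    have hτn : τ.v .n = n := (hl.v .n (by decide) (by decide)).trans (by simpa using hn)
    have hs := hI.pos_succ i hi
    have hle := hI.pos_le_lim (u := i + 1) (by omega)
    simp only [wp_then_iff, wp_inp_iff, wp_wr_iff, Expr.eval_add, Expr.eval_var, Expr.eval_one,
      St.tick_v, hx, St.set_v, St.tick_time, St.set_time, St.write_time, St.set_a, St.write_a,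
      St.tick_a, reduceCtorEq, if_true, if_false, Expr.eval_get, Expr.eval_ofNat, hτn,
      h1 i le_rfl, ← hs]
    refine ⟨hI.head_lt_base (by omega), hle, fun j hj => ?_, by omega⟩
    by_cases hji : j = i + 1
    · subst hji; simp
    · rw [Function.update_of_ne hji]
      exact h1 j (by omega)
  · rintro τ - - ⟨h1, h2⟩
    exact ⟨by simpa using h1, by simp; omega⟩

/-- The matrix `adj` has quadratically many entries, but it starts out as zero and only the entries
of edges are written; so the time is linear in `n` and in the length of the lists. -/
theorem edges_spec (hI : Input E n a pos) (hn : σ.v .n = n) (hst : ∀ u, u ≤ n → σ.a .st u = pos u)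
    (h0 : ∀ i, σ.a .adj i = 0) :
    wp E edges (fun τ => (∀ u w, u < n → w < n → τ.a .adj (u * n + w) = a u w) ∧
      (∀ u, u < n → ∀ j, pos u ≤ j → j < pos (u + 1) → τ.a .es j = u) ∧
      τ.time + 5 * pos 0 ≤ σ.time + 4 * n + 5 * pos n + 2) σ := by
  classical
  have hlim := hI.n_le
  have hτst : ∀ {τ : St}, InLoop .u (.for .j (Arr.st Var.u) (Arr.st (Var.u + 1))
      (.inp .w Var.j >> .wr .adj (Var.u * Var.n + Var.w) 1 >> .wr .es Var.j Var.u)) σ τ →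
      ∀ u, u ≤ n → τ.a .st u = pos u := by
    intro τ hl u hu
    rw [hl.a .st (by decide), hst u hu]
  refine wp_for (fun u τ =>
    (∀ u' w, u' < n → w < n → τ.a .adj (u' * n + w) = if u' < u then a u' w else 0) ∧
    (∀ u', u' < u → ∀ j, pos u' ≤ j → j < pos (u' + 1) → τ.a .es j = u') ∧
    τ.time + 5 * pos 0 ≤ σ.time + 4 * u + 5 * pos u + 1) 0 n rfl (by omega) (by omega) (by decide)
    ?_ ?_ ?_ ?_
  · intro τ hτ
    exact (hτ.v .n (by decide) (by decide)).trans hn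
  · exact ⟨by simp [h0], by simp, by simp; omega⟩
  · rintro u τ - hu hx hl ⟨h1, h2, h3⟩
    have hτn : τ.v .n = n := (hl.v .n (by decide) (by decide)).trans hn
    have hτs := hτst hl
    have hle := hI.pos_le_lim (u := u + 1) (by omega)
    refine wp_for (fun j τ' =>
      (∀ u' w, u' < n → w < n → τ'.a .adj (u' * n + w) = if u' < u then a u' w else
        if u' = u ∧ ∃ j', pos u ≤ j' ∧ j' < j ∧ E.inp j' = w then 1 else 0) ∧
      (∀ u', u' < u → ∀ j, pos u' ≤ j → j < pos (u' + 1) → τ'.a .es j = u') ∧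
      (∀ j', pos u ≤ j' → j' < j → τ'.a .es j' = u) ∧
      τ'.time + 5 * pos 0 ≤ σ.time + 4 * u + 5 * j + 3) (pos u) (pos (u + 1)) ?_
      (hI.pos_le_succ hu) hle (by decide) ?_ ?_ ?_ ?_
    · simp [hx, hτs u (by omega)]
    · intro τ' hτ'
      rw [Expr.eval_get, hτ'.a .st (by decide)]
      simp only [Expr.eval_add, Expr.eval_var, Expr.eval_one, hτ'.v .u (by decide) (by decide),
        St.tick_v, hx, St.tick_a]
      exact hτs _ (by omega)
    · refine ⟨fun u' w hu' hw => ?_, ?_, ?_, ?_⟩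
      · have : ¬ (u' = u ∧ ∃ j', pos u ≤ j' ∧ j' < pos u ∧ E.inp j' = w) := by
          rintro ⟨-, j', h, h', -⟩
          omega
        rw [if_neg this]
        simpa using h1 u' w hu' hw
      · simpa using h2
      · intro j' h h'; omega
      · simp; omega
    · rintro j υ hj hj' hυj hυ ⟨g1, g2, g3, g4⟩
      have hυn : υ.v .n = n := (hυ.v .n (by decide) (by decide)).trans (by simpa using hτn)
      have hυu : υ.v .u = u := (hυ.v .u (by decide) (by decide)).trans (by simpa using hx)
      have hw := hI.inp_lt u hu j hj hj'
      simp only [wp_then_iff, wp_inp_iff, wp_wr_iff, Expr.eval_add, Expr.eval_var, Expr.eval_one,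
        St.tick_v, hυj, hυu, hυn, St.set_v, St.tick_time, St.set_time, St.write_time, St.set_a,
        St.write_a, St.tick_a, reduceCtorEq, if_true, if_false, Expr.eval_mul, St.write_v]
      refine ⟨hI.pos_lt_base hu hj', by omega, by omega, fun u' w hu' hw' => ?_,
        fun u' hu' j' h h' => ?_, fun j' h h' => ?_, by omega⟩
      · by_cases he : u' * n + w = u * n + E.inp j
        · obtain ⟨rfl, rfl⟩ := pair_inj hw' hw he
          rw [Function.update_self, if_neg (lt_irrefl _), if_pos]
          exact ⟨rfl, j, hj, by omega, rfl⟩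
        · rw [Function.update_of_ne he, g1 u' w hu' hw']
          congr 1
          by_cases hu'' : u' = u
          · subst hu''
            have : (∃ j', pos u' ≤ j' ∧ j' < j ∧ E.inp j' = w) ↔
                ∃ j', pos u' ≤ j' ∧ j' < j + 1 ∧ E.inp j' = w := by
              constructor
              · rintro ⟨j', h, h', h''⟩
                exact ⟨j', h, by omega, h''⟩
              · rintro ⟨j', h, h', rfl⟩
                refine ⟨j', h, ?_, rfl⟩
                have : j' ≠ j := by
                  rintro rfl
                  exact he rfl
                omega
            simp only [this]
          · simp [hu'']
      · have : j' ≠ j := by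
          have := hI.pos_mono (u := u' + 1) (v := u) (by omega) (by omega)
          omega
        rw [Function.update_of_ne this]
        exact g2 u' hu' j' h h'
      · by_cases hjj : j' = j
        · subst hjj; simp
        · rw [Function.update_of_ne hjj]
          exact g3 j' h (by omega)
    · rintro υ hυj hυ ⟨g1, g2, g3, g4⟩
      refine ⟨fun u' w hu' hw => ?_, fun u' hu' j h h' => ?_, ?_⟩
      · rw [St.set_a, St.tick_a, g1 u' w hu' hw]
        rcases lt_trichotomy u' u with h | h | h
        · rw [if_pos h, if_pos (by omega)]
        · subst h
          rw [if_neg (lt_irrefl _), if_pos (Nat.lt_succ_self u')]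
          split_ifs with hex
          · obtain ⟨-, j', h, h', rfl⟩ := hex
            exact (hI.adj_one u' hu j' h h').symm
          · refine (hI.adj_zero u' hu w fun j h h' heq => hex ⟨rfl, j, h, h', heq⟩).symm
        · rw [if_neg (by omega), if_neg (fun h' => by omega), if_neg (by omega)]
      · rw [St.set_a, St.tick_a]
        by_cases hu'' : u' = u
        · subst hu''
          exact g3 j h h'
        · exact g2 u' (by omega) j h h'
      · simp; omega
  · rintro τ - - ⟨h1, h2, h3⟩
    refine ⟨fun u w hu hw => ?_, h2, by simp; omega⟩
    rw [St.tick_a, h1 u w hu hw, if_pos hu]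

end Program

end WordRAM

/-! ## The order of the vertices and the chunks -/

namespace WordRAM

/-- `ord` lists `t` different vertices, and `mk` marks them. -/
structure Listing (n t : ℕ) (ord mk : ℕ → ℕ) : Prop where
  lt : ∀ i, i < t → ord i < n
  inj : ∀ i j, i < t → j < t → ord i = ord j → i = j
  marked : ∀ v, v < n → (mk v ≠ 0 ↔ ∃ i, i < t ∧ ord i = v)

namespace Listing

variable {n t : ℕ} {ord mk : ℕ → ℕ}

theorem push (h : Listing n t ord mk) {w : ℕ} (hw : w < n) (hm : mk w = 0) :
    Listing n (t + 1) (Function.update ord t w) (Function.update mk w 1) := by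
  have hne : ∀ i, i < t → ord i ≠ w := fun i hi hiw => (h.marked w hw).2 ⟨i, hi, hiw⟩ hm
  refine ⟨fun i hi => ?_, fun i j hi hj hij => ?_, fun v hv => ?_⟩
  · rw [Function.update_apply]
    split_ifs
    · exact hw
    · exact h.lt i (by omega)
  · rw [Function.update_apply, Function.update_apply] at hij
    split_ifs at hij with h1 h2 h2
    · omega
    · exact absurd hij.symm (hne j (by omega))
    · exact absurd hij (hne i (by omega))
    · exact h.inj i j (by omega) (by omega) hij
  · rw [Function.update_apply]
    split_ifs with hvw
    · simp only [ne_eq, one_ne_zero, not_false_eq_true, true_iff]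
      exact ⟨t, by omega, by simp [hvw]⟩
    · rw [h.marked v hv]
      constructor
      · rintro ⟨i, hi, rfl⟩
        exact ⟨i, by omega, by rw [Function.update_of_ne (by omega)]⟩
      · rintro ⟨i, hi, hiv⟩
        rw [Function.update_apply] at hiv
        split_ifs at hiv with hit
        · exact absurd hiv.symm hvw
        · exact ⟨i, by omega, hiv⟩

theorem le (h : Listing n t ord mk) : t ≤ n := by
  have := Finset.card_le_card_of_injOn (s := Finset.range t) (t := Finset.range n) ord
    (fun i hi => by simpa using h.lt i (by simpa using hi))
    (fun i hi j hj hij => h.inj i j (by simpa using hi) (by simpa using hj) hij)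
  simpa using this

theorem lt_of_unmarked (h : Listing n t ord mk) {w : ℕ} (hw : w < n) (hm : mk w = 0) : t < n :=
  (h.push hw hm).le

theorem sum_le (h : Listing n t ord mk) (f : ℕ → ℕ) :
    ∑ i ∈ Finset.range t, f (ord i) ≤ ∑ v ∈ Finset.range n, f v := by
  rw [← Finset.sum_image (s := Finset.range t) (g := ord) (f := f)
    (fun i hi j hj hij => h.inj i j (by simpa using hi) (by simpa using hj) hij)]
  refine Finset.sum_le_sum_of_subset fun v hv => ?_
  obtain ⟨i, hi, rfl⟩ := Finset.mem_image.1 hv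
  simpa using h.lt i (by simpa using hi)

end Listing

/-- A state of the search: the separator comes first, and the neighbours of the vertices between
the separator and the head of the queue are in the queue. -/
structure Front (n s : ℕ) (a : ℕ → ℕ → ℕ) (inS : ℕ → Prop) (ord mk : ℕ → ℕ)
    (hd tl : ℕ) : Prop extends Listing n tl ord mk where
  le_hd : s ≤ hd
  hd_le : hd ≤ tl
  mem_iff : ∀ i, i < tl → (inS (ord i) ↔ i < s)
  mk_of_mem : ∀ v, v < n → inS v → mk v ≠ 0
  closed : ∀ i, s ≤ i → i < hd → ∀ w, w < n → a (ord i) w ≠ 0 → mk w ≠ 0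

theorem Front.push {n s hd tl : ℕ} {a : ℕ → ℕ → ℕ} {inS : ℕ → Prop} {ord mk : ℕ → ℕ}
    (h : Front n s a inS ord mk hd tl) {w : ℕ} (hw : w < n) (hm : mk w = 0) :
    Front n s a inS (Function.update ord tl w) (Function.update mk w 1) hd (tl + 1) where
  toListing := h.toListing.push hw hm
  le_hd := h.le_hd
  hd_le := by have := h.hd_le; omega
  mem_iff i hi := by
    have h1 := h.le_hd
    have h2 := h.hd_le
    rw [Function.update_apply]
    split_ifs with hit
    · exact ⟨fun hS => absurd hm (h.mk_of_mem w hw hS), fun _ => by omega⟩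
    · exact h.mem_iff i (by omega)
  mk_of_mem v hv hS := by
    rw [Function.update_apply]
    split_ifs
    · simp
    · exact h.mk_of_mem v hv hS
  closed i hi hi' v hv ha := by
    have h2 := h.hd_le
    rw [Function.update_of_ne (by omega)] at ha
    rw [Function.update_apply]
    split_ifs
    · simp
    · exact h.closed i hi hi' v hv ha

/-- The values `cs 0, …, cs c` cut the order of the vertices into chunks without edges between
them; the chunks `1, …, m - 1` are large. -/
structure Cuts (n k s : ℕ) (a : ℕ → ℕ → ℕ) (ord cs : ℕ → ℕ) (c m tl : ℕ) : Prop where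
  zero : cs 0 = s
  one : cs 1 = s
  one_le : 1 ≤ c
  mono : ∀ i, i < c → cs i ≤ cs (i + 1)
  last : cs c ≤ tl
  closed : ∀ i, i ≤ c → ∀ j, s ≤ j → j < cs i → ∀ w, w < n → a (ord j) w ≠ 0 →
    ∃ j', j' < cs i ∧ ord j' = w
  size : ∀ i, i < c → cs (i + 1) ≤ cs i + k
  big : ∀ i, 1 ≤ i → i < m → cs i + max s 1 ≤ cs (i + 1)

namespace Cuts

variable {n k s c m tl : ℕ} {a : ℕ → ℕ → ℕ} {ord cs : ℕ → ℕ}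

theorem mono' (h : Cuts n k s a ord cs c m tl) {i j : ℕ} (hij : i ≤ j) (hj : j ≤ c) :
    cs i ≤ cs j := by
  induction j, hij using Nat.le_induction with
  | base => exact le_rfl
  | succ v _ ih => exact (ih (by omega)).trans (h.mono _ (by omega))

theorem congr (h : Cuts n k s a ord cs c m tl) {ord' : ℕ → ℕ} {tl' : ℕ} (htl : tl ≤ tl')
    (hord : ∀ i, i < tl → ord' i = ord i) : Cuts n k s a ord' cs c m tl' where
  zero := h.zero
  one := h.one
  one_le := h.one_le
  mono := h.mono
  last := h.last.trans htl
  closed i hi j hj hj' w hw ha := by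
    have h1 := h.mono' hi le_rfl
    have h2 := h.last
    rw [hord j (by omega)] at ha
    obtain ⟨j', h3, h4⟩ := h.closed i hi j hj hj' w hw ha
    exact ⟨j', h3, by rw [hord j' (by omega), h4]⟩
  size := h.size
  big := h.big

theorem push (h : Cuts n k s a ord cs c m tl) (hm : m ≤ c)
    (hcl : ∀ j, s ≤ j → j < tl → ∀ w, w < n → a (ord j) w ≠ 0 → ∃ j', j' < tl ∧ ord j' = w)
    (hk : tl ≤ cs c + k) : Cuts n k s a ord (Function.update cs (c + 1) tl) (c + 1) m tl := by
  have key : ∀ i, i ≤ c → Function.update cs (c + 1) tl i = cs i := fun i hi =>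
    Function.update_of_ne (by omega) _ _
  have h1 := h.one_le
  refine ⟨?_, ?_, by omega, fun i hi => ?_, ?_, fun i hi => ?_, fun i hi => ?_, fun i hi hi' => ?_⟩
  · rw [key 0 (by omega), h.zero]
  · rw [key 1 (by omega), h.one]
  · by_cases hic : i = c
    · subst hic
      rw [Function.update_self, key i le_rfl]
      exact h.last
    · rw [key i (by omega), key (i + 1) (by omega)]
      exact h.mono i (by omega)
  · rw [Function.update_self]
  · by_cases hic : i = c + 1
    · subst hic
      rw [Function.update_self]
      exact hcl
    · rw [key i (by omega)]
      exact h.closed i (by omega)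
  · by_cases hic : i = c
    · subst hic
      rw [Function.update_self, key i le_rfl]
      exact hk
    · rw [key i (by omega), key (i + 1) (by omega)]
      exact h.size i (by omega)
  · rw [key i (by omega), key (i + 1) (by omega)]
    exact h.big i hi hi'

theorem push_big (h : Cuts n k s a ord cs c c tl)
    (hcl : ∀ j, s ≤ j → j < tl → ∀ w, w < n → a (ord j) w ≠ 0 → ∃ j', j' < tl ∧ ord j' = w)
    (hk : tl ≤ cs c + k) (hs : cs c + max s 1 ≤ tl) :
    Cuts n k s a ord (Function.update cs (c + 1) tl) (c + 1) (c + 1) tl := by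
  refine { h.push le_rfl hcl hk with big := fun i hi hi' => ?_ }
  by_cases hic : i = c
  · subst hic
    rw [Function.update_self, Function.update_of_ne (by omega)]
    exact hs
  · exact (h.push le_rfl hcl hk).big i hi (by omega)

/-- Chunks that were closed for being large are nonempty even if the separator is empty; this is the
role of the 1 in `max s 1`. It bounds the number of chunks in terms of `n`. -/
theorem le_add (h : Cuts n k s a ord cs c m tl) : ∀ i, i ≤ m → i ≤ c → i ≤ cs i + 1
  | 0, _, _ => by omega
  | 1, _, _ => by omega
  | i + 2, hi, hc => by
    have := h.le_add (i + 1) (by omega) (by omega)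
    have : cs (i + 1) + max s 1 ≤ cs (i + 2) := h.big (i + 1) (by omega) (by omega)
    omega

end Cuts

namespace Program

variable {E : Env} {n : ℕ} {a : ℕ → ℕ → ℕ} {pos : ℕ → ℕ} {σ : St}

theorem separator_spec (hI : Input E n a pos) (hn : σ.v .n = n) (h0 : ∀ i, σ.a .mk i = 0) :
    wp E separator (fun τ => τ.v .tl = τ.v .sg ∧
      Front n (τ.v .sg) a (fun v => E.inp (v + 17) ≠ 0) (τ.a .ord) (τ.a .mk) (τ.v .sg) (τ.v .sg) ∧
      τ.time ≤ σ.time + 8 * n + 10) σ := by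
  have hlim := hI.n_le
  unfold separator
  rw [wp_then_iff, wp_asg_iff]
  refine ⟨by simp, ?_⟩
  refine wp_then (P := fun τ => Listing n (τ.v .tl) (τ.a .ord) (τ.a .mk) ∧
    (∀ v, v < n → (τ.a .mk v ≠ 0 ↔ E.inp (v + 17) ≠ 0)) ∧ τ.time ≤ σ.time + 8 * n + 5)
    ?_ ?_
  · refine wp_for (fun u τ => Listing n (τ.v .tl) (τ.a .ord) (τ.a .mk) ∧
      (∀ v, v < n → (τ.a .mk v ≠ 0 ↔ v < u ∧ E.inp (v + 17) ≠ 0)) ∧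
      τ.time ≤ σ.time + 8 * u + 3) 0 n rfl (by omega) (by omega) (by decide) ?_ ?_ ?_ ?_
    · intro τ hτ
      exact (hτ.v .n (by decide) (by decide)).trans (by simpa using hn)
    · refine ⟨⟨?_, ?_, ?_⟩, ?_, ?_⟩ <;> simp [h0]
    · rintro u τ - hu hx hl ⟨h1, h2, h3⟩
      have hmk : τ.a .mk u = 0 := by
        by_contra h
        exact absurd ((h2 u hu).1 h).1 (lt_irrefl u)
      have ht := h1.lt_of_unmarked hu hmk
      simp only [wp_then_iff, wp_inp_iff, wp_ite_iff, Expr.eval_add, Expr.eval_var,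
        Expr.eval_ofNat, St.tick_v, hx, St.set_v, if_true, reduceCtorEq, if_false]
      refine ⟨hI.head_lt_base (by omega), ?_⟩
      by_cases hS : E.inp (u + 17) = 0
      · rw [if_pos hS]
        simp only [wp_skip_iff, St.set_v, St.tick_v, St.set_a, St.tick_a, reduceCtorEq, if_false,
          St.set_time, St.tick_time]
        refine ⟨h1, fun v hv => ?_, by omega⟩
        rw [h2 v hv]
        constructor
        · rintro ⟨h, h'⟩
          exact ⟨by omega, h'⟩
        · rintro ⟨h, h'⟩
          refine ⟨?_, h'⟩
          have : v ≠ u := by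
            rintro rfl
            exact h' hS
          omega
      · rw [if_neg hS]
        simp only [wp_then_iff, wp_wr_iff, wp_asg_iff, Expr.eval_add, Expr.eval_var, Expr.eval_one,
          St.set_v, St.tick_v, St.set_a, St.tick_a, reduceCtorEq, if_false, if_true,
          St.set_time, St.tick_time, St.write_v, St.write_a, St.write_time, hx]
        refine ⟨by omega, by omega, by omega, h1.push hu hmk, fun v hv => ?_, by omega⟩
        by_cases hvu : v = u
        · subst hvu
          simp [hS]
        · rw [Function.update_of_ne hvu, h2 v hv]
          constructor
          · rintro ⟨h, h'⟩
            exact ⟨by omega, h'⟩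
          · rintro ⟨h, h'⟩
            exact ⟨by omega, h'⟩
    · rintro τ - hl ⟨h1, h2, h3⟩
      refine ⟨h1, fun v hv => ?_, by simp; omega⟩
      rw [St.tick_a, h2 v hv]
      simp [hv]
  · rintro τ ⟨h1, h2, h3⟩ -
    have h4 := h1.le
    simp only [wp_asg_iff, Expr.eval_var, St.set_v, St.set_a, reduceCtorEq, if_false, if_true,
      St.set_time]
    refine ⟨by omega, trivial, ⟨h1, le_rfl, le_rfl, fun i hi => ?_, fun v hv hS => (h2 v hv).2 hS,
      fun i hi hi' => by omega⟩, by omega⟩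
    exact ⟨fun _ => hi, fun _ => (h2 _ (h1.lt i hi)).1 ((h1.marked _ (h1.lt i hi)).2 ⟨i, hi, rfl⟩)⟩

end Program

end WordRAM

/-! ### Searching the components and packing them into chunks. -/

namespace WordRAM

/-- The vertices `v` with `E.inp (v + 17) ≠ 0` form a separator; `lab` is constant on the components
of the remaining graph. -/
structure Separated (E : Env) (n k s : ℕ) (a : ℕ → ℕ → ℕ) (lab : ℕ → ℕ) : Prop where
  le : s ≤ k
  lab_eq : ∀ u v, u < n → v < n → E.inp (u + 17) = 0 → E.inp (v + 17) = 0 → a u v ≠ 0 → lab u = lab v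
  card : ∀ u, u < n → E.inp (u + 17) = 0 →
    s + ((Finset.range n).filter fun v => E.inp (v + 17) = 0 ∧ lab v = lab u).card ≤ k

/-- The total degree of the vertices at the first positions. -/
def work (pos ord : ℕ → ℕ) (h : ℕ) : ℕ :=
  ∑ i ∈ Finset.range h, (pos (ord i + 1) - pos (ord i))

theorem work_succ (pos ord : ℕ → ℕ) (h : ℕ) :
    work pos ord (h + 1) = work pos ord h + (pos (ord h + 1) - pos (ord h)) :=
  Finset.sum_range_succ _ _

theorem work_congr {pos ord ord' : ℕ → ℕ} {h : ℕ} (H : ∀ i, i < h → ord' i = ord i) :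
    work pos ord' h = work pos ord h :=
  Finset.sum_congr rfl fun i hi => by rw [H i (by simpa using hi)]

/-- An order of the vertices that consists of the separator and the chunks. -/
structure Ordered (n k s : ℕ) (a : ℕ → ℕ → ℕ) (ord cs : ℕ → ℕ) (nc : ℕ) : Prop where
  lt : ∀ i, i < n → ord i < n
  inj : ∀ i j, i < n → j < n → ord i = ord j → i = j
  surj : ∀ v, v < n → ∃ i, i < n ∧ ord i = v
  cuts : Cuts n k s a ord cs nc (nc - 1) n
  two_le : 2 ≤ nc
  last : cs nc = n

/-- The search has dealt with the vertices less than `u`. -/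
structure Searched (E : Env) (n k s : ℕ) (a : ℕ → ℕ → ℕ) (pos : ℕ → ℕ) (T u : ℕ) (τ : St) :
    Prop where
  front : Front n s a (fun v => E.inp (v + 17) ≠ 0) (τ.a .ord) (τ.a .mk) (τ.v .tl) (τ.v .tl)
  hd : τ.v .hd = τ.v .tl
  cuts : Cuts n k s a (τ.a .ord) (τ.a .cs) (τ.v .nc) (τ.v .nc) (τ.v .tl)
  done : ∀ v, v < n → v < u → τ.a .mk v ≠ 0
  slack : τ.v .tl < τ.a .cs (τ.v .nc) + max s 1
  time : τ.time ≤ T + 10 * u + 7 * work pos (τ.a .ord) (τ.v .tl) + 6 * τ.v .tl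

namespace Program

variable {E : Env} {n k s : ℕ} {a : ℕ → ℕ → ℕ} {pos lab : ℕ → ℕ} {σ : St}

/-- An unmarked neighbour of the vertex at the head lies outside the separator, since all of the
separator is marked; hence it has the same label. Afterwards all neighbours of that vertex are
marked, and the head may move on. -/
theorem expand_spec (hI : Input E n a pos) (hS : Separated E n k s a lab) (hn : σ.v .n = n)
    (hst : ∀ u, u ≤ n → σ.a .st u = pos u)
    (hF : Front n s a (fun v => E.inp (v + 17) ≠ 0) (σ.a .ord) (σ.a .mk) (σ.v .hd) (σ.v .tl))
    (hlt : σ.v .hd < σ.v .tl) :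
    wp E expand (fun τ => τ.v .hd = σ.v .hd + 1 ∧ σ.v .tl ≤ τ.v .tl ∧
      Front n s a (fun v => E.inp (v + 17) ≠ 0) (τ.a .ord) (τ.a .mk) (τ.v .hd) (τ.v .tl) ∧
      (∀ i, i < σ.v .tl → τ.a .ord i = σ.a .ord i) ∧
      (∀ i, σ.v .tl ≤ i → i < τ.v .tl → lab (τ.a .ord i) = lab (σ.a .ord (σ.v .hd))) ∧
      τ.time ≤ σ.time + 7 * (pos (σ.a .ord (σ.v .hd) + 1) - pos (σ.a .ord (σ.v .hd))) + 5) σ := by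
  have hlim := hI.n_le
  obtain ⟨y, hy⟩ : ∃ y, y = σ.a .ord (σ.v .hd) := ⟨_, rfl⟩
  obtain ⟨t, ht⟩ : ∃ t, t = σ.v .tl := ⟨_, rfl⟩
  obtain ⟨h, hh⟩ : ∃ h, h = σ.v .hd := ⟨_, rfl⟩
  rw [← ht, ← hh] at hF hlt
  rw [← ht, ← hh]
  rw [← hh] at hy
  rw [← hy]
  have hyn : y < n := by rw [hy]; exact hF.lt h hlt
  have hyS : E.inp (y + 17) = 0 := by
    by_contra hne
    have := (hF.mem_iff h hlt).1 (by rwa [← hy])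
    have := hF.le_hd
    omega
  unfold expand
  rw [wp_then_iff, wp_asg_iff]
  simp only [Expr.eval_get, Expr.eval_var, ← hh, ← hy]
  refine ⟨by omega, ?_⟩
  refine wp_then (P := fun τ => τ.v .hd = h ∧ t ≤ τ.v .tl ∧
      Front n s a (fun v => E.inp (v + 17) ≠ 0) (τ.a .ord) (τ.a .mk) (τ.v .hd) (τ.v .tl) ∧
      (∀ i, i < t → τ.a .ord i = σ.a .ord i) ∧
      (∀ i, t ≤ i → i < τ.v .tl → lab (τ.a .ord i) = lab y) ∧
      (∀ j, pos y ≤ j → j < pos (y + 1) → τ.a .mk (E.inp j) ≠ 0) ∧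
      τ.time ≤ σ.time + 7 * (pos (y + 1) - pos y) + 3) ?_ ?_
  · refine wp_for (fun j τ => τ.v .hd = h ∧ t ≤ τ.v .tl ∧
      Front n s a (fun v => E.inp (v + 17) ≠ 0) (τ.a .ord) (τ.a .mk) (τ.v .hd) (τ.v .tl) ∧
      (∀ i, i < t → τ.a .ord i = σ.a .ord i) ∧
      (∀ i, t ≤ i → i < τ.v .tl → lab (τ.a .ord i) = lab y) ∧
      (∀ j', pos y ≤ j' → j' < j → τ.a .mk (E.inp j') ≠ 0) ∧
      τ.time ≤ σ.time + 7 * (j - pos y) + 2) (pos y) (pos (y + 1)) ?_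
      (hI.pos_le_succ hyn) (hI.pos_le_lim (by omega)) (by decide) ?_ ?_ ?_ ?_
    · simp [hst y (by omega)]
    · intro τ hτ
      rw [Expr.eval_get, hτ.a .st (by decide)]
      simp only [Expr.eval_add, Expr.eval_var, Expr.eval_one, hτ.v .y (by decide) (by decide),
        St.set_v, St.set_a, if_true]
      exact hst _ (by omega)
    · simp only [St.set_v, St.set_a, reduceCtorEq, if_false, ← hh, ← ht]
      exact ⟨trivial, le_rfl, hF, fun _ _ => trivial, fun i hi hi' => by omega,
        fun j hj hj' => by omega, by simp⟩
    · rintro j τ hj hj' hτj hl ⟨h1, h2, h3, h4, h5, h6, h7⟩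
      have hw := hI.inp_lt y hyn j hj hj'
      have ha := hI.adj_one y hyn j hj hj'
      have hyτ : τ.v .y = y := (hl.v .y (by decide) (by decide)).trans (by simp)
      simp only [wp_then_iff, wp_inp_iff, wp_ite_iff, Expr.eval_get, Expr.eval_var, St.tick_v,
        hτj, St.set_v, St.set_a, St.tick_a, if_true, reduceCtorEq, if_false]
      refine ⟨hI.pos_lt_base hyn hj', ?_⟩
      by_cases hm : τ.a .mk (E.inp j) = 0
      · rw [if_pos hm]
        have htn := h3.lt_of_unmarked hw hm
        simp only [wp_then_iff, wp_wr_iff, wp_asg_iff, Expr.eval_add, Expr.eval_var, Expr.eval_one,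
          St.set_v, St.tick_v, St.set_a, St.tick_a, reduceCtorEq, if_false, if_true,
          St.set_time, St.tick_time, St.write_v, St.write_a, St.write_time]
        refine ⟨by omega, by omega, by omega, h1, by omega, h3.push hw hm, fun i hi => ?_,
          fun i hi hi' => ?_, fun j' h h' => ?_, by omega⟩
        · rw [Function.update_of_ne (by omega)]
          exact h4 i hi
        · rw [Function.update_apply]
          split_ifs with hit
          · refine (hS.lab_eq y _ hyn hw hyS ?_ (by omega)).symm
            by_contra hne
            exact h3.mk_of_mem _ hw hne hm
          · exact h5 i hi (by omega)
        · rw [Function.update_apply]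
          split_ifs with heq
          · simp
          · refine h6 j' h ?_
            have : j' ≠ j := by rintro rfl; exact heq rfl
            omega
      · rw [if_neg hm]
        simp only [wp_skip_iff, St.set_v, St.tick_v, St.set_a, St.tick_a, reduceCtorEq, if_false,
          St.set_time, St.tick_time]
        refine ⟨h1, h2, h3, h4, h5, fun j' h h' => ?_, by omega⟩
        by_cases hjj : j' = j
        · subst hjj; exact hm
        · exact h6 j' h (by omega)
    · rintro τ - - ⟨h1, h2, h3, h4, h5, h6, h7⟩
      exact ⟨h1, h2, h3, h4, h5, h6, by simp; omega⟩
  · rintro τ ⟨h1, h2, h3, h4, h5, h6, h7⟩ -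
    have h8 := h3.le
    simp only [wp_asg_iff, Expr.eval_add, Expr.eval_var, Expr.eval_one, St.set_v, St.set_a,
      St.set_time, reduceCtorEq, if_false, if_true, h1]
    refine ⟨by omega, trivial, h2, ?_, h4, h5, by omega⟩
    rw [h1] at h3
    have h9 := h3.le_hd
    refine ⟨h3.toListing, by omega, by omega, h3.mem_iff, h3.mk_of_mem,
      fun i hi hi' w hw ha => ?_⟩
    by_cases hih : i = h
    · subst hih
      rw [h4 i (by omega), ← hy] at ha
      by_contra hne
      refine ha (hI.adj_zero y hyn w fun j hj hj' hjw => ?_)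
      exact h6 j hj hj' (by rw [hjw]; exact hne)
    · exact h3.closed i hi (by omega) w hw ha

/-- The new part of the queue is a set of distinct vertices outside the separator with one common
label, and the size of such a class is bounded by hypothesis. -/
theorem component_size {t t' u : ℕ} {ord mk : ℕ → ℕ} (hS : Separated E n k s a lab) (hu : u < n)
    (huS : E.inp (u + 17) = 0) (hL : Listing n t' ord mk)
    (hord : ∀ i, t ≤ i → i < t' → E.inp (ord i + 17) = 0 ∧ lab (ord i) = lab u) :
    s + (t' - t) ≤ k := by
  have := Finset.card_le_card_of_injOn (s := Finset.Ico t t')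
    (t := (Finset.range n).filter fun v => E.inp (v + 17) = 0 ∧ lab v = lab u) ord
    (fun i hi => by
      have hi' := Finset.mem_Ico.1 (Finset.mem_coe.1 hi)
      exact Finset.mem_coe.2 (Finset.mem_filter.2
        ⟨Finset.mem_range.2 (hL.lt i hi'.2), hord i hi'.1 hi'.2⟩))
    (fun i hi j hj hij => by
      have hi' := Finset.mem_Ico.1 (Finset.mem_coe.1 hi)
      have hj' := Finset.mem_Ico.1 (Finset.mem_coe.1 hj)
      exact hL.inj i j hi'.2 hj'.2 hij)
  rw [Nat.card_Ico] at this
  have := hS.card u hu huS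
  omega

/-- Before the component is appended, the open chunk has fewer than `max s 1` vertices, and the
component has at most `k - s`; so the chunk never exceeds `k`. Time is charged to the scanned list
entries, to the queue positions and to the outer counter. -/
theorem component_spec {T u : ℕ} (hI : Input E n a pos) (hS : Separated E n k s a lab)
    (hn : σ.v .n = n) (hsg : σ.v .sg = s) (hst : ∀ u, u ≤ n → σ.a .st u = pos u) (hu : u < n)
    (hux : σ.v .u = u) (h : Searched E n k s a pos T u σ) :
    wp E component (fun τ => Searched E n k s a pos T (u + 1) (τ.set .u (u + 1))) σ.tick := by
  have hlim := hI.n_le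
  have hle := h.front.le
  have hsl := h.slack
  have hlast := h.cuts.last
  have hncle := h.cuts.le_add _ le_rfl le_rfl
  unfold component
  simp only [wp_ite_iff, Expr.eval_get, Expr.eval_var, St.tick_v, St.tick_a, hux]
  by_cases hm : σ.a .mk u = 0
  swap
  · rw [if_neg hm]
    refine ⟨h.front, h.hd, h.cuts, fun v hv hvu => ?_, h.slack, ?_⟩
    · by_cases hvu' : v = u
      · subst hvu'; exact hm
      · exact h.done v hv (by omega)
    · have := h.time
      simp only [St.set_time, St.tick_time, St.set_a, St.tick_a, St.set_v, St.tick_v, reduceCtorEq,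
        if_false]
      omega
  rw [if_pos hm]
  have htn := h.front.lt_of_unmarked hu hm
  obtain ⟨t, ht⟩ : ∃ t, t = σ.v .tl := ⟨_, rfl⟩
  have huS : E.inp (u + 17) = 0 := by
    by_contra hne
    exact h.front.mk_of_mem u hu hne hm
  simp only [wp_then_iff, wp_wr_iff, wp_asg_iff, Expr.eval_add, Expr.eval_var, Expr.eval_one,
    St.tick_v, St.write_v, hux, ← ht]
  rw [← ht] at htn hle hsl hlast
  refine ⟨by omega, by omega, by omega, ?_⟩
  refine wp_cut (P := fun τ => t < τ.v .tl ∧ τ.v .hd = τ.v .tl ∧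
    Front n s a (fun v => E.inp (v + 17) ≠ 0) (τ.a .ord) (τ.a .mk) (τ.v .tl) (τ.v .tl) ∧
    (∀ i, i < t → τ.a .ord i = σ.a .ord i) ∧ τ.a .ord t = u ∧ s + (τ.v .tl - t) ≤ k ∧
    τ.time ≤ T + 10 * u + 7 * work pos (τ.a .ord) (τ.v .tl) + 6 * τ.v .tl + 6) ?_ ?_
  · refine wp_whl (fun τ => t < τ.v .tl ∧ t ≤ τ.v .hd ∧
      Front n s a (fun v => E.inp (v + 17) ≠ 0) (τ.a .ord) (τ.a .mk) (τ.v .hd) (τ.v .tl) ∧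
      (∀ i, i < t → τ.a .ord i = σ.a .ord i) ∧ τ.a .ord t = u ∧
      (∀ i, t ≤ i → i < τ.v .tl → lab (τ.a .ord i) = lab u) ∧
      τ.time ≤ T + 10 * u + 7 * work pos (τ.a .ord) (τ.v .hd) + 6 * τ.v .hd + 5)
      (fun τ => n - τ.v .hd) ?_ ?_ ?_
    · have hhd := h.hd
      have hF := h.front
      have hT := h.time
      rw [← ht] at hhd hF hT
      have hF' := hF.push hu hm
      simp only [St.set_v, St.set_a, St.set_time, St.write_v, St.write_a, St.write_time, St.tick_v,
        St.tick_a, St.tick_time, reduceCtorEq, if_true, if_false, hhd, Function.update_self]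
      refine ⟨by omega, le_rfl, hF', fun i hi => ?_, trivial, fun i hi hi' => ?_, ?_⟩
      · rw [Function.update_of_ne (by omega)]
      · have : i = t := by omega
        rw [this, Function.update_self]
      · rw [work_congr (ord' := Function.update _ _ _) (ord := σ.a .ord)
          (fun i hi => Function.update_of_ne (by omega) _ _)]
        omega
    · rintro τ hl ⟨h1, h2, h3, h4, h5, h6, h7⟩ hne
      have hlt : τ.v .hd < τ.v .tl := by
        by_contra hge
        simp [hge] at hne
      have hle' := h3.le
      refine wp_mono (c := expand) ?_ (expand_spec (lab := lab) (σ := τ.tick) hI hS ?_ ?_ h3 hlt)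
      · rintro υ ⟨g1, g2, g3, g4, g5, g6⟩
        simp only [St.tick_v, St.tick_a, St.tick_time] at g1 g2 g4 g5 g6
        refine ⟨⟨by omega, by omega, g3, fun i hi => ?_, ?_, fun i hi hi' => ?_, ?_⟩, by omega⟩
        · rw [g4 i (by omega), h4 i hi]
        · rw [g4 t (by omega), h5]
        · by_cases hit : i < τ.v .tl
          · rw [g4 i hit, h6 i hi hit]
          · rw [g5 i (by omega) hi', h6 _ h2 hlt]
        · rw [g1, work_succ, work_congr (fun i hi => g4 i (by omega)), g4 _ hlt]
          omega
      · exact (hl.v .n (by decide)).trans hn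
      · intro v hv
        rw [St.tick_a, hl.a .st (by decide)]
        exact hst v hv
    · rintro τ - ⟨h1, h2, h3, h4, h5, h6, h7⟩ he
      have heq : τ.v .hd = τ.v .tl := by
        have := h3.hd_le
        by_contra hne
        rw [Expr.eval_lt, Expr.eval_var, Expr.eval_var, if_pos (by omega)] at he
        exact one_ne_zero he
      rw [heq] at h3 h7
      refine ⟨h1, heq, h3, h4, h5, ?_, ?_⟩
      · refine component_size hS hu huS h3.toListing fun i hi hi' => ⟨?_, h6 i hi hi'⟩
        have := h.front.le_hd
        have := h3.mem_iff i hi'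
        by_contra hne
        have := this.1 hne
        omega
      · simp only [St.tick_time, St.tick_a, St.tick_v]
        omega
  · rintro τ ⟨h1, h2, h3, h4, h5, h6, h7⟩ hl
    have hcs : τ.a .cs = σ.a .cs := hl.a .cs (by decide)
    have hnc : τ.v .nc = σ.v .nc := hl.v .nc (by decide)
    have hsg' : τ.v .sg = s := (hl.v .sg (by decide)).trans hsg
    have hle' := h3.le
    have hC : Cuts n k s a (τ.a .ord) (σ.a .cs) (σ.v .nc) (σ.v .nc) (τ.v .tl) :=
      h.cuts.congr (by omega) (fun i hi => h4 i (by omega))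
    have hdone : ∀ v, v < n → v < u + 1 → τ.a .mk v ≠ 0 := by
      intro v hv hvu
      rw [h3.marked v hv]
      by_cases hvu' : v = u
      · exact ⟨t, h1, by rw [h5, hvu']⟩
      · obtain ⟨i, hi, hiv⟩ := (h.front.marked v hv).1 (h.done v hv (by omega))
        exact ⟨i, by omega, by rw [h4 i (by omega), hiv]⟩
    have hcl : ∀ j, s ≤ j → j < τ.v .tl → ∀ w, w < n → τ.a .ord j < n → a (τ.a .ord j) w ≠ 0 →
        ∃ j', j' < τ.v .tl ∧ τ.a .ord j' = w := fun j hj hj' w hw _ ha =>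
      (h3.marked w hw).1 (h3.closed j hj hj' w hw ha)
    have hk := hS.le
    simp only [wp_ite_iff, Expr.eval_lt, Expr.eval_add, Expr.eval_get, Expr.eval_var, hsg', hcs,
      hnc]
    -- If the chunk is closed, it has at least `s` vertices, and at least one because a component
    -- has just been added, hence at least `max s 1`. If it stays open, it is below `s`.
    by_cases hc : τ.v .tl < σ.a .cs (σ.v .nc) + s
    · simp only [if_pos hc, one_ne_zero, if_false]
      refine ⟨h3, h2, ?_, hdone, ?_, ?_⟩
      · simp only [St.set_v, St.set_a, St.tick_v, St.tick_a, reduceCtorEq, if_false, hcs, hnc]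
        exact hC
      · simp only [St.set_v, St.set_a, St.tick_v, St.tick_a, reduceCtorEq, if_false, hcs, hnc]
        omega
      · simp only [St.set_v, St.set_a, St.set_time, St.tick_v, St.tick_a, St.tick_time,
          reduceCtorEq, if_false]
        omega
    · simp only [if_neg hc, if_true, wp_then_iff, wp_asg_iff, wp_wr_iff, Expr.eval_add,
        Expr.eval_var, Expr.eval_one, St.tick_v, hnc, St.set_v, reduceCtorEq, if_false]
      refine ⟨by omega, by omega, h3, h2, ?_, hdone, ?_, ?_⟩
      · simp only [St.set_v, St.set_a, St.write_v, St.write_a, St.tick_v, St.tick_a, reduceCtorEq,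
          if_false, if_true, hcs]
        exact hC.push_big (fun j hj hj' w hw ha => hcl j hj hj' w hw (h3.lt j hj') ha)
          (by omega) (by omega)
      · simp only [St.set_v, St.set_a, St.write_v, St.write_a, St.tick_v, St.tick_a, reduceCtorEq,
          if_false, if_true, hcs, Function.update_self]
        omega
      · simp only [St.set_v, St.set_a, St.set_time, St.write_v, St.write_a, St.write_time,
          St.tick_v, St.tick_a, St.tick_time, reduceCtorEq, if_false]
        omega

theorem sum_pos_le (hI : Input E n a pos) {m : ℕ} (hm : m ≤ n) :
    ∑ v ∈ Finset.range m, (pos (v + 1) - pos v) + pos 0 = pos m := by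
  induction m with
  | zero => simp
  | succ m ih =>
    have := hI.pos_le_succ (u := m) (by omega)
    have := ih (by omega)
    rw [Finset.sum_range_succ]
    omega

theorem chunks_spec (hI : Input E n a pos) (hS : Separated E n k s a lab)
    (hn : σ.v .n = n) (hsg : σ.v .sg = s) (htl : σ.v .tl = s) (hst : ∀ u, u ≤ n → σ.a .st u = pos u)
    (hF : Front n s a (fun v => E.inp (v + 17) ≠ 0) (σ.a .ord) (σ.a .mk) s s) :
    wp E chunks (fun τ => Ordered n k s a (τ.a .ord) (τ.a .cs) (τ.v .nc) ∧
      τ.time + 7 * pos 0 ≤ σ.time + 16 * n + 7 * pos n + 10) σ := by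
  have hlim := hI.n_le
  have hsn := hF.le
  unfold chunks
  simp only [wp_then_iff, wp_asg_iff, wp_wr_iff, Expr.eval_var, Expr.eval_one, Expr.eval_zero,
    St.set_v, St.write_v, reduceCtorEq, if_false, hsg]
  refine ⟨by omega, by omega, by omega, by omega, ?_⟩
  refine wp_for (fun u τ => Searched E n k s a pos (σ.time + 5) u τ) 0 n rfl (by omega) (by omega)
    (by decide) ?_ ?_ ?_ ?_
  · intro τ hτ
    exact (hτ.v .n (by decide) (by decide)).trans (by simpa using hn)
  · refine ⟨?_, ?_, ?_, fun v _ h => absurd h (Nat.not_lt_zero v), ?_, ?_⟩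
    · simpa [htl] using hF
    · simp [htl]
    · simp only [St.set_v, St.set_a, St.write_v, St.write_a, reduceCtorEq, if_false, if_true, htl]
      refine ⟨by simp, by simp, le_rfl, fun i hi => ?_, by simp, fun i hi j hj hj' => ?_,
        fun i hi => ?_, fun i hi hi' => by omega⟩
      · have : i = 0 := by omega
        subst this; simp
      · have : i = 0 ∨ i = 1 := by omega
        rcases this with rfl | rfl <;> simp at hj' <;> omega
      · have : i = 0 := by omega
        subst this; simp
    · simp [htl]
    · simp [htl]; omega
  · rintro u τ - hu hτu hl h
    refine component_spec hI hS ?_ ?_ ?_ hu hτu h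
    · exact (hl.v .n (by decide) (by decide)).trans (by simpa using hn)
    · exact (hl.v .sg (by decide) (by decide)).trans (by simpa using hsg)
    · intro v hv
      rw [hl.a .st (by decide)]
      simpa using hst v hv
  · rintro τ - hl h
    have hle := h.front.le
    have hlast := h.cuts.last
    have hsl := h.slack
    have hk := hS.le
    have hncle := h.cuts.le_add _ le_rfl le_rfl
    have h1 := h.cuts.one_le
    have hsurj : ∀ v, v < n → ∃ i, i < τ.v .tl ∧ τ.a .ord i = v := fun v hv =>
      (h.front.marked v hv).1 (h.done v hv hv)
    -- In the end all vertices are marked, that is, listed, so the list has length `n`.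
    have hn' : τ.v .tl = n := by
      refine le_antisymm hle ?_
      choose! g hg hg' using hsurj
      have := Finset.card_le_card_of_injOn (s := Finset.range n) (t := Finset.range (τ.v .tl)) g
        (fun i hi => by simpa using hg i (by simpa using hi))
        (fun i hi j hj hij => by
          rw [← hg' i (by simpa using hi), ← hg' j (by simpa using hj), hij])
      simpa using this
    rw [hn'] at hsl hlast
    have hsn' : s ≤ n := hn' ▸ h.front.le_hd
    simp only [wp_then_iff, wp_asg_iff, wp_wr_iff, Expr.eval_var, Expr.eval_add, Expr.eval_one,
      St.tick_v, St.tick_a, St.set_v, reduceCtorEq, if_false, if_true, St.write_a, St.write_v, St.set_a, hn']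
    have hkpos : n ≤ τ.a .cs (τ.v .nc) + k ∨ n = τ.a .cs (τ.v .nc) := by omega
    refine ⟨by omega, by omega, ⟨?_, ?_, ?_, ?_, by omega, by simp⟩, ?_⟩
    · exact fun i hi => h.front.lt i (by omega)
    · exact fun i j hi hj => h.front.inj i j (by omega) (by omega)
    · intro v hv
      rw [← hn']
      exact hsurj v hv
    · have hC := h.cuts
      rw [hn'] at hC
      -- The remaining vertices form the last chunk, which may be small or empty; the lower bound on
      -- sizes is therefore claimed only for the chunks before it.
      refine hC.push le_rfl (fun j hj hj' w hw ha => ?_) (by omega)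
      rw [← hn']
      exact (h.front.marked w hw).1 (h.front.closed j hj (by omega) w hw ha)
    · have h2 := h.front.sum_le fun v => pos (v + 1) - pos v
      have h3 := sum_pos_le hI le_rfl
      have h4 := h.time
      simp only [work, hn'] at h4 h2
      simp only [St.write_time, St.set_time, St.tick_time]
      omega

end Program

end WordRAM

/-! ## Codegrees and chunks -/

namespace FourVertex

open Finset

variable {R : Type*} [CommRing R]

/-- The number of common neighbours of `i` and `j` in `S`. -/
def wit (A : ℕ → ℕ → R) (S : Finset ℕ) (i j : ℕ) : R := ∑ l ∈ S, A i l * A l j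

/-- The position of the vertex with number `z` of a chunk together with the first `s` vertices. -/
def place (s lo z : ℕ) : ℕ := if z < s then z else z + lo

theorem sum_place {s lo b : ℕ} (h : s ≤ b) (f : ℕ → R) :
    ∑ z ∈ range b, f (place s lo z) =
      ∑ i ∈ range s, f i + ∑ i ∈ Ico (s + lo) (b + lo), f i := by
  rw [← sum_range_add_sum_Ico (fun z => f (place s lo z)) h, ← sum_Ico_add_right_sub_eq s b lo]
  congr 1
  · refine sum_congr rfl fun z hz => ?_
    rw [place, if_pos (mem_range.1 hz)]
  · refine sum_congr rfl fun z hz => ?_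
    have := (mem_Ico.1 hz).1
    rw [place, if_neg (by omega), Nat.sub_add_cancel (by omega)]

/-- The chunks of a vertex order. -/
structure Split (n s : ℕ) (A : ℕ → ℕ → R) (cs : ℕ → ℕ) (nc : ℕ) : Prop where
  symm : ∀ i j, A i j = A j i
  zero : cs 0 = s
  mono : ∀ c, c < nc → cs c ≤ cs (c + 1)
  last : cs nc = n
  closed : ∀ c, c ≤ nc → ∀ i j, s ≤ i → i < cs c → cs c ≤ j → j < n → A i j = 0

/-- The contribution of a chunk to the sum of the squares of the codegrees. -/
def chunkVal (n s : ℕ) (A : ℕ → ℕ → R) (cs : ℕ → ℕ) (c i j : ℕ) : R :=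
  if i < s ∧ j < s then -(wit A (Ico (cs c) (cs (c + 1))) i j) ^ 2
  else wit A (range n) (place s (cs c - s) i) (place s (cs c - s) j) ^ 2

namespace Split

variable {n s nc : ℕ} {A : ℕ → ℕ → R} {cs : ℕ → ℕ} (h : Split n s A cs nc)
include h

theorem mono' {i j : ℕ} (hij : i ≤ j) (hj : j ≤ nc) : cs i ≤ cs j := by
  induction j, hij using Nat.le_induction with
  | base => exact le_rfl
  | succ v _ ih => exact (ih (by omega)).trans (h.mono _ (by omega))

theorem le_cs {c : ℕ} (hc : c ≤ nc) : s ≤ cs c := h.zero ▸ h.mono' (Nat.zero_le c) hc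

theorem cs_le {c : ℕ} (hc : c ≤ nc) : cs c ≤ n := h.last ▸ h.mono' hc le_rfl

theorem exists_chunk {i : ℕ} (hi : s ≤ i) (hi' : i < n) :
    ∃ c, c < nc ∧ cs c ≤ i ∧ i < cs (c + 1) := by
  have key : ∀ m, i < cs m → ∃ c, c < m ∧ cs c ≤ i ∧ i < cs (c + 1) := by
    intro m
    induction m with
    | zero => rw [h.zero]; omega
    | succ m ih =>
      intro hm
      by_cases hlt : i < cs m
      · obtain ⟨c, h1, h2⟩ := ih hlt
        exact ⟨c, by omega, h2⟩
      · exact ⟨m, by omega, by omega, hm⟩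
  exact key nc (by rw [h.last]; exact hi')

theorem wit_split {c : ℕ} (hc : c < nc) (i j : ℕ) : wit A (range n) i j =
    wit A (range s) i j + wit A (Ico s (cs c)) i j + wit A (Ico (cs c) (cs (c + 1))) i j +
      wit A (Ico (cs (c + 1)) n) i j := by
  unfold wit
  rw [← sum_range_add_sum_Ico _ ((h.le_cs hc.le).trans (h.cs_le hc.le)),
    ← sum_Ico_consecutive _ (h.le_cs hc.le) (h.cs_le hc.le),
    ← sum_Ico_consecutive _ (h.mono c hc) (h.cs_le hc)]
  ring

theorem wit_comm (S : Finset ℕ) (i j : ℕ) : wit A S i j = wit A S j i :=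
  sum_congr rfl fun l _ => by rw [h.symm i l, h.symm l j, mul_comm]

theorem wit_before {c i j : ℕ} (hc : c ≤ nc) (hi : cs c ≤ i) (hi' : i < n) :
    wit A (Ico s (cs c)) i j = 0 :=
  sum_eq_zero fun l hl => by
    rw [mem_Ico] at hl
    rw [h.symm i l, h.closed c hc l i hl.1 hl.2 hi hi', zero_mul]

theorem wit_after {c i j : ℕ} (hc : c ≤ nc) (hi : s ≤ i) (hi' : i < cs c) :
    wit A (Ico (cs c) n) i j = 0 :=
  sum_eq_zero fun l hl => by
    rw [mem_Ico] at hl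
    rw [h.closed c hc i l hi hi' hl.1 hl.2, zero_mul]

/-- No edge joins different chunks, so a neighbour of a vertex of a chunk lies in the separator or
in the same chunk. -/
theorem wit_chunk {c i j : ℕ} (hc : c < nc) (hi : cs c ≤ i) (hi' : i < cs (c + 1)) :
    wit A (range n) i j = wit A (range s) i j + wit A (Ico (cs c) (cs (c + 1))) i j := by
  have := h.le_cs hc.le
  have := h.cs_le (c := c + 1) hc
  rw [h.wit_split hc, h.wit_before hc.le hi (by omega), h.wit_after hc (by omega) hi', add_zero,
    add_zero]

/-- A common neighbour of vertices from different chunks would have to lie in both chunks unless it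
is in the separator. -/
theorem wit_cross {c i j : ℕ} (hc : c < nc) (hi : s ≤ i) (hi' : i < cs c) (hj : cs c ≤ j)
    (hj' : j < cs (c + 1)) : wit A (range n) i j = wit A (range s) i j := by
  rw [h.wit_comm, h.wit_chunk hc hj hj', h.wit_comm]
  have : wit A (Ico (cs c) (cs (c + 1))) j i = 0 := sum_eq_zero fun l hl => by
    have := h.cs_le (c := c + 1) hc
    rw [mem_Ico] at hl
    rw [h.symm l i, h.closed c hc.le i l hi hi' hl.1 (by omega), mul_zero]
  rw [this, add_zero]

/-- Both sides sum over closed walks of length four that alternate between `X` and, at the two other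
places, `Y` and `Z`: the left side fixes the vertices in `Y` and `Z`, the right side the two in `X`.
-/
theorem sum_cross (X Y Z : Finset ℕ) :
    ∑ i ∈ Y, ∑ j ∈ Z, wit A X i j ^ 2 = ∑ l ∈ X, ∑ l' ∈ X, wit A Y l l' * wit A Z l l' := by
  have h1 : ∀ i j, wit A X i j ^ 2 =
      ∑ l ∈ X, ∑ l' ∈ X, (A l i * A i l') * (A l j * A j l') := by
    intro i j
    rw [sq, wit, sum_mul_sum]
    refine sum_congr rfl fun l _ => sum_congr rfl fun l' _ => ?_
    rw [h.symm i l, h.symm j l']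
    ring
  calc ∑ i ∈ Y, ∑ j ∈ Z, wit A X i j ^ 2
      = ∑ i ∈ Y, ∑ j ∈ Z, ∑ l ∈ X, ∑ l' ∈ X, (A l i * A i l') * (A l j * A j l') :=
        sum_congr rfl fun i _ => sum_congr rfl fun j _ => h1 i j
    _ = ∑ i ∈ Y, ∑ l ∈ X, ∑ l' ∈ X, ∑ j ∈ Z, (A l i * A i l') * (A l j * A j l') := by
        refine sum_congr rfl fun i _ => ?_
        rw [sum_comm]
        exact sum_congr rfl fun l _ => sum_comm
    _ = ∑ l ∈ X, ∑ l' ∈ X, ∑ i ∈ Y, ∑ j ∈ Z, (A l i * A i l') * (A l j * A j l') := by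
        rw [sum_comm]
        exact sum_congr rfl fun l _ => sum_comm
    _ = _ := by
        refine sum_congr rfl fun l _ => sum_congr rfl fun l' _ => ?_
        rw [wit, wit, sum_mul_sum]

/-- Induction on the number of chunks. For a pair in the separator let `W` count the common
neighbours in earlier chunks and `w` those in the new one. The pairs that join the new chunk to
earlier ones, in both orders, contribute the sum of `2 * W * w` by `sum_cross`, which equals `(W +
w)^2 - W^2 - w^2`. The squares telescope, and `-w^2` is what `chunkVal` contains for pairs in the
separator. -/
theorem sum_sq_aux : ∀ c, c ≤ nc → ∑ i ∈ range (cs c), ∑ j ∈ range (cs c), wit A (range n) i j ^ 2 =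
    ∑ i ∈ range s, ∑ j ∈ range s, (wit A (range n) i j ^ 2 + wit A (Ico s (cs c)) i j ^ 2) +
    ∑ c' ∈ range c, ∑ i ∈ range (cs (c' + 1) - (cs c' - s)),
      ∑ j ∈ range (cs (c' + 1) - (cs c' - s)), chunkVal n s A cs c' i j := by
  intro c
  induction c with
  | zero => intro _; simp [h.zero, wit]
  | succ c ih =>
    intro hc
    have h1 := h.le_cs (c := c) (by omega)
    have h2 := h.mono c hc
    have hsum : ∀ f : ℕ → R, ∑ i ∈ range (cs (c + 1)), f i =
        ∑ i ∈ range s, f i + ∑ i ∈ Ico s (cs c), f i + ∑ i ∈ Ico (cs c) (cs (c + 1)), f i := by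
      intro f
      rw [sum_range_add_sum_Ico f h1, sum_range_add_sum_Ico f h2]
    have hsum' : ∀ f : ℕ → R, ∑ i ∈ range (cs c), f i =
        ∑ i ∈ range s, f i + ∑ i ∈ Ico s (cs c), f i := fun f => (sum_range_add_sum_Ico f h1).symm
    have hcv : ∑ i ∈ range (cs (c + 1) - (cs c - s)), ∑ j ∈ range (cs (c + 1) - (cs c - s)),
        chunkVal n s A cs c i j =
        -∑ i ∈ range s, ∑ j ∈ range s, wit A (Ico (cs c) (cs (c + 1))) i j ^ 2 +
        (∑ i ∈ range s, ∑ j ∈ Ico (cs c) (cs (c + 1)), wit A (range n) i j ^ 2 +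
        ∑ i ∈ Ico (cs c) (cs (c + 1)), ∑ j ∈ range s, wit A (range n) i j ^ 2 +
        ∑ i ∈ Ico (cs c) (cs (c + 1)), ∑ j ∈ Ico (cs c) (cs (c + 1)),
          wit A (range n) i j ^ 2) := by
      have hp : ∀ i j, chunkVal n s A cs c i j = (fun i j => if i < s ∧ j < s then
          -(wit A (Ico (cs c) (cs (c + 1))) i j) ^ 2 else wit A (range n) i j ^ 2)
          (place s (cs c - s) i) (place s (cs c - s) j) := by
        intro i j
        have hlt : ∀ z, place s (cs c - s) z < s ↔ z < s := by
          intro z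
          unfold place
          split_ifs <;> omega
        simp only [chunkVal, hlt]
        split_ifs with hij
        · simp [place, hij.1, hij.2]
        · rfl
      simp only [hp]
      rw [sum_place (by omega) (fun i' => ∑ j ∈ range (cs (c + 1) - (cs c - s)),
        (fun i j => if i < s ∧ j < s then
          -(wit A (Ico (cs c) (cs (c + 1))) i j) ^ 2 else wit A (range n) i j ^ 2)
          i' (place s (cs c - s) j))]
      have e1 : s + (cs c - s) = cs c := by omega
      have e2 : cs (c + 1) - (cs c - s) + (cs c - s) = cs (c + 1) := by omega
      have hin : ∀ i', ∑ j ∈ range (cs (c + 1) - (cs c - s)), (fun i j => if i < s ∧ j < s then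
          -(wit A (Ico (cs c) (cs (c + 1))) i j) ^ 2 else wit A (range n) i j ^ 2)
          i' (place s (cs c - s) j) = ∑ j ∈ range s, (if i' < s ∧ j < s then
          -(wit A (Ico (cs c) (cs (c + 1))) i' j) ^ 2 else wit A (range n) i' j ^ 2) +
          ∑ j ∈ Ico (cs c) (cs (c + 1)), wit A (range n) i' j ^ 2 := by
        intro i'
        rw [sum_place (by omega) (fun j => if i' < s ∧ j < s then
          -(wit A (Ico (cs c) (cs (c + 1))) i' j) ^ 2 else wit A (range n) i' j ^ 2), e1, e2]
        congr 1
        refine sum_congr rfl fun j hj => if_neg ?_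
        have := (mem_Ico.1 hj).1
        omega
      simp only [hin, e1, e2]
      rw [sum_add_distrib, sum_add_distrib]
      have e3 : ∑ i ∈ range s, ∑ j ∈ range s, (if i < s ∧ j < s then
          -(wit A (Ico (cs c) (cs (c + 1))) i j) ^ 2 else wit A (range n) i j ^ 2) =
          -∑ i ∈ range s, ∑ j ∈ range s, wit A (Ico (cs c) (cs (c + 1))) i j ^ 2 := by
        simp only [← sum_neg_distrib]
        refine sum_congr rfl fun i hi => sum_congr rfl fun j hj => ?_
        rw [if_pos ⟨mem_range.1 hi, mem_range.1 hj⟩]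
      have e4 : ∑ i ∈ Ico (cs c) (cs (c + 1)), ∑ j ∈ range s, (if i < s ∧ j < s then
          -(wit A (Ico (cs c) (cs (c + 1))) i j) ^ 2 else wit A (range n) i j ^ 2) =
          ∑ i ∈ Ico (cs c) (cs (c + 1)), ∑ j ∈ range s, wit A (range n) i j ^ 2 := by
        refine sum_congr rfl fun i hi => sum_congr rfl fun j hj => if_neg ?_
        have := (mem_Ico.1 hi).1
        omega
      rw [e3, e4]
      ring
    have hcr : ∑ i ∈ Ico s (cs c), ∑ j ∈ Ico (cs c) (cs (c + 1)), wit A (range n) i j ^ 2 =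
        ∑ l ∈ range s, ∑ l' ∈ range s,
          wit A (Ico s (cs c)) l l' * wit A (Ico (cs c) (cs (c + 1))) l l' := by
      rw [← h.sum_cross]
      refine sum_congr rfl fun i hi => sum_congr rfl fun j hj => ?_
      rw [mem_Ico] at hi hj
      rw [h.wit_cross hc hi.1 hi.2 hj.1 hj.2]
    have hcr' : ∑ i ∈ Ico (cs c) (cs (c + 1)), ∑ j ∈ Ico s (cs c), wit A (range n) i j ^ 2 =
        ∑ l ∈ range s, ∑ l' ∈ range s,
          wit A (Ico s (cs c)) l l' * wit A (Ico (cs c) (cs (c + 1))) l l' := by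
      rw [← hcr, sum_comm]
      exact sum_congr rfl fun i _ => sum_congr rfl fun j _ => by rw [h.wit_comm]
    have hw : ∀ i j, wit A (Ico s (cs (c + 1))) i j =
        wit A (Ico s (cs c)) i j + wit A (Ico (cs c) (cs (c + 1))) i j := fun i j => by
      rw [wit, wit, wit, sum_Ico_consecutive _ h1 h2]
    have ih' := ih (by omega)
    rw [sum_range_succ _ c, hcv]
    simp only [hsum, hsum', sum_add_distrib, hcr, hcr', hw, add_sq, mul_assoc, ← mul_sum] at ih' ⊢
    linear_combination ih'

theorem sum_sq : ∑ i ∈ range n, ∑ j ∈ range n, wit A (range n) i j ^ 2 =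
    ∑ i ∈ range s, ∑ j ∈ range s, (wit A (range n) i j ^ 2 + wit A (Ico s n) i j ^ 2) +
    ∑ c ∈ range nc, ∑ i ∈ range (cs (c + 1) - (cs c - s)),
      ∑ j ∈ range (cs (c + 1) - (cs c - s)), chunkVal n s A cs c i j := by
  have := h.sum_sq_aux nc le_rfl
  rwa [h.last] at this

end Split

end FourVertex

/-! ## The work on a chunk -/

namespace WordRAM

namespace Program

variable {E : Env}

/-- `τ` occurs in a loop over pairs that was entered in `σ`. -/
structure InPairs (σ τ : St) : Prop where
  v : ∀ y, y ∉ [Var.i, .j, .u, .w, .x, .p, .h, .q2] → τ.v y = σ.v y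
  a : ∀ A, A ∉ [Arr.qm, .pc, .g0] → τ.a A = σ.a A

/-- The invariant may depend only on the two counters, on `q2` and on the arrays; the remaining
variables are restored by the frame, so a body needs to be treated only for one pair. The bound `κ`
is the time for that body. -/
theorem wp_pairs {z : Var} {c : Cmd} {Q : St → Prop} {σ : St} (N κ : ℕ) (V : ℕ → ℕ)
    (I : ℕ → ℕ → ℕ → (Arr → ℕ → ℕ) → Prop) (hz : z = .b ∨ z = .sg) (hzN : σ.v z = N)
    (hN : N ≤ E.lim) (hcv : ∀ x ∈ c.wv, x ∈ [Var.x, .p, .h, .q2])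
    (hca : ∀ A ∈ c.wa, A ∈ [Arr.qm, .pc, .g0])
    (hV : ∀ k, k < N → V k ≤ E.lim ∧
      σ.a .ord (k + (1 - if k < σ.v .sg then 1 else 0) * σ.v .lo) = V k)
    (h0 : I 0 0 (σ.v .q2) σ.a) (hrow : ∀ i q A, i < N → I i N q A → I (i + 1) 0 q A)
    (hstep : ∀ i j τ, i < N → j < N → InPairs σ τ → τ.v .i = i → τ.v .j = j → τ.v .u = V i →
      τ.v .w = V j → I i j (τ.v .q2) τ.a →
      wp E c (fun τ' => I i (j + 1) (τ'.v .q2) τ'.a ∧ τ'.time ≤ τ.time + κ) τ)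
    (hend : ∀ τ, I N 0 (τ.v .q2) τ.a → τ.time ≤ σ.time + N * (N * (κ + 3) + 5) + 2 → Q τ) :
    wp E (pairs z c) Q σ := by
  have hc : ∀ y, y ∉ [Var.x, .p, .h, .q2] → y ∉ c.wv := fun y hy h => hy (hcv y h)
  have hcA : ∀ A, A ∉ [Arr.qm, .pc, .g0] → A ∉ c.wa := fun A hA h => hA (hca A h)
  have hzz : ∀ {τ}, InPairs σ τ → τ.v z = N := by
    intro τ hτ
    rw [← hzN]
    rcases hz with rfl | rfl <;> exact hτ.v _ (by decide)
  have hzc : ∀ y, y ∈ [Var.i, .j, .u, .w] → y ∉ c.wv := fun y hy => hc y (by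
    revert hy
    cases y <;> decide)
  have hv : ∀ {τ}, InPairs σ τ → ∀ k, k < N → ∀ x, τ.v x = k → (vertex x).eval τ = V k := by
    intro τ hτ k hk x hx
    simp only [vertex, Expr.eval_get, Expr.eval_add, Expr.eval_mul, Expr.eval_sub, Expr.eval_one,
      Expr.eval_lt, Expr.eval_var, hx, hτ.a .ord (by decide), hτ.v .sg (by decide),
      hτ.v .lo (by decide)]
    exact (hV k hk).2
  refine wp_for (fun i τ => I i 0 (τ.v .q2) τ.a ∧
    τ.time ≤ σ.time + i * (N * (κ + 3) + 5) + 1) 0 N rfl (by omega) hN ?_ ?_ ?_ ?_ ?_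
  · simp [hzc .i (by decide)]
  · intro τ hτ
    refine hzz ⟨fun y hy => hτ.v y ?_ ?_, fun A hA => hτ.a A ?_⟩
    · have := hc y (fun h => hy (by revert h; cases y <;> decide))
      simp only [List.mem_cons, not_or] at hy
      simp [this, hy]
    · simp only [List.mem_cons, not_or] at hy
      exact hy.1
    · simpa using hcA A hA
  · simpa using h0
  · rintro i τ - hi hτi hl ⟨h1, h2⟩
    have hτ : InPairs σ τ := by
      refine ⟨fun y hy => hl.v y ?_ ?_, fun A hA => hl.a A ?_⟩
      · have := hc y (fun h => hy (by revert h; cases y <;> decide))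
        simp only [List.mem_cons, not_or] at hy
        simp [this, hy]
      · simp only [List.mem_cons, not_or] at hy
        exact hy.1
      · simpa using hcA A hA
    rw [wp_then_iff, wp_asg_iff]
    have hvi : (vertex .i).eval τ.tick = V i :=
      hv (τ := τ.tick) ⟨hτ.v, hτ.a⟩ i hi .i (by simpa using hτi)
    rw [hvi]
    refine ⟨(hV i hi).1, ?_⟩
    refine wp_for (fun j υ => I i j (υ.v .q2) υ.a ∧
      υ.time ≤ σ.time + i * (N * (κ + 3) + 5) + 4 + j * (κ + 3)) 0 N rfl (by omega) hN ?_ ?_ ?_ ?_ ?_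
    · simp [hzc .j (by decide)]
    · intro υ hυ
      have hz' : z ∉ [Var.i, .j, .u, .w, .x, .p, .h, .q2] := by
        rcases hz with rfl | rfl <;> decide
      have := hc z (by rcases hz with rfl | rfl <;> decide)
      simp only [List.mem_cons, not_or] at hz'
      rw [Expr.eval_var, hυ.v z (by simp [this, hz']) hz'.2.1]
      simpa [hz'] using hzz hτ
    · simp only [St.set_v, St.set_a, St.tick_v, St.tick_a, reduceCtorEq, if_false, St.set_time,
        St.tick_time]
      exact ⟨h1, by omega⟩
    · rintro j υ - hj hυj hm ⟨g1, g2⟩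
      have hυ : InPairs σ υ := by
        refine ⟨fun y hy => ?_, fun A hA => ?_⟩
        · have := hc y (fun h => hy (by revert h; cases y <;> decide))
          have hy' := hy
          simp only [List.mem_cons, not_or] at hy'
          rw [hm.v y (by simp [this, hy']) hy'.2.1]
          simpa [hy'] using hτ.v y hy
        · rw [hm.a A (by simpa using hcA A hA)]
          exact hτ.a A hA
      have hvj : (vertex .j).eval υ.tick = V j :=
        hv (τ := υ.tick) ⟨hυ.v, hυ.a⟩ j hj .j (by simpa using hυj)
      rw [wp_then_iff, wp_asg_iff, hvj]
      refine ⟨(hV j hj).1, ?_⟩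
      have hout : ∀ y, y ∈ [Var.i, .u] → υ.v y = (τ.tick.set .u (V i)).v y := by
        intro y hy
        have hy1 := hzc y (by revert hy; cases y <;> decide)
        have hy2 : y ≠ .w := by rintro rfl; revert hy; decide
        have hy3 : y ≠ .j := by rintro rfl; revert hy; decide
        exact hm.v y (by simp [hy1, hy2]) hy3
      refine wp_mono ?_ (hstep i j ((υ.tick).set .w (V j)) hi hj ?_ ?_ ?_ ?_ ?_ ?_)
      · rintro τ' ⟨k1, k2⟩
        simp only [St.set_v, St.set_a, St.set_time, St.tick_time, reduceCtorEq, if_false] at k2 ⊢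
        refine ⟨k1, ?_⟩
        rw [Nat.succ_mul]
        omega
      · refine ⟨fun y hy => ?_, fun A hA => hυ.a A hA⟩
        have hy' := hy
        simp only [List.mem_cons, not_or] at hy'
        simpa [hy'] using hυ.v y hy
      · simpa [hτi] using hout .i (by decide)
      · simpa using hυj
      · simpa using hout .u (by decide)
      · simp
      · simpa using g1
    · rintro υ - - ⟨g1, g2⟩
      simp only [St.set_v, St.set_a, St.set_time, St.tick_time, St.tick_v, St.tick_a, reduceCtorEq,
        if_false]
      refine ⟨hrow i _ _ hi g1, ?_⟩
      rw [Nat.succ_mul]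
      omega
  · rintro τ - - ⟨h1, h2⟩
    exact hend _ h1 (by simp only [St.tick_time]; omega)

end Program

theorem encodeMatrix_eq {b : ℕ} (A : Matrix (Fin b) (Fin b) ℕ) :
    encodeMatrix A = List.ofFn fun t : Fin (b * b) => A t.divNat t.modNat := by
  rw [List.ofFn_mul]
  unfold encodeMatrix
  congr 2
  funext i
  congr 1
  funext j
  congr 1
  · ext
    have := i.isLt
    simp [Fin.divNat, Nat.mul_add_div (by omega : 0 < b), mul_comm _ b, Nat.div_eq_of_lt j.isLt]
  · ext
    simp [Fin.modNat, Nat.mod_eq_of_lt j.isLt]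

theorem length_encodeMatrix {b : ℕ} (A : Matrix (Fin b) (Fin b) ℕ) :
    (encodeMatrix A).length = b * b := by
  rw [encodeMatrix_eq, List.length_ofFn]

theorem encodeMatrix_getD {b : ℕ} (f : ℕ → ℕ → ℕ) (t : ℕ) :
    (encodeMatrix (Matrix.of fun i j : Fin b => f i j)).getD t 0 =
      if t < b * b then f (t / b) (t % b) else 0 := by
  rw [encodeMatrix_eq, List.getD_eq_getElem?_getD]
  split_ifs with h
  · rw [List.getElem?_eq_getElem (by simpa using h)]
    simp [Fin.divNat, Fin.modNat]
  · rw [List.getElem?_eq_none (by simpa using h)]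
    rfl

/-- Besides the entries of the two matrices, all cells behind them must be zero, as in the initial
memory of the multiplication program. -/
theorem matInput_getD {b : ℕ} (f : ℕ → ℕ → ℕ) (m : ℕ → ℕ) (h0 : m 0 = b)
    (h1 : ∀ t, t < b * b → m (1 + t) = f (t / b) (t % b))
    (h2 : ∀ t, t < b * b → m (1 + b * b + t) = f (t / b) (t % b))
    (h3 : ∀ t, 1 + 2 * (b * b) ≤ t → m t = 0) (t : ℕ) : m t =
      (matInput (Matrix.of fun i j : Fin b => f i j) (Matrix.of fun i j : Fin b => f i j)).getD t
        0 := by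
  have hl := length_encodeMatrix (Matrix.of fun i j : Fin b => f i j)
  unfold matInput
  rcases t with _ | t
  · rw [List.getD_cons_zero, h0]
  rw [List.getD_cons_succ]
  by_cases ht : t < b * b
  · rw [List.getD_append _ _ _ _ (by omega), encodeMatrix_getD, if_pos ht, ← h1 t ht, add_comm]
  · rw [List.getD_append_right _ _ _ _ (by omega), encodeMatrix_getD, hl]
    split_ifs with ht'
    · rw [← h2 _ ht']
      congr 1
      omega
    · exact h3 _ (by omega)

/-- The state of a block of `b` vertices. -/
structure InBlock (E : Env) (n s lo b : ℕ) (a : ℕ → ℕ → ℕ) (V : ℕ → ℕ) (σ : St) : Prop where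
  n_eq : σ.v .n = n
  sg_eq : σ.v .sg = s
  lo_eq : σ.v .lo = lo
  b_eq : σ.v .b = b
  le : b ≤ n
  n_le : n ≤ E.lim
  le_lim : 24 ≤ E.lim
  ord_eq : ∀ k, k < b → σ.a .ord (FourVertex.place s lo k) = V k
  lt : ∀ k, k < b → V k < n
  inj : ∀ k k', k < b → k' < b → V k = V k' → k = k'
  adj_eq : ∀ u w, u < n → w < n → σ.a .adj (u * n + w) = a u w
  a_le : ∀ u w, u < n → w < n → a u w ≤ 1
  r_le : ∀ u, u < n → σ.a .r u ≤ 1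

theorem InBlock.congr {E : Env} {n s lo b : ℕ} {a : ℕ → ℕ → ℕ} {V : ℕ → ℕ} {σ τ : St}
    (h : InBlock E n s lo b a V σ) (hv : ∀ x ∈ [Var.n, .sg, .lo, .b], τ.v x = σ.v x)
    (ha : ∀ A ∈ [Arr.ord, .adj, .r], τ.a A = σ.a A) : InBlock E n s lo b a V τ where
  n_eq := (hv .n (by decide)).trans h.n_eq
  sg_eq := (hv .sg (by decide)).trans h.sg_eq
  lo_eq := (hv .lo (by decide)).trans h.lo_eq
  b_eq := (hv .b (by decide)).trans h.b_eq
  le := h.le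
  n_le := h.n_le
  le_lim := h.le_lim
  ord_eq k hk := by rw [ha .ord (by decide), h.ord_eq k hk]
  lt := h.lt
  inj := h.inj
  adj_eq u w hu hw := by rw [ha .adj (by decide), h.adj_eq u w hu hw]
  a_le := h.a_le
  r_le u hu := by rw [ha .r (by decide)]; exact h.r_le u hu

theorem InBlock.vertex {E : Env} {n s lo b : ℕ} {a : ℕ → ℕ → ℕ} {V : ℕ → ℕ} {σ : St}
    (h : InBlock E n s lo b a V σ) (k : ℕ) (hk : k < b) : V k ≤ E.lim ∧
      σ.a .ord (k + (1 - if k < σ.v .sg then 1 else 0) * σ.v .lo) = V k := by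
  have := h.lt k hk
  have := h.n_le
  refine ⟨by omega, ?_⟩
  rw [← h.ord_eq k hk, h.sg_eq, h.lo_eq, FourVertex.place]
  split_ifs <;> simp

/-- The adjacency function of the graph on the chosen vertices. -/
def chosen (a : ℕ → ℕ → ℕ) (r : ℕ → ℕ) (u w : ℕ) : ℕ := a u w * (r u * r w)

namespace Program

variable {E : Env} {n s lo b : ℕ} {a : ℕ → ℕ → ℕ} {V : ℕ → ℕ} {σ : St}

/-- The window is only partly written; the equality with the initial memory for every `t` relies on
the cells from `off` on being zero beforehand. -/
theorem fill_spec (h : InBlock E n s lo b a V σ)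
    (hq : ∀ i, σ.v .off ≤ i → σ.a .qm i = 0) :
    wp E fill (fun τ => (∀ t, τ.a .qm (σ.v .off + t) =
        (matInput (Matrix.of fun i j : Fin b => chosen a (σ.a .r) (V i) (V j))
          (Matrix.of fun i j : Fin b => chosen a (σ.a .r) (V i) (V j))).getD t 0) ∧
      τ.a .pc = σ.a .pc ∧ τ.a .g0 = σ.a .g0 ∧ τ.v .q2 = σ.v .q2 ∧
      τ.time ≤ σ.time + (b * (b * 6 + 5) + 3)) σ := by
  obtain ⟨off, hoff⟩ : ∃ off, σ.v .off = off := ⟨_, rfl⟩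
  rw [hoff] at hq ⊢
  have hb := h.b_eq
  have hlim := h.n_le
  have hlim' := h.le_lim
  have hle := h.le
  unfold fill
  simp only [wp_then_iff, wp_wr_iff, Expr.eval_var, hb, hoff]
  refine ⟨by omega, ?_⟩
  have h' : InBlock E n s lo b a V (σ.write .qm off b) := h.congr (fun _ _ => rfl) (fun A hA => by
    have : A ≠ .qm := by rintro rfl; revert hA; decide
    simp [this])
  refine wp_pairs b 3 V (fun i j q A => A .qm off = b ∧
    (∀ t, t < b * b → A .qm (off + (1 + t)) =
      if t < i * b + j then chosen a (σ.a .r) (V (t / b)) (V (t % b)) else 0) ∧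
    (∀ t, t < b * b → A .qm (off + (1 + b * b + t)) =
      if t < i * b + j then chosen a (σ.a .r) (V (t / b)) (V (t % b)) else 0) ∧
    (∀ t, 1 + 2 * (b * b) ≤ t → A .qm (off + t) = 0) ∧ A .pc = σ.a .pc ∧ A .g0 = σ.a .g0 ∧
    q = σ.v .q2)
    (.inl rfl) hb (by omega) (by decide) (by decide) h'.vertex ?_ ?_ ?_ ?_
  · simp only [St.write_a, if_true, Function.update_self, St.write_v, reduceCtorEq, if_false]
    refine ⟨trivial, fun t _ => ?_, fun t _ => ?_, fun t _ => ?_, trivial, trivial, trivial⟩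
    · rw [Function.update_of_ne (by omega), if_neg (by omega), hq _ (by omega)]
    · rw [Function.update_of_ne (by omega), if_neg (by omega), hq _ (by omega)]
    · rw [Function.update_of_ne (by omega), hq _ (by omega)]
  · intro i q A hi hI
    rw [Nat.succ_mul, add_zero]
    exact hI
  · rintro i j τ hi hj hτ hτi hτj hτu hτw ⟨g1, g2, g3, g4, g5, g6, g7⟩
    have hn : τ.v .n = n := (hτ.v .n (by decide)).trans h'.n_eq
    have hb : τ.v .b = b := (hτ.v .b (by decide)).trans h'.b_eq
    have hoff : τ.v .off = off := (hτ.v .off (by decide)).trans hoff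
    have hadj : τ.a .adj (V i * n + V j) = a (V i) (V j) := by
      rw [hτ.a .adj (by decide)]
      exact h'.adj_eq _ _ (h.lt i hi) (h.lt j hj)
    have hr : τ.a .r = σ.a .r := hτ.a .r (by decide)
    have hW : chosen a (σ.a .r) (V i) (V j) ≤ 1 := by
      have h1 := Nat.mul_le_mul (h.r_le _ (h.lt i hi)) (h.r_le _ (h.lt j hj))
      exact Nat.mul_le_mul (h.a_le _ _ (h.lt i hi) (h.lt j hj)) h1
    have hm := pair_lt hi hj
    obtain ⟨hd, hd'⟩ := pair_div (i := i) hj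
    simp only [wp_then_iff, wp_asg_iff, wp_wr_iff, Expr.eval_add, Expr.eval_mul, Expr.eval_get,
      Expr.eval_var, Expr.eval_one, hn, hb, hoff, hτi, hτj, hτu, hτw, hadj, hr, St.set_v,
      St.set_a, St.write_v, St.write_a, St.write_time, St.set_time, reduceCtorEq, if_true, if_false]
    change chosen a (σ.a .r) (V i) (V j) ≤ E.lim ∧ chosen a (σ.a .r) (V i) (V j) ≤ E.lim ∧
      chosen a (σ.a .r) (V i) (V j) ≤ E.lim ∧ _
    refine ⟨by omega, by omega, by omega, ⟨?_, fun t ht => ?_, fun t ht => ?_, fun t ht => ?_, g5, g6, g7⟩,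
      by omega⟩
    · rw [Function.update_of_ne (by omega), Function.update_of_ne (by omega), g1]
    · rw [Function.update_of_ne (by omega)]
      by_cases htm : t = i * b + j
      · rw [if_pos (by omega), htm, Function.update_self, hd, hd', chosen]
      · rw [Function.update_of_ne (by omega), g2 t ht]
        simp only [show t < i * b + (j + 1) ↔ t < i * b + j by omega]
    · by_cases htm : t = i * b + j
      · rw [if_pos (by omega), htm, Function.update_self, hd, hd', chosen]
      · rw [Function.update_of_ne (by omega), Function.update_of_ne (by omega), g3 t ht]
        simp only [show t < i * b + (j + 1) ↔ t < i * b + j by omega]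
    · rw [Function.update_of_ne (by omega), Function.update_of_ne (by omega), g4 t ht]
  · rintro τ ⟨g1, g2, g3, g4, g5, g6, g7⟩ ht
    simp only [St.write_time, Nat.reduceAdd] at ht
    refine ⟨fun t => ?_, g5, g6, g7, by omega⟩
    refine matInput_getD (fun i j => chosen a (σ.a .r) (V i) (V j)) (fun t => τ.a .qm (off + t))
      g1 (fun t ht => ?_) (fun t ht => ?_) g4 t
    · rw [g2 t ht, if_pos (by omega)]
    · rw [g3 t ht, if_pos (by omega)]

/-- The new entry for the codegree of a pair of vertices. -/
def newEntry (s c : ℕ) (W pc g0 : ZMod 24) (i j : ℕ) : ZMod 24 :=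
  if i < s ∧ j < s ∧ c ≠ 0 then pc + (W - g0) else W

/-- The contribution of a pair of vertices to the sum of squares. -/
def contribution (s c : ℕ) (W g0 : ZMod 24) (i j : ℕ) : ZMod 24 :=
  if i < s ∧ j < s then if c = 0 then 0 else -(W - g0) ^ 2 else W ^ 2

/-- Different pairs of a block use different cells, so each entry is updated once and from its old
value. The two partial sums in the invariant are the finished rows and the current row. -/
theorem collect_spec (h : InBlock E n s lo b a V σ) (W : ℕ → ℕ → ZMod 24)
    (hq : ∀ i j, i < b → j < b →
      (σ.a .qm (σ.v .off + (1 + 2 * (b * b) + (i * b + j))) : ZMod 24) = W i j)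
    (hpc : ∀ x, σ.a .pc x < 24) (hg : ∀ x, σ.a .g0 x < 24) :
    wp E collect (fun τ =>
      (∀ i j, i < b → j < b → (τ.a .pc (V i * n + V j) : ZMod 24) =
        newEntry s (σ.v .kc) (W i j) (σ.a .pc (V i * n + V j)) (σ.a .g0 (V i * n + V j)) i j) ∧
      (∀ x, (∀ i j, i < b → j < b → x ≠ V i * n + V j) → τ.a .pc x = σ.a .pc x) ∧
      (σ.v .kc = 0 → ∀ i j, i < b → j < b → i < s → j < s →
        (τ.a .g0 (V i * n + V j) : ZMod 24) = W i j) ∧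
      (σ.v .kc ≠ 0 → τ.a .g0 = σ.a .g0) ∧
      (τ.v .q2 : ZMod 24) = σ.v .q2 + ∑ i ∈ Finset.range b, ∑ j ∈ Finset.range b,
        contribution s (σ.v .kc) (W i j) (σ.a .g0 (V i * n + V j)) i j ∧
      (∀ x, τ.a .pc x < 24) ∧ (∀ x, τ.a .g0 x < 24) ∧
      τ.time ≤ σ.time + (b * (b * 9 + 5) + 2)) σ := by
  obtain ⟨c, hc⟩ : ∃ c, σ.v .kc = c := ⟨_, rfl⟩
  rw [hc]
  have hlim := h.n_le
  have hlim' := h.le_lim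
  have hle := h.le
  have hinj : ∀ {i j i' j'}, i < b → j < b → i' < b → j' < b →
      V i' * n + V j' = V i * n + V j → i' = i ∧ j' = j := by
    intro i j i' j' hi hj hi' hj' he
    obtain ⟨h1, h2⟩ := pair_inj (h.lt j' hj') (h.lt j hj) he
    exact ⟨h.inj _ _ hi' hi h1, h.inj _ _ hj' hj h2⟩
  have hcast : ∀ k : ℕ, ((k % 24 : ℕ) : ZMod 24) = k := fun k => ZMod.natCast_mod k 24
  have h23 : (23 : ZMod 24) = -1 := by decide
  refine wp_pairs b 6 V (fun i j q A =>
    (∀ i' j', i' < b → j' < b → (A .pc (V i' * n + V j') : ZMod 24) = if i' * b + j' < i * b + j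
      then newEntry s c (W i' j') (σ.a .pc (V i' * n + V j')) (σ.a .g0 (V i' * n + V j')) i' j'
      else σ.a .pc (V i' * n + V j')) ∧
    (∀ x, (∀ i j, i < b → j < b → x ≠ V i * n + V j) → A .pc x = σ.a .pc x) ∧
    (c = 0 → ∀ i' j', i' < b → j' < b → i' < s → j' < s → i' * b + j' < i * b + j →
      (A .g0 (V i' * n + V j') : ZMod 24) = W i' j') ∧
    (c ≠ 0 → A .g0 = σ.a .g0) ∧
    (q : ZMod 24) = σ.v .q2 + ∑ i' ∈ Finset.range i, ∑ j' ∈ Finset.range b,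
      contribution s c (W i' j') (σ.a .g0 (V i' * n + V j')) i' j' + ∑ j' ∈ Finset.range j,
      contribution s c (W i j') (σ.a .g0 (V i * n + V j')) i j' ∧
    (∀ x, A .pc x < 24) ∧ (∀ x, A .g0 x < 24) ∧ A .qm = σ.a .qm)
    (.inl rfl) h.b_eq (by omega) (by decide) (by decide) h.vertex ?_ ?_ ?_ ?_
  · simp [hpc, hg]
  · rintro i q A hi ⟨g1, g2, g3, g4, g5, g6⟩
    have e : (i + 1) * b + 0 = i * b + b := by rw [Nat.succ_mul, add_zero]
    rw [e]
    refine ⟨g1, g2, g3, g4, ?_, g6⟩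
    rw [g5, Finset.sum_range_succ _ i, Finset.sum_range_zero]
    ring
  · rintro i j τ hi hj hτ hτi hτj hτu hτw ⟨g1, g2, g3, g4, g5, g6, g7, g8⟩
    have hn : τ.v .n = n := (hτ.v .n (by decide)).trans h.n_eq
    have hb : τ.v .b = b := (hτ.v .b (by decide)).trans h.b_eq
    have hsg : τ.v .sg = s := (hτ.v .sg (by decide)).trans h.sg_eq
    have hoff : τ.v .off = σ.v .off := hτ.v .off (by decide)
    have hkc : τ.v .kc = c := (hτ.v .kc (by decide)).trans hc
    have hW := hq i j hi hj
    have hm := pair_lt hi hj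
    obtain ⟨x, hx⟩ : ∃ x, V i * n + V j = x := ⟨_, rfl⟩
    have hlt : ∀ {i' j'}, i' < b → j' < b → V i' * n + V j' ≠ x →
        (i' * b + j' < i * b + (j + 1) ↔ i' * b + j' < i * b + j) := by
      intro i' j' hi' hj' hne
      have : i' * b + j' ≠ i * b + j := by
        intro he
        obtain ⟨rfl, rfl⟩ := pair_inj hj' hj he
        exact hne hx
      omega
    have hpcx : (τ.a .pc x : ZMod 24) = σ.a .pc x := by
      rw [← hx, g1 i j hi hj, if_neg (lt_irrefl _)]
    obtain ⟨P, hP⟩ : ∃ P, σ.a .qm (σ.v .off + (1 + 2 * (b * b) + (i * b + j))) = P := ⟨_, rfl⟩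
    rw [hP] at hW
    have hP24 : P % 24 < 24 := Nat.mod_lt _ (by norm_num)
    have key1 : ∀ v : ℕ, (v : ZMod 24) =
          newEntry s c (W i j) (σ.a .pc x) (σ.a .g0 x) i j → ∀ i' j', i' < b → j' < b →
        (Function.update (τ.a .pc) x v (V i' * n + V j') : ZMod 24) =
        if i' * b + j' < i * b + (j + 1)
        then newEntry s c (W i' j') (σ.a .pc (V i' * n + V j')) (σ.a .g0 (V i' * n + V j')) i' j'
        else σ.a .pc (V i' * n + V j') := by
      intro v hv i' j' hi' hj'
      by_cases he : V i' * n + V j' = x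
      · obtain ⟨rfl, rfl⟩ := hinj hi hj hi' hj' (he.trans hx.symm)
        rw [if_pos (by omega), he, Function.update_self, hv]
      · rw [Function.update_of_ne he, g1 i' j' hi' hj']
        simp only [hlt hi' hj' he]
    have key2 : ∀ v : ℕ, ∀ y, (∀ i j, i < b → j < b → y ≠ V i * n + V j) →
        Function.update (τ.a .pc) x v y = σ.a .pc y := by
      intro v y hy
      rw [Function.update_of_ne (hx ▸ hy i j hi hj), g2 y hy]
    have key3 : ∀ (A : Arr) (v : ℕ), (∀ y, τ.a A y < 24) → v < 24 →
        ∀ y, Function.update (τ.a A) x v y < 24 := by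
      intro A v hA hv y
      rw [Function.update_apply]
      split_ifs
      · exact hv
      · exact hA y
    have key4 : ∀ q : ℕ, (q : ZMod 24) = τ.v .q2 + contribution s c (W i j) (σ.a .g0 x) i j →
        (q : ZMod 24) = σ.v .q2 + ∑ i' ∈ Finset.range i, ∑ j' ∈ Finset.range b,
          contribution s c (W i' j') (σ.a .g0 (V i' * n + V j')) i' j' +
          ∑ j' ∈ Finset.range (j + 1),
            contribution s c (W i j') (σ.a .g0 (V i * n + V j')) i j' := by
      intro q hq
      rw [hq, g5, Finset.sum_range_succ _ j, hx]
      ring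
    simp only [wp_then_iff, wp_asg_iff, wp_ite_iff, Expr.eval_add, Expr.eval_mul, Expr.eval_get,
      Expr.eval_var, Expr.eval_one, Expr.eval_mod, Expr.eval_ofNat, Expr.eval_lt, hn, hb, hoff,
      hτi, hτj, hτu, hτw, hsg, hkc, g8, hP, St.set_v, St.tick_v, St.set_a, St.tick_a, reduceCtorEq,
      if_true, if_false, hx]
    refine ⟨by omega, ?_⟩
    by_cases hij : i < s ∧ j < s
    swap
    · have : (if i < s then 1 else 0) * (if j < s then 1 else 0) = 0 := by
        split_ifs with h1 h2
        · exact absurd ⟨h1, h2⟩ hij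
        · rfl
        · rfl
        · rfl
      rw [if_pos this]
      simp only [wp_then_iff, wp_asg_iff, wp_wr_iff, Expr.eval_add, Expr.eval_mul, Expr.eval_mod,
        Expr.eval_ofNat, Expr.eval_var, St.set_v, St.tick_v, St.write_v, St.set_a, St.write_a,
        St.tick_a, St.set_time, St.write_time, St.tick_time, reduceCtorEq, if_true, if_false, hτu,
        hτw, hn, hx]
      have hlt24 := Nat.mod_lt (τ.v .q2 + P % 24 * (P % 24)) (by norm_num : 24 > 0)
      refine ⟨by omega, by omega, ⟨key1 _ ?_, key2 _, fun hc0 i' j' hi' hj' hi's hj's hlt' => ?_, g4,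
        key4 _ ?_, key3 _ _ g6 hP24, g7, g8⟩, by omega⟩
      · rw [hcast, hW, newEntry, if_neg (fun h => hij ⟨h.1, h.2.1⟩)]
      · have : V i' * n + V j' ≠ x := by
          rintro he
          obtain ⟨rfl, rfl⟩ := hinj hi hj hi' hj' (he.trans hx.symm)
          exact hij ⟨hi's, hj's⟩
        exact g3 hc0 i' j' hi' hj' hi's hj's ((hlt hi' hj' this).1 hlt')
      · rw [hcast]
        push_cast
        rw [hcast, hW, contribution, if_neg hij, sq]
    have h1 : (if i < s then 1 else 0) * (if j < s then 1 else 0) ≠ 0 := by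
      rw [if_pos hij.1, if_pos hij.2]
      exact one_ne_zero
    rw [if_neg h1]
    by_cases hc0 : c = 0
    · rw [if_pos hc0]
      simp only [wp_then_iff, wp_asg_iff, wp_wr_iff, Expr.eval_add, Expr.eval_mul, Expr.eval_mod,
        Expr.eval_ofNat, Expr.eval_var, St.set_v, St.tick_v, St.write_v, St.set_a, St.write_a,
        St.tick_a, St.set_time, St.write_time, St.tick_time, reduceCtorEq, if_true, if_false, hτu,
        hτw, hn, hx]
      refine ⟨by omega, by omega, ⟨key1 _ ?_, key2 _, fun _ i' j' hi' hj' hi's hj's hlt' => ?_,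
        fun h => absurd hc0 h, key4 _ ?_, key3 _ _ g6 hP24, key3 _ _ g7 hP24, g8⟩, by omega⟩
      · rw [hcast, hW, newEntry, if_neg (fun h => h.2.2 hc0)]
      · by_cases he : V i' * n + V j' = x
        · obtain ⟨rfl, rfl⟩ := hinj hi hj hi' hj' (he.trans hx.symm)
          rw [he, Function.update_self, hcast, hW]
        · rw [Function.update_of_ne he]
          exact g3 hc0 i' j' hi' hj' hi's hj's ((hlt hi' hj' he).1 hlt')
      · rw [contribution, if_pos hij, if_pos hc0, add_zero]
    · rw [if_neg hc0]
      simp only [wp_then_iff, wp_asg_iff, wp_wr_iff, Expr.eval_add, Expr.eval_mul, Expr.eval_mod,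
        Expr.eval_ofNat, Expr.eval_var, Expr.eval_get, St.set_v, St.tick_v, St.write_v, St.set_a,
        St.write_a, St.tick_a, St.set_time, St.write_time, St.tick_time, reduceCtorEq, if_true,
        if_false, hτu, hτw, hn, hx, g4 hc0]
      have hh : (((P % 24 + 23 * σ.a .g0 x) % 24 : ℕ) : ZMod 24) = W i j - σ.a .g0 x := by
        rw [hcast]
        push_cast
        rw [hcast, hW, h23]
        ring
      obtain ⟨hv, hhv⟩ : ∃ hv, (P % 24 + 23 * σ.a .g0 x) % 24 = hv := ⟨_, rfl⟩
      have hv24 : hv < 24 := hhv ▸ Nat.mod_lt _ (by norm_num)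
      have h2 := Nat.mod_lt (τ.a .pc x + hv) (by norm_num : 24 > 0)
      have h3 := Nat.mod_lt (τ.v .q2 + 23 * (hv * hv)) (by norm_num : 24 > 0)
      rw [hhv] at hh ⊢
      refine ⟨by omega, by omega, by omega, ⟨key1 _ ?_, key2 _, fun h => absurd h hc0,
        fun _ => trivial, key4 _ ?_, key3 _ _ g6 h2, ?_, g8⟩, by omega⟩
      · rw [hcast]
        push_cast
        rw [hh, hpcx, newEntry, if_pos ⟨hij.1, hij.2, hc0⟩]
      · rw [hcast]
        push_cast
        rw [hh, h23, contribution, if_pos hij, if_neg hc0]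
        ring
      · rw [← g4 hc0]
        exact g7
  · rintro τ ⟨g1, g2, g3, g4, g5, g6, g7, g8⟩ ht
    refine ⟨fun i j hi hj => ?_, g2, fun hc0 i j hi hj his hjs => ?_, g4, ?_, g6, g7, by omega⟩
    · rw [g1 i j hi hj, if_pos]
      have := pair_lt hi hj
      omega
    · refine g3 hc0 i j hi hj his hjs ?_
      have := pair_lt hi hj
      omega
    · simpa using g5

end Program

end WordRAM

/-! ### One block: codegrees and the sum of squares accumulated so far. -/

namespace WordRAM

open FourVertex

theorem wp_mm {E : Env} {b off : ℕ} {Q : St → Prop} {σ : St} (hb : σ.v .b = b)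
    (hoff : σ.v .off = off) (h1 : 1 ≤ b) (A B : Matrix (Fin b) (Fin b) ℕ) (hA : ∀ i j, A i j ≤ 1)
    (hB : ∀ i j, B i j ≤ 1) (hq : ∀ i, i < E.str → σ.a .qm (off + i) = (matInput A B).getD i 0)
    (h2 : E.qlim b < E.str) (h3 : 3 * b ^ 2 < E.str) (h4 : E.qlim b ≤ E.lim)
    (hQ : ∀ m : ℕ → ℕ, (∀ i, i < off ∨ off + E.str ≤ i → m i = σ.a .qm i) →
      (∀ i j : Fin b, m (off + (1 + 2 * b ^ 2 + (i * b + j))) = (A * B) i j) →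
      Q (σ.multiply m (E.qtime b))) : wp E .mm Q σ := by
  subst hb hoff
  exact ⟨h1, A, B, hA, hB, hq, h2, h3, h4, hQ⟩

/-- The state before a round. -/
structure InRound (E : Env) (n k s : ℕ) (a : ℕ → ℕ → ℕ) (nc : ℕ) (σ : St) : Prop where
  n_eq : σ.v .n = n
  sg_eq : σ.v .sg = s
  nc_eq : σ.v .nc = nc
  str_eq : σ.v .str = E.str
  ordered : Ordered n k s a (σ.a .ord) (σ.a .cs) nc
  adj_eq : ∀ u w, u < n → w < n → σ.a .adj (u * n + w) = a u w
  a_le : ∀ u w, a u w ≤ 1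
  a_symm : ∀ u w, a u w = a w u
  le_lim : 24 ≤ E.lim
  n_le : n + 2 ≤ E.lim
  qlim_lt : ∀ b, b ≤ n → E.qlim b < E.str
  lt_str : ∀ b, b ≤ n → 3 * b ^ 2 < E.str
  qlim_le : ∀ b, b ≤ n → E.qlim b ≤ E.lim

/-- The adjacency function in terms of positions. -/
def posAdj (a : ℕ → ℕ → ℕ) (σ : St) (i j : ℕ) : ZMod 24 :=
  chosen a (σ.a .r) (σ.a .ord i) (σ.a .ord j)

/-- The vertices of block `c`. -/
def blockVertex (s : ℕ) (ord cs : ℕ → ℕ) (c i : ℕ) : ℕ := ord (place s (cs c - s) i)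

/-- The number of vertices of block `c`. -/
def blockSize (s : ℕ) (cs : ℕ → ℕ) (c : ℕ) : ℕ := cs (c + 1) - (cs c - s)

/-- A bound for the time spent on a block with `b` vertices. -/
def blockTime (E : Env) (b : ℕ) : ℕ := b * (b * 15 + 10) + E.qtime b + 12

/-- The first `c` blocks of a round are done. -/
structure Collected (E : Env) (n s : ℕ) (a : ℕ → ℕ → ℕ) (off₀ T c : ℕ) (τ : St) : Prop where
  entry : ∀ c', c' < c → ∀ i j, i < blockSize s (τ.a .cs) c' → j < blockSize s (τ.a .cs) c' →
    ¬ (i < s ∧ j < s) → (τ.a .pc (blockVertex s (τ.a .ord) (τ.a .cs) c' i * n +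
      blockVertex s (τ.a .ord) (τ.a .cs) c' j) : ZMod 24) =
    wit (posAdj a τ) (Finset.range n) (place s (τ.a .cs c' - s) i) (place s (τ.a .cs c' - s) j)
  base : 1 ≤ c → ∀ i j, i < s → j < s →
    (τ.a .g0 (τ.a .ord i * n + τ.a .ord j) : ZMod 24) = wit (posAdj a τ) (Finset.range s) i j ∧
    (τ.a .pc (τ.a .ord i * n + τ.a .ord j) : ZMod 24) = wit (posAdj a τ) (Finset.range s) i j +
      wit (posAdj a τ) (Finset.Ico s (τ.a .cs c)) i j
  sum : (τ.v .q2 : ZMod 24) = ∑ c' ∈ Finset.range c,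
    ∑ i ∈ Finset.range (blockSize s (τ.a .cs) c'), ∑ j ∈ Finset.range (blockSize s (τ.a .cs) c'),
      chunkVal n s (posAdj a τ) (τ.a .cs) c' i j
  pc_lt : ∀ x, τ.a .pc x < 24
  g0_lt : ∀ x, τ.a .g0 x < 24
  off_eq : τ.v .off = off₀ + c * E.str
  qm_zero : ∀ x, τ.v .off ≤ x → τ.a .qm x = 0
  time : τ.time ≤ T + ∑ c' ∈ Finset.range c, blockTime E (blockSize s (τ.a .cs) c')

namespace InRound

variable {E : Env} {n k s nc : ℕ} {a : ℕ → ℕ → ℕ} {σ : St}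

theorem congr {τ : St} (h : InRound E n k s a nc σ)
    (hv : ∀ x ∈ [Var.n, .sg, .nc, .str], τ.v x = σ.v x)
    (ha : ∀ A ∈ [Arr.ord, .cs, .adj], τ.a A = σ.a A) : InRound E n k s a nc τ where
  n_eq := (hv .n (by decide)).trans h.n_eq
  sg_eq := (hv .sg (by decide)).trans h.sg_eq
  nc_eq := (hv .nc (by decide)).trans h.nc_eq
  str_eq := (hv .str (by decide)).trans h.str_eq
  ordered := by
    rw [ha .ord (by decide), ha .cs (by decide)]
    exact h.ordered
  adj_eq u w hu hw := by rw [ha .adj (by decide), h.adj_eq u w hu hw]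
  a_le := h.a_le
  a_symm := h.a_symm
  le_lim := h.le_lim
  n_le := h.n_le
  qlim_lt := h.qlim_lt
  lt_str := h.lt_str
  qlim_le := h.qlim_le

variable (h : InRound E n k s a nc σ)
include h

theorem split : Split n s (posAdj a σ) (σ.a .cs) nc where
  symm i j := by
    unfold posAdj chosen
    rw [h.a_symm, mul_comm (σ.a .r _)]
  zero := h.ordered.cuts.zero
  mono := h.ordered.cuts.mono
  last := h.ordered.last
  closed c hc i j hi hi' hj hj' := by
    by_cases ha : a (σ.a .ord i) (σ.a .ord j) = 0
    · simp [posAdj, chosen, ha]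
    · obtain ⟨j', h1, h2⟩ := h.ordered.cuts.closed c hc i hi hi' _ (h.ordered.lt j hj') ha
      have := h.ordered.inj j' j (by omega) hj' h2
      omega

theorem place_lt {c i : ℕ} (hc : c < nc) (hi : i < blockSize s (σ.a .cs) c) :
    place s (σ.a .cs c - s) i < n := by
  have h1 := h.split.le_cs hc.le
  have h2 := h.split.cs_le (c := c + 1) hc
  have h3 := h.split.mono c hc
  unfold place
  unfold blockSize at hi
  split_ifs <;> omega

theorem place_mem {c i : ℕ} (hc : c < nc) (hi : i < blockSize s (σ.a .cs) c) (his : ¬ i < s) :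
    σ.a .cs c ≤ place s (σ.a .cs c - s) i ∧ place s (σ.a .cs c - s) i < σ.a .cs (c + 1) := by
  have h1 := h.split.le_cs hc.le
  have h3 := h.split.mono c hc
  unfold place
  unfold blockSize at hi
  rw [if_neg his]
  omega

theorem blockSize_le {c : ℕ} (hc : c < nc) : blockSize s (σ.a .cs) c ≤ n := by
  have h1 := h.split.le_cs hc.le
  have h2 := h.split.cs_le (c := c + 1) hc
  have h3 := h.split.mono c hc
  unfold blockSize
  omega

theorem le_blockSize {c : ℕ} (hc : c < nc) : s ≤ blockSize s (σ.a .cs) c := by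
  have h1 := h.split.le_cs hc.le
  have h3 := h.split.mono c hc
  unfold blockSize
  omega

/-- If not both vertices belong to the separator, one of them belongs to the chunk and has all its
neighbours inside the block, so the product on the block is already the codegree. -/
theorem wit_block {c i j : ℕ} (hc : c < nc) (hi : i < blockSize s (σ.a .cs) c)
    (hj : j < blockSize s (σ.a .cs) c) (hij : ¬ (i < s ∧ j < s)) :
    wit (posAdj a σ) (Finset.range n) (place s (σ.a .cs c - s) i) (place s (σ.a .cs c - s) j) =
    wit (posAdj a σ) (Finset.range s) (place s (σ.a .cs c - s) i) (place s (σ.a .cs c - s) j) +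
    wit (posAdj a σ) (Finset.Ico (σ.a .cs c) (σ.a .cs (c + 1))) (place s (σ.a .cs c - s) i)
      (place s (σ.a .cs c - s) j) := by
  by_cases his : i < s
  · have := h.place_mem hc hj (fun hjs => hij ⟨his, hjs⟩)
    rw [h.split.wit_comm, h.split.wit_chunk hc this.1 this.2, h.split.wit_comm,
      h.split.wit_comm (Finset.Ico _ _)]
  · have := h.place_mem hc hi his
    exact h.split.wit_chunk hc this.1 this.2

theorem inBlock {c : ℕ} (hc : c < nc) (hr : ∀ u, u < n → σ.a .r u ≤ 1)
    (hlo : σ.v .lo = σ.a .cs c - s) (hb : σ.v .b = blockSize s (σ.a .cs) c) :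
    InBlock E n s (σ.a .cs c - s) (blockSize s (σ.a .cs) c) a
      (blockVertex s (σ.a .ord) (σ.a .cs) c) σ where
  n_eq := h.n_eq
  sg_eq := h.sg_eq
  lo_eq := hlo
  b_eq := hb
  le := h.blockSize_le hc
  n_le := by have := h.n_le; omega
  le_lim := h.le_lim
  ord_eq k _ := rfl
  lt k hk := h.ordered.lt _ (h.place_lt hc hk)
  inj i j hi hj hij := by
    have := h.ordered.inj _ _ (h.place_lt hc hi) (h.place_lt hc hj) hij
    have h1 := h.split.le_cs hc.le
    unfold place at this
    split_ifs at this <;> omega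
  adj_eq := h.adj_eq
  a_le u w _ _ := h.a_le u w
  r_le := hr

/-- A pair that is not inside the separator contains a vertex of exactly one chunk; so its entry,
once computed, is not overwritten by a later block. -/
theorem blockVertex_ne {c c' i j i' j' : ℕ} (hc : c < nc) (hc' : c' < c)
    (hi' : i' < blockSize s (σ.a .cs) c') (hj' : j' < blockSize s (σ.a .cs) c')
    (hij : ¬ (i' < s ∧ j' < s)) (hi : i < blockSize s (σ.a .cs) c)
    (hj : j < blockSize s (σ.a .cs) c) :
    blockVertex s (σ.a .ord) (σ.a .cs) c' i' * n + blockVertex s (σ.a .ord) (σ.a .cs) c' j' ≠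
    blockVertex s (σ.a .ord) (σ.a .cs) c i * n + blockVertex s (σ.a .ord) (σ.a .cs) c j := by
  intro he
  have hc'n : c' < nc := by omega
  have key : ∀ x y, x < blockSize s (σ.a .cs) c' → y < blockSize s (σ.a .cs) c →
      blockVertex s (σ.a .ord) (σ.a .cs) c' x = blockVertex s (σ.a .ord) (σ.a .cs) c y →
      x < s := by
    intro x y hx hy hxy
    by_contra hxs
    have h1 := h.ordered.inj _ _ (h.place_lt hc'n hx) (h.place_lt hc hy) hxy
    have h2 := h.place_mem hc'n hx hxs
    have h3 := h.split.mono' (i := c' + 1) (j := c) hc' hc.le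
    have h5 := h.split.le_cs (c := c') hc'n.le
    by_cases hys : y < s
    · have : place s (σ.a .cs c - s) y = y := if_pos hys
      omega
    · have h4 := h.place_mem hc hy hys
      omega
  obtain ⟨h1, h2⟩ := pair_inj (h.ordered.lt _ (h.place_lt hc'n hj')) (h.ordered.lt _ (h.place_lt hc hj)) he
  exact hij ⟨key _ _ hi' hi h1, key _ _ hj' hj h2⟩

end InRound

namespace Program

variable {E : Env} {n k s nc : ℕ} {a : ℕ → ℕ → ℕ} {σ : St}

/-- The middle vertex of the product runs through the block, that is, through the separator and the
chunk. -/
theorem cast_block_mul (h : InRound E n k s a nc σ) {c : ℕ} (hc : c < nc)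
    (i j : Fin (blockSize s (σ.a .cs) c)) :
    (((Matrix.of fun i j : Fin (blockSize s (σ.a .cs) c) => chosen a (σ.a .r)
        (blockVertex s (σ.a .ord) (σ.a .cs) c i) (blockVertex s (σ.a .ord) (σ.a .cs) c j)) *
      (Matrix.of fun i j : Fin (blockSize s (σ.a .cs) c) => chosen a (σ.a .r)
        (blockVertex s (σ.a .ord) (σ.a .cs) c i) (blockVertex s (σ.a .ord) (σ.a .cs) c j)))
        i j : ℕ) =
    wit (posAdj a σ) (Finset.range s) (place s (σ.a .cs c - s) i) (place s (σ.a .cs c - s) j) +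
    wit (posAdj a σ) (Finset.Ico (σ.a .cs c) (σ.a .cs (c + 1))) (place s (σ.a .cs c - s) i)
      (place s (σ.a .cs c - s) j) := by
  have h1 := h.split.le_cs hc.le
  have h3 := h.split.mono c hc
  have e1 : s + (σ.a .cs c - s) = σ.a .cs c := by omega
  have e2 : blockSize s (σ.a .cs) c + (σ.a .cs c - s) = σ.a .cs (c + 1) := by
    unfold blockSize; omega
  have := sum_place (lo := σ.a .cs c - s) (h.le_blockSize hc) fun l =>
    posAdj a σ (place s (σ.a .cs c - s) i) l * posAdj a σ l (place s (σ.a .cs c - s) j)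
  rw [e1, e2] at this
  rw [wit, wit, ← this, Matrix.mul_apply, Finset.sum_range]
  push_cast
  rfl

/-- A pair inside the separator gets its product minus the part from block 0 added, which is the
contribution of the chunk; every other pair of the block gets its final codegree. -/
theorem block_spec {off₀ T c : ℕ} (h : InRound E n k s a nc σ) (hr : ∀ u, u < n → σ.a .r u ≤ 1)
    (hc : c < nc) (hkc : σ.v .kc = c) (hoff : off₀ + (c + 1) * E.str ≤ E.lim)
    (hC : Collected E n s a off₀ T c σ) :
    wp E block (fun τ => Collected E n s a off₀ T (c + 1) (τ.set .kc (c + 1))) σ.tick := by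
  have hlim := h.n_le
  have hbn := h.blockSize_le hc
  have hsb := h.le_blockSize hc
  have hcn := h.split.cs_le hc.le
  have hcn' := h.split.cs_le (c := c + 1) hc
  unfold block
  rw [wp_then_iff, wp_asg_iff, wp_then_iff, wp_asg_iff]
  simp only [Expr.eval_sub, Expr.eval_get, Expr.eval_var, Expr.eval_add, Expr.eval_one, St.tick_v,
    St.tick_a, St.set_v, St.set_a, hkc, h.sg_eq, reduceCtorEq, if_true, if_false]
  change σ.a .cs c - s ≤ E.lim ∧ blockSize s (σ.a .cs) c ≤ E.lim ∧ _
  refine ⟨by omega, by omega, ?_⟩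
  obtain ⟨b, hb⟩ : ∃ b, blockSize s (σ.a .cs) c = b := ⟨_, rfl⟩
  obtain ⟨V, hV⟩ : ∃ V, blockVertex s (σ.a .ord) (σ.a .cs) c = V := ⟨_, rfl⟩
  obtain ⟨φ, hφ⟩ : ∃ φ, place s (σ.a .cs c - s) = φ := ⟨_, rfl⟩
  obtain ⟨off, hoffv⟩ : ∃ off, σ.v .off = off := ⟨_, rfl⟩
  obtain ⟨σ₁, hσ₁⟩ : ∃ σ₁, (σ.tick.set .lo (σ.a .cs c - s)).set .b (σ.a .cs (c + 1) - (σ.a .cs c - s)) =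
    σ₁ := ⟨_, rfl⟩
  rw [hσ₁]
  have hσ₁v : ∀ x, x ≠ .lo → x ≠ .b → σ₁.v x = σ.v x := by
    intro x hx hx'
    simp [← hσ₁, hx, hx']
  have hσ₁a : σ₁.a = σ.a := by rw [← hσ₁]; rfl
  have hσ₁t : σ₁.time = σ.time + 3 := by rw [← hσ₁]; rfl
  have h₁ : InRound E n k s a nc σ₁ := h.congr
    (fun x hx => hσ₁v x (by rintro rfl; revert hx; decide) (by rintro rfl; revert hx; decide))
    (fun A _ => by rw [hσ₁a])
  have hB : InBlock E n s (σ.a .cs c - s) b a V σ₁ := by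
    have := h₁.inBlock (c := c) hc (by rw [hσ₁a]; exact hr) (by simp [← hσ₁])
      (by simp [← hσ₁, blockSize])
    rwa [hσ₁a, hb, hV] at this
  have hmul := cast_block_mul h hc
  rw [hb, hV, hφ] at hmul
  rw [hb] at hbn hsb
  refine wp_then (fill_spec hB ?_) ?_
  · intro x hx
    rw [hσ₁a]
    exact hC.qm_zero x (by rwa [← hσ₁v .off (by decide) (by decide)])
  rintro σ₂ ⟨f1, f2, f3, f4, f5⟩ hl₂
  rw [hσ₁v .off (by decide) (by decide), hoffv, hσ₁a] at f1
  have hσ₂a : ∀ A ∈ [Arr.ord, .cs, .adj, .r], σ₂.a A = σ.a A := fun A hA => by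
    rw [hl₂.a A (by revert hA; cases A <;> decide), hσ₁a]
  have hB₂ : InBlock E n s (σ.a .cs c - s) b a V σ₂ := hB.congr
    (fun x hx => hl₂.v x (by revert hx; cases x <;> decide))
    (fun A hA => hl₂.a A (by revert hA; cases A <;> decide))
  have hoff₂ : σ₂.v .off = off := by
    rw [hl₂.v .off (by decide), hσ₁v .off (by decide) (by decide), hoffv]
  -- The two matrices end inside the window because `E.str` exceeds `3 * b ^ 2`; the zeros behind it
  -- are needed for the next block.
  have hstr : ∀ t, E.str ≤ t → σ₂.a .qm (off + t) = 0 := by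
    intro t ht
    rw [f1 t]
    have := length_encodeMatrix (Matrix.of fun i j : Fin b => chosen a (σ.a .r) (V i) (V j))
    have := h.lt_str b hbn
    refine List.getD_eq_default _ _ ?_
    rw [sq] at this
    simp only [matInput, List.length_cons, List.length_append]
    omega
  refine wp_then (P := fun τ => (∀ i j, i < b → j < b →
      (τ.a .qm (off + (1 + 2 * (b * b) + (i * b + j))) : ZMod 24) =
        wit (posAdj a σ) (Finset.range s) (φ i) (φ j) +
        wit (posAdj a σ) (Finset.Ico (σ.a .cs c) (σ.a .cs (c + 1))) (φ i) (φ j)) ∧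
      (∀ t, E.str ≤ t → τ.a .qm (off + t) = 0) ∧ τ.time ≤ σ₂.time + E.qtime b + 2) ?_ ?_
  · rw [wp_ite_iff, Expr.eval_var, hB₂.b_eq]
    by_cases hb0 : b = 0
    · rw [if_pos hb0, wp_skip_iff]
      exact ⟨fun i j hi => by omega, hstr, by simp only [St.tick_time]; omega⟩
    · rw [if_neg hb0]
      have hM : ∀ i j : Fin b,
          (Matrix.of fun i j : Fin b => chosen a (σ.a .r) (V i) (V j)) i j ≤ 1 := by
        intro i j
        have h1 := Nat.mul_le_mul (hr _ (hB.lt i i.2)) (hr _ (hB.lt j j.2))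
        exact Nat.mul_le_mul (h.a_le (V i) (V j)) h1
      refine wp_mm (σ := σ₂.tick) hB₂.b_eq hoff₂ (by omega) _ _ hM hM (fun t _ => f1 t)
        (h.qlim_lt b hbn) (h.lt_str b hbn) (h.qlim_le b hbn) fun m hm hm' => ⟨fun i j hi hj => ?_,
          fun t ht => ?_, ?_⟩
      · have := hm' ⟨i, hi⟩ ⟨j, hj⟩
        simp only [St.multiply_a, if_true]
        rw [← sq, this, hmul ⟨i, hi⟩ ⟨j, hj⟩]
      · simp only [St.multiply_a, if_true]
        rw [hm _ (by omega)]
        exact hstr t ht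
      · simp only [St.multiply_time, St.tick_time]
        omega
  rintro σ₃ ⟨g1, g2, g3⟩ hl₃
  have hB₃ : InBlock E n s (σ.a .cs c - s) b a V σ₃ := hB₂.congr
    (fun x hx => hl₃.v x (by revert hx; cases x <;> decide))
    (fun A hA => hl₃.a A (by revert hA; cases A <;> decide))
  have hσ₃a : ∀ A ∈ [Arr.ord, .cs, .adj, .r], σ₃.a A = σ.a A := fun A hA => by
    rw [hl₃.a A (by revert hA; cases A <;> decide), hσ₂a A hA]
  have hoff₃ : σ₃.v .off = off := (hl₃.v .off (by decide)).trans hoff₂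
  have hpc₃ : σ₃.a .pc = σ.a .pc := by rw [hl₃.a .pc (by decide), f2, hσ₁a]
  have hg₃ : σ₃.a .g0 = σ.a .g0 := by rw [hl₃.a .g0 (by decide), f3, hσ₁a]
  have hq₃ : σ₃.v .q2 = σ.v .q2 := by
    rw [hl₃.v .q2 (by decide), f4, hσ₁v .q2 (by decide) (by decide)]
  have hkc₃ : σ₃.v .kc = c := by
    rw [hl₃.v .kc (by decide), hl₂.v .kc (by decide), hσ₁v .kc (by decide) (by decide), hkc]
  refine wp_then (collect_spec hB₃ (fun i j => wit (posAdj a σ) (Finset.range s) (φ i) (φ j) +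
    wit (posAdj a σ) (Finset.Ico (σ.a .cs c) (σ.a .cs (c + 1))) (φ i) (φ j)) ?_ ?_ ?_) ?_
  · intro i j hi hj
    rw [hoff₃]
    exact g1 i j hi hj
  · rw [hpc₃]; exact hC.pc_lt
  · rw [hg₃]; exact hC.g0_lt
  rintro σ₄ ⟨k1, k2, k3, k4, k5, k6, k7, k8⟩ hl₄
  rw [hpc₃] at k1 k2
  rw [hg₃, hkc₃] at k1 k5
  rw [hkc₃] at k3 k4
  rw [hg₃] at k4
  rw [hq₃] at k5
  have hσ₄a : ∀ A ∈ [Arr.ord, .cs, .adj, .r], σ₄.a A = σ.a A := fun A hA => by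
    rw [hl₄.a A (by revert hA; cases A <;> decide), hσ₃a A hA]
  have hoff₄ : σ₄.v .off = off := (hl₄.v .off (by decide)).trans hoff₃
  have hstr₄ : σ₄.v .str = E.str := by
    rw [hl₄.v .str (by decide), hl₃.v .str (by decide), hl₂.v .str (by decide),
      hσ₁v .str (by decide) (by decide), h.str_eq]
  have hqm₄ : σ₄.a .qm = σ₃.a .qm := hl₄.a .qm (by decide)
  have hpos : posAdj a (σ₄.set .off (off + E.str)) = posAdj a σ := by
    funext i j
    simp only [posAdj, St.set_a, hσ₄a .ord (by decide), hσ₄a .r (by decide)]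
  have hpos' : posAdj a ((σ₄.set .off (off + E.str)).set .kc (c + 1)) = posAdj a σ := hpos
  have hoff' := hC.off_eq
  rw [hoffv] at hoff'
  have hsucc : off₀ + (c + 1) * E.str = off + E.str := by rw [Nat.succ_mul, hoff']; omega
  have hφs : ∀ i, i < s → φ i = i := fun i hi => by rw [← hφ]; exact if_pos hi
  have hVs : ∀ i, i < s → V i = σ.a .ord i := fun i hi => by
    rw [← hV, blockVertex, hφ, hφs i hi]
  rw [wp_asg_iff]
  simp only [Expr.eval_add, Expr.eval_var, hoff₄, hstr₄]
  refine ⟨by omega, ?_⟩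
  refine ⟨?_, ?_, ?_, k6, k7, ?_, ?_, ?_⟩
  · intro c' hc' i j hi hj hij
    rw [hpos']
    simp only [St.set_a, hσ₄a .ord (by decide), hσ₄a .cs (by decide)] at hi hj ⊢
    by_cases hcc : c' = c
    · subst hcc
      have hw := h.wit_block hc hi hj hij
      rw [hb] at hi hj
      rw [hφ] at hw ⊢
      rw [hV, k1 i j hi hj, newEntry, if_neg (fun h => hij ⟨h.1, h.2.1⟩), hw]
    · rw [k2, hC.entry c' (by omega) i j hi hj hij]
      intro i' j' hi' hj'
      have := h.blockVertex_ne (c' := c') hc (by omega) hi hj hij (i := i') (j := j') (hb ▸ hi')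
        (hb ▸ hj')
      rwa [hV] at this
  · intro _ i j hi hj
    rw [hpos']
    simp only [St.set_a, hσ₄a .ord (by decide), hσ₄a .cs (by decide)]
    have e1 := k1 i j (by omega) (by omega)
    rw [hVs i hi, hVs j hj, hφs i hi, hφs j hj] at e1
    have hz := h.split.zero
    have h1 := h.split.le_cs hc.le
    have h3 := h.split.mono c hc
    -- In block 0 the chunk is empty, so the product is the number of common neighbours in the
    -- separator, and both arrays are initialised with it.
    by_cases hc0 : c = 0
    · have e2 := k3 hc0 i j (by omega) (by omega) hi hj
      rw [hVs i hi, hVs j hj, hφs i hi, hφs j hj] at e2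
      subst hc0
      rw [e1, e2, newEntry, if_neg (by simp), hz, h.ordered.cuts.one]
      simp [wit]
    · obtain ⟨b1, b2⟩ := hC.base (by omega) i j hi hj
      rw [e1, newEntry, if_pos ⟨hi, hj, hc0⟩, k4 hc0, b1, b2]
      refine ⟨rfl, ?_⟩
      rw [wit, wit, wit, wit, ← Finset.sum_Ico_consecutive _ h1 h3]
      ring
  · rw [hpos']
    simp only [St.set_a, St.set_v, reduceCtorEq, if_false, hσ₄a .cs (by decide)]
    rw [k5, hC.sum, Finset.sum_range_succ _ c, hb]
    congr 1
    refine Finset.sum_congr rfl fun i hi => Finset.sum_congr rfl fun j hj => ?_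
    have hi := Finset.mem_range.1 hi
    have hj := Finset.mem_range.1 hj
    rw [contribution, chunkVal, hφ]
    by_cases hij : i < s ∧ j < s
    · rw [if_pos hij, if_pos hij, hφs i hij.1, hφs j hij.2]
      -- For the empty chunk 0 the square to be subtracted is zero, in accordance with the program
      -- adding nothing there.
      by_cases hc0 : c = 0
      · subst hc0
        rw [if_pos rfl, h.split.zero, h.ordered.cuts.one]
        simp [wit]
      · rw [if_neg hc0, hVs i hij.1, hVs j hij.2, (hC.base (by omega) i j hij.1 hij.2).1]
        ring
    · have hw := h.wit_block hc (hb ▸ hi) (hb ▸ hj) hij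
      rw [hφ] at hw
      rw [if_neg hij, if_neg hij, hw]
  · simp only [St.set_v, reduceCtorEq, if_false, if_true]
    omega
  · intro x hx
    simp only [St.set_v, reduceCtorEq, if_false, if_true, St.set_a] at hx ⊢
    rw [hqm₄, show x = off + (x - off) by omega]
    exact g2 _ (by omega)
  · have := hC.time
    simp only [St.set_time, St.set_a, hσ₄a .cs (by decide)]
    rw [Finset.sum_range_succ _ c, hb]
    have : blockTime E b = b * (b * 6 + 5) + b * (b * 9 + 5) + E.qtime b + 12 := by
      unfold blockTime; ring
    omega

end Program

end WordRAM

/-! ## A round -/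

namespace WordRAM

open FourVertex

variable {E : Env} {n k s nc : ℕ} {a : ℕ → ℕ → ℕ} {pos : ℕ → ℕ} {σ τ : St}

namespace InRound

variable (h : InRound E n k s a nc σ)
include h

theorem not_adj {c i j : ℕ} (hc : c ≤ nc) (hi : s ≤ i) (hi' : i < σ.a .cs c) (hj : σ.a .cs c ≤ j)
    (hj' : j < n) : a (σ.a .ord i) (σ.a .ord j) = 0 := by
  by_contra hne
  obtain ⟨j', h1, h2⟩ := h.ordered.cuts.closed c hc i hi hi' _ (h.ordered.lt j hj') hne
  have := h.split.cs_le hc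
  have := h.ordered.inj j' j (by omega) hj' h2
  omega

/-- The positions of two vertices that are equal or adjacent occur together in a block. -/
theorem exists_block {i j : ℕ} (hi : i < n) (hj : j < n)
    (hij : i = j ∨ a (σ.a .ord i) (σ.a .ord j) ≠ 0) (hs : ¬ (i < s ∧ j < s)) :
    ∃ c, c < nc ∧ (i < s ∨ σ.a .cs c ≤ i ∧ i < σ.a .cs (c + 1)) ∧
      (j < s ∨ σ.a .cs c ≤ j ∧ j < σ.a .cs (c + 1)) := by
  by_cases his : i < s
  · obtain ⟨c, h1, h2⟩ := h.split.exists_chunk (i := j) (by omega) hj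
    exact ⟨c, h1, .inl his, .inr h2⟩
  obtain ⟨c, h1, h2, h3⟩ := h.split.exists_chunk (i := i) (by omega) hi
  refine ⟨c, h1, .inr ⟨h2, h3⟩, ?_⟩
  rcases hij with rfl | hij
  · exact .inr ⟨h2, h3⟩
  by_contra hne
  by_cases hjc : j < σ.a .cs c
  · exact hij (by rw [h.a_symm, h.not_adj h1.le (by omega) hjc h2 hi])
  · exact hij (h.not_adj (c := c + 1) h1 (by omega) h3 (by omega) hj)

theorem exists_place {c i : ℕ} (hc : c < nc) (hi : i < s ∨ σ.a .cs c ≤ i ∧ i < σ.a .cs (c + 1)) :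
    ∃ z, z < blockSize s (σ.a .cs) c ∧ place s (σ.a .cs c - s) z = i ∧ (z < s ↔ i < s) := by
  have h1 := h.split.le_cs hc.le
  have h2 := h.le_blockSize hc
  by_cases his : i < s
  · exact ⟨i, by omega, if_pos his, Iff.rfl⟩
  · refine ⟨i - (σ.a .cs c - s), by unfold blockSize; omega, ?_, by omega⟩
    rw [place, if_neg (by omega)]
    omega

theorem wit_range (i j : ℕ) : wit (posAdj a σ) (Finset.range n) i j =
    ∑ v ∈ Finset.range n, (chosen a (σ.a .r) (σ.a .ord i) v : ZMod 24) *
      chosen a (σ.a .r) v (σ.a .ord j) := by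
  refine Finset.sum_bij (fun l _ => σ.a .ord l) (fun l hl => ?_) (fun l hl l' hl' he => ?_)
    (fun v hv => ?_) (fun l hl => rfl)
  · exact Finset.mem_range.2 (h.ordered.lt l (Finset.mem_range.1 hl))
  · exact h.ordered.inj l l' (Finset.mem_range.1 hl) (Finset.mem_range.1 hl') he
  · obtain ⟨l, h1, h2⟩ := h.ordered.surj v (Finset.mem_range.1 hv)
    exact ⟨l, Finset.mem_range.2 h1, h2⟩

theorem sum_range_ord (f : ℕ → ZMod 24) :
    ∑ i ∈ Finset.range n, f (σ.a .ord i) = ∑ v ∈ Finset.range n, f v := by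
  refine Finset.sum_bij (fun l _ => σ.a .ord l) (fun l hl => ?_) (fun l hl l' hl' he => ?_)
    (fun v hv => ?_) (fun l hl => rfl)
  · exact Finset.mem_range.2 (h.ordered.lt l (Finset.mem_range.1 hl))
  · exact h.ordered.inj l l' (Finset.mem_range.1 hl) (Finset.mem_range.1 hl') he
  · obtain ⟨l, h1, h2⟩ := h.ordered.surj v (Finset.mem_range.1 hv)
    exact ⟨l, Finset.mem_range.2 h1, h2⟩

theorem wit_union (i j : ℕ) : wit (posAdj a σ) (Finset.range s) i j +
    wit (posAdj a σ) (Finset.Ico s n) i j = wit (posAdj a σ) (Finset.range n) i j :=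
  Finset.sum_range_add_sum_Ico _ (h.split.zero ▸ h.split.cs_le (Nat.zero_le nc))

/-- For a pair in the separator, the contributions of all chunks have been collected by now. Any
other pair that is equal or adjacent lies in one block, whose entry is exact. -/
theorem codeg_pos {off₀ T : ℕ} (hC : Collected E n s a off₀ T nc σ) {i j : ℕ} (hi : i < n)
    (hj : j < n) (hij : i = j ∨ a (σ.a .ord i) (σ.a .ord j) ≠ 0) :
    (σ.a .pc (σ.a .ord i * n + σ.a .ord j) : ZMod 24) =
      wit (posAdj a σ) (Finset.range n) i j := by
  have htwo := h.ordered.two_le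
  by_cases hs : i < s ∧ j < s
  · rw [(hC.base (by omega) i j hs.1 hs.2).2, h.split.last, h.wit_union]
  · obtain ⟨c, h1, h2, h3⟩ := h.exists_block hi hj hij hs
    obtain ⟨x, hx, hxi, hxs⟩ := h.exists_place h1 h2
    obtain ⟨y, hy, hyj, hys⟩ := h.exists_place h1 h3
    have := hC.entry c h1 x y hx hy (by rwa [hxs, hys])
    rwa [blockVertex, blockVertex, hxi, hyj] at this

/-- After all blocks, the entries for equal or adjacent vertices are the codegrees. -/
theorem codeg_eq {off₀ T : ℕ} (hC : Collected E n s a off₀ T nc σ) {u w : ℕ} (hu : u < n)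
    (hw : w < n) (huw : u = w ∨ a u w ≠ 0) : (σ.a .pc (u * n + w) : ZMod 24) =
    ∑ v ∈ Finset.range n, (chosen a (σ.a .r) u v : ZMod 24) * chosen a (σ.a .r) v w := by
  obtain ⟨i, hi, rfl⟩ := h.ordered.surj u hu
  obtain ⟨j, hj, rfl⟩ := h.ordered.surj w hw
  rw [h.codeg_pos hC hi hj ?_, h.wit_range]
  rcases huw with huw | huw
  · exact .inl (h.ordered.inj i j hi hj huw)
  · exact .inr huw

end InRound

/-- The positions in the lists enumerate the ordered adjacent pairs without repetition, so a sum
over positions is a sum over the adjacency matrix. -/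
theorem Input.sum_edges (hI : Input E n a pos) (f : ℕ → ℕ → ZMod 24) (e : ℕ → ℕ)
    (he : ∀ u, u < n → ∀ j, pos u ≤ j → j < pos (u + 1) → e j = u) :
    ∑ t ∈ Finset.Ico (pos 0) (pos n), f (e t) (E.inp t) =
      ∑ u ∈ Finset.range n, ∑ w ∈ Finset.range n, (a u w : ZMod 24) * f u w := by
  have key : ∀ m, m ≤ n → ∑ t ∈ Finset.Ico (pos 0) (pos m), f (e t) (E.inp t) =
      ∑ u ∈ Finset.range m, ∑ w ∈ Finset.range n, (a u w : ZMod 24) * f u w := by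
    intro m
    induction m with
    | zero => simp
    | succ m ih =>
      intro hm
      rw [← Finset.sum_Ico_consecutive _ (hI.pos_mono (Nat.zero_le m) (by omega))
        (hI.pos_le_succ (by omega)), ih (by omega), Finset.sum_range_succ _ m]
      congr 1
      have h1 : ∑ t ∈ Finset.Ico (pos m) (pos (m + 1)), f (e t) (E.inp t) =
          ∑ w ∈ (Finset.Ico (pos m) (pos (m + 1))).image E.inp, (a m w : ZMod 24) * f m w := by
        rw [Finset.sum_image]
        · refine Finset.sum_congr rfl fun t ht => ?_
          rw [Finset.mem_Ico] at ht
          rw [he m hm t ht.1 ht.2, hI.adj_one m hm t ht.1 ht.2, Nat.cast_one, one_mul]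
        · intro t ht t' ht' htt
          have ht := Finset.mem_Ico.1 (Finset.mem_coe.1 ht)
          have ht' := Finset.mem_Ico.1 (Finset.mem_coe.1 ht')
          exact hI.inj m hm t t' ht.1 ht.2 ht'.1 ht'.2 htt
      rw [h1]
      refine Finset.sum_subset (fun w hw => ?_) (fun w _ hw => ?_)
      · obtain ⟨t, ht, rfl⟩ := Finset.mem_image.1 hw
        rw [Finset.mem_Ico] at ht
        exact Finset.mem_range.2 (hI.inp_lt m hm t ht.1 ht.2)
      · rw [hI.adj_zero m hm w fun t ht ht' htw =>
          hw (Finset.mem_image.2 ⟨t, Finset.mem_Ico.2 ⟨ht, ht'⟩, htw⟩), Nat.cast_zero, zero_mul]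
  exact key n le_rfl

namespace Program

theorem sample_spec (hn : σ.v .n = n) (hlim : n + 2 ≤ E.lim) :
    wp E sample (fun τ => (∀ u, u < n → τ.a .r u = (E.coins (σ.pos + u)).toNat) ∧
      τ.v .nr = ∑ u ∈ Finset.range n, (E.coins (σ.pos + u)).toNat ∧ τ.pos = σ.pos + n ∧
      τ.time ≤ σ.time + 5 * n + 3) σ := by
  have hle : ∀ m, ∑ u ∈ Finset.range m, (E.coins (σ.pos + u)).toNat ≤ m := by
    intro m
    induction m with
    | zero => simp
    | succ m ih =>
      rw [Finset.sum_range_succ]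
      have := Bool.toNat_le (E.coins (σ.pos + m))
      omega
  unfold sample
  rw [wp_then_iff, wp_asg_iff]
  refine ⟨by simp, ?_⟩
  refine wp_for (fun i τ => (∀ u, u < i → τ.a .r u = (E.coins (σ.pos + u)).toNat) ∧
    τ.v .nr = ∑ u ∈ Finset.range i, (E.coins (σ.pos + u)).toNat ∧ τ.pos = σ.pos + i ∧
    τ.time ≤ σ.time + 5 * i + 2) 0 n rfl (by omega) (by omega) (by decide) ?_ ?_ ?_ ?_
  · intro τ hτ
    exact (hτ.v .n (by decide) (by decide)).trans (by simpa using hn)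
  · simp
  · rintro i τ - hi hx - ⟨h1, h2, h3, h4⟩
    have hb := Bool.toNat_le (E.coins (σ.pos + i))
    have hs := hle (i + 1)
    rw [Finset.sum_range_succ] at hs
    simp only [wp_then_iff, wp_flip_iff, wp_wr_iff, wp_asg_iff, Expr.eval_add, Expr.eval_var,
      St.tick_v, St.tick_pos, hx, h3, St.set_v, St.toss_v, St.toss_a, St.toss_pos, St.toss_time,
      St.write_v, St.write_a, St.write_pos, St.set_pos, St.tick_time, St.set_time, St.write_time,
      St.set_a, St.tick_a, reduceCtorEq, if_true, if_false, h2]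
    refine ⟨by omega, by omega, fun u hu => ?_, by rw [Finset.sum_range_succ], by omega, by omega⟩
    by_cases hui : u = i
    · subst hui; simp
    · rw [Function.update_of_ne hui]
      exact h1 u (by omega)
  · rintro τ - - ⟨h1, h2, h3, h4⟩
    exact ⟨h1, h2, h3, by simp only [St.tick_time]; omega⟩

/-- At this point `pc` holds the full codegrees within the separator and `g0` their part inside it;
the difference counts the common neighbours in all chunks, whose square is the second term in
`sum_sq`. -/
theorem crossing_spec (hn : σ.v .n = n) (hsg : σ.v .sg = s) (hsn : s ≤ n)
    (hord : ∀ i, i < n → σ.a .ord i < n) (hlim : n + 2 ≤ E.lim) (hlim' : 24 ≤ E.lim)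
    (hpc : ∀ x, σ.a .pc x < 24) :
    wp E crossing (fun τ => (τ.v .q2 : ZMod 24) = σ.v .q2 +
      ∑ i ∈ Finset.range s, ∑ j ∈ Finset.range s,
        ((σ.a .pc (σ.a .ord i * n + σ.a .ord j) : ZMod 24) ^ 2 +
        ((σ.a .pc (σ.a .ord i * n + σ.a .ord j) : ZMod 24) -
          σ.a .g0 (σ.a .ord i * n + σ.a .ord j)) ^ 2) ∧
      τ.time ≤ σ.time + (s * (s * 6 + 5) + 2)) σ := by
  have hcast : ∀ k : ℕ, ((k % 24 : ℕ) : ZMod 24) = k := fun k => ZMod.natCast_mod k 24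
  have h23 : (23 : ZMod 24) = -1 := by decide
  obtain ⟨f, hf⟩ : ∃ f : ℕ → ℕ → ZMod 24, ∀ i j, f i j =
      ((σ.a .pc (σ.a .ord i * n + σ.a .ord j) : ZMod 24) ^ 2 +
        ((σ.a .pc (σ.a .ord i * n + σ.a .ord j) : ZMod 24) -
          σ.a .g0 (σ.a .ord i * n + σ.a .ord j)) ^ 2) := ⟨_, fun _ _ => rfl⟩
  simp only [← hf]
  refine wp_pairs s 3 (σ.a .ord) (fun i j q A => A = σ.a ∧
    (q : ZMod 24) = σ.v .q2 + ∑ i' ∈ Finset.range i, ∑ j' ∈ Finset.range s, f i' j' +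
      ∑ j' ∈ Finset.range j, f i j')
    (.inr rfl) hsg (by omega) (by decide) (by decide) (fun z hz => ?_) ?_ ?_ ?_ ?_
  · have := hord z (by omega)
    rw [hsg, if_pos hz]
    exact ⟨by omega, by simp⟩
  · simp
  · rintro i q A - ⟨h1, h2⟩
    refine ⟨h1, ?_⟩
    rw [h2, Finset.sum_range_succ _ i, Finset.sum_range_zero]
    ring
  · rintro i j τ hi hj hτ hτi hτj hτu hτw ⟨g1, g2⟩
    have hn' : τ.v .n = n := (hτ.v .n (by decide)).trans hn
    obtain ⟨x, hx⟩ : ∃ x, σ.a .ord i * n + σ.a .ord j = x := ⟨_, rfl⟩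
    have hpcx := hpc x
    have h1 := Nat.mod_lt (σ.a .pc x + 23 * σ.a .g0 x) (by norm_num : 24 > 0)
    simp only [wp_then_iff, wp_asg_iff, Expr.eval_add, Expr.eval_mul, Expr.eval_mod, Expr.eval_get,
      Expr.eval_ofNat, Expr.eval_var, St.set_v, St.set_a, St.set_time, reduceCtorEq, if_true,
      if_false, hn', hτu, hτw, g1, hx]
    have hh : (((σ.a .pc x + 23 * σ.a .g0 x) % 24 : ℕ) : ZMod 24) = σ.a .pc x - σ.a .g0 x := by
      rw [hcast]
      push_cast
      rw [h23]
      ring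
    obtain ⟨hv, hhv⟩ : ∃ hv, (σ.a .pc x + 23 * σ.a .g0 x) % 24 = hv := ⟨_, rfl⟩
    rw [hhv] at hh h1 ⊢
    have h2 := Nat.mod_lt (τ.v .q2 + (σ.a .pc x * σ.a .pc x + hv * hv)) (by norm_num : 24 > 0)
    refine ⟨by omega, by omega, by omega, ⟨trivial, ?_⟩, by omega⟩
    rw [hcast]
    push_cast
    rw [hh, g2, Finset.sum_range_succ _ j, hf i j, hx]
    ring
  · rintro τ ⟨-, g2⟩ ht
    exact ⟨by simpa using g2, by simpa [add_assoc] using ht⟩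

/-- The contribution of an edge to the statistics. -/
structure EdgeSums (τ : St) (S : (ℕ → ℕ → ZMod 24) → ZMod 24) (x : ℕ → ℕ → ZMod 24)
    (cg : ℕ → ℕ → ZMod 24) : Prop where
  e1 : (τ.v .e1 : ZMod 24) = S fun u w => x u w
  ed : (τ.v .ed : ZMod 24) = S fun u w => x u w * cg u u
  ed2 : (τ.v .ed2 : ZMod 24) = S fun u w => x u w * (cg u u * cg u u)
  edd : (τ.v .edd : ZMod 24) = S fun u w => x u w * (cg u u * cg w w)
  ep : (τ.v .ep : ZMod 24) = S fun u w => x u w * cg u w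
  epd : (τ.v .epd : ZMod 24) = S fun u w => x u w * (cg u w * cg u u)
  epp : (τ.v .epp : ZMod 24) = S fun u w => x u w * (cg u w * cg u w)

theorem edgeSums_spec (hI : Input E n a pos) (hn : σ.v .n = n)
    (hst : ∀ u, u ≤ n → σ.a .st u = pos u)
    (hes : ∀ u, u < n → ∀ j, pos u ≤ j → j < pos (u + 1) → σ.a .es j = u)
    (hr : ∀ u, u < n → σ.a .r u ≤ 1) (hpc : ∀ x, σ.a .pc x < 24) :
    wp E edgeSums (fun τ => EdgeSums τ
        (fun f => ∑ u ∈ Finset.range n, ∑ w ∈ Finset.range n, (a u w : ZMod 24) * f u w)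
        (fun u w => (σ.a .r u : ZMod 24) * σ.a .r w) (fun u w => σ.a .pc (u * n + w)) ∧
      τ.time + 15 * pos 0 ≤ σ.time + 15 * pos n + 9) σ := by
  have hlim := hI.two_le
  have hcast : ∀ k : ℕ, ((k % 24 : ℕ) : ZMod 24) = k := fun k => ZMod.natCast_mod k 24
  have hm : ∀ k : ℕ, k % 24 ≤ E.lim := fun k => by
    have := Nat.mod_lt k (by norm_num : 24 > 0)
    omega
  have hex : ∀ j, pos 0 ≤ j → j < pos n → ∃ u, u < n ∧ pos u ≤ j ∧ j < pos (u + 1) := by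
    intro j hj hj'
    have key : ∀ m, j < pos m → ∃ u, u < m ∧ pos u ≤ j ∧ j < pos (u + 1) := by
      intro m
      induction m with
      | zero => omega
      | succ m ih =>
        intro hm
        by_cases hlt : j < pos m
        · obtain ⟨c, h1, h2⟩ := ih hlt
          exact ⟨c, by omega, h2⟩
        · exact ⟨m, by omega, by omega, hm⟩
    exact key n hj'
  simp only [← hI.sum_edges _ (σ.a .es) hes]
  unfold edgeSums
  simp only [wp_then_iff, wp_asg_iff, Expr.eval_zero]
  refine ⟨by omega, by omega, by omega, by omega, by omega, by omega, by omega, ?_⟩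
  refine wp_for (fun i τ => EdgeSums τ
        (fun f => ∑ t ∈ Finset.Ico (pos 0) i, f (σ.a .es t) (E.inp t))
        (fun u w => (σ.a .r u : ZMod 24) * σ.a .r w) (fun u w => σ.a .pc (u * n + w)) ∧
    τ.time + 15 * pos 0 ≤ σ.time + 15 * i + 8) (pos 0) (pos n) ?_
    (hI.pos_mono (Nat.zero_le n) le_rfl) (hI.pos_le_lim le_rfl) (by decide) ?_ ?_ ?_ ?_
  · simpa using hst 0 (Nat.zero_le n)
  · intro τ hτ
    rw [Expr.eval_get, hτ.a .st (by decide), Expr.eval_var, hτ.v .n (by decide) (by decide)]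
    simp only [St.set_v, St.set_a, reduceCtorEq, if_false, hn]
    exact hst n le_rfl
  · refine ⟨⟨?_, ?_, ?_, ?_, ?_, ?_, ?_⟩, ?_⟩ <;> simp
    omega
  · rintro j τ hj hj' hτj hl ⟨⟨g1, g2, g3, g4, g5, g6, g7⟩, g8⟩
    obtain ⟨u, hu, huj, huj'⟩ := hex j hj hj'
    have hesj := hes u hu j huj huj'
    have hw := hI.inp_lt u hu j huj huj'
    have hn' : τ.v .n = n := (hl.v .n (by decide) (by decide)).trans (by simpa using hn)
    have hpc' : τ.a .pc = σ.a .pc := hl.a .pc (by decide)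
    have hr' : τ.a .r = σ.a .r := hl.a .r (by decide)
    have hes' : τ.a .es = σ.a .es := hl.a .es (by decide)
    have hrr := Nat.mul_le_mul (hr u hu) (hr _ hw)
    have hp1 := hpc (u * n + u)
    have hp2 := hpc (E.inp j * n + E.inp j)
    have hp3 := hpc (u * n + E.inp j)
    have hn2 := hI.n_le
    simp only [wp_then_iff, wp_asg_iff, wp_inp_iff, Expr.eval_add, Expr.eval_mul, Expr.eval_mod,
      Expr.eval_get, Expr.eval_ofNat, Expr.eval_var, St.set_v, St.set_a, St.set_time, St.tick_v,
      St.tick_a, St.tick_time, reduceCtorEq, if_true, if_false, hn', hτj, hpc', hr', hes', hesj]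
    refine ⟨by omega, hI.pos_lt_base hu huj', by omega, by omega, by omega, by omega, hm _, hm _,
      hm _, hm _, hm _, hm _, hm _, ⟨?_, ?_, ?_, ?_, ?_, ?_, ?_⟩, by omega⟩ <;>
    · simp only [St.set_v, reduceCtorEq, if_true, if_false, hcast, Nat.cast_add, Nat.cast_mul, g1,
        g2, g3, g4, g5, g6, g7, Finset.sum_Ico_succ_top hj, hesj]
  · rintro τ - - ⟨g1, g2⟩
    exact ⟨⟨g1.1, g1.2, g1.3, g1.4, g1.5, g1.6, g1.7⟩, by simp only [St.tick_time]; omega⟩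

/-- The tests are evaluated in the same variables and arrays throughout, so exactly the branch of
`x₀` is taken. -/
theorem dispatch_spec {α : Type*} {test val : α → Expr} {x₀ : α}
    (ht : ∀ x, (test x).eval σ ≠ 0 ↔ x = x₀) (hlim : 24 ≤ E.lim) :
    ∀ l : List α, x₀ ∈ l → ∀ τ : St, τ.v = σ.v → τ.a = σ.a →
      wp E (dispatch test val l) (fun υ => υ.v .res = (val x₀).eval σ % 24 ∧
        υ.time ≤ τ.time + l.length + 1) τ := by
  intro l
  induction l with
  | nil => intro h; simp at h
  | cons x l ih =>
    intro hx τ hv ha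
    have he : ∀ (e : Expr) (υ : St), υ.v = σ.v → υ.a = σ.a → e.eval υ = e.eval σ := by
      intro e υ hv ha
      induction e with
      | var y => rw [Expr.eval_var, hv, Expr.eval_var]
      | num k => rfl
      | get A e ih => rw [Expr.eval_get, ih, ha, Expr.eval_get]
      | bin o e f ih ih' => simp only [Expr.eval, ih, ih']
    unfold dispatch
    rw [wp_ite_iff, he _ τ hv ha]
    by_cases hxx : x = x₀
    · rw [if_neg ((ht x).2 hxx), wp_asg_iff, Expr.eval_mod, he _ τ.tick hv ha, hxx]
      have := Nat.mod_lt ((val x₀).eval σ) (by norm_num : 24 > 0)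
      simp only [Expr.eval_ofNat, St.set_v, if_true, St.set_time, St.tick_time, List.length_cons]
      exact ⟨by omega, trivial, by omega⟩
    · rw [if_pos (not_not.1 fun hne => hxx ((ht x).1 hne))]
      have hx' : x₀ ∈ l := by
        rcases List.mem_cons.1 hx with h | h
        · exact absurd h.symm hxx
        · exact h
      refine wp_mono ?_ (ih hx' τ.tick hv ha)
      rintro υ ⟨h1, h2⟩
      simp only [St.tick_time, List.length_cons] at h2 ⊢
      exact ⟨h1, by omega⟩

end Program

end WordRAM

/-! ### A complete round: from codegrees to the residue of the count. -/

namespace WordRAM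

open FourVertex

/-- The codegree of two vertices in the graph on the chosen vertices. -/
def chosenCodeg (n : ℕ) (a : ℕ → ℕ → ℕ) (r : ℕ → ℕ) (u w : ℕ) : ZMod 24 :=
  ∑ v ∈ Finset.range n, (chosen a r u v : ZMod 24) * chosen a r v w

/-- Sums weighted by adjacency read codegrees only at adjacent pairs and on the diagonal, where `pc`
is known to be right. The one sum over all pairs is supplied separately. -/
theorem isStats_of_sums {n : ℕ} {a : ℕ → ℕ → ℕ} {r : ℕ → ℕ} {pc : ℕ → ℕ → ZMod 24} {τ : St}
    (ha : ∀ u w, a u w ≤ 1) (hs : ∀ u w, a u w = a w u) (hr : ∀ u, u < n → r u ≤ 1)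
    (hpc : ∀ u w, u < n → w < n → u = w ∨ a u w ≠ 0 → pc u w = chosenCodeg n a r u w)
    (hnr : (τ.v .nr : ZMod 24) = ∑ u ∈ Finset.range n, (r u : ZMod 24))
    (hq2 : (τ.v .q2 : ZMod 24) =
      ∑ u ∈ Finset.range n, ∑ w ∈ Finset.range n, chosenCodeg n a r u w ^ 2)
    (hE : Program.EdgeSums τ
      (fun f => ∑ u ∈ Finset.range n, ∑ w ∈ Finset.range n, (a u w : ZMod 24) * f u w)
      (fun u w => (r u : ZMod 24) * r w) pc) :
    IsStats (fun x y : Fin n => (chosen a r x y : ZMod 24)) (fun x : Fin n => (r x : ZMod 24))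
      (fun x => (τ.v x : ZMod 24)) := by
  have hcg : ∀ x y : Fin n, codeg (fun x y : Fin n => (chosen a r x y : ZMod 24)) x y =
      chosenCodeg n a r x y := by
    intro x y
    rw [codeg, chosenCodeg, Finset.sum_range]
  have hdeg : ∀ x : Fin n, deg (fun x y : Fin n => (chosen a r x y : ZMod 24)) x =
      chosenCodeg n a r x x := by
    intro x
    rw [deg, chosenCodeg, Finset.sum_range]
    refine Finset.sum_congr rfl fun y _ => ?_
    have h1 := ha x y
    have h2 := hs x y
    have h3 := hr x x.2
    have h4 := hr y y.2
    rw [← Nat.cast_mul]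
    congr 1
    unfold chosen
    rw [← h2]
    interval_cases a x y <;> interval_cases r x <;> interval_cases r y <;> rfl
  have key : ∀ f g : ℕ → ℕ → ZMod 24, (∀ u w, u < n → w < n → a u w ≠ 0 → f u w = g u w) →
      ∑ u ∈ Finset.range n, ∑ w ∈ Finset.range n,
        (a u w : ZMod 24) * ((r u : ZMod 24) * r w * f u w) =
      ∑ x : Fin n, ∑ y : Fin n, (chosen a r x y : ZMod 24) * g x y := by
    intro f g hfg
    rw [Finset.sum_range]
    refine Finset.sum_congr rfl fun x _ => ?_
    rw [Finset.sum_range]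
    refine Finset.sum_congr rfl fun y _ => ?_
    by_cases h : a x y = 0
    · simp [chosen, h]
    · rw [hfg x y x.2 y.2 h, chosen]
      push_cast
      ring
  refine ⟨?_, ?_, ?_, ?_, ?_, ?_, ?_, ?_, ?_⟩
  · rw [hnr, Finset.sum_range]
  · rw [hE.e1]
    simpa using key (fun _ _ => 1) (fun _ _ => 1) (fun _ _ _ _ _ => rfl)
  · rw [hE.ed]
    simp only [hdeg]
    exact key (fun u _ => pc u u) (fun u _ => chosenCodeg n a r u u)
      (fun u w hu hw h => hpc u u hu hu (.inl rfl))
  · rw [hE.ed2]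
    simp only [hdeg]
    exact key (fun u _ => pc u u * pc u u) (fun u _ => chosenCodeg n a r u u * chosenCodeg n a r u u)
      (fun u w hu hw h => by simp only [hpc u u hu hu (.inl rfl)])
  · rw [hE.edd]
    simp only [hdeg]
    exact key (fun u w => pc u u * pc w w)
      (fun u w => chosenCodeg n a r u u * chosenCodeg n a r w w)
      (fun u w hu hw h => by simp only [hpc u u hu hu (.inl rfl), hpc w w hw hw (.inl rfl)])
  · rw [hE.ep]
    simp only [hcg]
    exact key (fun u w => pc u w) (fun u w => chosenCodeg n a r u w)
      (fun u w hu hw h => hpc u w hu hw (.inr h))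
  · rw [hE.epd]
    simp only [hcg, hdeg]
    exact key (fun u w => pc u w * pc u u)
      (fun u w => chosenCodeg n a r u w * chosenCodeg n a r u u)
      (fun u w hu hw h => by simp only [hpc u u hu hu (.inl rfl), hpc u w hu hw (.inr h)])
  · rw [hE.epp]
    simp only [hcg]
    exact key (fun u w => pc u w * pc u w)
      (fun u w => chosenCodeg n a r u w * chosenCodeg n a r u w)
      (fun u w hu hw h => by simp only [hpc u w hu hw (.inr h)])
  · rw [hq2, Finset.sum_range]
    refine Finset.sum_congr rfl fun x _ => ?_
    rw [Finset.sum_range]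
    exact Finset.sum_congr rfl fun y _ => by rw [hcg, sq]

/-- The state after `i` rounds. -/
structure Ready (E : Env) (n k s : ℕ) (a : ℕ → ℕ → ℕ) (nc : ℕ) (pos : ℕ → ℕ) (i : ℕ) (τ : St) :
    Prop where
  inRound : InRound E n k s a nc τ
  st_eq : ∀ u, u ≤ n → τ.a .st u = pos u
  es_eq : ∀ u, u < n → ∀ j, pos u ≤ j → j < pos (u + 1) → τ.a .es j = u
  hb_eq : ∀ j, j < 16 → τ.a .hb j = E.inp (j + 1)
  pc_lt : ∀ x, τ.a .pc x < 24
  g0_lt : ∀ x, τ.a .g0 x < 24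
  off_eq : τ.v .off = i * (nc * E.str)
  qm_zero : ∀ x, τ.v .off ≤ x → τ.a .qm x = 0
  pos_eq : τ.pos = i * n

/-- `eval` computes `F` in time `L`. -/
structure Evaluates (E : Env) (F : (Var → ZMod 24) → ZMod 24) (L : ℕ) (eval : Cmd) : Prop where
  wv : ∀ x ∈ eval.wv, x = .res
  wa : eval.wa = []
  tosses : eval.tosses = false
  wp : ∀ τ : St, (∀ j, j < 16 → τ.a .hb j = E.inp (j + 1)) →
    wp E eval (fun υ => (υ.v .res : ZMod 24) = F (fun x => (τ.v x : ZMod 24)) ∧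
      υ.v .res < 24 ∧ υ.time ≤ τ.time + L) τ

/-- A bound for the time of a round. -/
def roundTime (E : Env) (n s : ℕ) (cs : ℕ → ℕ) (nc : ℕ) (pos : ℕ → ℕ) (L : ℕ) : ℕ :=
  5 * n + (∑ c ∈ Finset.range nc, blockTime E (blockSize s cs c) + (s * (s * 6 + 5) +
    (15 * (pos n - pos 0) + (L + 24))))

/-- The vertices chosen in round `i`. -/
def coinFun (E : Env) (n i u : ℕ) : ℕ := (E.coins (i * n + u)).toNat

namespace Program

variable {E : Env} {n k s nc : ℕ} {a : ℕ → ℕ → ℕ} {pos : ℕ → ℕ} {σ : St}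

theorem blocks_spec {off₀ T : ℕ} (h : InRound E n k s a nc σ) (hr : ∀ u, u < n → σ.a .r u ≤ 1)
    (hnc : nc ≤ E.lim) (hoff : off₀ + nc * E.str ≤ E.lim)
    (hC : Collected E n s a off₀ T 0 (σ.set .kc 0)) :
    wp E (.for .kc 0 Var.nc block) (fun τ => Collected E n s a off₀ (T + 1) nc τ) σ := by
  have hin : ∀ {τ}, InLoop .kc block σ τ → InRound E n k s a nc τ := fun hl => h.congr
    (fun x hx => hl.v x (by revert hx; cases x <;> decide) (by rintro rfl; revert hx; decide))
    (fun A hA => hl.a A (by revert hA; cases A <;> decide))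
  refine wp_for (fun c τ => Collected E n s a off₀ T c τ) 0 nc rfl (Nat.zero_le _) hnc (by decide)
    ?_ hC ?_ ?_
  · intro τ hτ
    exact (hin hτ).nc_eq
  · intro c τ _ hc hτ hl hCτ
    refine block_spec (hin hl) ?_ hc hτ (hoff.trans' ?_) hCτ
    · rw [hl.a .r (by decide)]
      exact hr
    · exact Nat.add_le_add_left (Nat.mul_le_mul_right _ hc) _
  · intro τ _ hl hCτ
    have ht := hCτ.time
    refine ⟨hCτ.entry, hCτ.base, hCτ.sum, hCτ.pc_lt, hCτ.g0_lt, hCτ.off_eq, hCτ.qm_zero, ?_⟩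
    simp only [St.tick_time, St.tick_a]
    omega

/-- Here `bad` is the event that the count on the chosen set is not divisible by 24. The program
never sees it; it sees the value of `F` at the statistics, which vanishes exactly if the event
fails. -/
theorem round_spec {eval : Cmd} {F : (Var → ZMod 24) → ZMod 24} {L i : ℕ}
    (hI : Input E n a pos) (hR : Ready E n k s a nc pos i σ) (hev : Evaluates E F L eval)
    (hnc : nc ≤ E.lim) (hoff : (i + 1) * (nc * E.str) ≤ E.lim) {bad : Prop} [Decidable bad]
    (hF : ∀ f : Var → ZMod 24, IsStats (fun x y : Fin n => (chosen a (coinFun E n i) x y : ZMod 24))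
      (fun x : Fin n => (coinFun E n i x : ZMod 24)) f → (F f = 0 ↔ ¬ bad)) :
    wp E (round eval) (fun τ => Ready E n k s a nc pos (i + 1) τ ∧
      τ.v .ans = (if bad then 1 else σ.v .ans) ∧ τ.a .cs = σ.a .cs ∧
      τ.time + 2 ≤ σ.time + roundTime E n s (σ.a .cs) nc pos L) σ := by
  have h := hR.inRound
  have hlim := h.n_le
  have hlim' := h.le_lim
  have hsn : s ≤ n := h.split.zero ▸ h.split.cs_le (Nat.zero_le nc)
  have hpos := hI.pos_mono (Nat.zero_le n) le_rfl
  unfold round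
  refine wp_then (sample_spec h.n_eq hlim) ?_
  rintro σ₁ ⟨a1, a2, a3, a4⟩ hl₁
  have h₁ : InRound E n k s a nc σ₁ := h.congr
    (fun x hx => hl₁.v x (by revert hx; cases x <;> decide))
    (fun A hA => hl₁.a A (by revert hA; cases A <;> decide))
  rw [hR.pos_eq] at a1 a2 a3
  have hr₁ : ∀ u, u < n → σ₁.a .r u = coinFun E n i u := a1
  have hr1 : ∀ u, coinFun E n i u ≤ 1 := fun u => Bool.toNat_le _
  rw [wp_then_iff, wp_asg_iff]
  refine ⟨Nat.zero_le _, ?_⟩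
  have hoff₁ : σ₁.v .off = i * (nc * E.str) := (hl₁.v .off (by decide)).trans hR.off_eq
  refine wp_then (blocks_spec (off₀ := i * (nc * E.str)) (T := σ₁.time + 2) (k := k) (nc := nc)
    (h₁.congr (fun x hx => ?_) fun A _ => rfl) ?_ hnc ?_ ?_) ?_
  · rw [St.set_v, if_neg]
    rintro rfl
    revert hx
    decide
  · intro u hu
    rw [St.set_a, hr₁ u hu]
    exact hr1 u
  · rw [Nat.succ_mul] at hoff
    exact hoff
  · refine ⟨fun c hc => absurd hc (Nat.not_lt_zero c), fun h => absurd h (by norm_num), ?_, ?_, ?_,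
      ?_, ?_, ?_⟩
    · simp [Expr.eval]
    · simp only [St.set_a, hl₁.a .pc (by decide)]
      exact hR.pc_lt
    · simp only [St.set_a, hl₁.a .g0 (by decide)]
      exact hR.g0_lt
    · simpa using hoff₁
    · simp only [St.set_a, hl₁.a .qm (by decide), St.set_v, reduceCtorEq, if_false, hoff₁,
        ← hR.off_eq]
      exact hR.qm_zero
    · simp
  rintro σ₂ hC hl₂
  have hv₂ : ∀ x ∈ [Var.n, .sg, .nc, .str, .nr, .ans], σ₂.v x = σ₁.v x := fun x hx => by
    rw [hl₂.v x (by revert hx; cases x <;> decide), St.set_v, if_neg]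
    rintro rfl
    revert hx
    decide
  have ha₂ : ∀ A ∈ [Arr.ord, .cs, .adj, .r, .st, .es, .hb], σ₂.a A = σ₁.a A := fun A hA => by
    rw [hl₂.a A (by revert hA; cases A <;> decide), St.set_a]
  have h₂ : InRound E n k s a nc σ₂ := h₁.congr
    (fun x hx => hv₂ x (by revert hx; cases x <;> decide))
    (fun A hA => ha₂ A (by revert hA; cases A <;> decide))
  have hr₂ : ∀ u, u < n → σ₂.a .r u = coinFun E n i u := by
    rw [ha₂ .r (by decide)]
    exact hr₁
  have hr₂' : ∀ u, u < n → σ₂.a .r u ≤ 1 := fun u hu => (hr₂ u hu).trans_le (hr1 u)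
  have hst₂ : ∀ u, u ≤ n → σ₂.a .st u = pos u := by
    rw [ha₂ .st (by decide), hl₁.a .st (by decide)]
    exact hR.st_eq
  have hes₂ : ∀ u, u < n → ∀ j, pos u ≤ j → j < pos (u + 1) → σ₂.a .es j = u := by
    rw [ha₂ .es (by decide), hl₁.a .es (by decide)]
    exact hR.es_eq
  have hhb₂ : ∀ j, j < 16 → σ₂.a .hb j = E.inp (j + 1) := by
    rw [ha₂ .hb (by decide), hl₁.a .hb (by decide)]
    exact hR.hb_eq
  have hcs₂ : σ₂.a .cs = σ.a .cs := by rw [ha₂ .cs (by decide), hl₁.a .cs (by decide)]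
  have hpos₂ : σ₂.pos = i * n + n := by rw [hl₂.pos (by decide)]; exact a3
  refine wp_then (crossing_spec h₂.n_eq h₂.sg_eq hsn h₂.ordered.lt hlim hlim' hC.pc_lt) ?_
  rintro σ₃ ⟨c1, c2⟩ hl₃
  have ha₃ : σ₃.a = σ₂.a := funext fun A => hl₃.a A (by cases A <;> decide)
  have hn₃ : σ₃.v .n = n := (hl₃.v .n (by decide)).trans h₂.n_eq
  refine wp_then (edgeSums_spec hI hn₃ (by rw [ha₃]; exact hst₂) (by rw [ha₃]; exact hes₂)
    (by rw [ha₃]; exact hr₂') (by rw [ha₃]; exact hC.pc_lt)) ?_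
  rintro σ₄ ⟨d1, d2⟩ hl₄
  have ha₄ : σ₄.a = σ₂.a := (funext fun A => hl₄.a A (by cases A <;> decide)).trans ha₃
  rw [ha₃] at d1
  have hchosen : ∀ u w, u < n → w < n → chosen a (σ₂.a .r) u w = chosen a (coinFun E n i) u w :=
    fun u w hu hw => by rw [chosen, chosen, hr₂ u hu, hr₂ w hw]
  have hstats := isStats_of_sums (pc := fun u w => σ₂.a .pc (u * n + w)) (τ := σ₄) h.a_le h.a_symm
    hr₂' (fun u w hu hw huw => h₂.codeg_eq hC hu hw huw) ?_ ?_ d1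
  rotate_left
  · rw [hl₄.v .nr (by decide), hl₃.v .nr (by decide), hv₂ .nr (by decide), a2]
    push_cast
    exact Finset.sum_congr rfl fun u hu => by rw [hr₂ u (Finset.mem_range.1 hu), coinFun]
  · rw [hl₄.v .q2 (by decide), c1, hC.sum]
    -- The sum over vertices is rewritten as a sum over positions, where the decomposition into
    -- chunks is available.
    have e1 : ∑ u ∈ Finset.range n, ∑ w ∈ Finset.range n,
        chosenCodeg n a (σ₂.a .r) u w ^ 2 = ∑ x ∈ Finset.range n, ∑ y ∈ Finset.range n,
        wit (posAdj a σ₂) (Finset.range n) x y ^ 2 := by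
      rw [← h₂.sum_range_ord]
      refine Finset.sum_congr rfl fun x hx => ?_
      rw [← h₂.sum_range_ord]
      refine Finset.sum_congr rfl fun y hy => ?_
      rw [h₂.wit_range, chosenCodeg]
    rw [e1, h₂.split.sum_sq, add_comm]
    congr 1
    refine Finset.sum_congr rfl fun x hx => Finset.sum_congr rfl fun y hy => ?_
    have hx := Finset.mem_range.1 hx
    have hy := Finset.mem_range.1 hy
    have h2 := h.ordered.two_le
    obtain ⟨b1, b2⟩ := hC.base (by omega) x y hx hy
    rw [b1, b2, h₂.split.last, h₂.wit_union, ← h₂.wit_union x y]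
    ring
  have hfun : (fun x y : Fin n => (chosen a (σ₂.a .r) x y : ZMod 24)) =
      fun x y : Fin n => (chosen a (coinFun E n i) x y : ZMod 24) :=
    funext fun x => funext fun y => by rw [hchosen x y x.2 y.2]
  have hfun' : (fun x : Fin n => (σ₂.a .r x : ZMod 24)) =
      fun x : Fin n => (coinFun E n i x : ZMod 24) := funext fun x => by rw [hr₂ x x.2]
  rw [hfun, hfun'] at hstats
  refine wp_then (hev.wp σ₄ (by rw [ha₄]; exact hhb₂)) ?_
  rintro σ₅ ⟨e1, e2, e3⟩ hl₅
  have hv₅ : ∀ x, x ≠ .res → σ₅.v x = σ₄.v x := fun x hx => hl₅.v x fun hx' => hx (hev.wv x hx')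
  have ha₅ : σ₅.a = σ₂.a := (funext fun A => hl₅.a A (by simp [hev.wa])).trans ha₄
  have hpos₅ : σ₅.pos = (i + 1) * n := by
    rw [hl₅.pos hev.tosses, hl₄.pos (by decide), hl₃.pos (by decide), hpos₂, Nat.succ_mul]
  have hv₅' : ∀ x ∈ [Var.n, .sg, .nc, .str, .ans, .off], σ₅.v x = σ₂.v x := fun x hx => by
    rw [hv₅ x (by rintro rfl; revert hx; decide), hl₄.v x (by revert hx; cases x <;> decide),
      hl₃.v x (by revert hx; cases x <;> decide)]
  have hans₅ : σ₅.v .ans = σ.v .ans := by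
    rw [hv₅' .ans (by decide), hv₂ .ans (by decide), hl₁.v .ans (by decide)]
  have hready : ∀ τ : St, (∀ x, x ≠ .ans → τ.v x = σ₅.v x) → τ.a = σ₅.a → τ.pos = σ₅.pos →
      Ready E n k s a nc pos (i + 1) τ := by
    intro τ hv ha hp
    have ha' := ha.trans ha₅
    have hoffτ : τ.v .off = σ₂.v .off := (hv .off (by decide)).trans (hv₅' .off (by decide))
    refine ⟨h₂.congr (fun x hx => ?_) (fun A _ => by rw [ha']), by rw [ha']; exact hst₂,
      by rw [ha']; exact hes₂, by rw [ha']; exact hhb₂, by rw [ha']; exact hC.pc_lt,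
      by rw [ha']; exact hC.g0_lt, ?_, ?_, hp.trans hpos₅⟩
    · rw [hv x (by rintro rfl; revert hx; decide), hv₅' x (by revert hx; cases x <;> decide)]
    · rw [hoffτ, hC.off_eq, Nat.succ_mul]
    · rw [hoffτ, ha']
      exact hC.qm_zero
  have htime : σ₅.time + 5 ≤ σ.time + roundTime E n s (σ.a .cs) nc pos L := by
    have := hC.time
    rw [hcs₂] at this
    unfold roundTime
    omega
  -- As `res` is less than 24, it is zero as soon as its residue is.
  have hres : σ₅.v .res = 0 ↔ ¬ bad := by
    rw [← hF _ hstats, ← e1]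
    constructor
    · intro h0
      rw [h0, Nat.cast_zero]
    · intro h0
      have := (ZMod.natCast_eq_zero_iff (σ₅.v .res) 24).1 h0
      exact Nat.eq_zero_of_dvd_of_lt this e2
  rw [wp_ite_iff, Expr.eval_var]
  by_cases hb : bad
  · rw [if_neg (fun h0 => hres.1 h0 hb), wp_asg_iff, if_pos hb]
    refine ⟨by simp; omega, hready _ (fun x hx => by simp [hx]) rfl rfl, by simp, ?_, ?_⟩
    · simp only [St.set_a, St.tick_a, ha₅, hcs₂]
    · simp only [St.set_time, St.tick_time]
      omega
  · rw [if_pos (hres.2 hb), wp_skip_iff, if_neg hb]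
    refine ⟨hready _ (fun x hx => rfl) rfl rfl, hans₅, ?_, ?_⟩
    · simp only [St.tick_a, ha₅, hcs₂]
    · simp only [St.tick_time]
      omega

end Program

end WordRAM

/-! ## The whole program -/

namespace WordRAM

open FourVertex

theorem Front.eq_card {n s : ℕ} {a : ℕ → ℕ → ℕ} {inS : ℕ → Prop} [DecidablePred inS]
    {ord mk : ℕ → ℕ} (h : Front n s a inS ord mk s s) :
    s = ((Finset.range n).filter inS).card := by
  have : (Finset.range n).filter inS = (Finset.range s).image ord := by
    ext v
    rw [Finset.mem_filter, Finset.mem_range, Finset.mem_image]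
    constructor
    · rintro ⟨hv, hS⟩
      obtain ⟨i, hi, hiv⟩ := (h.marked v hv).1 (h.mk_of_mem v hv hS)
      exact ⟨i, Finset.mem_range.2 hi, hiv⟩
    · rintro ⟨i, hi, rfl⟩
      have hi := Finset.mem_range.1 hi
      exact ⟨h.lt i hi, (h.mem_iff i hi).2 hi⟩
  rw [this, Finset.card_image_of_injOn, Finset.card_range]
  intro i hi j hj hij
  exact h.inj i j (Finset.mem_range.1 (Finset.mem_coe.1 hi))
    (Finset.mem_range.1 (Finset.mem_coe.1 hj)) hij

/-- All chunks but the empty first and the last one are nonempty. -/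
theorem Ordered.chunks_le {n k s nc : ℕ} {a : ℕ → ℕ → ℕ} {ord cs : ℕ → ℕ}
    (h : Ordered n k s a ord cs nc) : nc ≤ n + 2 := by
  have h1 := h.cuts.le_add (nc - 1) le_rfl (by omega)
  have h2 := h.cuts.mono' (i := nc - 1) (j := nc) (by omega) le_rfl
  have h3 := h.last
  omega

/-- The initial state. -/
def St.start : St := ⟨fun _ => 0, fun _ _ => 0, 0, 0⟩

namespace Program

variable {E : Env} {n k : ℕ} {a : ℕ → ℕ → ℕ} {pos lab : ℕ → ℕ} {σ : St}

theorem stride_eval (c d : ℕ) (σ : St) : (stride c d).eval σ = c * σ.v .n ^ d := by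
  induction d with
  | zero => simp [stride]
  | succ d ih => rw [stride, Expr.eval_mul, ih, Expr.eval_var, pow_succ, mul_assoc]

theorem setup_spec {c d : ℕ} (hI : Input E n a pos) (hstr : E.str = c * n ^ d + 3 * n ^ 2 + 1)
    (hlim : E.str ≤ E.lim) :
    wp E (setup c d) (fun τ => τ.v .n = n ∧ τ.v .str = E.str ∧ τ.time = σ.time + 2) σ := by
  unfold setup
  simp only [wp_then_iff, wp_inp_iff, wp_asg_iff, Expr.eval_zero, hI.inp_zero, Expr.eval_add,
    Expr.eval_mul, Expr.eval_ofNat, Expr.eval_one, Expr.eval_var, stride_eval, St.set_v, if_true,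
    reduceCtorEq, if_false, St.set_time, ← sq, ← hstr]
  exact ⟨hI.head_lt_base (by omega), hlim, trivial, trivial, trivial⟩

/-- A bound for the time of the whole program. -/
def mainTime (E : Env) (n s : ℕ) (cs : ℕ → ℕ) (nc : ℕ) (pos : ℕ → ℕ) (L : ℕ) : ℕ :=
  20 * roundTime E n s cs nc pos L + 32 * n + 12 * (pos n - pos 0) + 140

/-- The bound `hlim` provides windows for twenty rounds with at most `n + 2` blocks each. The order
and the cuts are exposed in the conclusion because the running time is expressed through the block
sizes. -/
theorem main_spec {eval : Cmd} {F : (Var → ZMod 24) → ZMod 24} {L c d : ℕ} (hI : Input E n a pos)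
    (hbit : ∀ i, i < 16 → E.inp (i + 1) ≤ 1)
    (hS : Separated E n k (((Finset.range n).filter fun v => E.inp (v + 17) ≠ 0).card) a lab)
    (ha : ∀ u w, a u w ≤ 1) (hs : ∀ u w, a u w = a w u)
    (hstr : E.str = c * n ^ d + 3 * n ^ 2 + 1) (hlim : 20 * ((n + 2) * E.str) ≤ E.lim)
    (hq : ∀ b, b ≤ n → E.qlim b < E.str) (hev : Evaluates E F L eval) (bad : ℕ → Prop)
    (hF : ∀ i, ∀ f : Var → ZMod 24,
      IsStats (fun x y : Fin n => (chosen a (coinFun E n i) x y : ZMod 24))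
      (fun x : Fin n => (coinFun E n i x : ZMod 24)) f → (F f = 0 ↔ ¬ bad i)) :
    wp E (main c d eval) (fun τ => τ.v .ans ≤ 1 ∧ (τ.v .ans = 1 ↔ ∃ i, i < 20 ∧ bad i) ∧
      ∃ s ord cs nc, s ≤ k ∧ Ordered n k s a ord cs nc ∧ τ.time ≤ mainTime E n s cs nc pos L)
      St.start := by
  classical
  have hstr1 : 1 ≤ E.str := by omega
  have hstrn : (n + 2) * 1 ≤ (n + 2) * E.str := Nat.mul_le_mul_left _ hstr1
  have hstrlim : 1 * E.str ≤ (n + 2) * E.str := Nat.mul_le_mul_right _ (by omega)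
  have h24 := hI.two_le
  have hpos := hI.pos_mono (Nat.zero_le n) le_rfl
  unfold main
  refine wp_then (setup_spec hI hstr (by omega)) ?_
  rintro σ₁ ⟨n₁, str₁, t₁⟩ l₁
  refine wp_then (readH_spec hI hbit) ?_
  rintro σ₂ ⟨hb₂, t₂⟩ l₂
  have n₂ : σ₂.v .n = n := (l₂.v .n (by decide)).trans n₁
  refine wp_then (starts_spec hI n₂) ?_
  rintro σ₃ ⟨st₃, t₃⟩ l₃
  have n₃ : σ₃.v .n = n := (l₃.v .n (by decide)).trans n₂
  have z₃ : ∀ A ∈ [Arr.adj, .mk, .qm, .pc, .g0], σ₃.a A = fun _ => 0 := fun A hA => by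
    rw [l₃.a A (by revert hA; cases A <;> decide), l₂.a A (by revert hA; cases A <;> decide),
      l₁.a A (fun h => List.not_mem_nil h)]
    rfl
  refine wp_then (edges_spec hI n₃ st₃ (by rw [z₃ .adj (by decide)]; exact fun _ => rfl)) ?_
  rintro σ₄ ⟨adj₄, es₄, t₄⟩ l₄
  have n₄ : σ₄.v .n = n := (l₄.v .n (by decide)).trans n₃
  refine wp_then (separator_spec hI n₄ (by
    rw [l₄.a .mk (by decide), z₃ .mk (by decide)]; exact fun _ => rfl)) ?_
  rintro σ₅ ⟨tl₅, fr₅, t₅⟩ l₅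
  obtain ⟨s, hs₅⟩ : ∃ s, σ₅.v .sg = s := ⟨_, rfl⟩
  rw [hs₅] at tl₅ fr₅
  have n₅ : σ₅.v .n = n := (l₅.v .n (by decide)).trans n₄
  have st₅ : ∀ u, u ≤ n → σ₅.a .st u = pos u := by
    rw [l₅.a .st (by decide), l₄.a .st (by decide)]
    exact st₃
  rw [← fr₅.eq_card] at hS
  refine wp_then (chunks_spec hI hS n₅ hs₅ tl₅ st₅ fr₅) ?_
  rintro σ₆ ⟨or₆, t₆⟩ l₆
  rw [wp_then_iff, wp_asg_iff]
  refine ⟨Nat.zero_le _, ?_⟩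
  rw [wp_then_iff, wp_asg_iff]
  refine ⟨Nat.zero_le _, ?_⟩
  obtain ⟨nc, hnc⟩ : ∃ nc, σ₆.v .nc = nc := ⟨_, rfl⟩
  obtain ⟨σ₇, hσ₇⟩ : ∃ σ₇, (σ₆.set .off (Expr.eval σ₆ 0)).set .ans
    (Expr.eval (σ₆.set .off (Expr.eval σ₆ 0)) 0) = σ₇ := ⟨_, rfl⟩
  rw [hσ₇]
  rw [hnc] at or₆
  have hncn := or₆.chunks_le
  have ha₇ : σ₇.a = σ₆.a := by rw [← hσ₇]; rfl
  have hv₇ : ∀ x, x ≠ .off → x ≠ .ans → σ₇.v x = σ₆.v x := fun x hx hx' => by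
    simp [← hσ₇, hx, hx']
  have hz : ∀ A ∈ [Arr.qm, .pc, .g0], σ₇.a A = fun _ => 0 := fun A hA => by
    rw [ha₇, l₆.a A (by revert hA; cases A <;> decide), l₅.a A (by revert hA; cases A <;> decide),
      l₄.a A (by revert hA; cases A <;> decide), z₃ A (by revert hA; cases A <;> decide)]
  have hround : InRound E n k s a nc σ₇ := by
    refine ⟨?_, ?_, ?_, ?_, by rw [ha₇]; exact or₆, ?_, ha, hs, hI.two_le, by omega, hq, ?_, ?_⟩
    · rw [hv₇ .n (by decide) (by decide), l₆.v .n (by decide), n₅]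
    · rw [hv₇ .sg (by decide) (by decide), l₆.v .sg (by decide), hs₅]
    · rw [hv₇ .nc (by decide) (by decide), hnc]
    · rw [hv₇ .str (by decide) (by decide), l₆.v .str (by decide), l₅.v .str (by decide),
        l₄.v .str (by decide), l₃.v .str (by decide), l₂.v .str (by decide), str₁]
    · rw [ha₇, l₆.a .adj (by decide), l₅.a .adj (by decide)]
      exact adj₄
    · intro b hb
      have := Nat.pow_le_pow_left hb 2
      omega
    · intro b hb
      have := hq b hb
      omega
  have hready : Ready E n k s a nc pos 0 σ₇ := by
    refine ⟨hround, ?_, ?_, ?_, ?_, ?_, ?_, ?_, ?_⟩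
    · rw [ha₇, l₆.a .st (by decide)]
      exact st₅
    · rw [ha₇, l₆.a .es (by decide), l₅.a .es (by decide)]
      exact es₄
    · rw [ha₇, l₆.a .hb (by decide), l₅.a .hb (by decide), l₄.a .hb (by decide),
        l₃.a .hb (by decide)]
      exact hb₂
    · rw [hz .pc (by decide)]
      exact fun _ => by norm_num
    · rw [hz .g0 (by decide)]
      exact fun _ => by norm_num
    · simp [← hσ₇]
    · rw [hz .qm (by decide)]
      exact fun _ _ => rfl
    · rw [← hσ₇, St.set_pos, St.set_pos, l₆.pos (by decide), l₅.pos (by decide),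
        l₄.pos (by decide), l₃.pos (by decide), l₂.pos (by decide), l₁.pos rfl]
      simp [St.start]
  obtain ⟨R, hR⟩ : ∃ R, roundTime E n s (σ₆.a .cs) nc pos L = R := ⟨_, rfl⟩
  have hrep : Var.rep ∉ (round eval).wv := by
    have h1 : Var.rep ∉ eval.wv := fun h => absurd (hev.wv _ h) (by decide)
    have h2 : (round eval).wv = sample.wv ++ ([Var.q2] ++ ((Cmd.for .kc 0 Var.nc block).wv ++
      (crossing.wv ++ (edgeSums.wv ++ (eval.wv ++ [Var.ans]))))) := rfl
    rw [h2]
    simp only [List.mem_append, not_or]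
    exact ⟨by decide, by decide, by decide, by decide, by decide, h1, by decide⟩
  refine wp_for (fun i τ => Ready E n k s a nc pos i τ ∧
    τ.v .ans = (if ∃ i', i' < i ∧ bad i' then 1 else 0) ∧ τ.a .cs = σ₆.a .cs ∧
    τ.time ≤ σ₇.time + 1 + i * R) 0 20 rfl (by omega) (by omega) hrep (fun _ _ => rfl) ?_ ?_ ?_
  · refine ⟨⟨hround.congr (fun x hx => ?_) fun _ _ => rfl, hready.st_eq, hready.es_eq,
      hready.hb_eq, hready.pc_lt, hready.g0_lt, ?_, ?_, hready.pos_eq⟩, ?_, ?_, ?_⟩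
    · rw [St.set_v, if_neg (by rintro rfl; revert hx; decide)]
    · simpa using hready.off_eq
    · simp only [St.set_v, St.set_a, reduceCtorEq, if_false]
      exact hready.qm_zero
    · simp [← hσ₇]
    · rw [St.set_a, ha₇]
    · simp
  · rintro i τ - hi hτi hl ⟨g1, g2, g3, g4⟩
    have hoff : (i + 1) * (nc * E.str) ≤ E.lim := by
      have h1 := Nat.mul_le_mul_right E.str hncn
      have h2 := Nat.mul_le_mul (show i + 1 ≤ 20 by omega) h1
      omega
    have g1' : Ready E n k s a nc pos i τ.tick :=
      ⟨g1.inRound.congr (fun _ _ => rfl) fun _ _ => rfl, g1.st_eq, g1.es_eq, g1.hb_eq, g1.pc_lt,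
        g1.g0_lt, g1.off_eq, g1.qm_zero, g1.pos_eq⟩
    refine wp_mono ?_ (round_spec hI g1' hev (by omega) hoff (hF i))
    rintro υ ⟨k1, k2, k3, k4⟩
    simp only [St.tick_a, St.tick_v, St.tick_time, g3, hR] at k2 k3 k4
    refine ⟨⟨k1.inRound.congr (fun x hx => ?_) fun _ _ => rfl, k1.st_eq, k1.es_eq,
      k1.hb_eq, k1.pc_lt, k1.g0_lt, ?_, ?_, k1.pos_eq⟩, ?_, ?_, ?_⟩
    · rw [St.set_v, if_neg (by rintro rfl; revert hx; decide)]
    · simpa using k1.off_eq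
    · simp only [St.set_v, St.set_a, reduceCtorEq, if_false]
      exact k1.qm_zero
    · simp only [St.set_v, reduceCtorEq, if_false]
      rw [k2, g2]
      by_cases hb : bad i
      · rw [if_pos hb, if_pos ⟨i, by omega, hb⟩]
      · rw [if_neg hb]
        have : (∃ i', i' < i ∧ bad i') ↔ ∃ i', i' < i + 1 ∧ bad i' := by
          constructor
          · rintro ⟨i', h, h'⟩
            exact ⟨i', by omega, h'⟩
          · rintro ⟨i', h, h'⟩
            refine ⟨i', ?_, h'⟩
            have : i' ≠ i := by rintro rfl; exact hb h'
            omega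
        simp only [this]
    · rw [St.set_a, k3]
    · rw [St.set_time, Nat.succ_mul]
      omega
  · rintro τ - - ⟨g1, g2, g3, g4⟩
    have g2' : τ.tick.v .ans = _ := g2
    refine ⟨by rw [g2']; split_ifs <;> omega, by rw [g2']; split_ifs with hex <;> simp [hex], s,
      σ₆.a .ord, σ₆.a .cs, nc, hS.le, or₆, ?_⟩
    have h7 : σ₇.time = σ₆.time + 2 := by rw [← hσ₇]; rfl
    have h0 : St.start.time = 0 := rfl
    unfold mainTime
    rw [hR]
    simp only [St.tick_time]
    omega

/-- Compare the first entries of the array `hb` with the values of a function. -/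
def testExpr (f : ℕ → ℕ) : ℕ → Expr
  | 0 => 1
  | m + 1 => testExpr f m * Expr.eq (Arr.hb (.num m)) (.num (f m))

theorem testExpr_eval (f : ℕ → ℕ) (m : ℕ) (σ : St) :
    (testExpr f m).eval σ ≠ 0 ↔ ∀ j, j < m → σ.a .hb j = f j := by
  induction m with
  | zero => simp [testExpr]
  | succ m ih =>
    rw [testExpr, Expr.eval_mul, mul_ne_zero_iff, ih, Expr.eval_eq, Expr.eval_get, Expr.eval_num,
      Expr.eval_num]
    constructor
    · rintro ⟨h1, h2⟩ j hj
      by_cases hjm : j = m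
      · subst hjm
        by_contra hne
        simp [hne] at h2
      · exact h1 j (by omega)
    · intro h
      refine ⟨fun j hj => h j (by omega), ?_⟩
      simp [h m (by omega)]

open Classical in
/-- The adjacency matrix of a graph on four vertices, row by row. -/
noncomputable def bits (H : SimpleGraph (Fin 4)) (m : ℕ) : ℕ :=
  if h : m < 4 * 4 then
    if H.Adj (Fin.divNat (⟨m, h⟩ : Fin (4 * 4))) (Fin.modNat (⟨m, h⟩ : Fin (4 * 4))) then 1 else 0
  else 0

theorem bits_injective {H H' : SimpleGraph (Fin 4)} (h : ∀ m, m < 16 → bits H m = bits H' m) :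
    H = H' := by
  ext i j
  have h1 := h (finProdFinEquiv (i, j)) (finProdFinEquiv (i, j)).2
  have h2 : finProdFinEquiv.symm (finProdFinEquiv (i, j)) = (i, j) := Equiv.symm_apply_apply _ _
  have h3 : Fin.divNat (finProdFinEquiv (i, j)) = i := congrArg Prod.fst h2
  have h4 : Fin.modNat (finProdFinEquiv (i, j)) = j := congrArg Prod.snd h2
  rw [bits, bits, dif_pos (finProdFinEquiv (i, j)).2, dif_pos (finProdFinEquiv (i, j)).2, Fin.eta,
    h3, h4] at h1
  by_cases hH : H.Adj i j <;> by_cases hH' : H'.Adj i j <;> simp_all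

theorem dispatch_wv {α : Type*} (test val : α → Expr) :
    ∀ l : List α, ∀ x ∈ (dispatch test val l).wv, x = .res
  | [] => by simp [dispatch, Cmd.wv]
  | _ :: l => by
    have := dispatch_wv test val l
    simp only [dispatch, Cmd.wv, List.mem_append, List.mem_singleton]
    rintro x (h | h)
    · exact h
    · exact this x h

theorem dispatch_wa {α : Type*} (test val : α → Expr) :
    ∀ l : List α, (dispatch test val l).wa = []
  | [] => rfl
  | _ :: l => dispatch_wa test val l

theorem dispatch_tosses {α : Type*} (test val : α → Expr) :
    ∀ l : List α, (dispatch test val l).tosses = false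
  | [] => rfl
  | _ :: l => dispatch_tosses test val l

/-- A program that evaluates, for the graph `H` of the input, the given expression. -/
noncomputable def evalFor (val : SimpleGraph (Fin 4) → Expr) (l : List (SimpleGraph (Fin 4))) :
    Cmd :=
  dispatch (fun H => testExpr (bits H) 16) val l

/-- The graph `H` is part of the input, while an expression is part of the program; as there are
only finitely many graphs on four vertices, the program contains an expression for each and compares
the input with all of them. -/
theorem evaluates_evalFor {val : SimpleGraph (Fin 4) → Expr}
    {F : SimpleGraph (Fin 4) → (Var → ZMod 24) → ZMod 24}
    (hval : ∀ H, ∀ σ : St, ((val H).eval σ : ZMod 24) = F H fun x => (σ.v x : ZMod 24))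
    {H : SimpleGraph (Fin 4)} (hH : ∀ m, m < 16 → E.inp (m + 1) = bits H m) (hlim : 24 ≤ E.lim)
    {l : List (SimpleGraph (Fin 4))} (hl : H ∈ l) :
    Evaluates E (F H) (l.length + 1) (evalFor val l) where
  wv := dispatch_wv _ _ l
  wa := dispatch_wa _ _ l
  tosses := dispatch_tosses _ _ l
  wp τ hτ := by
    refine wp_mono ?_ (dispatch_spec (σ := τ) (x₀ := H) (fun H' => ?_) hlim l hl τ rfl rfl)
    · rintro υ ⟨h1, h2⟩
      rw [h1]
      refine ⟨?_, Nat.mod_lt _ (by norm_num), by omega⟩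
      rw [← hval H τ]
      exact ZMod.natCast_mod _ 24
    · rw [testExpr_eval]
      constructor
      · intro h
        refine bits_injective fun m hm => ?_
        rw [← h m hm, hτ m hm, hH m hm]
      · rintro rfl j hj
        rw [hτ j hj, hH j hj]

end Program

end WordRAM

/-! ## The encoding of the input -/

namespace WordRAM

open FourVertex

theorem ofFn_eq_map_range {α : Type*} (f : ℕ → α) (n : ℕ) :
    (List.ofFn fun v : Fin n => f v) = (List.range n).map f :=
  List.ext_getElem (by simp) (by simp)

theorem length_flatten_map_range {α : Type*} (f : ℕ → List α) (n : ℕ) :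
    ((List.range n).map f).flatten.length = ∑ v ∈ Finset.range n, (f v).length := by
  induction n with
  | zero => simp
  | succ n ih =>
    rw [List.range_succ, List.map_append, List.flatten_append, List.length_append, ih,
      Finset.sum_range_succ]
    simp

theorem flatten_map_range_getD {f : ℕ → List ℕ} {n u t : ℕ} (hu : u < n) (ht : t < (f u).length) :
    ((List.range n).map f).flatten.getD (∑ v ∈ Finset.range u, (f v).length + t) 0 =
      (f u).getD t 0 := by
  induction n with
  | zero => omega
  | succ n ih =>
    have hl := length_flatten_map_range f n
    rw [List.range_succ, List.map_append, List.flatten_append]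
    by_cases hun : u < n
    · rw [List.getD_append _ _ _ _ ?_, ih hun]
      rw [hl]
      have : ∑ v ∈ Finset.range (u + 1), (f v).length ≤ ∑ v ∈ Finset.range n, (f v).length :=
        Finset.sum_le_sum_of_subset (Finset.range_mono hun)
      rw [Finset.sum_range_succ] at this
      omega
    · have : u = n := by omega
      subst this
      rw [List.getD_append_right _ _ _ _ (by omega), hl, Nat.add_sub_cancel_left]
      simp

variable {n : ℕ}

/-- The degree of the vertex `u`. -/
def natDeg (adj : Fin n → List (Fin n)) (u : ℕ) : ℕ := if h : u < n then (adj ⟨u, h⟩).length else 0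

/-- The start of the adjacency list of `u` in the input. -/
def listStart (adj : Fin n → List (Fin n)) (u : ℕ) : ℕ :=
  2 * n + 17 + ∑ v ∈ Finset.range u, natDeg adj v

open Classical in
/-- The adjacency function of a graph, for vertices given as natural numbers. -/
noncomputable def natAdj (G : SimpleGraph (Fin n)) (u w : ℕ) : ℕ :=
  if ∃ (hu : u < n) (hw : w < n), G.Adj ⟨u, hu⟩ ⟨w, hw⟩ then 1 else 0

theorem natAdj_le (G : SimpleGraph (Fin n)) (u w : ℕ) : natAdj G u w ≤ 1 := by
  unfold natAdj
  split_ifs <;> omega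

theorem natAdj_symm (G : SimpleGraph (Fin n)) (u w : ℕ) : natAdj G u w = natAdj G w u := by
  unfold natAdj
  congr 1
  exact propext ⟨fun ⟨h, h', h''⟩ => ⟨h', h, h''.symm⟩, fun ⟨h, h', h''⟩ => ⟨h', h, h''.symm⟩⟩

theorem natAdj_ne_zero {G : SimpleGraph (Fin n)} {u w : ℕ} (hu : u < n) (hw : w < n) :
    natAdj G u w ≠ 0 ↔ G.Adj ⟨u, hu⟩ ⟨w, hw⟩ := by
  unfold natAdj
  split_ifs with h
  · obtain ⟨_, _, h⟩ := h
    exact ⟨fun _ => h, fun _ => one_ne_zero⟩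
  · simp only [ne_eq, not_true_eq_false, false_iff]
    exact fun h' => h ⟨hu, hw, h'⟩

variable {G : SimpleGraph (Fin n)} {adj : Fin n → List (Fin n)} {S : Finset (Fin n)}
  {H : SimpleGraph (Fin 4)}

/-- The input as a function. -/
noncomputable def inputFun (H : SimpleGraph (Fin 4)) (adj : Fin n → List (Fin n))
    (S : Finset (Fin n)) (i : ℕ) : ℕ :=
  (encodeInput H adj S).getD i 0

theorem inputFun_bits {m : ℕ} (hm : m < 16) : inputFun H adj S (m + 1) = Program.bits H m := by
  classical
  rw [inputFun, encodeInput, List.getD_cons_succ]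
  have hf : (List.ofFn fun i : Fin 4 => List.ofFn fun j : Fin 4 =>
      if H.Adj i j then 1 else 0).flatten =
      encodeMatrix (Matrix.of fun i j : Fin 4 => if H.Adj i j then 1 else 0) := rfl
  have hl := length_encodeMatrix (Matrix.of fun i j : Fin 4 => if H.Adj i j then 1 else 0)
  rw [hf, List.getD_append _ _ _ _ (by simp; omega), List.getD_append _ _ _ _ (by simp; omega),
    List.getD_append _ _ _ _ (by omega), encodeMatrix_eq, List.getD_eq_getElem?_getD,
    List.getElem?_eq_getElem (by simpa using hm), Program.bits, dif_pos hm]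
  simp only [List.getElem_ofFn, Matrix.of_apply, Option.getD_some]

theorem inputFun_separator (v : Fin n) :
    inputFun H adj S (v + 17) = open Classical in if v ∈ S then 1 else 0 := by
  classical
  rw [inputFun, encodeInput, show (v : ℕ) + 17 = v + 16 + 1 from rfl, List.getD_cons_succ]
  have hl := length_encodeMatrix (Matrix.of fun i j : Fin 4 => if H.Adj i j then 1 else 0)
  have hl' : (List.ofFn fun i : Fin 4 => List.ofFn fun j : Fin 4 =>
      if H.Adj i j then 1 else 0).flatten.length = 16 := hl
  have hv := v.2
  rw [List.getD_append _ _ _ _ (by simp; omega), List.getD_append _ _ _ _ (by simp),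
    List.getD_append_right _ _ _ _ (by omega), hl', Nat.add_sub_cancel,
    List.getD_eq_getElem?_getD, List.getElem?_eq_getElem (by simp)]
  simp

theorem inputFun_deg {u : ℕ} (hu : u < n) : inputFun H adj S (u + n + 17) = natDeg adj u := by
  classical
  rw [inputFun, encodeInput, show u + n + 17 = u + n + 16 + 1 from rfl, List.getD_cons_succ]
  have hl := length_encodeMatrix (Matrix.of fun i j : Fin 4 => if H.Adj i j then 1 else 0)
  have hl' : (List.ofFn fun i : Fin 4 => List.ofFn fun j : Fin 4 =>
      if H.Adj i j then 1 else 0).flatten.length = 16 := hl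
  rw [List.getD_append _ _ _ _ (by simp; omega), List.getD_append_right _ _ _ _ (by simp),
    List.length_append, hl', List.length_ofFn, show u + n + 16 - (16 + n) = u by omega,
    List.getD_eq_getElem?_getD, List.getElem?_eq_getElem (by simpa using hu), natDeg, dif_pos hu]
  simp

theorem inputFun_list {u : ℕ} (hu : u < n) {t : ℕ} (ht : t < (adj ⟨u, hu⟩).length) :
    inputFun H adj S (listStart adj u + t) = (adj ⟨u, hu⟩)[t] := by
  classical
  obtain ⟨f, hf⟩ : ∃ f : ℕ → List ℕ, f = fun v => if h : v < n then
    (adj ⟨v, h⟩).map fun u : Fin n => (u : ℕ) else [] := ⟨_, rfl⟩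
  have hfl : ∀ v, (f v).length = natDeg adj v := by
    intro v
    rw [hf, natDeg]
    dsimp only
    split_ifs <;> simp
  have hf' : (List.ofFn fun v => (adj v).map fun u => (u : ℕ)) = (List.range n).map f := by
    rw [← ofFn_eq_map_range]
    congr 1
    funext v
    rw [hf]
    simp [List.map_eq_flatMap]
  have hfu : f u = (adj ⟨u, hu⟩).map fun u : Fin n => (u : ℕ) := by rw [hf]; simp [hu]
  rw [inputFun, encodeInput, listStart, show 2 * n + 17 + ∑ v ∈ Finset.range u, natDeg adj v + t =
    2 * n + 16 + (∑ v ∈ Finset.range u, natDeg adj v + t) + 1 by omega, List.getD_cons_succ]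
  have hl := length_encodeMatrix (Matrix.of fun i j : Fin 4 => if H.Adj i j then 1 else 0)
  have hl' : (List.ofFn fun i : Fin 4 => List.ofFn fun j : Fin 4 =>
      if H.Adj i j then 1 else 0).flatten.length = 16 := hl
  rw [List.getD_append_right _ _ _ _ (by simp; omega), List.length_append, List.length_append, hl',
    List.length_ofFn, List.length_ofFn, hf',
    show 2 * n + 16 + (∑ v ∈ Finset.range u, natDeg adj v + t) - (16 + n + n) =
      ∑ v ∈ Finset.range u, natDeg adj v + t by omega]
  simp only [← hfl]
  rw [flatten_map_range_getD hu (by rw [hfu]; simpa using ht), hfu, List.getD_eq_getElem?_getD,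
    List.getElem?_eq_getElem (by simpa using ht)]
  simp

theorem natDeg_le (hadj : IsAdjacencyList G adj) (u : ℕ) : natDeg adj u ≤ n := by
  unfold natDeg
  split_ifs with h
  · simpa using (hadj ⟨u, h⟩).1.length_le_card
  · omega

theorem listStart_le (hadj : IsAdjacencyList G adj) : listStart adj n ≤ n * n + 2 * n + 17 := by
  have : ∑ v ∈ Finset.range n, natDeg adj v ≤ _ :=
    Finset.sum_le_card_nsmul (Finset.range n) (natDeg adj) n fun v _ => natDeg_le hadj v
  rw [Finset.card_range, smul_eq_mul] at this
  unfold listStart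
  omega

theorem inputFun_le (hadj : IsAdjacencyList G adj) (i : ℕ) : inputFun H adj S i ≤ n + 1 := by
  classical
  have key : ∀ x ∈ encodeInput H adj S, x ≤ n + 1 := by
    intro x hx
    simp only [encodeInput, List.mem_cons, List.mem_append, List.mem_flatten, List.mem_ofFn] at hx
    rcases hx with rfl | ((⟨l, ⟨i, rfl⟩, hx⟩ | ⟨v, rfl⟩) | ⟨v, rfl⟩) | ⟨l, ⟨v, rfl⟩, hx⟩
    · omega
    · obtain ⟨j, rfl⟩ := (List.mem_ofFn' _ _).1 hx
      dsimp only
      split_ifs <;> omega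
    · split_ifs <;> omega
    · have := (hadj v).1.length_le_card
      rw [Fintype.card_fin] at this
      omega
    · obtain ⟨w, -, rfl⟩ : ∃ w ∈ adj v, x = (w : ℕ) := by simpa using hx
      have := w.2
      omega
  rw [inputFun, List.getD_eq_getElem?_getD]
  rcases lt_or_ge i (encodeInput H adj S).length with h | h
  · rw [List.getElem?_eq_getElem h]
    exact key _ (List.getElem_mem h)
  · rw [List.getElem?_eq_none h]
    simp

/-- Positions inside a list correspond to its entries; absence of repetitions gives the injectivity,
and the membership criterion gives both directions of adjacency. -/
theorem input_of_encodeInput (hadj : IsAdjacencyList G adj) {E : Env}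
    (hinp : E.inp = inputFun H adj S) (hbase : listStart adj n ≤ E.base) (hle : E.base ≤ E.lim)
    (h24 : 24 ≤ E.lim) : Input E n (natAdj G) (listStart adj) := by
  have hsucc : ∀ u, listStart adj (u + 1) = listStart adj u + natDeg adj u := fun u => by
    rw [listStart, listStart, Finset.sum_range_succ, ← add_assoc]
  have key : ∀ u (hu : u < n) j, listStart adj u ≤ j → j < listStart adj (u + 1) →
      ∃ h : j - listStart adj u < (adj ⟨u, hu⟩).length,
        E.inp j = (adj ⟨u, hu⟩)[j - listStart adj u] := by
    intro u hu j hj hj'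
    rw [hsucc, natDeg, dif_pos hu] at hj'
    have h : j - listStart adj u < (adj ⟨u, hu⟩).length := by omega
    refine ⟨h, ?_⟩
    rw [← inputFun_list (H := H) (S := S) hu h, hinp]
    congr 1
    omega
  refine ⟨by rw [hinp]; rfl, ?_, fun u hu => ?_, ?_, ?_, ?_, ?_, hbase, hle, h24⟩
  · simp [listStart]
  · rw [hsucc, hinp, inputFun_deg hu]
  · intro u hu j hj hj'
    obtain ⟨h, he⟩ := key u hu j hj hj'
    rw [he]
    exact Fin.is_lt _
  · intro u hu j hj hj'
    obtain ⟨h, he⟩ := key u hu j hj hj'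
    have h1 := ((hadj ⟨u, hu⟩).2 _).1 (List.getElem_mem h)
    have h2 := (natAdj_ne_zero hu (Fin.is_lt _)).2 h1
    have h3 := natAdj_le G u ((adj ⟨u, hu⟩)[j - listStart adj u])
    rw [he]
    exact le_antisymm h3 (Nat.one_le_iff_ne_zero.2 h2)
  · intro u hu w hw
    by_contra hne
    have hwn : w < n := by
      by_contra h
      refine hne (if_neg ?_)
      rintro ⟨-, h', -⟩
      exact h h'
    have h1 := ((hadj ⟨u, hu⟩).2 _).2 ((natAdj_ne_zero hu hwn).1 hne)
    obtain ⟨t, ht, hte⟩ := List.getElem_of_mem h1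
    refine hw (listStart adj u + t) (by omega) ?_ ?_
    · rw [hsucc, natDeg, dif_pos hu]
      omega
    · rw [hinp, inputFun_list hu ht, hte]
  · intro u hu j j' hj hj1 hj' hj1' he
    obtain ⟨h, he1⟩ := key u hu j hj hj1
    obtain ⟨h', he2⟩ := key u hu j' hj' hj1'
    rw [he1, he2] at he
    have := (List.Nodup.getElem_inj_iff (hadj ⟨u, hu⟩).1).1 (Fin.ext he)
    omega

/-- The label of a vertex is the number of its component under an injective numbering. Labels inside
the separator are irrelevant and set to 0. -/
theorem separated_of_isKSeparator {k : ℕ} (hS : IsKSeparator G k S) {E : Env}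
    (hinp : E.inp = inputFun H adj S) : ∃ lab, Separated E n k
      (((Finset.range n).filter fun v => E.inp (v + 17) ≠ 0).card) (natAdj G) lab := by
  classical
  have hmem : ∀ v (hv : v < n), E.inp (v + 17) = 0 ↔ (⟨v, hv⟩ : Fin n) ∉ S := by
    intro v hv
    rw [hinp, show v + 17 = ((⟨v, hv⟩ : Fin n) : ℕ) + 17 from rfl, inputFun_separator]
    split_ifs with h <;> simp [h]
  have hcard : ((Finset.range n).filter fun v => E.inp (v + 17) ≠ 0).card = S.card := by
    have : (Finset.range n).filter (fun v => E.inp (v + 17) ≠ 0) =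
        S.image fun v : Fin n => (v : ℕ) := by
      ext v
      simp only [Finset.mem_filter, Finset.mem_range, Finset.mem_image]
      constructor
      · rintro ⟨hv, h⟩
        exact ⟨⟨v, hv⟩, not_not.1 fun h' => h ((hmem v hv).2 h'), rfl⟩
      · rintro ⟨v, hv, rfl⟩
        exact ⟨v.2, fun h => (hmem v v.2).1 h hv⟩
    rw [this, Finset.card_image_of_injective _ Fin.val_injective]
  rw [hcard]
  obtain ⟨e, he⟩ := Countable.exists_injective_nat
    (G.induce {v : Fin n | v ∉ S}).ConnectedComponent
  obtain ⟨lab, hlab⟩ : ∃ lab : ℕ → ℕ, ∀ v (hv : v < n) (hvS : (⟨v, hv⟩ : Fin n) ∉ S),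
      lab v = e ((G.induce {v : Fin n | v ∉ S}).connectedComponentMk ⟨⟨v, hv⟩, hvS⟩) := by
    refine ⟨fun v => if h : ∃ hv : v < n, (⟨v, hv⟩ : Fin n) ∉ S then
      e ((G.induce {v : Fin n | v ∉ S}).connectedComponentMk ⟨⟨v, h.1⟩, h.2⟩) else 0, ?_⟩
    intro v hv hvS
    exact dif_pos ⟨hv, hvS⟩
  refine ⟨lab, hS.1, ?_, ?_⟩
  · intro u v hu hv hu' hv' ha
    have huS := (hmem u hu).1 hu'
    have hvS := (hmem v hv).1 hv'
    rw [hlab u hu huS, hlab v hv hvS]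
    congr 1
    refine SimpleGraph.ConnectedComponent.eq.2 (SimpleGraph.Adj.reachable ?_)
    exact (natAdj_ne_zero hu hv).1 ha
  · intro u hu hu'
    have huS := (hmem u hu).1 hu'
    have h1 := hS.2 ((G.induce {v : Fin n | v ∉ S}).connectedComponentMk ⟨⟨u, hu⟩, huS⟩)
    have h2 := hS.1
    refine (Nat.add_le_add_left (le_trans ?_ h1) _).trans_eq (by omega)
    rw [← Set.ncard_coe_finset]
    -- The second branch is a default that is never taken on the vertices with the label of `u`, all
    -- of which lie outside the separator.
    refine Set.ncard_le_ncard_of_injOn (fun v => if h : ∃ hv : v < n, (⟨v, hv⟩ : Fin n) ∉ S then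
      (⟨⟨v, h.1⟩, h.2⟩ : {v : Fin n | v ∉ S}) else ⟨⟨u, hu⟩, huS⟩) ?_ ?_ (Set.toFinite _)
    · intro v hv
      obtain ⟨hv1, hv2, hv3⟩ := Finset.mem_filter.1 (Finset.mem_coe.1 hv)
      have hv1 := Finset.mem_range.1 hv1
      have hvS := (hmem v hv1).1 hv2
      rw [hlab v hv1 hvS, hlab u hu huS] at hv3
      rw [dif_pos ⟨hv1, hvS⟩]
      exact he hv3
    · intro v hv w hw hvw
      obtain ⟨hv1, hv2, -⟩ := Finset.mem_filter.1 (Finset.mem_coe.1 hv)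
      obtain ⟨hw1, hw2, -⟩ := Finset.mem_filter.1 (Finset.mem_coe.1 hw)
      have hv1 := Finset.mem_range.1 hv1
      have hw1 := Finset.mem_range.1 hw1
      simp only [dif_pos (show ∃ hv : v < n, (⟨v, hv⟩ : Fin n) ∉ S from ⟨hv1, (hmem v hv1).1 hv2⟩),
        dif_pos (show ∃ hv : w < n, (⟨w, hv⟩ : Fin n) ∉ S from ⟨hw1, (hmem w hw1).1 hw2⟩),
        Subtype.mk.injEq, Fin.mk.injEq] at hvw
      exact hvw

theorem chosen_natAdj (E : Env) (i : ℕ) (x y : Fin n) :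
    (chosen (natAdj G) (coinFun E n i) x y : ZMod 24) = adjFun G (coinSet E.coins n i) x y := by
  have h := natAdj_ne_zero (G := G) x.2 y.2
  have h' := natAdj_le G x y
  rw [chosen, adjFun, coinFun, coinFun]
  simp only [coinSet, Finset.mem_filter, Finset.mem_univ, true_and]
  by_cases ha : G.Adj x y
  · have : natAdj G x y = 1 := by
      have := h.2 ha
      omega
    rw [this]
    cases hx : E.coins (i * n + x) <;> cases hy : E.coins (i * n + y) <;> simp [ha, hx, hy]
  · have : natAdj G x y = 0 := by
      by_contra hne
      exact ha (h.1 hne)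
    rw [this]
    simp [ha]

theorem coinFun_eq (E : Env) (i : ℕ) (x : Fin n) :
    (coinFun E n i x : ZMod 24) = memFun (coinSet E.coins n i) x := by
  rw [memFun, coinFun]
  simp only [coinSet, Finset.mem_filter, Finset.mem_univ, true_and]
  cases hx : E.coins (i * n + x) <;> simp [hx]

end WordRAM

/-! ## Running times -/

namespace WordRAM

/-- One step changes at most one cell. -/
theorem Exec.exists_finset {coins : ℕ → Bool} {B : ℕ} {p : Prog} {s s' : State} {t : ℕ}
    (h : Exec coins B p s t s') : ∃ F : Finset ℕ, F.card ≤ t ∧ ∀ i, i ∉ F → s'.mem i = s.mem i := by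
  classical
  induction h with
  | skip s => exact ⟨∅, by simp, fun _ _ => rfl⟩
  | const s r v h => exact ⟨∅, by simp, fun _ _ => rfl⟩
  | op s o r a b h => exact ⟨∅, by simp, fun _ _ => rfl⟩
  | load s r a h => exact ⟨∅, by simp, fun _ _ => rfl⟩
  | store s a r =>
    refine ⟨{s.reg a}, by simp, fun i hi => ?_⟩
    exact Function.update_of_ne (by simpa using hi) _ _
  | flip s r h => exact ⟨∅, by simp, fun _ _ => rfl⟩
  | seq _ _ ih ih' =>
    obtain ⟨F, hF, h⟩ := ih
    obtain ⟨F', hF', h'⟩ := ih'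
    refine ⟨F ∪ F', (Finset.card_union_le _ _).trans (by omega), fun i hi => ?_⟩
    rw [Finset.mem_union, not_or] at hi
    rw [h' i hi.2, h i hi.1]
  | cond_true _ _ ih =>
    obtain ⟨F, hF, h⟩ := ih
    exact ⟨F, by omega, h⟩
  | cond_false _ _ ih =>
    obtain ⟨F, hF, h⟩ := ih
    exact ⟨F, by omega, h⟩
  | loop_exit _ => exact ⟨∅, by simp, fun _ _ => rfl⟩
  | loop_step _ _ _ ih ih' =>
    obtain ⟨F, hF, h⟩ := ih
    obtain ⟨F', hF', h'⟩ := ih'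
    refine ⟨F ∪ F', (Finset.card_union_le _ _).trans (by omega), fun i hi => ?_⟩
    rw [Finset.mem_union, not_or] at hi
    rw [h' i hi.2, h i hi.1]

/-- Every cell of the product has to be written. -/
theorem two_le_of_isMatMulExponent {ω : ℝ} (hω : IsMatMulExponent ω) : 2 ≤ ω := by
  obtain ⟨P, c, C, h⟩ := hω
  have key : ∀ n : ℕ, 1 ≤ n → (n : ℝ) ^ (2 - ω) ≤ |C| := by
    intro n hn
    have hn' : (0 : ℝ) < n := by exact_mod_cast hn
    -- For the all-ones matrices every entry of the product is `n`, hence nonzero, whereas the cells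
    -- for the product are initially zero; so `n * n` cells must change.
    obtain ⟨s, ⟨t, ht, he⟩, hs⟩ := h n hn (Matrix.of fun _ _ => 1) (Matrix.of fun _ _ => 1)
      (fun _ _ => le_rfl) (fun _ _ => le_rfl) fun _ => false
    obtain ⟨F, hF, hmem⟩ := he.exists_finset
    have hsub : (Finset.range (n * n)).image (fun m => 1 + 2 * n ^ 2 + m) ⊆ F := by
      intro x hx
      obtain ⟨m, hm, rfl⟩ := Finset.mem_image.1 hx
      by_contra hxF
      have h1 := hmem _ hxF
      have hm := Finset.mem_range.1 hm
      have h2 := hs ⟨m / n, Nat.div_lt_of_lt_mul hm⟩ ⟨m % n, Nat.mod_lt _ hn⟩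
      simp only [Nat.div_add_mod'] at h2
      rw [h2] at h1
      change _ = List.getD _ _ _ at h1
      rw [List.getD_eq_default] at h1
      · simp [Matrix.mul_apply] at h1
        omega
      · simp only [List.length_cons, List.length_append, length_encodeMatrix]
        nlinarith
    have hcard := Finset.card_le_card hsub
    rw [Finset.card_image_of_injective _ (add_right_injective _), Finset.card_range] at hcard
    have h3 : ((n * n : ℕ) : ℝ) ≤ |C| * (n : ℝ) ^ ω := by
      have : n * n ≤ ⌊|C| * (n : ℝ) ^ ω⌋₊ := (hcard.trans (hF.trans ht)).trans
        (Nat.floor_le_floor (mul_le_mul_of_nonneg_right (le_abs_self C) (by positivity)))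
      exact (Nat.cast_le.2 this).trans (Nat.floor_le (by positivity))
    rw [Real.rpow_sub hn', div_le_iff₀ (by positivity), Real.rpow_two]
    push_cast at h3
    rwa [pow_two]
  by_contra hlt
  have hlim := ((tendsto_rpow_atTop (show 0 < 2 - ω by linarith)).comp
    tendsto_natCast_atTop_atTop).eventually_gt_atTop |C|
  obtain ⟨n, hn, hn'⟩ := (hlim.and (Filter.eventually_ge_atTop 1)).exists
  exact absurd (key n hn') (not_le.2 hn)

variable {n k s nc L : ℕ} {E : Env} {a : ℕ → ℕ → ℕ} {pos lab ord cs : ℕ → ℕ}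

theorem Input.deg_le (hI : Input E n a pos) {u : ℕ} (hu : u < n) :
    E.inp (u + n + 17) ≤ ((Finset.range n).filter fun w => a u w ≠ 0).card := by
  have h := hI.pos_succ u hu
  rw [show E.inp (u + n + 17) = (Finset.Ico (pos u) (pos (u + 1))).card by
    rw [Nat.card_Ico]; omega]
  refine Finset.card_le_card_of_injOn E.inp ?_ ?_
  · intro j hj
    obtain ⟨h1, h2⟩ := Finset.mem_Ico.1 (Finset.mem_coe.1 hj)
    have h3 := hI.adj_one u hu j h1 h2
    exact Finset.mem_coe.2 (Finset.mem_filter.2 ⟨Finset.mem_range.2 (hI.inp_lt u hu j h1 h2),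
      by omega⟩)
  · intro j hj j' hj' he
    obtain ⟨h1, h2⟩ := Finset.mem_Ico.1 (Finset.mem_coe.1 hj)
    obtain ⟨h3, h4⟩ := Finset.mem_Ico.1 (Finset.mem_coe.1 hj')
    exact hI.inj u hu j j' h1 h2 h3 h4 he

/-- A neighbour of a vertex outside the separator is in the separator or has the same label, and
these two sets together have at most `k` elements. -/
theorem Separated.deg_le
    (hS : Separated E n k (((Finset.range n).filter fun v => E.inp (v + 17) ≠ 0).card) a lab)
    {u : ℕ} (hu : u < n) (hu' : E.inp (u + 17) = 0) :
    ((Finset.range n).filter fun w => a u w ≠ 0).card ≤ k := by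
  classical
  refine le_trans ?_ (hS.card u hu hu')
  refine (Finset.card_le_card ?_).trans (Finset.card_union_le _ _)
  intro w hw
  obtain ⟨hw, ha⟩ := Finset.mem_filter.1 hw
  rw [Finset.mem_union, Finset.mem_filter, Finset.mem_filter]
  by_cases h : E.inp (w + 17) = 0
  · exact Or.inr ⟨hw, h, (hS.lab_eq u w hu (Finset.mem_range.1 hw) hu' h ha).symm⟩
  · exact Or.inl ⟨hw, h⟩

/-- The number of edges is linear for bounded separators. -/
theorem Input.total_le (hI : Input E n a pos)
    (hS : Separated E n k (((Finset.range n).filter fun v => E.inp (v + 17) ≠ 0).card) a lab) :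
    pos n - pos 0 ≤ 2 * (k * n) := by
  classical
  have h1 : ∀ m, m ≤ n → pos m = pos 0 + ∑ u ∈ Finset.range m, E.inp (u + n + 17) := by
    intro m hm
    induction m with
    | zero => simp
    | succ m ih =>
      rw [hI.pos_succ m (by omega), ih (by omega), Finset.sum_range_succ]
      omega
  -- Vertices outside the separator have degree at most `k`; the at most `k` vertices of the
  -- separator have degree at most `n`.
  have h2 : ∑ u ∈ Finset.range n, E.inp (u + n + 17) ≤
      ∑ u ∈ Finset.range n, (k + if E.inp (u + 17) ≠ 0 then n else 0) := by
    refine Finset.sum_le_sum fun u hu => ?_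
    have hu := Finset.mem_range.1 hu
    have h3 := hI.deg_le hu
    split_ifs with h
    · have h4 : _ ≤ (Finset.range n).card :=
        Finset.card_filter_le (Finset.range n) fun w => a u w ≠ 0
      rw [Finset.card_range] at h4
      omega
    · have := hS.deg_le hu (not_not.1 h)
      omega
  rw [Finset.sum_add_distrib, ← Finset.sum_filter, Finset.sum_const, Finset.sum_const,
    Finset.card_range, smul_eq_mul, smul_eq_mul] at h2
  have h5 := Nat.mul_le_mul_right n hS.le
  rw [h1 n le_rfl, Nat.add_sub_cancel_left]
  calc _ ≤ _ := h2
    _ ≤ n * k + k * n := by omega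
    _ = _ := by ring

namespace Ordered

theorem le_cs (h : Ordered n k s a ord cs nc) {c : ℕ} (hc : c ≤ nc) : s ≤ cs c := by
  have := h.cuts.mono' (Nat.zero_le c) hc
  rwa [h.cuts.zero] at this

theorem cs_le (h : Ordered n k s a ord cs nc) {c : ℕ} (hc : c ≤ nc) : cs c ≤ n := by
  have := h.cuts.mono' hc le_rfl
  rwa [h.last] at this

theorem blockSize_le (h : Ordered n k s a ord cs nc) (hs : s ≤ k) {c : ℕ} (hc : c < nc) :
    blockSize s cs c ≤ 2 * k := by
  have := h.cuts.size c hc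
  have := h.le_cs hc.le
  unfold blockSize
  omega

/-- The chunks partition the vertices outside the separator, and each of the `nc` blocks adds one
copy of the separator. Those copies are paid for by the large chunks. -/
theorem sum_blockSize_le (h : Ordered n k s a ord cs nc) :
    ∑ c ∈ Finset.range nc, blockSize s cs c ≤ 4 * n := by
  have h1 : ∀ m, m ≤ nc → ∑ c ∈ Finset.range m, blockSize s cs c + s = m * s + cs m := by
    intro m hm
    induction m with
    | zero => simp [h.cuts.zero]
    | succ m ih =>
      have h2 := ih (by omega)
      have h3 := h.cuts.mono m (by omega)
      have h4 := h.le_cs (show m ≤ nc by omega)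
      rw [Finset.sum_range_succ, blockSize, Nat.succ_mul]
      omega
  -- The separator and each large chunk contain at least `s` vertices, so the cuts grow at least
  -- like multiples of `s`.
  have h5 : ∀ m, 1 ≤ m → m ≤ nc - 1 → m * s ≤ cs m := by
    intro m hm
    induction m, hm using Nat.le_induction with
    | base => intro; rw [h.cuts.one]; omega
    | succ m hm ih =>
      intro hm'
      have h2 := ih (by omega)
      have h3 := h.cuts.big m hm (by omega)
      have h4 := le_max_left s 1
      rw [Nat.succ_mul]
      omega
  have h2 := h.two_le
  have h6 := h5 (nc - 1) (by omega) le_rfl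
  have h7 := h.cs_le (show nc - 1 ≤ nc by omega)
  have h8 := h1 nc le_rfl
  have h9 : nc * s = (nc - 1) * s + s := by
    rw [← Nat.succ_mul]
    congr 1
    omega
  have h10 := h.le_cs (Nat.zero_le nc)
  have h11 := h.cs_le (Nat.zero_le nc)
  rw [h.last] at h8
  omega

end Ordered

/-- Split `b ^ ω` as `b ^ (ω - 1) * b` and bound the first factor through `b ≤ 2 * k`; the quadratic
work is dominated because `k ≤ k ^ (ω - 1)`, which needs `2 ≤ ω`. -/
theorem blockTime_le {ω D : ℝ} (hω : 2 ≤ ω) (hD : 0 ≤ D) (hq : ∀ b, (E.qtime b : ℝ) ≤ D * b ^ ω)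
    (hk : 1 ≤ k) {b : ℕ} (hb : b ≤ 2 * k) :
    (blockTime E b : ℝ) ≤ (40 + D * 2 ^ (ω - 1)) * (k : ℝ) ^ (ω - 1) * b + 12 := by
  have hk' : (1 : ℝ) ≤ k := by exact_mod_cast hk
  have hb' : (b : ℝ) ≤ 2 * k := by exact_mod_cast hb
  have hkp : (k : ℝ) ≤ (k : ℝ) ^ (ω - 1) := by
    conv_lhs => rw [← Real.rpow_one (k : ℝ)]
    exact Real.rpow_le_rpow_of_exponent_le hk' (by linarith)
  have h1 : (b : ℝ) ^ ω ≤ 2 ^ (ω - 1) * (k : ℝ) ^ (ω - 1) * b := by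
    rcases Nat.eq_zero_or_pos b with rfl | hb0
    · rw [Nat.cast_zero, Real.zero_rpow (by linarith), mul_zero]
    · have hb0' : (0 : ℝ) < b := by exact_mod_cast hb0
      rw [show ω = ω - 1 + 1 by ring, Real.rpow_add_one hb0'.ne', show ω - 1 + 1 - 1 = ω - 1 by ring,
        ← Real.mul_rpow (by norm_num) (by linarith)]
      exact mul_le_mul_of_nonneg_right (Real.rpow_le_rpow hb0'.le hb' (by linarith)) hb0'.le
  have h2 := hq b
  have h3 := mul_le_mul_of_nonneg_left h1 hD
  have hb0 : (0 : ℝ) ≤ b := Nat.cast_nonneg b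
  have h4 : (b : ℝ) * (b * 15 + 10) ≤ 40 * (k : ℝ) ^ (ω - 1) * b := by
    have : (b : ℝ) * 15 + 10 ≤ 40 * (k : ℝ) ^ (ω - 1) := by linarith
    nlinarith
  unfold blockTime
  push_cast
  nlinarith

/-- The bound per block is linear in the block size, so the total of the block sizes gives the
factor `n`. The edges contribute O(kn), and so do the pairs in the separator, as `s` is at most `k`
and at most `n`. -/
theorem Program.mainTime_le {ω D : ℝ} (hω : 2 ≤ ω) (hD : 0 ≤ D)
    (hq : ∀ b, (E.qtime b : ℝ) ≤ D * b ^ ω) (hn : 1 ≤ n) (hk : 1 ≤ k) (hs : s ≤ k)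
    (h : Ordered n k s a ord cs nc) (hpos : pos n - pos 0 ≤ 2 * (k * n)) :
    (Program.mainTime E n s cs nc pos L : ℝ) ≤
      (20 * (4 * (40 + D * 2 ^ (ω - 1)) + L + 106) + 196) * ((k : ℝ) ^ (ω - 1) * n) := by
  obtain ⟨p, hp⟩ : ∃ p, (k : ℝ) ^ (ω - 1) = p := ⟨_, rfl⟩
  obtain ⟨g, hg⟩ : ∃ g, 40 + D * 2 ^ (ω - 1) = g := ⟨_, rfl⟩
  have hk' : (1 : ℝ) ≤ k := by exact_mod_cast hk
  have hn' : (1 : ℝ) ≤ n := by exact_mod_cast hn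
  have hkp : (k : ℝ) ≤ p := by
    rw [← hp]
    conv_lhs => rw [← Real.rpow_one (k : ℝ)]
    exact Real.rpow_le_rpow_of_exponent_le hk' (by linarith)
  have hg0 : 0 ≤ g := by rw [← hg]; positivity
  have hblock : (∑ c ∈ Finset.range nc, blockTime E (blockSize s cs c) : ℕ) ≤
      g * p * (4 * n) + 36 * n := by
    push_cast
    have h1 : ∑ c ∈ Finset.range nc, (blockTime E (blockSize s cs c) : ℝ) ≤
        ∑ c ∈ Finset.range nc, (g * p * (blockSize s cs c : ℝ) + 12) := by
      refine Finset.sum_le_sum fun c hc => ?_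
      rw [← hg, ← hp]
      exact blockTime_le hω hD hq hk (h.blockSize_le hs (Finset.mem_range.1 hc))
    rw [Finset.sum_add_distrib, ← Finset.mul_sum, Finset.sum_const, Finset.card_range,
      nsmul_eq_mul] at h1
    have h2 : (∑ c ∈ Finset.range nc, (blockSize s cs c : ℝ)) ≤ 4 * n := by
      exact_mod_cast h.sum_blockSize_le
    have h3 : (nc : ℝ) ≤ 3 * n := by
      have := h.chunks_le
      exact_mod_cast (show nc ≤ 3 * n by omega)
    have h4 := mul_le_mul_of_nonneg_left h2 (mul_nonneg hg0 (by linarith : 0 ≤ p))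
    linarith
  have hsn : s ≤ n := (h.le_cs (Nat.zero_le nc)).trans (h.cs_le (Nat.zero_le nc))
  have hkn : (k : ℝ) * n ≤ p * n := mul_le_mul_of_nonneg_right hkp (by linarith)
  have hnkn : (n : ℝ) ≤ k * n := by nlinarith
  have hss : ((s * (s * 6 + 5) : ℕ) : ℝ) ≤ 11 * (k * n) := by
    have h1 : (s : ℝ) ≤ k := by exact_mod_cast hs
    have h2 : (s : ℝ) ≤ n := by exact_mod_cast hsn
    have h3 : (s : ℝ) * s ≤ k * n := mul_le_mul h1 h2 (Nat.cast_nonneg s) (by linarith)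
    push_cast
    nlinarith
  have hpos' : ((pos n - pos 0 : ℕ) : ℝ) ≤ 2 * (k * n) := by exact_mod_cast hpos
  have h1 : (1 : ℝ) ≤ p * n := by linarith
  have hL : (L : ℝ) ≤ L * (p * n) := le_mul_of_one_le_right (Nat.cast_nonneg L) h1
  rw [hp, hg]
  unfold Program.mainTime roundTime
  simp only [Nat.cast_add, Nat.cast_mul, Nat.cast_ofNat, Nat.cast_one] at hss hblock ⊢
  nlinarith
end WordRAM

/-! ## The theorem -/

namespace WordRAM

open FourVertex

/-- Functions bounded by words of logarithmic length. -/
def PolyBounded (f : ℕ → ℕ) : Prop := ∃ c, ∀ n, 1 ≤ n → f n ≤ c * n ^ c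

namespace PolyBounded

variable {f g : ℕ → ℕ}

theorem const (k : ℕ) : PolyBounded fun _ => k :=
  ⟨k, fun _ hn => Nat.le_mul_of_pos_right _ (pow_pos hn _)⟩

theorem id : PolyBounded fun n => n := ⟨1, fun n _ => by simp⟩

theorem add (hf : PolyBounded f) (hg : PolyBounded g) : PolyBounded fun n => f n + g n := by
  obtain ⟨c, hc⟩ := hf
  obtain ⟨d, hd⟩ := hg
  refine ⟨c + d, fun n hn => ?_⟩
  have h1 := Nat.mul_le_mul_left c (Nat.pow_le_pow_right hn (Nat.le_add_right c d))
  have h2 := Nat.mul_le_mul_left d (Nat.pow_le_pow_right hn (Nat.le_add_left d c))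
  rw [add_mul]
  exact add_le_add ((hc n hn).trans h1) ((hd n hn).trans h2)

theorem mul (hf : PolyBounded f) (hg : PolyBounded g) : PolyBounded fun n => f n * g n := by
  obtain ⟨c, hc⟩ := hf
  obtain ⟨d, hd⟩ := hg
  refine ⟨c * d + (c + d), fun n hn => ?_⟩
  calc f n * g n ≤ c * n ^ c * (d * n ^ d) := Nat.mul_le_mul (hc n hn) (hd n hn)
    _ = c * d * n ^ (c + d) := by rw [pow_add]; ring
    _ ≤ _ := Nat.mul_le_mul (Nat.le_add_right _ _) (Nat.pow_le_pow_right hn (Nat.le_add_left _ _))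

theorem pow (hf : PolyBounded f) (k : ℕ) : PolyBounded fun n => f n ^ k := by
  induction k with
  | zero => exact const 1
  | succ k ih => exact (ih.mul hf)

end PolyBounded

/-- The distance of the matrices handed to the multiplication program. -/
def stride (c n : ℕ) : ℕ := c * n ^ c + 3 * n ^ 2 + 1

/-- The first cell after the input, at the latest. -/
def inputEnd (n : ℕ) : ℕ := n * n + 2 * n + 17

/-- A bound for the numbers in the variables and arrays. -/
def wordLim (c n : ℕ) : ℕ := 20 * ((n + 2) * stride c n) + inputEnd n + 24

/-- A bound for the words used by a compiled program of size `K`. -/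
def wordBound (c K n : ℕ) : ℕ :=
  inputEnd n + 16 * wordLim c n ^ K + 17 * wordLim c n + 16 * stride c n + 16

theorem polyBounded_wordBound (c K : ℕ) : PolyBounded (wordBound c K) := by
  have h1 : PolyBounded (stride c) :=
    (((PolyBounded.const c).mul (PolyBounded.id.pow c)).add
      ((PolyBounded.const 3).mul (PolyBounded.id.pow 2))).add (.const 1)
  have h2 : PolyBounded inputEnd :=
    ((PolyBounded.id.mul .id).add ((PolyBounded.const 2).mul .id)).add (.const 17)
  have h3 : PolyBounded (wordLim c) :=
    (((PolyBounded.const 20).mul ((PolyBounded.id.add (.const 2)).mul h1)).add h2).add (.const 24)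
  exact (((h2.add ((PolyBounded.const 16).mul (h3.pow K))).add
    ((PolyBounded.const 17).mul h3)).add ((PolyBounded.const 16).mul h1)).add (.const 16)

/-- Computes the end of the input and the constants used by compiled programs. -/
def prelude : Prog :=
  .seq (.load 0 0) (.seq (.op .mul 3 0 0) (.seq (.op .add 4 0 0) (.seq (.op .add 3 3 4)
    (.seq (.const 4 17) (.seq (.op .add 3 3 4) (.const 7 16))))))

/-- The arrays start at `inputEnd n`, which is computed from `n` alone and lies behind the input for
every graph, so the lists need not be measured first. -/
theorem prelude_exec {coins : ℕ → Bool} {B n : ℕ} {E : Env} {l : List ℕ} (hl : l.getD 0 0 = n)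
    (hE : E.inp = fun i => l.getD i 0) (hbase : E.base = inputEnd n) (hlen : l.length ≤ E.base)
    (hB : E.base + 16 ≤ B) : ∃ s, Exec coins B prelude (init l) 7 s ∧ Rep E St.start s := by
  unfold inputEnd at hbase
  have hn : n ≤ n * n := Nat.le_mul_self n
  have h0 : (init l).mem 0 = n := hl
  have hB0 : E.base ≤ B := by omega
  refine ⟨_, .seq (.load _ _ _ ?_) (.seq (.op _ _ _ _ _ ?_) (.seq (.op _ _ _ _ _ ?_)
    (.seq (.op _ _ _ _ _ ?_) (.seq (.const _ _ _ ?_) (.seq (.op _ _ _ _ _ ?_)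
    (.const _ _ _ ?_)))))), ?_⟩
  · change (init l).mem 0 ≤ B
    omega
  · change (init l).mem 0 * (init l).mem 0 ≤ B
    rw [h0]
    omega
  · change (init l).mem 0 + (init l).mem 0 ≤ B
    omega
  · change (init l).mem 0 * (init l).mem 0 + ((init l).mem 0 + (init l).mem 0) ≤ B
    rw [h0]
    omega
  · omega
  · change (init l).mem 0 * (init l).mem 0 + ((init l).mem 0 + (init l).mem 0) + 17 ≤ B
    rw [h0]
    omega
  · omega
  · refine ⟨fun x => ?_, ?_, rfl, rfl, fun i _ => ?_, fun A i => ?_, rfl,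
      fun _ => Nat.zero_le _, fun _ _ => Nat.zero_le _⟩
    · have h3 : vr x ≠ 3 := by unfold vr; omega
      have h4 : vr x ≠ 4 := by unfold vr; omega
      have h7 : vr x ≠ 7 := by unfold vr; omega
      have hz : vr x ≠ 0 := by unfold vr; omega
      simp [State.setReg, init, St.start, Function.update, h3, h4, h7, hz]
    · change (init l).mem 0 * (init l).mem 0 + ((init l).mem 0 + (init l).mem 0) + 17 = _
      rw [h0, hbase]
      ring
    · rw [hE]
      rfl
    · exact List.getD_eq_default _ _ (by omega)

theorem length_encodeInput {n : ℕ} {adj : Fin n → List (Fin n)} {S : Finset (Fin n)}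
    {H : SimpleGraph (Fin 4)} : (encodeInput H adj S).length = listStart adj n := by
  classical
  have hl := length_encodeMatrix (Matrix.of fun i j : Fin 4 => if H.Adj i j then 1 else 0)
  have hl' : (List.ofFn fun i : Fin 4 => List.ofFn fun j : Fin 4 =>
      if H.Adj i j then 1 else 0).flatten.length = 16 := hl
  have h : ∑ v ∈ Finset.range n, natDeg adj v = ∑ v : Fin n, (adj v).length := by
    rw [← Fin.sum_univ_eq_sum_range]
    exact Finset.sum_congr rfl fun v _ => dif_pos v.2
  rw [encodeInput, List.length_cons, List.length_append, List.length_append, List.length_append,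
    hl', List.length_ofFn, List.length_ofFn, listStart, h, List.length_flatten, List.map_ofFn,
    List.sum_ofFn]
  have : ∀ v, (List.length ∘ fun v => (adj v).map fun u => (u : ℕ)) v = (adj v).length := by
    intro v
    simp
  simp only [this]
  omega

/-- There is a vertex, and it is counted either in the separator or in its own component. -/
theorem Separated.one_le {n k : ℕ} {E : Env} {a : ℕ → ℕ → ℕ} {lab : ℕ → ℕ}
    (hS : Separated E n k (((Finset.range n).filter fun v => E.inp (v + 17) ≠ 0).card) a lab)
    (hn : 1 ≤ n) : 1 ≤ k := by
  by_cases h : E.inp (0 + 17) = 0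
  · refine le_trans ?_ (hS.card 0 hn h)
    refine le_add_left (Finset.card_pos.2 ⟨0, ?_⟩)
    exact Finset.mem_filter.2 ⟨Finset.mem_range.2 hn, h, rfl⟩
  · refine le_trans (Finset.card_pos.2 ⟨0, ?_⟩) hS.le
    exact Finset.mem_filter.2 ⟨Finset.mem_range.2 hn, h⟩

/-- The round's functions of natural numbers are the adjacency and membership functions of the
chosen random set, so the expression yields the residue of its count. -/
theorem bad_iff {n : ℕ} {G : SimpleGraph (Fin n)} {H : SimpleGraph (Fin 4)} {E : Env}
    {F : (Var → ZMod 24) → ZMod 24}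
    (hF : ∀ (R : Finset (Fin n)) (f : Var → ZMod 24), IsStats (adjFun G R) (memFun R) f →
      (embCount G R H : ZMod 24) = F f) (i : ℕ) (f : Var → ZMod 24)
    (hf : IsStats (fun x y : Fin n => (chosen (natAdj G) (coinFun E n i) x y : ZMod 24))
      (fun x : Fin n => (coinFun E n i x : ZMod 24)) f) :
    F f = 0 ↔ ¬ ¬ 24 ∣ embCount G (coinSet E.coins n i) H := by
  have h1 : (fun x y : Fin n => (chosen (natAdj G) (coinFun E n i) x y : ZMod 24)) =
      adjFun G (coinSet E.coins n i) := funext fun x => funext fun y => chosen_natAdj E i x y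
  have h2 : (fun x : Fin n => (coinFun E n i x : ZMod 24)) = memFun (coinSet E.coins n i) :=
    funext fun x => coinFun_eq E i x
  rw [h1, h2] at hf
  rw [← hF _ f hf, not_not]
  exact ZMod.natCast_eq_zero_iff _ _

theorem isIndContained_of_embCount {n : ℕ} {G : SimpleGraph (Fin n)} {H : SimpleGraph (Fin 4)}
    {R : Finset (Fin n)} (h : ¬ 24 ∣ embCount G R H) : H.IsIndContained G := by
  classical
  have hne : embCount G R H ≠ 0 := fun h0 => h (h0 ▸ dvd_zero 24)
  obtain ⟨x, hx⟩ := Finset.card_ne_zero.1 hne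
  exact (Finset.mem_filter.1 hx).2.isIndContained

/-- All randomness is isolated: for every coin sequence the answer is determined by whether one of
the first twenty blocks of coins selects a set with count not divisible by 24. The first conclusion
ensures that the time bound leaves room for all these coins. -/
theorem exists_program {ω : ℝ} (hω : IsMatMulExponent ω) : ∃ (P : Prog) (c : ℕ) (C : ℝ),
    ∀ (n : ℕ), 1 ≤ n → ∀ (G : SimpleGraph (Fin n)) (adj : Fin n → List (Fin n)),
    IsAdjacencyList G adj → ∀ (k : ℕ) (S : Finset (Fin n)), IsKSeparator G k S →
    ∀ H : SimpleGraph (Fin 4), 20 * n ≤ ⌊C * (k : ℝ) ^ (ω - 1) * n⌋₊ ∧ ∀ coins : ℕ → Bool,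
      ∃ s : State, HaltsWith coins (c * n ^ c) P (encodeInput H adj S)
        ⌊C * (k : ℝ) ^ (ω - 1) * n⌋₊ s ∧ s.reg 0 ≤ 1 ∧
        (s.reg 0 = 1 ↔ ∃ i, i < 20 ∧ ¬ 24 ∣ embCount G (coinSet coins n i) H) := by
  classical
  have hω2 := two_le_of_isMatMulExponent hω
  obtain ⟨Q, e, D₀, hQ⟩ := hω
  obtain ⟨D, hD⟩ : ∃ D, |D₀| = D := ⟨_, rfl⟩
  have hD0 : 0 ≤ D := hD ▸ abs_nonneg D₀
  obtain ⟨M, hM⟩ := Q.exists_regsLt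
  choose F hFe hF using exists_expressible
  choose val hval using hFe
  obtain ⟨l, hl⟩ : ∃ l : List (SimpleGraph (Fin 4)), ∀ H, H ∈ l :=
    ⟨Finset.univ.toList, fun H => Finset.mem_toList.2 (Finset.mem_univ H)⟩
  obtain ⟨p, hp⟩ : ∃ p, Program.main e e (Program.evalFor val l) = p := ⟨_, rfl⟩
  obtain ⟨c, hc⟩ := polyBounded_wordBound e p.size
  obtain ⟨N, hN⟩ : ∃ N, 12 * p.size + M + 10 = N := ⟨_, rfl⟩
  obtain ⟨g, hg⟩ : ∃ g : ℝ, 20 * (4 * (40 + D * 2 ^ (ω - 1)) + (l.length + 1 : ℕ) + 106) + 196 = g :=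
    ⟨_, rfl⟩
  have hg0 : 0 ≤ g := by rw [← hg]; positivity
  -- The summand 28 covers the 8 steps outside the compiled program as well as the requirement of
  -- `20 * n` coins.
  refine ⟨.seq prelude (.seq (compile Q M p) (.op .add 0 (vr .ans) 11)), c, N * g + 28, ?_⟩
  intro n hn G adj hadj k S hS H
  have base_le : inputEnd n ≤ wordLim e n := by unfold wordLim; omega
  obtain ⟨E₀, hE₀⟩ : ∃ E₀ : (ℕ → Bool) → Env, E₀ = fun coins => ⟨coins, wordLim e n, inputEnd n,
    inputFun H adj S, stride e n, fun b => e * b ^ e, fun b => ⌊D * (b : ℝ) ^ ω⌋₊⟩ := ⟨_, rfl⟩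
  have hstart : listStart adj n ≤ inputEnd n := listStart_le hadj
  have hk : 1 ≤ k := by
    obtain ⟨lab, h⟩ := separated_of_isKSeparator (H := H) (E := E₀ fun _ => false) hS
      (by rw [hE₀])
    exact h.one_le hn
  have hk' : (1 : ℝ) ≤ k := by exact_mod_cast hk
  have hn' : (1 : ℝ) ≤ n := by exact_mod_cast hn
  have hpow : (1 : ℝ) ≤ (k : ℝ) ^ (ω - 1) := Real.one_le_rpow hk' (by linarith)
  have hpn : (n : ℝ) ≤ (k : ℝ) ^ (ω - 1) * n := by nlinarith
  -- It suffices to bound step counts by real numbers; the floor in the time bound is removed here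
  -- once and for all.
  have hT : ∀ t : ℕ, (t : ℝ) ≤ (N * g + 28) * ((k : ℝ) ^ (ω - 1) * n) →
      t ≤ ⌊(N * g + 28) * (k : ℝ) ^ (ω - 1) * n⌋₊ := fun t ht => Nat.le_floor (by rwa [mul_assoc])
  have hNg : 0 ≤ N * g * ((k : ℝ) ^ (ω - 1) * n) := by positivity
  refine ⟨hT _ (by push_cast; nlinarith), fun coins => ?_⟩
  obtain ⟨E, hE⟩ : ∃ E, E₀ coins = E := ⟨_, rfl⟩
  have e_coins : E.coins = coins := by rw [← hE, hE₀]
  have e_lim : E.lim = wordLim e n := by rw [← hE, hE₀]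
  have e_base : E.base = inputEnd n := by rw [← hE, hE₀]
  have e_inp : E.inp = inputFun H adj S := by rw [← hE, hE₀]
  have e_str : E.str = stride e n := by rw [← hE, hE₀]
  have e_qlim : E.qlim = fun b => e * b ^ e := by rw [← hE, hE₀]
  have e_qtime : E.qtime = fun b : ℕ => ⌊D * (b : ℝ) ^ ω⌋₊ := by rw [← hE, hE₀]
  have h24 : 24 ≤ E.lim := by rw [e_lim, wordLim]; omega
  have hI : Input E n (natAdj G) (listStart adj) :=
    input_of_encodeInput hadj e_inp (by rw [e_base]; exact hstart) (by rw [e_base, e_lim]; exact base_le) h24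
  obtain ⟨lab, hsep⟩ := separated_of_isKSeparator (H := H) hS e_inp
  have hbits : ∀ m, m < 16 → E.inp (m + 1) = Program.bits H m := fun m hm => by
    rw [e_inp, inputFun_bits hm]
  have hmul : E.Multiplies Q := by
    intro b hb A B hA hB
    obtain ⟨s, ⟨t, ht, hex⟩, hs⟩ := hQ b hb A B hA hB fun _ => false
    refine ⟨t, s, by rw [e_qlim]; exact hex, ?_, hs⟩
    rw [e_qtime]
    refine ht.trans (Nat.floor_le_floor ?_)
    rw [← hD]
    exact mul_le_mul_of_nonneg_right (le_abs_self D₀) (by positivity)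
  have hspec := Program.main_spec (E := E) (n := n) (k := k) (a := natAdj G) (c := e) (d := e)
    (pos := listStart adj) (lab := lab) hI (fun i hi => by
      rw [hbits i hi, Program.bits, dif_pos hi]
      split_ifs <;> omega) hsep (natAdj_le G) (natAdj_symm G) e_str
    (by rw [e_str, e_lim, wordLim]; omega) (fun b hb => by
      rw [e_qlim, e_str, stride]
      have := Nat.mul_le_mul_left e (Nat.pow_le_pow_left hb e)
      dsimp only
      omega)
    (Program.evaluates_evalFor hval hbits h24 (hl H))
    (fun i => ¬ 24 ∣ embCount G (coinSet E.coins n i) H) (bad_iff fun R f hf => hF H _ G R f hf)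
  rw [hp] at hspec
  have hword := hc n hn
  have hbound : E.base + 16 * E.lim ^ p.size + 17 * E.lim + 16 * E.str + 16 ≤ c * n ^ c := by
    rw [e_base, e_lim, e_str]
    exact hword
  obtain ⟨s₁, hs₁, hrep₁⟩ := prelude_exec (coins := coins) (B := c * n ^ c) (n := n) (E := E)
    (l := encodeInput H adj S) rfl e_inp e_base (by rw [length_encodeInput, e_base]; exact hstart)
    (by omega)
  obtain ⟨t, s₂, σ, hs₂, hrep₂, ⟨hans, hiff, s, ord, cs, nc, hsk, hord, htime⟩, ht⟩ :=
    compile_sound (B := c * n ^ c) (K := p.size) e_coins hM hmul (by omega)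
    (fun i _ => by
      have := inputFun_le (S := S) (H := H) hadj i
      rw [e_inp, e_lim, wordLim, inputEnd]
      omega) (by omega) (by omega) p _ St.start s₁ le_rfl hspec hrep₁
  rw [hN, show St.start.time = 0 from rfl, mul_zero, add_zero] at ht
  have hadd : BinOp.add.eval (s₂.reg (vr .ans)) (s₂.reg 11) = σ.v .ans := by
    rw [hrep₂.var, hrep₂.zero]
    rfl
  refine ⟨_, ⟨_, hT _ ?_, .seq hs₁ (.seq hs₂ (.op _ _ _ _ _ ?_))⟩, ?_⟩
  · have h1 := Program.mainTime_le (L := l.length + 1) hω2 hD0 (fun b => by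
      rw [e_qtime]
      exact Nat.floor_le (by positivity)) hn hk hsk hord (hI.total_le hsep)
    rw [hg] at h1
    have h2 : (σ.time : ℝ) ≤ _ := (Nat.cast_le.2 htime).trans h1
    have h3 : (t : ℝ) ≤ N * σ.time := by exact_mod_cast ht
    have h4 := mul_le_mul_of_nonneg_left h2 (Nat.cast_nonneg (α := ℝ) N)
    push_cast
    nlinarith
  · rw [hadd]
    omega
  · have hreg : (s₂.setReg 0 (BinOp.add.eval (s₂.reg (vr .ans)) (s₂.reg 11))).reg 0 = σ.v .ans := by
      rw [hadd]
      exact Function.update_self (f := s₂.reg) 0 _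
    rw [hreg, ← e_coins]
    exact ⟨hans, hiff⟩

end WordRAM

theorem mainTheorem4 (ω : ℝ) (hω : IsMatMulExponent ω) :
    ∃ (P : WordRAM.Prog) (c : ℕ) (C : ℝ),
      ∀ (n : ℕ), 1 ≤ n → ∀ (G : SimpleGraph (Fin n)) (adj : Fin n → List (Fin n)),
      IsAdjacencyList G adj → ∀ (k : ℕ) (S : Finset (Fin n)), IsKSeparator G k S →
      ∀ H : SimpleGraph (Fin 4), H ≠ ⊤ → H ≠ ⊥ →
      ∀ T : ℕ, T = ⌊C * (k : ℝ) ^ (ω - 1) * n⌋₊ →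
        (∀ ρ : Fin T → Bool, ∃ s : WordRAM.State,
          WordRAM.HaltsWith (WordRAM.extendCoins ρ) (c * n ^ c) P (encodeInput H adj S) T s ∧
          (s.reg 0 = 0 ∨ s.reg 0 = 1) ∧
          (s.reg 0 = 1 → H.IsIndContained G)) ∧
        (H.IsIndContained G →
          2 / 3 ≤ WordRAM.coinProb T fun ρ => ∃ s : WordRAM.State,
            WordRAM.HaltsWith (WordRAM.extendCoins ρ) (c * n ^ c) P (encodeInput H adj S) T s ∧
            s.reg 0 = 1) := by
  classical
  obtain ⟨P, c, C, h⟩ := WordRAM.exists_program hω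
  refine ⟨P, c, C, fun n hn G adj hadj k S hS H hT hB T hTe => ?_⟩
  obtain ⟨h20, hrun⟩ := h n hn G adj hadj k S hS H
  subst hTe
  refine ⟨fun ρ => ?_, fun hind => ?_⟩
  · obtain ⟨s, hs, hle, hiff⟩ := hrun (WordRAM.extendCoins ρ)
    refine ⟨s, hs, by omega, fun h1 => ?_⟩
    obtain ⟨i, -, hi⟩ := hiff.1 h1
    exact WordRAM.isIndContained_of_embCount hi
  · have hcard := FourVertex.two_pow_le_card hT hB hind
    rw [Fintype.card_fin] at hcard
    -- The success event of the twenty random sets implies the answer 1, so its probability is a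
    -- lower bound.
    refine (WordRAM.two_thirds_le_coinProb h20
      (fun R => ¬ 24 ∣ FourVertex.embCount G R H) (by convert hcard)).trans
      (WordRAM.coinProb_mono fun ρ hρ => ?_)
    obtain ⟨s, hs, -, hiff⟩ := hrun (WordRAM.extendCoins ρ)
    exact ⟨s, hs, hiff.2 hρ⟩
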